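/- Let $\mathbb S^1=\mathbb R/2\pi\mathbb Z$ and $\mathbb T^2=\mathbb S^1\times\mathbb S^1$ with coordinates $(\theta,\varphi)$. For $a\ne b$ in $\mathbb S^1$ let $[a;b]$ and $(a;b)$ be the closed and the open arc from $a$ to $b$ in the positive direction. **Diagrams.** A *rectangle* is a subset $r=[\theta_1;\theta_2]\times[\varphi_1;\varphi_2]\subset\mathbb T^2$ with $\theta_1\ne\theta_2$, $\varphi_1\ne\varphi_2$; its vertices are the four points of $\{\theta_1,\theta_2\}\times\{\varphi_1,\varphi_2\}$. Two rectangles are *compatible* if their intersection is empty, or consists of common vertices of the two, or is a rectangle free of vertices of both. A *rectangular diagram of a quasi-surface* is a countable (possibly infinite) collection $\Pi$ of pairwise compatible rectangles such that the set $\Theta(\Pi)$ of all $\theta_1,\theta_2$ and the set $\Phi(\Pi)$ of all $\varphi_1,\varphi_2$ of rectangles in $\Pi$ are discrete subsets of $\mathbb S^1$, and every $x\in\mathbb S^1$ is one of $\theta_1,\theta_2,\varphi_1,\varphi_2$ for only finitely many rectangles of $\Pi$. Its boundary $\partial\Pi$ is the set of points that are a vertex of exactly one rectangle of $\Pi$.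 It is a *rectangular diagram of a surface* if $\partial\Pi$ is a rectangular diagram of a link, i.e. a finite set such that each meridian $\{\theta\}\times\mathbb S^1$ and each longitude $\mathbb S^1\times\{\varphi\}$ contains none or exactly two of its points. **The surface $\widehat\Pi$.** View $\mathbb S^3$ as the join $\mathbb S^1*\mathbb S^1$: the point $[\theta,\varphi,\tau]$, $\tau\in[0;1]$, is the point $(\cos(\pi\tau/2)e^{i\varphi},\sin(\pi\tau/2)e^{i\theta})$ of the unit sphere in $\mathbb C^2$. For a rectangle $r$ let $h_r$ be the bounded harmonic function on $r$ without its vertices that is $0$ on the open horizontal sides $(\theta_1;\theta_2)\times\{\varphi_1,\varphi_2\}$ and $1$ on the open vertical sides $\{\theta_1,\theta_2\}\times(\varphi_1;\varphi_2)$, and let $\zeta(x)=\frac2\pi\arctan\sqrt{\tan(\pi x/2)}$, $\zeta(1)=1$. The *tile* $\widehat r$ is the closure in $\mathbb S^3$ of the set of points $[\theta,\varphi,\zeta(h_r(\theta,\varphi))]$, where $(\theta,\varphi)$ runs over $r$ without its vertices, and $\widehat\Pi=\bigcup_{r\in\Pi}\widehat r$. **Normal surfaces.** For finite $X,Y\subset\mathbb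 S^1$, each with at least three points, $T(X,Y)$ is the triangulation of $\mathbb S^3$ whose $3$-simplices are the sets $\Delta=[\theta';\theta'']*[\varphi';\varphi'']=\{[\theta,\varphi,\tau]:\theta\in[\theta';\theta''],\ \varphi\in[\varphi';\varphi''],\ \tau\in[0;1]\}$, where $\theta',\theta''$ are consecutive points of $X$ and $\varphi',\varphi''$ are consecutive points of $Y$ in the circular order. A *normal disc* in $\Delta$ is a properly embedded disc $d\subset\Delta$ ($C^1$, with corners) that is disjoint from the vertices of $\Delta$, is transverse to the edges of $\Delta$, meets each edge at most once and meets at least one edge (so that it is a normal triangle or a normal quadrilateral). A $C^1$-embedded surface $F\subset\mathbb S^3$ without boundary, not necessarily compact, is *normal* with respect to $T(X,Y)$ if every connected component of $F\cap\Delta$ is a normal disc in $\Delta$, for every $3$-simplex $\Delta$ of $T(X,Y)$. **Proposition.** Let $\Pi$ be a rectangular diagram of a surface with $\partial\Pi=\varnothing$. Let $X,Y\subset\mathbb S^1$ be finite subsets with $|X|,|Y|\geqslant3$, disjoint from $\Theta(\Pi)$ and $\Phi(\Pi)$ respectively, such that every rectangle of $\Pi$ contains at least one point of $X\times Y$. Then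 $\widehat\Pi$ is an embedded surface that is normal with respect to $T(X,Y)$. -/

import Mathlib

open Set
open scoped Manifold ContDiff

namespace RectDiagram

noncomputable section

/-! ### The circle, its arcs, and the torus -/

/-- The length of the arc of the circle `ℝ / 2πℤ` that runs from `a` to `b` in the positive
direction; it lies in `[0, 2π)`, and it is `0` when `a = b`. -/
def arcLen (a b : Real.Angle) : ℝ := toIcoMod Real.two_pi_pos 0 (b - a).toReal

/-- The closed arc `[a; b]` running from `a` to `b` in the positive direction (for `a ≠ b`). -/
def arc (a b : Real.Angle) : Set Real.Angle := {x | arcLen a x ≤ arcLen a b}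

/-- The open arc `(a; b)` running from `a` to `b` in the positive direction (for `a ≠ b`). -/
def openArc (a b : Real.Angle) : Set Real.Angle := {x | 0 < arcLen a x ∧ arcLen a x < arcLen a b}

/-- The two-torus; the first coordinate is `θ`, the second one is `φ`. -/
abbrev Torus : Type := Real.Angle × Real.Angle

/-! ### Rectangular diagrams -/

/-- A rectangle `[θ₁; θ₂] × [φ₁; φ₂]` in the torus. As `θ₁ ≠ θ₂` and `φ₁ ≠ φ₂`, these four
angles are determined by the rectangle as a subset of the torus. -/
structure Rect where
  θ₁ : Real.Angle
  θ₂ : Real.Angle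
  φ₁ : Real.Angle
  φ₂ : Real.Angle
  θ_ne : θ₁ ≠ θ₂
  φ_ne : φ₁ ≠ φ₂

/-- The rectangle as a subset of the torus. -/
def Rect.carrier (r : Rect) : Set Torus := arc r.θ₁ r.θ₂ ×ˢ arc r.φ₁ r.φ₂

/-- The four vertices of a rectangle. -/
def Rect.vertices (r : Rect) : Set Torus := {r.θ₁, r.θ₂} ×ˢ {r.φ₁, r.φ₂}

/-- Compatibility of two rectangles: they are disjoint, or meet in a set of common vertices only,
or meet in a rectangle that is free of vertices of both. -/
def Compatible (r s : Rect) : Prop :=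
  r.carrier ∩ s.carrier = ∅ ∨
  r.carrier ∩ s.carrier ⊆ r.vertices ∩ s.vertices ∨
  ∃ q : Rect, r.carrier ∩ s.carrier = q.carrier ∧
    Disjoint q.carrier r.vertices ∧ Disjoint q.carrier s.vertices

/-- The set of the `θ`-coordinates of the vertical sides. -/
def Thetas (P : Set Rect) : Set Real.Angle := ⋃ r ∈ P, {r.θ₁, r.θ₂}

/-- The set of the `φ`-coordinates of the horizontal sides. -/
def Phis (P : Set Rect) : Set Real.Angle := ⋃ r ∈ P, {r.φ₁, r.φ₂}

/-- A rectangular diagram of a quasi-surface. -/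
structure IsQuasiSurfaceDiagram (P : Set Rect) : Prop where
  countable : P.Countable
  compatible : P.Pairwise Compatible
  discrete_Thetas : IsDiscrete (Thetas P)
  discrete_Phis : IsDiscrete (Phis P)
  finite_sides : ∀ x : Real.Angle, {r ∈ P | x = r.θ₁ ∨ x = r.θ₂ ∨ x = r.φ₁ ∨ x = r.φ₂}.Finite

/-- The boundary of a diagram: the set of its free vertices, that is, of the points that are a
vertex of exactly one rectangle of the diagram. -/
def boundary (P : Set Rect) : Set Torus := {v | ∃! r, r ∈ P ∧ v ∈ r.vertices}

/-- A rectangular diagram of a link: a finite set of points of the torus such that every meridian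
and every longitude contains either none or exactly two of them. -/
structure IsLinkDiagram (R : Set Torus) : Prop where
  finite : R.Finite
  meridian : ∀ θ : Real.Angle,
    {v ∈ R | v.1 = θ}.ncard = 0 ∨ {v ∈ R | v.1 = θ}.ncard = 2
  longitude : ∀ φ : Real.Angle,
    {v ∈ R | v.2 = φ}.ncard = 0 ∨ {v ∈ R | v.2 = φ}.ncard = 2

/-- A rectangular diagram of a surface. -/
structure IsSurfaceDiagram (P : Set Rect) : Prop extends IsQuasiSurfaceDiagram P where
  boundary_link : IsLinkDiagram (boundary P)

/-! ### The three-sphere as the join of two circles -/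

/-- The three-sphere, with its standard smooth structure. -/
abbrev S3 : Type := Metric.sphere (0 : EuclideanSpace ℝ (Fin (3 + 1))) 1

/-- The point `[θ, φ, τ]` of the join of two circles, identified with the unit sphere of `ℝ⁴`
through `(cos (πτ/2) e^{iφ}, sin (πτ/2) e^{iθ})`. For `τ = 0` it does not depend on `θ`, for
`τ = 1` it does not depend on `φ`, and there is no other coincidence for `τ ∈ [0, 1]`. -/
def joinPt (θ φ : Real.Angle) (τ : ℝ) : S3 :=
  ⟨!₂[Real.cos (Real.pi * τ / 2) * φ.cos, Real.cos (Real.pi * τ / 2) * φ.sin,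
      Real.sin (Real.pi * τ / 2) * θ.cos, Real.sin (Real.pi * τ / 2) * θ.sin], by
    rw [mem_sphere_zero_iff_norm, EuclideanSpace.norm_eq, Real.sqrt_eq_one]
    simp only [Fin.sum_univ_four, Real.norm_eq_abs, sq_abs]
    simp
    linear_combination Real.cos (Real.pi * τ / 2) ^ 2 * φ.cos_sq_add_sin_sq +
      Real.sin (Real.pi * τ / 2) ^ 2 * θ.cos_sq_add_sin_sq +
      Real.cos_sq_add_sin_sq (Real.pi * τ / 2)⟩

/-! ### The surface of a diagram -/

/-- The bounded harmonic function on a rectangle without its vertices that is `1` on the open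
vertical sides and `0` on the open horizontal sides, in its explicit form obtained by separation
of variables. On the vertical sides, where the series converges only conditionally, the value `1`
is given directly; on the horizontal sides all terms of the series vanish. -/
def Rect.h (r : Rect) (v : Torus) : ℝ :=
  open Classical in
  if v.1 = r.θ₁ ∨ v.1 = r.θ₂ then 1
  else
    4 / Real.pi * ∑' n : ℕ,
      Real.sin ((2 * n + 1) * Real.pi / arcLen r.φ₁ r.φ₂ * arcLen r.φ₁ v.2) *
        (Real.exp ((2 * n + 1) * Real.pi / arcLen r.φ₁ r.φ₂ * arcLen r.θ₁ v.1) +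
          Real.exp ((2 * n + 1) * Real.pi / arcLen r.φ₁ r.φ₂ * arcLen v.1 r.θ₂)) /
        ((2 * n + 1) *
          (1 + Real.exp ((2 * n + 1) * Real.pi / arcLen r.φ₁ r.φ₂ * arcLen r.θ₁ r.θ₂)))

/-- The function `ζ(x) = (2/π) arctan √(tan (πx/2))` from `[0, 1]` to `[0, 1]`, with `ζ(1) = 1`. -/
def zeta (x : ℝ) : ℝ :=
  open Classical in
  if x = 1 then 1 else 2 / Real.pi * Real.arctan (Real.sqrt (Real.tan (Real.pi * x / 2)))

/-- The tile of a rectangle: the closure of the image in the three-sphere of the graph of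
`ζ ∘ h_r` over the rectangle without its vertices. -/
def Rect.tile (r : Rect) : Set S3 :=
  closure ((fun v : Torus => joinPt v.1 v.2 (zeta (r.h v))) '' (r.carrier \ r.vertices))

/-- The subset of the three-sphere associated with a diagram: the union of all tiles. -/
def surface (P : Set Rect) : Set S3 := ⋃ r ∈ P, r.tile

/-! ### Surfaces and discs of class `C¹` in the three-sphere -/

/-- The cone `[0; 1) · A`, where `A` is a subset of the equator of the unit sphere of `ℝ³`. -/
def cone (A : Set Real.Angle) : Set (EuclideanSpace ℝ (Fin 3)) :=
  {x | ∃ s ∈ Ico (0 : ℝ) 1, ∃ α ∈ A, x = !₂[s * α.cos, s * α.sin, 0]}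

/-- `f` is a `C¹`-diffeomorphism from an open neighbourhood of `p` in the three-sphere to the open
unit ball, it sends `p` to the centre, and it sends the part of `F` in the neighbourhood to the
cone over `A`. -/
def IsConeChart (F : Set S3) (p : S3) (A : Set Real.Angle)
    (f : OpenPartialHomeomorph S3 (EuclideanSpace ℝ (Fin 3))) : Prop :=
  f ∈ IsManifold.maximalAtlas (𝓡 3) 1 S3 ∧ p ∈ f.source ∧ f p = 0 ∧
    f.target = Metric.ball 0 1 ∧ f '' (f.source ∩ F) = cone A

/-- An embedded surface without boundary, of class `C¹`, not necessarily compact. -/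
def IsEmbeddedSurface (F : Set S3) : Prop := ∀ p ∈ F, ∃ f, IsConeChart F p univ f

/-- The admissible bases of cones for a surface with corners: the whole equator (interior points)
and the proper arcs of the equator (boundary points and corners). -/
def IsCornerBase (A : Set Real.Angle) : Prop := A = univ ∨ ∃ a b, a ≠ b ∧ A = arc a b

/-- An embedded surface with corners, of class `C¹`. -/
def IsEmbeddedSurfaceWithCorners (F : Set S3) : Prop :=
  ∀ p ∈ F, ∃ A f, IsCornerBase A ∧ IsConeChart F p A f

/-- The curve `γ` is transverse to the surface with corners `d` at the point `γ t` of `d`: in a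
chart in which `d` lies in the horizontal plane the velocity of `γ` is not horizontal. -/
def TransverseAt (d : Set S3) (γ : ℝ → S3) (t : ℝ) : Prop :=
  ∃ A f, IsCornerBase A ∧ IsConeChart d (γ t) A f ∧
    ∃ c : ℝ, c ≠ 0 ∧ HasDerivAt (fun s => f (γ s) 2) c t

/-! ### The three-simplices of the join triangulation and normal surfaces -/

/-- The three-simplex `[θ₁; θ₂] * [φ₁; φ₂]` of the join. -/
def Rect.simplex (r : Rect) : Set S3 :=
  {p | ∃ v ∈ r.carrier, ∃ τ ∈ Icc (0 : ℝ) 1, p = joinPt v.1 v.2 τ}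

/-- The boundary of the three-simplex, which is the union of its four faces
`{θ₁} * [φ₁; φ₂]`, `{θ₂} * [φ₁; φ₂]`, `[θ₁; θ₂] * {φ₁}` and `[θ₁; θ₂] * {φ₂}`. -/
def Rect.simplexBoundary (r : Rect) : Set S3 :=
  {p | ∃ v ∈ r.carrier, (v.1 = r.θ₁ ∨ v.1 = r.θ₂ ∨ v.2 = r.φ₁ ∨ v.2 = r.φ₂) ∧
    ∃ τ ∈ Icc (0 : ℝ) 1, p = joinPt v.1 v.2 τ}

/-- The four vertices of the three-simplex: `θ₁`, `θ₂` on the circle `τ = 1`, and `φ₁`, `φ₂` on the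
circle `τ = 0`. -/
def Rect.simplexVertices (r : Rect) : Set S3 :=
  {joinPt r.θ₁ 0 1, joinPt r.θ₂ 0 1, joinPt 0 r.φ₁ 0, joinPt 0 r.φ₂ 0}

/-- The six edges of the three-simplex, each one as a regular curve to be restricted to the
interval `[0, 1]`: four segments joining the two circles, an arc of the circle `τ = 1` and an arc
of the circle `τ = 0`. -/
def Rect.simplexEdges (r : Rect) : Set (ℝ → S3) :=
  {γ | (∃ v ∈ r.vertices, γ = fun t => joinPt v.1 v.2 t) ∨
    γ = (fun t => joinPt (r.θ₁ + ((t * arcLen r.θ₁ r.θ₂ : ℝ) : Real.Angle)) 0 1) ∨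
    γ = (fun t => joinPt 0 (r.φ₁ + ((t * arcLen r.φ₁ r.φ₂ : ℝ) : Real.Angle)) 0)}

/-- `a` and `b` are distinct points of `X`, and `b` follows `a` in the circular order of `X`. For
`X` with at least two points this says that `(a; b)` is a connected component of the complement
of `X`. -/
def Consecutive (X : Finset Real.Angle) (a b : Real.Angle) : Prop :=
  a ∈ X ∧ b ∈ X ∧ a ≠ b ∧ ∀ x ∈ X, x ∉ openArc a b

/-- The three-simplices of the triangulation `T(X, Y)` of the three-sphere, the join of the
triangulations of the two circles with the vertex sets `X` and `Y`. The rectangle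
`[θ₁; θ₂] × [φ₁; φ₂]` stands for the three-simplex `[θ₁; θ₂] * [φ₁; φ₂]`. -/
def joinTriangulation (X Y : Finset Real.Angle) : Set Rect :=
  {r | Consecutive X r.θ₁ r.θ₂ ∧ Consecutive Y r.φ₁ r.φ₂}

/-- `d` is a properly embedded disc in the three-simplex: an embedded surface with corners that is
the image of an embedding of the closed unit disc, and whose intersection with the boundary of the
three-simplex is the boundary of the disc. -/
def IsProperDisc (Δ : Rect) (d : Set S3) : Prop :=
  d ⊆ Δ.simplex ∧ IsEmbeddedSurfaceWithCorners d ∧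
  ∃ e : Metric.closedBall (0 : EuclideanSpace ℝ (Fin 2)) 1 → S3,
    Topology.IsEmbedding e ∧ range e = d ∧
    ∀ x, e x ∈ Δ.simplexBoundary ↔ ‖(x : EuclideanSpace ℝ (Fin 2))‖ = 1

/-- `d` is a normal disc in the three-simplex: a properly embedded disc that avoids the vertices,
is transverse to the edges, and meets each edge at most once. It is also required to meet some
edge, which rules out discs bounded by a curve inside one face; the discs that remain are exactly
the normal triangles and the normal quadrilaterals. (All edges lie in the boundary of the
three-simplex, so a common point of `d` and an edge lies on the boundary of `d`.) -/
structure IsNormalDisc (Δ : Rect) (d : Set S3) : Prop where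
  proper : IsProperDisc Δ d
  avoids_vertices : Disjoint d Δ.simplexVertices
  transverse : ∀ γ ∈ Δ.simplexEdges, ∀ t ∈ Icc (0 : ℝ) 1, γ t ∈ d → TransverseAt d γ t
  edge_once : ∀ γ ∈ Δ.simplexEdges, (d ∩ γ '' Icc (0 : ℝ) 1).Subsingleton
  meets_edge : ∃ γ ∈ Δ.simplexEdges, (d ∩ γ '' Icc (0 : ℝ) 1).Nonempty

/-- `F` is a normal surface with respect to the triangulation with the three-simplices `T`: it is
an embedded surface, and every connected component of its intersection with every three-simplex
is a normal disc. -/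
def IsNormalSurface (T : Set Rect) (F : Set S3) : Prop :=
  IsEmbeddedSurface F ∧
  ∀ Δ ∈ T, ∀ p ∈ F ∩ Δ.simplex, IsNormalDisc Δ (connectedComponentIn (F ∩ Δ.simplex) p)

end

end RectDiagram

/-!
Write `q` for the squared modulus of the first complex coordinate of a point of the sphere, and
`pt θ φ q` for the point with the angles `θ`, `φ`. The tile of `r` consists of the points
`pt θ φ q` with `q = mfun (r.h (θ, φ))`, for `(θ, φ)` in `r` and not a vertex, and of a whole segment
`0 ≤ q ≤ 1` over each vertex (`mem_tile_iff`). The series for `r.h` is the sum of an angle and of a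
function that is analytic up to and across the left side; hence the tile is near a vertical side the
zero set of an analytic function `tileEq`, whose derivative across the side is positive by the Hopf
lemma (`stripN_deriv_left`). Exchanging the two factors of the torus replaces `r.h` by `1 - r.h`
(`stripH_swap`). So the horizontal sides and the circle `q = 1` need no treatment of their own.

*The surface is embedded.* As the boundary is empty, each vertex belongs to exactly two rectangles,
which lie in opposite quadrants (`opposite_frames`). The tangent plane of a tile at a point over a
vertex depends on `q` only, and the two tiles fit together to a `C¹` surface
(`exists_vertex_graph`). The sides over a given `α` cover the whole circle (`exists_side_over`);
their tiles make up, near the circle `q = 0`, a `C¹` graph over the disc of the first complex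
coordinate (`exists_graph_circle`). The other tiles, possibly infinite in number, keep away: two
rectangles with a common point that is not a vertex cross, and then `h` is larger for the narrow
one by the maximum principle (`rectH_lt_of_crossing`); as the sides are discrete, a comparison with
one intermediate rectangle gives a bound for all of them (`eventually_side`,
`exists_lower_bound_of_crossing`). A `C¹` graph has a cone chart (`LocalCoords.exists_isConeChart`).

*The surface is normal.* Every rectangle contains a point of `X × Y`, so none of its sides fits
between consecutive points (`Consecutive.exists_position`). The part of a tile in a simplex thus
splits into *cells*, each lying over a product of intervals that reaches the ends of the window and
contains at most one vertex of the rectangle. A component is the patch of one cell without a vertex,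
or of the two cells at a common vertex (`Linked.eventually_mem`). The former is a graph, with a side
collapsed to a point where it meets one of the circles; the latter is swept out by rays from the
vertex, along which the height has a limit for each direction (`isDiscIn_of_vertex`). Both are discs,
and they meet each edge at most once, because over a point of the torus that is not a vertex, and
on each of the two circles, they have at most one point (`Linked.isNormalDisc`).
-/

open Real (Angle sin cos exp sinh sqrt arctan)
open Complex (I arg add_re add_im mul_re mul_im ofReal_re ofReal_im I_re I_im im_ofReal_mul
  ofReal_zero re_ofNat im_ofNat)
open ContinuousLinearMap (fst snd comp_apply prod_apply coe_fst' coe_snd')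
open scoped Real

namespace RectDiagram

noncomputable section

open Filter Topology

-- The products with the maximum norm carry the implicit equations and the local coordinates; the
-- Euclidean spaces are those of the charts, of the discs and of the sphere.
local notation "ℝ²" => ℝ × ℝ
local notation "ℝ³" => (ℝ × ℝ) × ℝ
local notation "E²" => EuclideanSpace ℝ (Fin 2)
local notation "E³" => EuclideanSpace ℝ (Fin 3)
local notation "E⁴" => EuclideanSpace ℝ (Fin (3 + 1))

/-! ### Arcs of the circle in real coordinates -/

lemma arcLen_nonneg (a b : Angle) : 0 ≤ arcLen a b := left_le_toIcoMod Real.two_pi_pos 0 _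

lemma arcLen_lt (a b : Angle) : arcLen a b < 2 * π := by
  have := toIcoMod_lt_right Real.two_pi_pos 0 (b - a).toReal
  simpa [arcLen] using this

lemma coe_arcLen (a b : Angle) : (arcLen a b : Angle) = b - a := by
  rw [arcLen, Angle.coe_toIcoMod, Angle.coe_toReal]

lemma add_arcLen (a b : Angle) : a + (arcLen a b : ℝ) = b := by rw [coe_arcLen]; abel

lemma add_coe_add {a : Angle} {x y z : ℝ} (h : x + y = z) : a + (x : ℝ) + (y : ℝ) = a + (z : ℝ) := by
  rw [add_assoc, ← Angle.coe_add, h]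

lemma coe_inj_of_abs_lt {x y : ℝ} (h : (x : Angle) = y) (hlt : |x - y| < 2 * π) : x = y := by
  obtain ⟨k, hk⟩ := Angle.angle_eq_iff_two_pi_dvd_sub.1 h
  rw [hk, abs_mul, abs_of_pos Real.two_pi_pos] at hlt
  have h1 : |(k : ℝ)| < 1 := by
    have := Real.two_pi_pos
    by_contra h2
    push Not at h2
    nlinarith
  have h2 : k = 0 := by
    have : |k| < 1 := by exact_mod_cast h1
    exact Int.abs_lt_one_iff.1 this
  rw [h2] at hk
  simp at hk
  linarith

lemma add_coe_inj_of_abs_lt {a : Angle} {x y : ℝ}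
    (h : a + (x : Angle) = a + (y : Angle)) (hlt : |x - y| < 2 * π) : x = y :=
  coe_inj_of_abs_lt (add_left_cancel h) hlt

lemma arcLen_add_coe (a : Angle) {t : ℝ} (h0 : 0 ≤ t) (h1 : t < 2 * π) :
    arcLen a (a + (t : Angle)) = t := by
  have h : a + ((arcLen a (a + (t : Angle)) : ℝ) : Angle) = a + (t : Angle) := add_arcLen _ _
  refine add_coe_inj_of_abs_lt h ?_
  have h2 := arcLen_nonneg a (a + (t : Angle))
  have h3 := arcLen_lt a (a + (t : Angle))
  rw [abs_lt]; constructor <;> linarith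

lemma arcLen_self (a : Angle) : arcLen a a = 0 := by
  have := arcLen_add_coe a le_rfl Real.two_pi_pos
  simpa using this

lemma arcLen_pos {a b : Angle} (h : a ≠ b) : 0 < arcLen a b := by
  rcases (arcLen_nonneg a b).eq_or_lt with h0 | h0
  · exact absurd (by rw [← add_arcLen a b, ← h0]; simp) h
  · exact h0

/-- `α` is an end of the arc `[p; q]`, and the arc leaves `α` in the positive direction (`σ = 1`)
or in the negative direction (`σ = -1`). -/
def IsEnd (p q α : Angle) (σ : ℝ) : Prop := (σ = 1 ∧ α = p) ∨ (σ = -1 ∧ α = q)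

lemma IsEnd.sign {p q α : Angle} {σ : ℝ} (h : IsEnd p q α σ) : σ = 1 ∨ σ = -1 :=
  h.imp And.left And.left

lemma IsEnd.mul_self {p q α : Angle} {σ : ℝ} (h : IsEnd p q α σ) : σ * σ = 1 := by
  rcases h.sign with h | h <;> rw [h] <;> norm_num

lemma IsEnd.abs_sign_mul {p q α : Angle} {σ : ℝ} (h : IsEnd p q α σ) (x : ℝ) : |σ * x| = |x| := by
  rcases h.sign with h | h <;> simp [h]

lemma IsEnd.end_eq {p q α : Angle} {σ : ℝ} (h : IsEnd p q α σ) : α = p ∨ α = q :=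
  h.imp And.right And.right

lemma exists_isEnd {p q α : Angle} (h : α = p ∨ α = q) : ∃ σ, IsEnd p q α σ :=
  h.elim (fun h => ⟨1, Or.inl ⟨rfl, h⟩⟩) (fun h => ⟨-1, Or.inr ⟨rfl, h⟩⟩)

lemma mem_arc_iff_left {p q x : Angle} :
    x ∈ arc p q ↔ ∃ t ∈ Icc (0 : ℝ) (arcLen p q), x = p + (t : Angle) := by
  constructor
  · intro h
    exact ⟨arcLen p x, ⟨arcLen_nonneg _ _, h⟩, (add_arcLen p x).symm⟩
  · rintro ⟨t, ⟨h0, h1⟩, rfl⟩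
    show arcLen p _ ≤ _
    rw [arcLen_add_coe p h0 (h1.trans_lt (arcLen_lt p q))]
    exact h1

lemma IsEnd.mem_arc_iff {p q α x : Angle} {σ : ℝ} (h : IsEnd p q α σ) :
    x ∈ arc p q ↔ ∃ t ∈ Icc (0 : ℝ) (arcLen p q), x = α + (σ * t : ℝ) := by
  rw [mem_arc_iff_left]
  rcases h with ⟨rfl, rfl⟩ | ⟨rfl, rfl⟩
  · simp
  · constructor
    · rintro ⟨t, ⟨h0, h1⟩, rfl⟩
      refine ⟨arcLen p α - t, ⟨by linarith, by linarith⟩, ?_⟩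
      conv_rhs => rw [← add_arcLen p α]
      rw [add_assoc, ← Angle.coe_add, arcLen_add_coe p (arcLen_nonneg _ _) (arcLen_lt _ _)]
      congr 2; ring
    · rintro ⟨t, ⟨h0, h1⟩, rfl⟩
      refine ⟨arcLen p α - t, ⟨by linarith, by linarith⟩, ?_⟩
      conv_lhs => rw [← add_arcLen p α]
      rw [add_assoc, ← Angle.coe_add]
      congr 2; ring

lemma IsEnd.mem_arc {p q α : Angle} {σ t : ℝ} (h : IsEnd p q α σ) (h0 : 0 ≤ t)
    (h1 : t ≤ arcLen p q) : α + (σ * t : ℝ) ∈ arc p q :=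
  h.mem_arc_iff.2 ⟨t, ⟨h0, h1⟩, rfl⟩

lemma IsEnd.self_mem_arc {p q α : Angle} {σ : ℝ} (h : IsEnd p q α σ) : α ∈ arc p q := by
  simpa using h.mem_arc le_rfl (arcLen_nonneg p q)

lemma IsEnd.sign_mul_inj {p q α : Angle} {σ s t : ℝ} (h : IsEnd p q α σ) (e : σ * s = σ * t) :
    s = t := by
  rcases h.sign with h | h <;> simpa [h] using e

lemma IsEnd.coord_inj {p q α : Angle} {σ s t : ℝ} (h : IsEnd p q α σ)
    (hst : α + (σ * s : ℝ) = α + (σ * t : ℝ)) (hlt : |s - t| < 2 * π) : s = t :=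
  h.sign_mul_inj (add_coe_inj_of_abs_lt hst (by rwa [← mul_sub, h.abs_sign_mul]))

/-- In the coordinate of an end of an arc, points of the circle near the end belong to the arc
exactly when their coordinate is nonnegative. -/
lemma IsEnd.coord_mem {p q α : Angle} {σ t : ℝ} (h : IsEnd p q α σ)
    (hm : α + (σ * t : ℝ) ∈ arc p q) (h0 : arcLen p q - 2 * π < t)
    (h1 : t < 2 * π) : 0 ≤ t ∧ t ≤ arcLen p q := by
  obtain ⟨s, ⟨hs0, hs1⟩, hs⟩ := h.mem_arc_iff.1 hm
  have hlt := arcLen_lt p q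
  obtain rfl := h.coord_inj hs (by rw [abs_lt]; constructor <;> linarith)
  exact ⟨hs0, hs1⟩

/-- The other end of an arc, seen from one end. -/
lemma IsEnd.other {p q α : Angle} {σ : ℝ} (h : IsEnd p q α σ) :
    IsEnd p q (α + (σ * arcLen p q : ℝ)) (-σ) := by
  rcases h with ⟨rfl, rfl⟩ | ⟨rfl, rfl⟩
  · right; exact ⟨rfl, by rw [one_mul, add_arcLen]⟩
  · left
    refine ⟨by norm_num, ?_⟩
    conv_lhs => lhs; rw [← add_arcLen p α]
    rw [add_assoc, ← Angle.coe_add]; simp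

lemma IsEnd.eq_or_eq {p q α β : Angle} {σ : ℝ} (h : IsEnd p q α σ) (hβ : β = p ∨ β = q) :
    β = α ∨ β = α + (σ * arcLen p q : ℝ) := by
  rcases h with ⟨rfl, rfl⟩ | ⟨rfl, rfl⟩
  · rw [one_mul, add_arcLen]; exact hβ
  · have h2 : α + (-1 * arcLen p α : ℝ) = p := by
      conv_lhs => lhs; rw [← add_arcLen p α]
      rw [add_assoc, ← Angle.coe_add]; simp
    rw [h2]; exact hβ.symm

/-- In the coordinate of an end, the only ends of the arc are `0` and the length. -/
lemma IsEnd.coord_eq {p q α : Angle} {σ t : ℝ} (h : IsEnd p q α σ)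
    (hβ : α + (σ * t : ℝ) = p ∨ α + (σ * t : ℝ) = q)
    (h0 : 0 ≤ t) (h1 : t ≤ arcLen p q) : t = 0 ∨ t = arcLen p q := by
  have hlt := arcLen_lt p q
  exact (h.eq_or_eq hβ).imp
    (fun h2 => h.coord_inj (by simpa using h2) (by rw [abs_lt]; constructor <;> linarith))
    fun h2 => h.coord_inj h2 (by rw [abs_lt]; constructor <;> linarith)

/-- The arc `[p'; q']` lies in the open arc `(p; q)`, in coordinates. -/
def Inside (p q p' q' : Angle) : Prop :=
  ∃ t : ℝ, 0 < t ∧ p' = p + (t : Angle) ∧ t + arcLen p' q' < arcLen p q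

/-- An arc that meets `[p; q]` and avoids both ends of it lies inside. -/
lemma inside_of_inter {p q p' q' w : Angle} (hw : w ∈ arc p q) (hw' : w ∈ arc p' q')
    (hp : p ∉ arc p' q') (hq : q ∉ arc p' q') : Inside p q p' q' := by
  obtain ⟨t, ⟨h0, h1⟩, rfl⟩ := mem_arc_iff_left.1 hw
  obtain ⟨s, ⟨hs0, hs1⟩, hs⟩ := mem_arc_iff_left.1 hw'
  have e1 : p' = p + (t - s : ℝ) := by rw [Angle.coe_sub, ← add_sub_assoc, hs]; abel
  have hst : s < t := by
    by_contra hst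
    push Not at hst
    apply hp
    refine mem_arc_iff_left.2 ⟨s - t, ⟨by linarith, by linarith⟩, ?_⟩
    rw [e1, add_assoc, ← Angle.coe_add]; simp
  refine ⟨t - s, by linarith, e1, ?_⟩
  by_contra hcon
  push Not at hcon
  apply hq
  refine mem_arc_iff_left.2 ⟨s + (arcLen p q - t), ⟨by linarith, by linarith⟩, ?_⟩
  rw [e1, add_assoc, ← Angle.coe_add]
  conv_lhs => rw [← add_arcLen p q]
  congr 2; ring

lemma Inside.left_not_mem {p q p' q' : Angle} (h : Inside p q p' q') : p ∉ arc p' q' := by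
  obtain ⟨t, ht, rfl, h2⟩ := h
  intro hm
  obtain ⟨s, ⟨hs0, hs1⟩, hs⟩ := mem_arc_iff_left.1 hm
  rw [add_assoc, ← Angle.coe_add] at hs
  have := arcLen_lt p q
  have h3 : p + (0 : ℝ) = p + (t + s : ℝ) := by simpa using hs
  have := add_coe_inj_of_abs_lt h3 (by rw [abs_lt]; constructor <;> linarith)
  linarith

lemma Inside.right_not_mem {p q p' q' : Angle} (h : Inside p q p' q') : q ∉ arc p' q' := by
  obtain ⟨t, ht, rfl, h2⟩ := h
  intro hm
  obtain ⟨s, ⟨hs0, hs1⟩, hs⟩ := mem_arc_iff_left.1 hm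
  rw [add_assoc, ← Angle.coe_add] at hs
  have := arcLen_lt p q
  have := arcLen_nonneg p q
  have h3 : p + (arcLen p q : ℝ) = p + (t + s : ℝ) := by rw [add_arcLen]; exact hs
  have := add_coe_inj_of_abs_lt h3 (by rw [abs_lt]; constructor <;> linarith)
  linarith

/-- If a point within `ε` of `α` lies in `[p; q]` and the ends of the arc other than `α` are not
within `ε` of `α`, then `α` is an end of the arc or lies in it at depth at least `ε`. -/
lemma end_or_deep {p q α : Angle} {ε x : ℝ} (hx : |x| < ε) (hm : α + (x : Angle) ∈ arc p q)
    (hp : ∀ t : ℝ, |t| < ε → p = α + (t : Angle) → p = α)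
    (hq : ∀ t : ℝ, |t| < ε → q = α + (t : Angle) → q = α) :
    (α = p ∨ α = q) ∨ ∃ T : ℝ, α = p + (T : Angle) ∧ ε ≤ T ∧ T ≤ arcLen p q - ε := by
  obtain ⟨t, ⟨h0, h1⟩, ht⟩ := mem_arc_iff_left.1 hm
  have e1 : α = p + (t - x : ℝ) := by rw [Angle.coe_sub, ← add_sub_assoc, ← ht]; abel
  have e2 : p = α + (x - t : ℝ) := by rw [e1, add_assoc, ← Angle.coe_add]; simp
  have e3 : q = α + (x - t + arcLen p q : ℝ) := by rw [Angle.coe_add, ← add_assoc, ← e2, add_arcLen]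
  by_cases hc : |x - t| < ε
  · exact Or.inl (Or.inl (hp _ hc e2).symm)
  by_cases hc' : |x - t + arcLen p q| < ε
  · exact Or.inl (Or.inr (hq _ hc' e3).symm)
  right
  refine ⟨t - x, e1, ?_, ?_⟩
  · rw [abs_lt] at hx hc
    by_contra h
    exact hc ⟨by linarith, by linarith⟩
  · rw [abs_lt] at hx hc'
    by_contra h
    exact hc' ⟨by linarith, by linarith⟩

lemma nhds_angle (θ : Angle) : 𝓝 θ = map (fun x : ℝ => θ + (x : Angle)) (𝓝 0) := by
  have h1 : IsOpenMap (fun x : ℝ => θ + (x : Angle)) :=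
    (isOpenMap_add_left θ).comp QuotientAddGroup.isOpenMap_coe
  have h2 : Continuous (fun x : ℝ => θ + (x : Angle)) := continuous_const.add Angle.continuous_coe
  have := h1.map_nhds_eq (x := 0) h2.continuousAt
  simpa using this.symm

lemma discrete_gap {s : Set Angle} (hs : IsDiscrete s) {α : Angle} (hα : α ∈ s) :
    ∃ ε > 0, ∀ t : ℝ, |t| < ε → α + (t : Angle) ∈ s → α + (t : Angle) = α := by
  obtain ⟨u, hu, hus⟩ := isDiscrete_iff_forall_mem_exists_isOpen.1 hs α hα
  have hαu : α ∈ u := by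
    have : α ∈ u ∩ s := by rw [hus]; rfl
    exact this.1
  have : u ∈ 𝓝 α := hu.mem_nhds hαu
  rw [nhds_angle, mem_map, Metric.mem_nhds_iff] at this
  obtain ⟨ε, hε, hb⟩ := this
  refine ⟨ε, hε, fun t ht hts => ?_⟩
  have h1 : α + (t : Angle) ∈ u := hb (by simpa [Real.dist_eq] using ht)
  have h2 : α + (t : Angle) ∈ u ∩ s := ⟨h1, hts⟩
  rw [hus] at h2
  exact h2

/-! ### Consecutive points and the position of an arc in a window -/

lemma Consecutive.not_mem {X : Finset Angle} {a b : Angle} (h : Consecutive X a b)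
    {s : ℝ} (h0 : 0 < s) (h1 : s < arcLen a b) : a + (s : Angle) ∉ X := by
  intro hm
  refine h.2.2.2 _ hm ?_
  have := arcLen_lt a b
  show 0 < arcLen a _ ∧ arcLen a _ < _
  rw [arcLen_add_coe a h0.le (by linarith)]
  exact ⟨h0, h1⟩

/-- An arc that contains a point of `X` and has an end in the window between two consecutive points
of `X` reaches beyond the window. -/
lemma Consecutive.lt_arcLen {X : Finset Angle} {a b p q α : Angle} {σ t s : ℝ}
    (h : Consecutive X a b) (hα : IsEnd p q α σ)
    (hp : p ∉ X) (hq : q ∉ X) (hX : ∃ x ∈ X, x ∈ arc p q) (hs : α = a + (s : Angle))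
    (h0 : 0 ≤ s + σ * t) (h1 : s + σ * t ≤ arcLen a b)
    (h0' : 0 < s) (h1' : s < arcLen a b) : t < arcLen p q := by
  by_contra hcon
  push Not at hcon
  obtain ⟨x, hx, hxm⟩ := hX
  obtain ⟨t', ⟨ht0, ht1⟩, rfl⟩ := hα.mem_arc_iff.1 hxm
  have hmem : a + (s + σ * t' : ℝ) ∈ X := by rw [Angle.coe_add, ← add_assoc, ← hs]; exact hx
  have hα' : α ∉ X := by rcases hα.end_eq with h | h <;> rw [h] <;> assumption
  have ht' : t' ≠ 0 := by rintro rfl; simp at hx; exact hα' hx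
  have ht'' : t' < arcLen p q := by
    refine lt_of_le_of_ne ht1 ?_
    rintro rfl
    rcases hα.other.end_eq with h | h <;> rw [h] at hx
    · exact hp hx
    · exact hq hx
  have ht0' : 0 < t' := lt_of_le_of_ne ht0 (Ne.symm ht')
  rcases hα.sign with rfl | rfl
  · exact h.not_mem (by linarith) (by linarith) hmem
  · exact h.not_mem (by linarith) (by linarith) hmem

/-- The position, relative to a window `[a; b]`, of an arc `[p; q]` near one of its points: in the
coordinate of the end `α` of the arc, the interval `[x0, x1]` is the part of the arc in the window
around the given point. It reaches from `α`, if `x0 = 0`, or else from an end of the window, to the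
other end of the window. -/
structure Position (a b p q α : Angle) (σ x0 x1 : ℝ) : Prop where
  isEnd : IsEnd p q α σ
  nonneg : 0 ≤ x0
  lt : x0 < x1
  lt_len : x1 < arcLen p q
  win1 : IsEnd a b (α + (σ * x1 : ℝ)) (-σ)
  start : (x0 = 0 ∧ x1 < arcLen a b) ∨ (0 < x0 ∧ x1 - x0 = arcLen a b)

lemma Consecutive.exists_position {X : Finset Angle} {a b p q θ : Angle}
    (h : Consecutive X a b) (hp : p ∉ X) (hq : q ∉ X) (hX : ∃ x ∈ X, x ∈ arc p q)
    (hθ : θ ∈ arc p q) (hθ' : θ ∈ arc a b) :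
    ∃ α σ x0 x1 x, Position a b p q α σ x0 x1 ∧ x0 ≤ x ∧ x ≤ x1 ∧ θ = α + (σ * x : ℝ) := by
  obtain ⟨s0, ⟨hs0, hs1⟩, hs⟩ := mem_arc_iff_left.1 hθ'
  have hb : a + (arcLen a b : ℝ) = b := add_arcLen a b
  have hlt := arcLen_lt a b
  -- the end `p`, then the end `q`, is in the window on the proper side of the given point
  by_cases c1 : ∃ s, 0 < s ∧ s < arcLen a b ∧ p = a + (s : Angle) ∧ s ≤ s0
  · obtain ⟨s, hs', hsl, hps, hle⟩ := c1
    have hE : IsEnd p q p 1 := Or.inl ⟨rfl, rfl⟩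
    refine ⟨p, 1, 0, arcLen a b - s, s0 - s, ⟨hE, le_rfl, by linarith,
      h.lt_arcLen hE hp hq hX hps (by linarith) (by linarith) hs' hsl, Or.inr ⟨rfl, ?_⟩,
      Or.inl ⟨rfl, by linarith⟩⟩, by linarith, by linarith, ?_⟩
    · conv_rhs => rw [← hb]
      rw [hps]; exact add_coe_add (by ring)
    · rw [hs, hps]; exact (add_coe_add (by ring)).symm
  by_cases c2 : ∃ s, 0 < s ∧ s < arcLen a b ∧ q = a + (s : Angle) ∧ s0 ≤ s
  · obtain ⟨s, hs', hsl, hps, hle⟩ := c2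
    have hE : IsEnd p q q (-1) := Or.inr ⟨rfl, rfl⟩
    refine ⟨q, -1, 0, s, s - s0, ⟨hE, le_rfl, by linarith,
      h.lt_arcLen hE hp hq hX hps (by linarith) (by linarith) hs' hsl, Or.inl ⟨by norm_num, ?_⟩,
      Or.inl ⟨rfl, by linarith⟩⟩, by linarith, by linarith, ?_⟩
    · rw [hps, add_assoc, ← Angle.coe_add]; simp
    · rw [hs, hps]; exact (add_coe_add (by ring)).symm
  obtain ⟨t, ⟨ht0, ht1⟩, ht⟩ := mem_arc_iff_left.1 hθ
  have ep : p = a + (s0 - t : ℝ) := by rw [Angle.coe_sub, ← add_sub_assoc, ← hs, ht]; abel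
  have eq' : q = a + (s0 + (arcLen p q - t) : ℝ) := by
    conv_lhs => rw [← add_arcLen p q, ep]
    rw [add_assoc, ← Angle.coe_add]; congr 2; rw [← ep]; ring
  have hpa : p ≠ a := fun e => hp (e ▸ h.1)
  have hpb : p ≠ b := fun e => hp (e ▸ h.2.1)
  have hqa : q ≠ a := fun e => hq (e ▸ h.1)
  have hqb : q ≠ b := fun e => hq (e ▸ h.2.1)
  -- otherwise the arc reaches beyond both ends of the window
  have hts : s0 < t := by
    by_contra hc
    push Not at hc
    rcases (sub_nonneg.2 hc).eq_or_lt with h0 | h0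
    · rw [← h0] at ep; exact hpa (by simpa using ep)
    rcases (show s0 - t ≤ arcLen a b by linarith).eq_or_lt with h1 | h1
    · rw [h1, hb] at ep; exact hpb ep
    exact c1 ⟨_, h0, h1, ep, by linarith⟩
  have hts' : arcLen a b - s0 < arcLen p q - t := by
    by_contra hc
    push Not at hc
    have h2 : 0 ≤ s0 + (arcLen p q - t) := by linarith
    rcases h2.eq_or_lt with h0 | h0
    · rw [← h0] at eq'; exact hqa (by simpa using eq')
    rcases (show s0 + (arcLen p q - t) ≤ arcLen a b by linarith).eq_or_lt with h1 | h1
    · rw [h1, hb] at eq'; exact hqb eq'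
    exact c2 ⟨_, h0, h1, eq', by linarith⟩
  have hab : 0 < arcLen a b := arcLen_pos h.2.2.1
  refine ⟨p, 1, t - s0, t - s0 + arcLen a b, t, ⟨Or.inl ⟨rfl, rfl⟩, by linarith, by linarith,
    by linarith, ?_, Or.inr ⟨by linarith, by ring⟩⟩, by linarith, by linarith,
    by rw [one_mul]; exact ht⟩
  right
  refine ⟨rfl, ?_⟩
  conv_rhs => rw [← hb]
  rw [ep]; exact add_coe_add (by ring)

/-! ### The harmonic function of a rectangle -/

/-- The sum of the series that defines `Rect.h`, for a rectangle of width `A` and height `π`. -/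
def stripSeries (A X Y : ℝ) : ℝ :=
  4 / π * ∑' n : ℕ, sin ((2 * n + 1) * Y) * (exp ((2 * n + 1) * X) + exp ((2 * n + 1) * (A - X))) /
    ((2 * n + 1) * (1 + exp ((2 * n + 1) * A)))

/-- The holomorphic function in the strip `|Re Z| < A` whose imaginary part is what remains of
`stripSeries` once the contribution of the half-strip at the left side is removed. -/
def eta (A : ℝ) (Z : ℂ) : ℂ :=
  ∑' n : ℕ, 4 * Complex.cosh ((2 * n + 1) * Z) / ((2 * n + 1) * (1 + exp ((2 * n + 1) * A)))

/-- The imaginary part of `eta` in real coordinates. -/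
def etaIm (A X Y : ℝ) : ℝ := (eta A (X + Y * I)).im

lemma norm_cosh_le (Z : ℂ) {B : ℝ} (h : |Z.re| ≤ B) : ‖Complex.cosh Z‖ ≤ exp B := by
  rw [Complex.cosh, norm_div]
  have h1 := abs_le.1 h
  have h2 : ‖Complex.exp Z‖ ≤ exp B := by rw [Complex.norm_exp]; exact Real.exp_le_exp.2 h1.2
  have h3 : ‖Complex.exp (-Z)‖ ≤ exp B := by
    rw [Complex.norm_exp]; exact Real.exp_le_exp.2 (by simp; linarith)
  have := norm_add_le (Complex.exp Z) (Complex.exp (-Z))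
  simp only [Complex.norm_ofNat]
  linarith

lemma eta_term_bound {A B : ℝ} {Z : ℂ} (h : |Z.re| ≤ B) (n : ℕ) :
    ‖4 * Complex.cosh ((2 * n + 1) * Z) /
      ((2 * n + 1) * (1 + exp ((2 * n + 1) * A)))‖ ≤ 4 * exp (-(A - B)) ^ n
        * exp (-(A - B)) ^ n * exp (-(A - B)) := by
  have hk : (0 : ℝ) < 2 * n + 1 := by positivity
  have h1 : ‖Complex.cosh ((2 * n + 1) * Z)‖ ≤ exp ((2 * n + 1) * B) := by
    refine norm_cosh_le _ ?_
    have : ((2 * n + 1) * Z : ℂ).re = (2 * n + 1) * Z.re := by simp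
    rw [this, abs_mul, abs_of_pos hk]
    exact mul_le_mul_of_nonneg_left h hk.le
  have h2 : ‖((2 * n + 1) * (1 + exp ((2 * n + 1) * A)) : ℂ)‖ =
      (2 * n + 1) * (1 + exp ((2 * n + 1) * A)) := by
    have : ((2 * n + 1) * (1 + exp ((2 * n + 1) * A)) : ℂ) =
      (((2 * n + 1) * (1 + exp ((2 * n + 1) * A)) : ℝ) : ℂ) := by push_cast; rfl
    rw [this, Complex.norm_real, Real.norm_of_nonneg (by positivity)]
  rw [norm_div, h2, norm_mul, Complex.norm_ofNat, div_le_iff₀ (by positivity)]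
  have h3 : 4 * exp (-(A - B)) ^ n * exp (-(A - B)) ^ n * exp (-(A - B)) =
      4 * exp (-((2 * n + 1) * (A - B))) := by
    rw [← Real.exp_nat_mul, mul_assoc, mul_assoc, ← Real.exp_add, ← Real.exp_add]
    congr 2; ring
  rw [h3]
  have h4 : exp ((2 * n + 1) * B) = exp (-((2 * n + 1) * (A - B))) *
      exp ((2 * n + 1) * A) := by rw [← Real.exp_add]; congr 1; ring
  have h5 := Real.exp_pos (-((2 * n + 1) * (A - B)))
  have h6 := Real.exp_pos ((2 * n + 1) * A)
  calc 4 * ‖Complex.cosh ((2 * n + 1) * Z)‖ ≤ 4 * exp ((2 * n + 1) * B) := by linarith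
    _ = 4 * exp (-((2 * n + 1) * (A - B))) * (1 * exp ((2 * n + 1) * A)) := by rw [h4]; ring
    _ ≤ 4 * exp (-((2 * n + 1) * (A - B))) *
      ((2 * n + 1) * (1 + exp ((2 * n + 1) * A))) := by
      have : (0 : ℝ) ≤ n := by positivity
      gcongr <;> linarith

lemma eta_bound_summable {A B : ℝ} (h : B < A) :
    Summable (fun n : ℕ => 4 * exp (-(A - B)) ^ n * exp (-(A - B)) ^ n * exp (-(A - B))) := by
  have h1 : exp (-(A - B)) < 1 := by rw [Real.exp_lt_one_iff]; linarith
  have h0 := Real.exp_pos (-(A - B))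
  have : Summable (fun n : ℕ => (exp (-(A - B)) * exp (-(A - B))) ^ n) :=
    summable_geometric_of_lt_one (by positivity) (by nlinarith)
  refine ((this.mul_left 4).mul_right (exp (-(A - B)))).congr fun n => ?_
  rw [mul_pow]; ring

lemma isOpen_strip (A : ℝ) : IsOpen {Z : ℂ | |Z.re| < A} :=
  isOpen_lt (Complex.continuous_re.abs) continuous_const

lemma eta_differentiableOn (A : ℝ) : DifferentiableOn ℂ (eta A) {Z | |Z.re| < A} := by
  intro Z hZ
  obtain ⟨B, hB1, hB2⟩ := exists_between (show |Z.re| < A from hZ)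
  have : DifferentiableOn ℂ (eta A) {Z | |Z.re| < B} :=
    Complex.differentiableOn_tsum_of_summable_norm (eta_bound_summable hB2)
      (fun n => by fun_prop) (isOpen_strip B)
      (fun n W hW => eta_term_bound (show |W.re| < B from hW).le n)
  exact (this.differentiableAt ((isOpen_strip B).mem_nhds hB1)).differentiableWithinAt

lemma eta_hasSum {A : ℝ} {Z : ℂ} (h : |Z.re| < A) :
    HasSum (fun n : ℕ => 4 * Complex.cosh ((2 * n + 1) * Z) /
      ((2 * n + 1) * (1 + exp ((2 * n + 1) * A)))) (eta A Z) :=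
  (Summable.of_norm_bounded (eta_bound_summable h) (fun n => eta_term_bound le_rfl n)).hasSum

lemma cosh_add_mul_I_im (x y : ℝ) : (Complex.cosh (x + y * I)).im = sinh x * sin y := by
  rw [Complex.cosh_add, Complex.cosh_mul_I, Complex.sinh_mul_I, ← Complex.ofReal_cosh,
    ← Complex.ofReal_sinh, ← Complex.ofReal_cos, ← Complex.ofReal_sin]
  simp only [mul_re, mul_im, add_im, ofReal_re, ofReal_im, I_re, I_im]
  ring

lemma etaIm_hasSum {A X : ℝ} (Y : ℝ) (h : |X| < A) :
    HasSum (fun n : ℕ => 4 * (sinh ((2 * n + 1) * X) * sin ((2 * n + 1) * Y)) /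
      ((2 * n + 1) * (1 + exp ((2 * n + 1) * A)))) (etaIm A X Y) := by
  have := Complex.hasSum_im (eta_hasSum (A := A) (Z := X + Y * I) (by simpa using h))
  refine this.congr_fun fun n => ?_
  have h1 : ((2 * n + 1) * (1 + exp ((2 * n + 1) * A)) : ℂ) =
      (((2 * n + 1) * (1 + exp ((2 * n + 1) * A)) : ℝ) : ℂ) := by push_cast; rfl
  have h2 : ((2 * n + 1) * (X + Y * I) : ℂ) =
    (((2 * n + 1) * X : ℝ) : ℂ) + (((2 * n + 1) * Y : ℝ) : ℂ) * I := by push_cast; ring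
  rw [h1, Complex.div_ofReal_im, h2]
  have h3 : ∀ z : ℂ, (4 * z).im = 4 * z.im := fun z => by simp
  rw [h3, cosh_add_mul_I_im]

lemma etaIm_zero_left (A Y : ℝ) (hA : 0 < A) : etaIm A 0 Y = 0 :=
  (etaIm_hasSum Y (by simpa using hA)).unique (by simp)

lemma sin_odd_mul_pi_sub (n : ℕ) (Y : ℝ) : sin ((2 * n + 1) * (π - Y)) = sin ((2 * n + 1) * Y) := by
  have : (2 * n + 1) * (π - Y) = π - (2 * n + 1) * Y + n * (2 * π) := by ring
  rw [this, Real.sin_add_nat_mul_two_pi, Real.sin_pi_sub]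

lemma etaIm_zero_right {A X : ℝ} (h : |X| < A) : etaIm A X 0 = 0 :=
  (etaIm_hasSum 0 h).unique (by simp)

lemma etaIm_contDiffAt {A X Y : ℝ} (h : |X| < A) :
    ContDiffAt ℝ ω (fun p : ℝ² => etaIm A p.1 p.2) (X, Y) := by
  have h1 : ContDiffAt ℂ ω (eta A) (X + Y * I) :=
    ((eta_differentiableOn A).contDiffOn (isOpen_strip A)).contDiffAt
      ((isOpen_strip A).mem_nhds (by simpa using h))
  have h2 : ContDiffAt ℝ ω (fun p : ℝ² => (p.1 : ℂ) + p.2 * I) (X, Y) := by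
    have e1 : ContDiff ℝ ω (fun p : ℝ² => (p.1 : ℂ)) := Complex.ofRealCLM.contDiff.comp contDiff_fst
    have e2 : ContDiff ℝ ω (fun p : ℝ² => (p.2 : ℂ)) := Complex.ofRealCLM.contDiff.comp contDiff_snd
    exact (e1.add (e2.mul contDiff_const)).contDiffAt
  have h3 := ContDiffAt.comp (X, Y) (h1.restrict_scalars ℝ) h2
  exact Complex.imCLM.contDiff.contDiffAt.comp _ h3

/-- The holomorphic function in the strip `0 < Re Z < A` with the imaginary part
`(π/2) stripSeries`. -/
def psi (A : ℝ) (Z : ℂ) : ℂ :=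
  Complex.log ((1 - Complex.exp (-Z)) / (1 + Complex.exp (-Z))) + eta A Z

lemma exp_neg_norm_lt {Z : ℂ} (h : 0 < Z.re) : ‖Complex.exp (-Z)‖ < 1 := by
  rw [Complex.norm_exp]; simpa using h

lemma one_add_exp_ne {Z : ℂ} (h : 0 < Z.re) : 1 + Complex.exp (-Z) ≠ 0 := by
  intro h0
  have h1 : Complex.exp (-Z) = -1 := by linear_combination h0
  have := exp_neg_norm_lt h
  rw [h1] at this; simp at this

/-- The value of `tanh ((X + i Y) / 2)` up to a positive factor; its argument is the angle in `psi`.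
-/
lemma tanh_half_eq {X Y : ℝ} (hX : 0 < X) : ∃ c : ℝ, 0 < c ∧
    (1 - Complex.exp (-(X + Y * I))) / (1 + Complex.exp (-(X + Y * I))) =
      c * (sinh X + sin Y * I) := by
  set w := Complex.exp (-(X + Y * I)) with hw
  have hne : 1 + w ≠ 0 := one_add_exp_ne (by simpa using hX)
  have hpos : 0 < Complex.normSq (1 + w) := Complex.normSq_pos.2 hne
  have hwre : w.re = exp (-X) * cos Y := by rw [hw, Complex.exp_re]; simp
  have hwim : w.im = -(exp (-X) * sin Y) := by rw [hw, Complex.exp_im]; simp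
  refine ⟨2 * exp (-X) / Complex.normSq (1 + w), by positivity, ?_⟩
  rw [div_eq_iff hne]
  have hs : sinh X = (exp X - exp (-X)) / 2 := Real.sinh_eq X
  have he : exp (-X) * exp X = 1 := by rw [← Real.exp_add]; simp
  have hq : (Complex.normSq (1 + w) : ℂ) ≠ 0 := by exact_mod_cast hpos.ne'
  have key : (1 - w) * (starRingEnd ℂ) (1 + w) = 2 * exp (-X) * (sinh X + sin Y * I) := by
    apply Complex.ext
    · have : ((1 - w) * (starRingEnd ℂ) (1 + w)).re = 1 - w.re ^ 2 - w.im ^ 2 := by simp; ring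
      rw [this, hwre, hwim, hs]
      simp only [mul_re, mul_im, add_re, add_im, ofReal_re, ofReal_im,
        I_re, I_im, re_ofNat, im_ofNat]
      have := Real.sin_sq_add_cos_sq Y
      linear_combination (-exp (-X) ^ 2) * this - he
    · have : ((1 - w) * (starRingEnd ℂ) (1 + w)).im = - 2 * w.im := by simp; ring
      rw [this, hwim]
      simp only [mul_re, mul_im, add_re, add_im, ofReal_re, ofReal_im,
        I_re, I_im, re_ofNat, im_ofNat]
      ring
  have h1 : (1 + w) * (starRingEnd ℂ) (1 + w) = Complex.normSq (1 + w) := Complex.mul_conj _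
  push_cast
  rw [div_mul_eq_mul_div, div_mul_eq_mul_div, eq_div_iff hq]
  rw [← h1]
  push_cast at key
  linear_combination (1 + w) * key

lemma psi_differentiableAt {A : ℝ} {Z : ℂ} (h0 : 0 < Z.re) (h1 : Z.re < A) :
    DifferentiableAt ℂ (psi A) Z := by
  have hη : DifferentiableAt ℂ (eta A) Z :=
    (eta_differentiableOn A).differentiableAt ((isOpen_strip A).mem_nhds
      (by rw [mem_ofPred_eq, abs_lt]; constructor <;> linarith))
  refine DifferentiableAt.add ?_ hη
  have hne := one_add_exp_ne h0
  refine DifferentiableAt.clog (by fun_prop (disch := assumption)) ?_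
  obtain ⟨c, hc, he⟩ := tanh_half_eq (X := Z.re) (Y := Z.im) h0
  rw [Complex.re_add_im] at he
  rw [he]
  left
  have : 0 < sinh Z.re := Real.sinh_pos_iff.2 h0
  have h3 : (c * (sinh Z.re + sin Z.im * I) : ℂ).re = c * sinh Z.re := by
    simp only [mul_re, mul_im, add_re, add_im, ofReal_re, ofReal_im, I_re, I_im]; ring
  rw [h3]; positivity

lemma psi_im {A X Y : ℝ} (hX : 0 < X) : (psi A (X + Y * I)).im =
    arg (sinh X + sin Y * I) + etaIm A X Y := by
  rw [psi, add_im, Complex.log_im]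
  obtain ⟨c, hc, he⟩ := tanh_half_eq (X := X) (Y := Y) hX
  rw [he, Complex.arg_real_mul _ hc]; rfl

lemma hasSum_log_ratio {w : ℂ} (h : ‖w‖ < 1) :
    HasSum (fun n : ℕ => 2 * w ^ (2 * n + 1) / (2 * n + 1)) (Complex.log ((1 + w) / (1 - w))) := by
  have := Complex.hasSum_arctan (z := -I * w) (by simpa using h)
  have h2 := this.mul_left (2 * I)
  have e : 2 * I * Complex.arctan (-I * w) = Complex.log ((1 + w) / (1 - w)) := by
    rw [Complex.arctan]
    have e1 : -I * w * I = w := by linear_combination -w * Complex.I_mul_I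
    rw [e1]
    linear_combination -Complex.log ((1 + w) / (1 - w)) * Complex.I_mul_I
  rw [e] at h2
  refine h2.congr_fun fun n => ?_
  have e2 : (-I * w) ^ (2 * n + 1) = (-1) ^ n * (-I) * w ^ (2 * n + 1) := by
    rw [mul_pow, pow_succ (-I), pow_mul]; simp
  rw [e2]
  have e3 : ((-1 : ℂ) ^ n) * (-1) ^ n = 1 := by rw [← mul_pow]; simp
  have e4 : 2 * I * ((-1) ^ n * ((-1) ^ n * (-I) * w ^ (2 * n + 1)) /
      ((2 * n + 1 : ℕ) : ℂ)) = ((-1) ^ n * (-1) ^ n) * (-(I * I)) *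
      (2 * w ^ (2 * n + 1) / (2 * n + 1)) := by push_cast; ring
  rw [e4, e3, Complex.I_mul_I]
  ring

lemma stripSeries_eq {A X : ℝ} (Y : ℝ) (h0 : 0 < X) (h1 : X < A) :
    stripSeries A X Y = 2 / π * (psi A (X + Y * I)).im := by
  have hn : ‖-Complex.exp (-(X + Y * I))‖ < 1 := by
    rw [norm_neg]; exact exp_neg_norm_lt (by simpa using h0)
  have s1 := Complex.hasSum_im (hasSum_log_ratio hn)
  have s2 := etaIm_hasSum (A := A) Y (abs_lt.2 ⟨by linarith, h1⟩)
  have s3 := (s1.add s2).mul_left (1 / 2)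
  have e : (psi A (X + Y * I)).im =
    (Complex.log ((1 + -Complex.exp (-(X + Y * I))) /
      (1 - -Complex.exp (-(X + Y * I))))).im + etaIm A X Y := by
    rw [psi, add_im, sub_neg_eq_add, ← sub_eq_add_neg]; rfl
  rw [← e] at s3
  rw [stripSeries]
  have : HasSum (fun n : ℕ => sin ((2 * n + 1) * Y) *
    (exp ((2 * n + 1) * X) + exp ((2 * n + 1) * (A - X))) /
    ((2 * n + 1) * (1 + exp ((2 * n + 1) * A)))) (1 / 2 * (psi A (X + Y * I)).im) := by
    refine s3.congr_fun fun n => ?_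
    have e1 : (-Complex.exp (-(X + Y * I))) ^ (2 * n + 1) =
        -Complex.exp (((-((2 * n + 1) * X) : ℝ) : ℂ) + ((-((2 * n + 1) * Y) : ℝ) : ℂ) * I) := by
      rw [Odd.neg_pow ⟨n, rfl⟩, ← Complex.exp_nat_mul]; congr 2; push_cast; ring
    have e2 : (2 * (-Complex.exp (-(X + Y * I))) ^ (2 * n + 1) / (2 * n + 1) : ℂ).im =
        2 * (exp (-((2 * n + 1) * X)) * sin ((2 * n + 1) * Y)) / (2 * n + 1) := by
      rw [e1]
      have : (2 * n + 1 : ℂ) = ((2 * n + 1 : ℝ) : ℂ) := by push_cast; rfl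
      rw [this, Complex.div_ofReal_im]
      congr 1
      have h3 : ∀ z : ℂ, (2 * -z).im = -(2 * z.im) := fun z => by simp
      rw [h3, Complex.exp_im]
      simp
    rw [e2]
    have hk : (0 : ℝ) < 2 * n + 1 := by positivity
    have he := Real.exp_pos ((2 * n + 1) * A)
    rw [Real.sinh_eq]
    have e3 : exp ((2 * n + 1) * (A - X)) =
      exp ((2 * n + 1) * A) * exp (-((2 * n + 1) * X)) := by
      rw [← Real.exp_add]; congr 1; ring
    rw [e3]
    field_simp
    ring
  rw [this.tsum_eq]; ring

lemma re_add_mul_I (a b : ℝ) : (a + b * I : ℂ).re = a := by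
  simp only [mul_re, add_re, ofReal_re, ofReal_im, I_re, I_im]
  ring

lemma im_add_mul_I (a b : ℝ) : (a + b * I : ℂ).im = b := by
  simp only [mul_im, add_im, ofReal_re, ofReal_im, I_re, I_im]
  ring

/-- The function `Rect.h` for a rectangle of width `A` and height `π`, in real coordinates. -/
def stripH (A X Y : ℝ) : ℝ := open Classical in if X = 0 ∨ X = A then 1 else stripSeries A X Y

lemma stripSeries_reflect_left (A X Y : ℝ) : stripSeries A (A - X) Y = stripSeries A X Y := by
  unfold stripSeries
  congr 1
  refine tsum_congr fun n => ?_
  rw [sub_sub_cancel, add_comm (exp ((2 * n + 1) * (A - X)))]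

lemma stripSeries_reflect_right (A X Y : ℝ) : stripSeries A X (π - Y) = stripSeries A X Y := by
  unfold stripSeries
  congr 1
  refine tsum_congr fun n => ?_
  rw [sin_odd_mul_pi_sub]

lemma stripSeries_neg (A X Y : ℝ) : stripSeries A X (-Y) = -stripSeries A X Y := by
  unfold stripSeries
  rw [← mul_neg, ← tsum_neg]
  congr 1
  refine tsum_congr fun n => ?_
  rw [mul_neg, Real.sin_neg]; ring

lemma stripH_reflect_left (A X Y : ℝ) : stripH A (A - X) Y = stripH A X Y := by
  unfold stripH
  rw [stripSeries_reflect_left]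
  congr 1
  simp only [eq_iff_iff, sub_eq_zero, sub_eq_self]
  constructor <;> rintro (h | h) <;> simp [h]

lemma stripH_reflect_right (A X Y : ℝ) : stripH A X (π - Y) = stripH A X Y := by
  unfold stripH
  rw [stripSeries_reflect_right]

lemma stripH_of_ne {A X : ℝ} (Y : ℝ) (h0 : 0 < X) (h1 : X < A) :
    stripH A X Y = stripSeries A X Y := by
  rw [stripH, if_neg]
  push Not; exact ⟨h0.ne', h1.ne⟩

lemma stripH_left (A Y : ℝ) : stripH A 0 Y = 1 := by simp [stripH]

lemma stripH_right (A Y : ℝ) : stripH A A Y = 1 := by simp [stripH]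

lemma stripH_bottom {A X : ℝ} (h0 : 0 < X) (h1 : X < A) : stripH A X 0 = 0 := by
  rw [stripH_of_ne 0 h0 h1]; simp [stripSeries]

lemma stripH_top {A X : ℝ} (h0 : 0 < X) (h1 : X < A) : stripH A X π = 0 := by
  rw [← stripH_bottom h0 h1, ← stripH_reflect_right]; simp

/-- Near the left side the function is an angle plus a smooth function. -/
lemma stripH_eq_arg {A X Y : ℝ} (h0 : 0 ≤ X) (h1 : X < A) (hs : X = 0 → 0 < sin Y) :
    stripH A X Y = 2 / π * (arg (sinh X + sin Y * I) + etaIm A X Y) := by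
  rcases h0.eq_or_lt with rfl | h0
  · rw [stripH_left, etaIm_zero_left A Y h1]
    have := hs rfl
    rw [Real.sinh_zero, ofReal_zero, zero_add, Complex.arg_real_mul _ this, Complex.arg_I]
    have := Real.pi_pos
    field_simp
    norm_num
  · rw [stripH_of_ne Y h0 h1, stripSeries_eq Y h0 h1, psi_im h0]

/-- The closed rectangle of width `A` and height `π` without its vertices. -/
def stripRect (A : ℝ) : Set (ℝ²) :=
  {p | p ∈ Icc 0 A ×ˢ Icc 0 π ∧ ¬((p.1 = 0 ∨ p.1 = A) ∧ (p.2 = 0 ∨ p.2 = π))}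

lemma continuousAt_stripArg {A : ℝ} {p : ℝ²} (h : |p.1| < A) (hs : 0 < sinh p.1 ∨ sin p.2 ≠ 0) :
    ContinuousAt (fun p : ℝ² => 2 / π * (arg (sinh p.1 + sin p.2 * I) + etaIm A p.1 p.2)) p := by
  have h1 : ContinuousAt (fun p : ℝ² => etaIm A p.1 p.2) p := (etaIm_contDiffAt h).continuousAt
  have h2 : ContinuousAt (fun p : ℝ² => (sinh p.1 + sin p.2 * I : ℂ)) p := by
    refine Continuous.continuousAt ?_
    have e1 : Continuous fun p : ℝ² => ((sinh p.1 : ℝ) : ℂ) :=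
      Complex.continuous_ofReal.comp (Real.continuous_sinh.comp continuous_fst)
    have e2 : Continuous fun p : ℝ² => ((sin p.2 : ℝ) : ℂ) :=
      Complex.continuous_ofReal.comp (Real.continuous_sin.comp continuous_snd)
    exact e1.add (e2.mul continuous_const)
  have h3 : (sinh p.1 + sin p.2 * I : ℂ) ∈ Complex.slitPlane := by
    rcases hs with hs | hs
    · left; rwa [re_add_mul_I]
    · right; rwa [im_add_mul_I]
  exact continuousAt_const.mul (ContinuousAt.add (f := fun p : ℝ² =>
    arg (sinh p.1 + sin p.2 * I))
    (ContinuousAt.comp (f := fun p : ℝ² => (sinh p.1 + sin p.2 * I : ℂ))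
      (Complex.continuousAt_arg h3) h2) h1)

lemma sin_pos_of_mem {Y : ℝ} (h : Y ∈ Icc 0 π) (h' : ¬(Y = 0 ∨ Y = π)) : 0 < sin Y := by
  push Not at h'
  exact Real.sin_pos_of_pos_of_lt_pi (lt_of_le_of_ne h.1 (Ne.symm h'.1)) (lt_of_le_of_ne h.2 h'.2)

lemma continuousWithinAt_stripH_aux {A : ℝ} {p : ℝ²} (hp : p ∈ stripRect A) (h : p.1 < A) :
    ContinuousWithinAt (fun p : ℝ² => stripH A p.1 p.2) (stripRect A) p := by
  have hs : ∀ q ∈ stripRect A, q.1 = 0 → 0 < sin q.2 := fun q hq h0 =>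
    sin_pos_of_mem hq.1.2 fun hc => hq.2 ⟨Or.inl h0, hc⟩
  have h0 : 0 ≤ p.1 := hp.1.1.1
  have hc := continuousAt_stripArg (A := A) (p := p) (by rw [abs_of_nonneg h0]; exact h) (by
    rcases h0.eq_or_lt with h0 | h0
    · right; exact (hs p hp h0.symm).ne'
    · left; exact Real.sinh_pos_iff.2 h0)
  refine hc.continuousWithinAt.congr_of_eventuallyEq ?_ (stripH_eq_arg h0 h (hs p hp))
  have : ∀ᶠ q : ℝ² in 𝓝[stripRect A] p, q.1 < A :=
    mem_nhdsWithin_of_mem_nhds (continuousAt_fst.eventually_lt continuousAt_const h)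
  filter_upwards [this, self_mem_nhdsWithin] with q hq1 hq2
  exact stripH_eq_arg hq2.1.1.1 hq1 (hs q hq2)

lemma continuousOn_stripH {A : ℝ} (hA : 0 < A) :
    ContinuousOn (fun p : ℝ² => stripH A p.1 p.2) (stripRect A) := by
  intro p hp
  by_cases h : p.1 < A
  · exact continuousWithinAt_stripH_aux hp h
  have hpA : p.1 = A := le_antisymm hp.1.1.2 (not_lt.1 h)
  let f : ℝ² → ℝ² := fun p => (A - p.1, p.2)
  have hf : MapsTo f (stripRect A) (stripRect A) := by
    rintro q ⟨⟨⟨h1, h2⟩, h3⟩, h4⟩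
    refine ⟨⟨⟨by simp [f]; linarith, by simp [f]; linarith⟩, h3⟩, ?_⟩
    rintro ⟨h5, h6⟩
    refine h4 ⟨?_, h6⟩
    simp only [f] at h5
    rcases h5 with h5 | h5
    · right; linarith
    · left; linarith
  have h1 := continuousWithinAt_stripH_aux (hf hp) (by simp [f, hpA, hA])
  have h2 : ContinuousWithinAt f (stripRect A) p := by apply Continuous.continuousWithinAt; fun_prop
  have := h1.comp h2 hf
  refine this.congr (fun q _ => ?_) ?_ <;> simp [f, stripH_reflect_left]

/-! ### The minimum principle -/

/-- The minimum principle on a rectangle, for a lower semicontinuous function which is the imaginary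
part of a holomorphic function inside. -/
lemma min_principle {x1 x2 y1 y2 : ℝ} {v : ℝ² → ℝ} {G : ℂ → ℂ}
    (hv : LowerSemicontinuousOn v (Icc x1 x2 ×ˢ Icc y1 y2))
    (hG : DifferentiableOn ℂ G {Z | Z.re ∈ Ioo x1 x2 ∧ Z.im ∈ Ioo y1 y2})
    (hvG : ∀ x ∈ Ioo x1 x2, ∀ y ∈ Ioo y1 y2, v (x, y) = (G (x + y * I)).im)
    (hfr : ∀ p ∈ Icc x1 x2 ×ˢ Icc y1 y2, p ∉ Ioo x1 x2 ×ˢ Ioo y1 y2 → 0 ≤ v p) :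
    ∀ p ∈ Ioo x1 x2 ×ˢ Ioo y1 y2, 0 ≤ v p ∧
      ((∃ p ∈ Icc x1 x2 ×ˢ Icc y1 y2, p ∉ Ioo x1 x2 ×ˢ Ioo y1 y2 ∧ 0 < v p) → 0 < v p) := by
  intro p hp
  have hx : x1 < x2 := hp.1.1.trans hp.1.2
  have hy : y1 < y2 := hp.2.1.trans hp.2.2
  set K := Icc x1 x2 ×ˢ Icc y1 y2 with hK
  set U := Ioo x1 x2 ×ˢ Ioo y1 y2 with hU
  have hUK : U ⊆ K := prod_mono Ioo_subset_Icc_self Ioo_subset_Icc_self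
  have hcl : K ⊆ closure U := by
    rw [hU, closure_prod_eq, closure_Ioo hx.ne, closure_Ioo hy.ne]
  -- an interior minimum forces the function to be constant inside
  have hconst : ∀ c ∈ U, IsMinOn v K c → ∀ q ∈ U, v q = v c := by
    intro c hc hmin q hq
    let S : Set ℂ := {Z | Z.re ∈ Ioo x1 x2 ∧ Z.im ∈ Ioo y1 y2}
    have hS : S = Ioo x1 x2 ×ℂ Ioo y1 y2 := rfl
    have hSo : IsOpen S := by rw [hS]; exact isOpen_Ioo.reProdIm isOpen_Ioo
    have hSc : IsPreconnected S := by
      rw [hS]; exact (Convex.inter ((convex_Ioo x1 x2).linear_preimage Complex.reLm)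
        ((convex_Ioo y1 y2).linear_preimage Complex.imLm)).isPreconnected
    have hval : ∀ Z ∈ S, ‖Complex.exp (I * G Z)‖ = exp (-v (Z.re, Z.im)) := by
      intro Z hZ
      rw [Complex.norm_exp, hvG _ hZ.1 _ hZ.2, Complex.re_add_im]
      simp
    have hcS : (c.1 + c.2 * I : ℂ) ∈ S := ⟨by simpa using hc.1, by simpa using hc.2⟩
    have hqS : (q.1 + q.2 * I : ℂ) ∈ S := ⟨by simpa using hq.1, by simpa using hq.2⟩
    have := Complex.norm_eqOn_of_isPreconnected_of_isMaxOn (f := fun Z => Complex.exp (I * G Z))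
      hSc hSo ((hG.const_mul _).cexp) hcS (by
        intro Z hZ
        simp only [mem_ofPred_eq, Function.comp]
        rw [hval Z hZ, hval _ hcS]
        apply Real.exp_le_exp.2
        have := hmin (hUK (show (Z.re, Z.im) ∈ U from ⟨hZ.1, hZ.2⟩))
        simpa using this) hqS
    simp only [Function.comp, Function.const] at this
    rw [hval _ hcS, hval _ hqS] at this
    have := Real.exp_injective this
    simpa using this
  -- lower semicontinuity bounds the function on the boundary by such a constant
  have hbd : ∀ c ∈ U, IsMinOn v K c → ∀ q ∈ K, v q ≤ v c := by
    intro c hc hmin q hq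
    by_contra hlt
    push Not at hlt
    have h1 := hv q hq _ hlt
    have h2 : (𝓝[U] q).NeBot := mem_closure_iff_nhdsWithin_neBot.1 (hcl hq)
    have h3 := (h1.filter_mono (nhdsWithin_mono q hUK)).and self_mem_nhdsWithin
    obtain ⟨q', hq1, hq2⟩ := h3.exists
    rw [hconst c hc hmin q' hq2] at hq1
    exact lt_irrefl _ hq1
  have hcor : (x1, y1) ∈ K := ⟨⟨le_rfl, hx.le⟩, ⟨le_rfl, hy.le⟩⟩
  have hcorU : (x1, y1) ∉ U := fun h => lt_irrefl _ h.1.1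
  obtain ⟨c, hcK, hmin⟩ := LowerSemicontinuousOn.exists_isMinOn ⟨_, hcor⟩
    (isCompact_Icc.prod isCompact_Icc) hv
  have hc0 : 0 ≤ v c := by
    by_cases hcU : c ∈ U
    · exact (hfr _ hcor hcorU).trans (hbd c hcU hmin _ hcor)
    · exact hfr c hcK hcU
  have hnn : ∀ q ∈ K, 0 ≤ v q := fun q hq => hc0.trans (hmin hq)
  refine ⟨hnn p (hUK hp), ?_⟩
  rintro ⟨q, hqK, hqU, hq0⟩
  refine lt_of_le_of_ne (hnn p (hUK hp)) ?_
  intro h0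
  have hpmin : IsMinOn v K p := fun r hr => by simp only [mem_ofPred_eq]; rw [← h0]; exact hnn r hr
  have := hbd p hp hpmin q hqK
  linarith

/-- A function on the rectangle without its vertices, symmetric and asymptotically nonnegative at
the vertices, is nonnegative if it is nonnegative on the sides. -/
lemma strip_min_principle {A : ℝ} (hA : 0 < A) {f : ℝ → ℝ → ℝ} {G : ℂ → ℂ}
    (hf : ContinuousOn (fun p : ℝ² => f p.1 p.2) (stripRect A))
    (hl : ∀ X Y, f (A - X) Y = f X Y) (hr : ∀ X Y, f X (π - Y) = f X Y)
    (hcorner : ∀ ε > 0, ∃ δ > 0, ∀ X Y, 0 ≤ X → X < δ → 0 ≤ Y → Y < δ → 0 < X + Y → -ε < f X Y)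
    (hG : DifferentiableOn ℂ G {Z | Z.re ∈ Ioo 0 A ∧ Z.im ∈ Ioo 0 π})
    (hvG : ∀ x ∈ Ioo 0 A, ∀ y ∈ Ioo 0 π, f x y = (G (x + y * I)).im)
    (hfr : ∀ p ∈ stripRect A, p ∉ Ioo 0 A ×ˢ Ioo 0 π → 0 ≤ f p.1 p.2) :
    ∀ x ∈ Ioo 0 A, ∀ y ∈ Ioo 0 π, 0 ≤ f x y ∧
      ((∃ p ∈ stripRect A, p ∉ Ioo 0 A ×ˢ Ioo 0 π ∧ 0 < f p.1 p.2) → 0 < f x y) := by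
  classical
  have hπ := Real.pi_pos
  -- the extension by zero to the vertices is lower semicontinuous
  let v : ℝ² → ℝ := fun p => if (p.1 = 0 ∨ p.1 = A) ∧ (p.2 = 0 ∨ p.2 = π) then 0 else f p.1 p.2
  have hvin : ∀ p ∈ stripRect A, v p = f p.1 p.2 := fun p hp => if_neg hp.2
  have hUR : ∀ p ∈ Ioo 0 A ×ˢ Ioo 0 π, p ∈ stripRect A := by
    rintro p ⟨⟨h1, h2⟩, h3, h4⟩
    refine ⟨⟨⟨h1.le, h2.le⟩, ⟨h3.le, h4.le⟩⟩, ?_⟩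
    rintro ⟨h | h, _⟩ <;> linarith
  have hlsc : LowerSemicontinuousOn v (Icc 0 A ×ˢ Icc 0 π) := by
    intro p hp c hc
    by_cases hcor : (p.1 = 0 ∨ p.1 = A) ∧ (p.2 = 0 ∨ p.2 = π)
    · have hvp : v p = 0 := if_pos hcor
      rw [hvp] at hc
      obtain ⟨δ, hδ, hδ'⟩ := hcorner (-c) (by linarith)
      have h1 : ∀ᶠ q : ℝ² in 𝓝 p, |q.1 - p.1| < min δ (A / 2) ∧ |q.2 - p.2| < min δ (π / 2) := by
        have e1 : ContinuousAt (fun q : ℝ² => |q.1 - p.1|) p := by fun_prop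
        have e2 : ContinuousAt (fun q : ℝ² => |q.2 - p.2|) p := by fun_prop
        refine (e1.eventually_lt continuousAt_const ?_).and (e2.eventually_lt continuousAt_const ?_)
        · simp; exact ⟨hδ, hA⟩
        · simp; exact ⟨hδ, hπ⟩
      filter_upwards [mem_nhdsWithin_of_mem_nhds h1, self_mem_nhdsWithin] with q hq hqK
      by_cases hqc : (q.1 = 0 ∨ q.1 = A) ∧ (q.2 = 0 ∨ q.2 = π)
      · have : v q = 0 := if_pos hqc
        rw [this]; exact hc
      have : v q = f q.1 q.2 := if_neg hqc
      rw [this]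
      obtain ⟨⟨hq1, hq2⟩, hq3, hq4⟩ := hqK
      rw [lt_min_iff, lt_min_iff, abs_lt, abs_lt, abs_lt, abs_lt] at hq
      obtain ⟨⟨⟨b1, b2⟩, b3, b4⟩, ⟨b5, b6⟩, b7, b8⟩ := hq
      have hpos : ∀ X Y : ℝ, 0 ≤ X → 0 ≤ Y → (X ≠ 0 ∨ Y ≠ 0) → 0 < X + Y := fun X Y hX hY h =>
        h.elim (fun h => add_pos_of_pos_of_nonneg (hX.lt_of_ne' h) hY)
          fun h => add_pos_of_nonneg_of_pos hX (hY.lt_of_ne' h)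
      have hqc' : ¬(q.1 = 0 ∨ q.1 = A) ∨ ¬(q.2 = 0 ∨ q.2 = π) := by
        by_contra h; push Not at h; exact hqc (by tauto)
      rw [← neg_neg c]
      rcases hcor with ⟨hx | hx, hy | hy⟩ <;> rw [hx] at b1 b2 <;> rw [hy] at b5 b6
      · refine hδ' _ _ hq1 (by linarith) hq3 (by linarith) (hpos _ _ hq1 hq3 ?_)
        tauto
      · rw [← hr]
        refine hδ' _ _ hq1 (by linarith) (by linarith) (by linarith) (hpos _ _ hq1 (by linarith) ?_)
        rw [sub_ne_zero, ne_comm (a := π)]; tauto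
      · rw [← hl]
        refine hδ' _ _ (by linarith) (by linarith) hq3 (by linarith) (hpos _ _ (by linarith) hq3 ?_)
        rw [sub_ne_zero, ne_comm (a := A)]; tauto
      · rw [← hl, ← hr]
        refine hδ' _ _ (by linarith) (by linarith) (by linarith) (by linarith)
          (hpos _ _ (by linarith) (by linarith) ?_)
        rw [sub_ne_zero, ne_comm (a := A), sub_ne_zero, ne_comm (a := π)]; tauto
    · have hpR : p ∈ stripRect A := ⟨hp, hcor⟩
      rw [hvin p hpR] at hc
      have h1 := (hf p hpR).eventually (lt_mem_nhds hc)
      have h2 : ∀ᶠ q : ℝ² in 𝓝 p, ¬((q.1 = 0 ∨ q.1 = A) ∧ (q.2 = 0 ∨ q.2 = π)) := by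
        have : IsClosed {q : ℝ² | (q.1 = 0 ∨ q.1 = A) ∧ (q.2 = 0 ∨ q.2 = π)} :=
          ((isClosed_eq continuous_fst continuous_const).union
            (isClosed_eq continuous_fst continuous_const)).inter
          ((isClosed_eq continuous_snd continuous_const).union
            (isClosed_eq continuous_snd continuous_const))
        exact this.isOpen_compl.mem_nhds hcor
      rw [eventually_nhdsWithin_iff] at h1 ⊢
      filter_upwards [h1, h2] with q hq1 hq2 hqK
      have hqR : q ∈ stripRect A := ⟨hqK, hq2⟩
      rw [hvin q hqR]; exact hq1 hqR
  intro x hx y hy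
  have := min_principle hlsc hG (fun x hx y hy => by
    rw [hvin _ (hUR (x, y) ⟨hx, hy⟩)]; exact hvG x hx y hy) (fun p hp hpU => by
      by_cases hcor : (p.1 = 0 ∨ p.1 = A) ∧ (p.2 = 0 ∨ p.2 = π)
      · exact (if_pos hcor).symm.le
      · rw [hvin p ⟨hp, hcor⟩]; exact hfr p ⟨hp, hcor⟩ hpU) (x, y) ⟨hx, hy⟩
  rw [hvin _ (hUR (x, y) ⟨hx, hy⟩)] at this
  refine ⟨this.1, ?_⟩
  rintro ⟨p, hp, hpU, h0⟩
  exact this.2 ⟨p, hp.1, hpU, by rw [hvin p hp]; exact h0⟩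

/-- Inside the rectangle the function is positive. -/
lemma stripH_pos {A X Y : ℝ} (h0 : 0 < X) (h1 : X < A) (h2 : 0 < Y) (h3 : Y < π) :
    0 < stripH A X Y := by
  have hA : 0 < A := h0.trans h1
  have hπ := Real.pi_pos
  refine (strip_min_principle hA (f := stripH A) (G := fun Z => ((2 / π : ℝ) : ℂ) * psi A Z)
    (continuousOn_stripH hA) (stripH_reflect_left A) (stripH_reflect_right A) ?_ ?_ ?_ ?_
    X ⟨h0, h1⟩ Y ⟨h2, h3⟩).2 ?_
  -- near a vertex the angle is nonnegative and the remaining term is small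
  · intro ε hε
    have hc : ContinuousAt (fun p : ℝ² => 2 / π * etaIm A p.1 p.2) (0, 0) :=
      continuousAt_const.mul (etaIm_contDiffAt (by simpa using hA)).continuousAt
    have hc' := hc.eventually (lt_mem_nhds (a := -ε) (by simp [etaIm_zero_left A 0 hA, hε]))
    obtain ⟨δ, hδ, hδ'⟩ := Metric.eventually_nhds_iff.1 hc'
    refine ⟨min δ (min A π), by positivity, fun X Y hX hXδ hY hYδ hXY => ?_⟩
    simp only [lt_min_iff] at hXδ hYδ
    have hlt := hδ' (y := (X, Y)) (by
      rw [Prod.dist_eq]; simp [abs_of_nonneg hX, abs_of_nonneg hY]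
      exact ⟨hXδ.1, hYδ.1⟩)
    refine hlt.trans_le ?_
    rw [stripH_eq_arg hX hXδ.2.1]
    · have : 0 ≤ arg (sinh X + sin Y * I) := by
        rw [Complex.arg_nonneg_iff]
        rw [im_add_mul_I]
        exact Real.sin_nonneg_of_nonneg_of_le_pi hY hYδ.2.2.le
      gcongr; simpa using this
    · rintro rfl
      exact Real.sin_pos_of_pos_of_lt_pi (by linarith) hYδ.2.2
  · intro Z hZ
    exact ((psi_differentiableAt hZ.1.1 hZ.1.2).const_mul _).differentiableWithinAt
  · intro x hx y _
    rw [im_ofReal_mul, stripH_of_ne y hx.1 hx.2, stripSeries_eq y hx.1 hx.2]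
  · rintro ⟨x, y⟩ ⟨⟨⟨hx1, hx2⟩, hy1, hy2⟩, hc⟩ hU
    simp only at *
    rcases hx1.eq_or_lt with rfl | hx1
    · rw [stripH_left]; norm_num
    rcases hx2.eq_or_lt with rfl | hx2
    · rw [stripH_right]; norm_num
    rcases hy1.eq_or_lt with rfl | hy1
    · rw [stripH_bottom hx1 hx2]
    rcases hy2.eq_or_lt with rfl | hy2
    · rw [stripH_top hx1 hx2]
    exact absurd ⟨⟨hx1, hx2⟩, hy1, hy2⟩ hU
  · refine ⟨(0, π / 2), ⟨⟨⟨le_rfl, hA.le⟩, ⟨by positivity, by simp only; linarith⟩⟩, ?_⟩, ?_, ?_⟩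
    · rintro ⟨_, h | h⟩ <;> simp at h <;> linarith
    · rintro ⟨⟨h, _⟩, _⟩; exact lt_irrefl _ h
    · simp [stripH_left]

/-! ### Exchanging the sides of the rectangle -/

/-- The function `sinh x / x`, continuous at zero. -/
def shc : ℝ → ℝ := dslope sinh 0

/-- The function `sin x / x`, continuous at zero. -/
def snc : ℝ → ℝ := dslope sin 0

lemma mul_shc (x : ℝ) : x * shc x = sinh x := by
  have := sub_smul_dslope sinh 0 x
  simpa [shc] using this

lemma mul_snc (x : ℝ) : x * snc x = sin x := by
  have := sub_smul_dslope sin 0 x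
  simpa [snc] using this

lemma continuous_shc : Continuous shc := by
  rw [← continuousOn_univ]
  exact (continuousOn_dslope univ_mem).2 ⟨Real.continuous_sinh.continuousOn,
    Real.differentiable_sinh 0⟩

lemma continuous_snc : Continuous snc := by
  rw [← continuousOn_univ]
  exact (continuousOn_dslope univ_mem).2 ⟨Real.continuous_sin.continuousOn,
    Real.differentiable_sin 0⟩

lemma shc_zero : shc 0 = 1 := by simp [shc, dslope_same, Real.deriv_sinh]

lemma snc_zero : snc 0 = 1 := by simp [snc, dslope_same, Real.deriv_sin]

lemma abs_arctan_mul_sub_le {p t : ℝ} (hp : 0 ≤ p) (ht : 1 / 2 ≤ t) :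
    |arctan (t * p) - arctan p| ≤ |t - 1| := by
  have hd : ∀ x ∈ Ici (1 / 2 : ℝ), HasDerivWithinAt (fun t => arctan (t * p))
      (1 / (1 + (x * p) ^ 2) * (1 * p)) (Ici (1 / 2 : ℝ)) x := fun x _ =>
    (((hasDerivAt_id x).mul_const p).arctan).hasDerivWithinAt
  have hb : ∀ x ∈ Ici (1 / 2 : ℝ), ‖1 / (1 + (x * p) ^ 2) * (1 * p)‖ ≤ 1 := by
    intro x hx
    have hx : (1 / 2 : ℝ) ≤ x := hx
    rw [Real.norm_of_nonneg (by positivity), one_mul, one_div_mul_eq_div,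
      div_le_one (by positivity)]
    nlinarith [mul_le_mul hx le_rfl hp (by linarith), sq_nonneg (x * p - 1)]
  have := (convex_Ici (1 / 2 : ℝ)).norm_image_sub_le_of_norm_hasDerivWithin_le hd hb
    (show (1 : ℝ) ∈ Ici (1 / 2 : ℝ) by norm_num) (show t ∈ Ici (1 / 2 : ℝ) from ht)
  simpa using this

/-- Near a vertex the angles seen in two rectangles with the sides exchanged are asymptotically
complementary. -/
lemma arg_add_arg_corner {c : ℝ} (hc : 0 < c) : ∀ ε > 0, ∃ δ > 0, ∀ X Y : ℝ,
    0 ≤ X → X < δ → 0 ≤ Y → Y < δ → 0 < X + Y →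
    |arg (sinh X + sin Y * I) + arg (sinh (c * Y) + sin (c * X) * I) - π / 2| < ε := by
  intro ε hε
  have hπ := Real.pi_pos
  -- the factor by which the tangents of the two angles fail to be inverse to each other
  let t : ℝ² → ℝ := fun p => (shc (c * p.2) * shc p.1) / (snc (c * p.1) * snc p.2)
  have ht : ContinuousAt t (0, 0) := by
    refine ContinuousAt.div ?_ ?_ ?_
    · exact ((continuous_shc.comp (continuous_const.mul continuous_snd)).mul
        (continuous_shc.comp continuous_fst)).continuousAt
    · exact ((continuous_snc.comp (continuous_const.mul continuous_fst)).mul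
        (continuous_snc.comp continuous_snd)).continuousAt
    · simp [snc_zero]
  have ht0 : t (0, 0) = 1 := by simp [t, snc_zero, shc_zero]
  have hev : ∀ᶠ p in 𝓝 ((0 : ℝ), (0 : ℝ)), |t p - 1| < min ε (1 / 2) := by
    have : ContinuousAt (fun p => |t p - 1|) (0, 0) := (ht.sub continuousAt_const).abs
    exact this.eventually_lt continuousAt_const (by simp [ht0, hε])
  obtain ⟨δ, hδ, hδ'⟩ := Metric.eventually_nhds_iff.1 hev
  refine ⟨min δ (min π (π / c)), by positivity, fun X Y hX hXδ hY hYδ hXY => ?_⟩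
  simp only [lt_min_iff] at hXδ hYδ
  have hcX : c * X < π := by rw [mul_comm]; exact (lt_div_iff₀ hc).1 hXδ.2.2
  have hst := hδ' (y := (X, Y)) (by
    rw [Prod.dist_eq]; simp [abs_of_nonneg hX, abs_of_nonneg hY]
    exact ⟨hXδ.1, hYδ.1⟩)
  rw [lt_min_iff] at hst
  rcases hX.eq_or_lt with rfl | hX
  · have h1 : 0 < sin Y := Real.sin_pos_of_pos_of_lt_pi (by linarith) hYδ.2.1
    have h2 : 0 < sinh (c * Y) := Real.sinh_pos_iff.2 (mul_pos hc (by linarith))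
    rw [mul_zero, Real.sin_zero, Real.sinh_zero, ofReal_zero, zero_add, zero_mul, add_zero,
      Complex.arg_real_mul _ h1, Complex.arg_I, Complex.arg_ofReal_of_nonneg h2.le]
    simpa using hε
  rcases hY.eq_or_lt with rfl | hY
  · have h1 : 0 < sin (c * X) := Real.sin_pos_of_pos_of_lt_pi (mul_pos hc hX) hcX
    have h2 : 0 < sinh X := Real.sinh_pos_iff.2 hX
    rw [mul_zero, Real.sin_zero, Real.sinh_zero, ofReal_zero, zero_add, zero_mul, add_zero,
      Complex.arg_real_mul _ h1, Complex.arg_I, Complex.arg_ofReal_of_nonneg h2.le]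
    simpa using hε
  have h1 : 0 < sin Y := Real.sin_pos_of_pos_of_lt_pi hY hYδ.2.1
  have h2 : 0 < sinh (c * Y) := Real.sinh_pos_iff.2 (mul_pos hc hY)
  have h3 : 0 < sin (c * X) := Real.sin_pos_of_pos_of_lt_pi (mul_pos hc hX) hcX
  have h4 : 0 < sinh X := Real.sinh_pos_iff.2 hX
  have harg : ∀ a b : ℝ, 0 < a → arg (a + b * I) = arctan (b / a) := by
    intro a b ha
    have e : b / a = Real.tan (arg (a + b * I)) := by
      rw [Complex.tan_arg, re_add_mul_I, im_add_mul_I]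
    rw [e, Real.arctan_tan]
    · have := Complex.abs_arg_lt_pi_div_two_iff (z := a + b * I) |>.2
        (Or.inl (by rwa [re_add_mul_I]))
      exact (abs_lt.1 this).1
    · have := Complex.abs_arg_lt_pi_div_two_iff (z := a + b * I) |>.2
        (Or.inl (by rwa [re_add_mul_I]))
      exact (abs_lt.1 this).2
  rw [harg _ _ h4, harg _ _ h2]
  have e1 : arctan (sin (c * X) / sinh (c * Y)) = π / 2 - arctan (sinh (c * Y) / sin (c * X)) := by
    rw [← Real.arctan_inv_of_pos (by positivity), inv_div]
  have e2 : sinh (c * Y) / sin (c * X) = t (X, Y) * (sin Y / sinh X) := by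
    have n1 : snc (c * X) ≠ 0 := by intro h; rw [← mul_snc, h] at h3; simp at h3
    have n2 : snc Y ≠ 0 := by intro h; rw [← mul_snc, h] at h1; simp at h1
    have n3 : shc X ≠ 0 := by intro h; rw [← mul_shc, h] at h4; simp at h4
    simp only [t]
    rw [← mul_shc (c * Y), ← mul_snc (c * X), ← mul_snc Y, ← mul_shc X]
    field_simp
  rw [e1, e2]
  have := abs_arctan_mul_sub_le (p := sin Y / sinh X) (t := t (X, Y)) (by positivity)
    (by have := (abs_lt.1 hst.2).1; linarith)
  rw [abs_sub_comm] at this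
  refine lt_of_le_of_lt (le_of_eq ?_) (this.trans_lt hst.1)
  congr 1; ring

/-- The difference that `stripH_swap` asserts to vanish is small near a vertex. -/
lemma swap_corner {A : ℝ} (hA : 0 < A) : ∀ ε > 0, ∃ δ > 0, ∀ X Y : ℝ,
    0 ≤ X → X < δ → 0 ≤ Y → Y < δ → 0 < X + Y →
    |stripH A X Y + stripH (π ^ 2 / A) (π / A * Y) (π / A * X) - 1| < ε := by
  intro ε hε
  have hπ := Real.pi_pos
  set c := π / A with hc
  have hc0 : 0 < c := by positivity
  set A' := π ^ 2 / A with hA'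
  have hA0 : 0 < A' := by positivity
  have hcA : c * A = π := by rw [hc]; field_simp
  have hcA' : c * π = A' := by rw [hc, hA']; ring
  obtain ⟨δ1, hδ1, h1⟩ := arg_add_arg_corner hc0 (ε / 2) (by positivity)
  have hev : ∀ᶠ p in 𝓝 ((0 : ℝ), (0 : ℝ)),
      |etaIm A p.1 p.2 + etaIm A' (c * p.2) (c * p.1)| < ε / 2 := by
    have e1 : ContinuousAt (fun p : ℝ² => etaIm A p.1 p.2) (0, 0) :=
      (etaIm_contDiffAt (by simpa using hA)).continuousAt
    have e2 : ContinuousAt (fun p : ℝ² => etaIm A' p.1 p.2) (c * (0 : ℝ), c * (0 : ℝ)) :=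
      (etaIm_contDiffAt (by simpa using hA0)).continuousAt
    have e3 : ContinuousAt (fun p : ℝ² => (c * p.2, c * p.1)) (0, 0) := by
      apply Continuous.continuousAt; fun_prop
    have e4 : ContinuousAt (fun p : ℝ² => etaIm A' (c * p.2) (c * p.1)) (0, 0) :=
      ContinuousAt.comp (g := fun p : ℝ² => etaIm A' p.1 p.2)
        (f := fun p : ℝ² => (c * p.2, c * p.1)) e2 e3
    refine (e1.add e4).abs.eventually_lt continuousAt_const ?_
    simp [etaIm_zero_left A 0 hA, etaIm_zero_left A' 0 hA0, hε]
  obtain ⟨δ, hδ, hδ'⟩ := Metric.eventually_nhds_iff.1 hev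
  refine ⟨min (min δ δ1) (min A π), by positivity, fun X Y hX hXδ hY hYδ hXY => ?_⟩
  simp only [lt_min_iff] at hXδ hYδ
  have h2 := h1 X Y hX hXδ.1.2 hY hYδ.1.2 hXY
  have h3 := hδ' (y := (X, Y)) (by
    rw [Prod.dist_eq]; simp [abs_of_nonneg hX, abs_of_nonneg hY]
    exact ⟨hXδ.1.1, hYδ.1.1⟩)
  rw [stripH_eq_arg hX hXδ.2.1, stripH_eq_arg (A := A') (X := c * Y) (Y := c * X) (by positivity)]
  · rw [show ∀ a b d e : ℝ, 2 / π * (a + b) + 2 / π * (d + e) - 1 =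
      2 / π * ((a + d - π / 2) + (b + e)) by intros; field_simp; ring]
    rw [abs_mul, abs_of_pos (by positivity)]
    have h4 := abs_add_le (arg (sinh X + sin Y * I) + arg (sinh (c * Y) + sin (c * X) * I) - π / 2)
      (etaIm A X Y + etaIm A' (c * Y) (c * X))
    have h5 : 2 / π < 1 := by rw [div_lt_one hπ]; linarith [Real.pi_gt_three]
    have h6 : 0 < 2 / π := by positivity
    calc _ ≤ 1 * _ := mul_le_mul_of_nonneg_right h5.le (abs_nonneg _)
      _ < ε := by linarith
  · rw [← hcA']; exact mul_lt_mul_of_pos_left hYδ.2.2 hc0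
  · intro h
    have hY0 : Y = 0 := by simpa [hc0.ne'] using h
    refine Real.sin_pos_of_pos_of_lt_pi (mul_pos hc0 (by linarith)) ?_
    rw [← hcA]; exact mul_lt_mul_of_pos_left hXδ.2.1 hc0
  · rintro rfl
    exact Real.sin_pos_of_pos_of_lt_pi (by linarith) hYδ.2.2

/-- Exchanging the two directions replaces the function by its complement to one. -/
lemma stripH_swap {A X Y : ℝ} (h0 : 0 < X) (h1 : X < A) (h2 : 0 < Y) (h3 : Y < π) :
    stripH A X Y + stripH (π ^ 2 / A) (π / A * Y) (π / A * X) = 1 := by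
  have hA : 0 < A := h0.trans h1
  have hπ := Real.pi_pos
  set c := π / A with hc
  have hc0 : 0 < c := by positivity
  set A' := π ^ 2 / A with hA'
  have hA0 : 0 < A' := by positivity
  have hcA : c * A = π := by rw [hc]; field_simp
  have hcA' : c * π = A' := by rw [hc, hA']; ring
  let u : ℝ → ℝ → ℝ := fun X Y => stripH A X Y + stripH A' (c * Y) (c * X) - 1
  let G : ℂ → ℂ := fun Z => ((2 / π : ℝ) : ℂ) * psi A Z -
    ((2 / π : ℝ) : ℂ) * psi A' (-(c * I) * Z) - I
  have hmaps : MapsTo (fun p : ℝ² => (c * p.2, c * p.1)) (stripRect A) (stripRect A') := by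
    rintro ⟨x, y⟩ ⟨⟨⟨hx1, hx2⟩, hy1, hy2⟩, hcor⟩
    simp only at *
    refine ⟨⟨⟨by positivity, ?_⟩, by positivity, ?_⟩, ?_⟩
    · simp only; rw [← hcA']; exact mul_le_mul_of_nonneg_left hy2 hc0.le
    · simp only; rw [← hcA]; exact mul_le_mul_of_nonneg_left hx2 hc0.le
    · simp only
      have e1 : c * y = A' ↔ y = π := by rw [← hcA', mul_right_inj' hc0.ne']
      have e2 : c * x = π ↔ x = A := by rw [← hcA, mul_right_inj' hc0.ne']
      rw [e1, e2, mul_eq_zero, mul_eq_zero]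
      simp only [hc0.ne', false_or]
      rintro ⟨ha, hb⟩; exact hcor ⟨hb, ha⟩
  have hu : ContinuousOn (fun p : ℝ² => u p.1 p.2) (stripRect A) := by
    refine ((continuousOn_stripH hA).add ?_).sub continuousOn_const
    exact (continuousOn_stripH hA0).comp (f := fun p : ℝ² => (c * p.2, c * p.1)) (by fun_prop) hmaps
  have hul : ∀ X Y, u (A - X) Y = u X Y := fun X Y => by
    simp only [u]; rw [stripH_reflect_left, mul_sub, hcA, stripH_reflect_right]
  have hur : ∀ X Y, u X (π - Y) = u X Y := fun X Y => by
    simp only [u]; rw [stripH_reflect_right, mul_sub, hcA', stripH_reflect_left]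
  have hG : DifferentiableOn ℂ G {Z | Z.re ∈ Ioo 0 A ∧ Z.im ∈ Ioo 0 π} := by
    intro Z hZ
    have hre : (-(c * I) * Z).re = c * Z.im := by simp
    have d1 := psi_differentiableAt (A := A) (Z := Z) hZ.1.1 hZ.1.2
    have d2 := psi_differentiableAt (A := A') (Z := -(c * I) * Z)
      (by rw [hre]; exact mul_pos hc0 hZ.2.1)
      (by rw [hre, ← hcA']; exact mul_lt_mul_of_pos_left hZ.2.2 hc0)
    have d3 : DifferentiableAt ℂ (fun Z : ℂ => -(c * I) * Z) Z := by fun_prop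
    exact (((d1.const_mul _).sub ((d2.comp Z d3).const_mul _)).sub_const _).differentiableWithinAt
  have huG : ∀ x ∈ Ioo 0 A, ∀ y ∈ Ioo 0 π, u x y = (G (x + y * I)).im := by
    intro x hx y hy
    have hcy : 0 < c * y := mul_pos hc0 hy.1
    have hcy' : c * y < A' := by rw [← hcA']; exact mul_lt_mul_of_pos_left hy.2 hc0
    have e1 : (-(c * I) * (x + y * I) : ℂ) = ((c * y : ℝ) : ℂ) + ((-(c * x) : ℝ) : ℂ) * I := by
      push_cast; linear_combination (-(c : ℂ) * y) * Complex.I_mul_I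
    simp only [u, G]
    rw [Complex.sub_im, Complex.sub_im, im_ofReal_mul, im_ofReal_mul, e1,
      ← stripSeries_eq y hx.1 hx.2, ← stripSeries_eq _ hcy hcy', stripSeries_neg,
      stripH_of_ne y hx.1 hx.2, stripH_of_ne _ hcy hcy', I_im]
    ring
  have hfr : ∀ p ∈ stripRect A, p ∉ Ioo 0 A ×ˢ Ioo 0 π → u p.1 p.2 = 0 := by
    rintro ⟨x, y⟩ ⟨⟨⟨hx1, hx2⟩, hy1, hy2⟩, hcor⟩ hU
    simp only [u] at *
    by_cases hx : x = 0 ∨ x = A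
    · have hy : ¬(y = 0 ∨ y = π) := fun h => hcor ⟨hx, h⟩
      push Not at hy
      have hy3 : 0 < c * y := mul_pos hc0 (lt_of_le_of_ne hy1 (Ne.symm hy.1))
      have hy4 : c * y < A' := by
        rw [← hcA']; exact mul_lt_mul_of_pos_left (lt_of_le_of_ne hy2 hy.2) hc0
      rcases hx with rfl | rfl
      · rw [stripH_left, mul_zero, stripH_bottom hy3 hy4]; norm_num
      · rw [stripH_right, hcA, stripH_top hy3 hy4]; norm_num
    · push Not at hx
      have hx3 := lt_of_le_of_ne hx1 (Ne.symm hx.1)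
      have hx4 := lt_of_le_of_ne hx2 hx.2
      rcases hy1.eq_or_lt with rfl | hy1
      · rw [stripH_bottom hx3 hx4, mul_zero, stripH_left]; norm_num
      rcases hy2.eq_or_lt with rfl | hy2
      · rw [stripH_top hx3 hx4, hcA', stripH_right]; norm_num
      exact absurd ⟨⟨hx3, hx4⟩, hy1, hy2⟩ hU
  -- the difference vanishes on the sides; the minimum principle applies to it and to its negative
  have hcor := swap_corner hA
  have p1 := (strip_min_principle hA hu hul hur (fun ε hε => by
    obtain ⟨δ, hδ, h⟩ := hcor ε hε
    exact ⟨δ, hδ, fun X Y a b d e f => (abs_lt.1 (h X Y a b d e f)).1⟩) hG huG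
    (fun p hp hpU => (hfr p hp hpU).symm.le) X ⟨h0, h1⟩ Y ⟨h2, h3⟩).1
  have p2 := (strip_min_principle hA (f := fun x y => -u x y) (G := fun Z => -G Z) hu.neg
    (fun X Y => by rw [hul]) (fun X Y => by rw [hur]) (fun ε hε => by
    obtain ⟨δ, hδ, h⟩ := hcor ε hε
    exact ⟨δ, hδ, fun X Y a b d e f => by
      have := (abs_lt.1 (h X Y a b d e f)).2
      exact neg_lt_neg this⟩) hG.neg
    (fun x hx y hy => by rw [huG x hx y hy, Complex.neg_im])
    (fun p hp hpU => by
      show 0 ≤ -u p.1 p.2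
      rw [hfr p hp hpU, neg_zero]) X ⟨h0, h1⟩ Y ⟨h2, h3⟩).1
  have : u X Y = 0 := le_antisymm (by linarith) p1
  simp only [u] at this
  linarith

lemma stripH_lt_one {A X Y : ℝ} (h0 : 0 < X) (h1 : X < A) (h2 : 0 < Y) (h3 : Y < π) :
    stripH A X Y < 1 := by
  have hA : 0 < A := h0.trans h1
  have hπ := Real.pi_pos
  have hc0 : 0 < π / A := by positivity
  have := stripH_swap h0 h1 h2 h3
  have := stripH_pos (A := π ^ 2 / A) (X := π / A * Y) (Y := π / A * X) (by positivity)
    ((mul_lt_mul_of_pos_left h3 hc0).trans_eq (by ring)) (by positivity)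
    ((mul_lt_mul_of_pos_left h1 hc0).trans_eq (by field_simp))
  linarith

/-! ### The equation of a tile near a vertical side -/

/-- The real part of `(sinh X + i sin Y) exp (i etaIm)`; it is a positive multiple of
`cos ((π/2) stripH)`, and it is smooth up to and across the left side. -/
def stripN (A X Y : ℝ) : ℝ := sinh X * cos (etaIm A X Y) - sin Y * sin (etaIm A X Y)

/-- The imaginary part of `(sinh X + i sin Y) exp (i etaIm)`; it is a positive multiple of
`sin ((π/2) stripH)`, and it is smooth up to and across the left side. -/
def stripD (A X Y : ℝ) : ℝ := sin Y * cos (etaIm A X Y) + sinh X * sin (etaIm A X Y)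

lemma stripN_contDiffAt {A X Y : ℝ} (h : |X| < A) :
    ContDiffAt ℝ ω (fun p : ℝ² => stripN A p.1 p.2) (X, Y) := by
  have h1 := etaIm_contDiffAt (Y := Y) h
  exact ((Real.contDiff_sinh.comp contDiff_fst).contDiffAt.mul h1.cos).sub
    ((Real.contDiff_sin.comp contDiff_snd).contDiffAt.mul h1.sin)

lemma stripD_contDiffAt {A X Y : ℝ} (h : |X| < A) :
    ContDiffAt ℝ ω (fun p : ℝ² => stripD A p.1 p.2) (X, Y) := by
  have h1 := etaIm_contDiffAt (Y := Y) h
  exact ((Real.contDiff_sin.comp contDiff_snd).contDiffAt.mul h1.cos).add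
    ((Real.contDiff_sinh.comp contDiff_fst).contDiffAt.mul h1.sin)

lemma stripND_eq {A X Y : ℝ} (h0 : 0 ≤ X) (h1 : X < A) (hY : Y ∈ Icc 0 π)
    (hc : ¬(X = 0 ∧ (Y = 0 ∨ Y = π))) :
    ∃ R > 0, stripN A X Y = R * cos (π / 2 * stripH A X Y) ∧
      stripD A X Y = R * sin (π / 2 * stripH A X Y) := by
  have hs : X = 0 → 0 < sin Y := fun h => sin_pos_of_mem hY fun hy => hc ⟨h, hy⟩
  set w : ℂ := sinh X + sin Y * I with hw
  have hwre : w.re = sinh X := re_add_mul_I _ _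
  have hwim : w.im = sin Y := im_add_mul_I _ _
  have hw0 : w ≠ 0 := by
    intro hw0
    rcases h0.eq_or_lt with h0 | h0
    · have := hs h0.symm; rw [← hwim, hw0] at this; simp at this
    · have := Real.sinh_pos_iff.2 h0; rw [← hwre, hw0] at this; simp at this
  have hpi := Real.pi_pos
  have he : π / 2 * stripH A X Y = arg w + etaIm A X Y := by
    rw [stripH_eq_arg h0 h1 hs]; field_simp; rfl
  have hn : ‖w‖ ≠ 0 := norm_ne_zero_iff.2 hw0
  refine ⟨‖w‖, norm_pos_iff.2 hw0, ?_, ?_⟩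
  · rw [he, Real.cos_add, Complex.cos_arg hw0, Complex.sin_arg, hwre, hwim, stripN]
    field_simp
  · rw [he, Real.sin_add, Complex.cos_arg hw0, Complex.sin_arg, hwre, hwim, stripD]
    field_simp

lemma stripN_left {A : ℝ} (hA : 0 < A) (Y : ℝ) : stripN A 0 Y = 0 := by
  simp [stripN, etaIm_zero_left A Y hA]

lemma stripD_left {A : ℝ} (hA : 0 < A) (Y : ℝ) : stripD A 0 Y = sin Y := by
  simp [stripD, etaIm_zero_left A Y hA]

lemma stripD_bottom {A X : ℝ} (h : |X| < A) : stripD A X 0 = 0 := by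
  simp [stripD, etaIm_zero_right h]

lemma stripN_bottom {A X : ℝ} (h : |X| < A) : stripN A X 0 = sinh X := by
  simp [stripN, etaIm_zero_right h]

lemma hasDerivAt_arg_curve {f g : ℝ → ℝ} {f' g' t : ℝ} (hf : HasDerivAt f f' t)
    (hg : HasDerivAt g g' t) (h : 0 < f t ∨ g t ≠ 0) :
    HasDerivAt (fun s => arg (f s + g s * I)) ((f' + g' * I) / (f t + g t * I) : ℂ).im t := by
  have h1 : HasDerivAt (fun s => (f s + g s * I : ℂ)) (f' + g' * I) t :=
    hf.ofReal_comp.add (hg.ofReal_comp.mul_const _)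
  have h2 := h1.clog_real (by
    rcases h with h | h
    · left; rwa [re_add_mul_I]
    · right; rwa [im_add_mul_I])
  have h3 := Complex.imCLM.hasFDerivAt.comp_hasDerivAt t h2
  exact h3.congr_of_eventuallyEq (.of_forall fun s => (Complex.log_im _).symm)

/-- The derivative of `etaIm` across the bottom side is nonnegative, since `eta` increases along the
positive reals. -/
lemma etaIm_deriv_bottom {A X : ℝ} (h0 : 0 < X) (h1 : X < A) :
    ∃ e, 0 ≤ e ∧ HasDerivAt (fun Y => etaIm A X Y) e 0 := by
  have hd : HasDerivAt (eta A) (deriv (eta A) X) (X : ℂ) :=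
    ((eta_differentiableOn A).differentiableAt ((isOpen_strip A).mem_nhds (by
      rw [mem_ofPred_eq, ofReal_re, abs_lt]; constructor <;> linarith))).hasDerivAt
  refine ⟨(deriv (eta A) X).re, ?_, ?_⟩
  · have hr : HasDerivAt (fun x : ℝ => (eta A x).re) (deriv (eta A) X).re X := hd.real_of_complex
    have hmono : MonotoneOn (fun x : ℝ => (eta A x).re) (Ioo 0 A) := by
      intro x hx y hy hxy
      have s : ∀ x ∈ Ioo 0 A, HasSum (fun n : ℕ => 4 * Real.cosh ((2 * n + 1) * x) /
          ((2 * n + 1) * (1 + exp ((2 * n + 1) * A)))) (eta A x).re := by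
        intro x hx
        have := Complex.hasSum_re (eta_hasSum (A := A) (Z := (x : ℂ)) (by
          rw [ofReal_re, abs_lt]; constructor <;> linarith [hx.1, hx.2]))
        refine this.congr_fun fun n => ?_
        rw [← ofReal_re (4 * Real.cosh ((2 * n + 1) * x) /
          ((2 * n + 1) * (1 + exp ((2 * n + 1) * A))))]
        push_cast; rfl
      refine hasSum_le (fun n => ?_) (s x hx) (s y hy)
      have hk : (0 : ℝ) < 2 * n + 1 := by positivity
      have : Real.cosh ((2 * n + 1) * x) ≤ Real.cosh ((2 * n + 1) * y) := by
        rw [Real.cosh_le_cosh, abs_of_pos (mul_pos hk hx.1), abs_of_pos (mul_pos hk hy.1)]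
        exact mul_le_mul_of_nonneg_left hxy hk.le
      gcongr
    have hw : HasDerivWithinAt (fun x : ℝ => (eta A x).re) (deriv (eta A) X).re (Ioo 0 A) X :=
      hr.hasDerivWithinAt
    rw [← hw.derivWithin (isOpen_Ioo.uniqueDiffWithinAt ⟨h0, h1⟩)]
    exact hmono.derivWithin_nonneg
  · have hc : HasDerivAt (fun Y : ℝ => (X + Y * I : ℂ)) (1 * I) (0 : ℝ) := by
      have : HasDerivAt (fun Y : ℝ => (Y : ℂ)) 1 0 := Complex.ofRealCLM.hasDerivAt
      exact (this.mul_const _).const_add _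
    have hd' : HasDerivAt (eta A) (deriv (eta A) X) (X + (0 : ℝ) * I : ℂ) := by simpa using hd
    have h3 := HasDerivAt.comp (h₂ := eta A) (0 : ℝ) hd' hc
    have h4 := Complex.imCLM.hasFDerivAt.comp_hasDerivAt (0 : ℝ) h3
    simpa [Function.comp_def, etaIm] using h4

/-- The Hopf lemma for the left side, read off from the rectangle with the sides exchanged. -/
lemma stripN_deriv_left {A Y : ℝ} (hA : 0 < A) (hY : Y ∈ Icc 0 π) :
    ∃ e, 0 < e ∧ HasDerivAt (fun X => stripN A X Y) e 0 := by
  have hη : HasDerivAt (fun X => etaIm A X Y) (deriv (fun X => etaIm A X Y) 0) 0 := by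
    have h1 : ContDiffAt ℝ ω (fun p : ℝ² => etaIm A p.1 p.2) (0, Y) :=
      etaIm_contDiffAt (by simpa using hA)
    have h2 := (h1.differentiableAt (by simp)).hasFDerivAt
    have h3 : HasDerivAt (fun X : ℝ => (X, Y)) (1, 0) 0 :=
      (hasDerivAt_id (0 : ℝ)).prodMk (hasDerivAt_const 0 Y)
    have h4 := HasFDerivAt.comp_hasDerivAt (0 : ℝ) h2 h3
    exact h4.differentiableAt.hasDerivAt
  generalize deriv (fun X => etaIm A X Y) 0 = p at hη
  have hN : HasDerivAt (fun X => stripN A X Y) (1 - sin Y * p) 0 := by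
    have h1 := ((Real.hasDerivAt_sinh 0).mul hη.cos).sub (hη.sin.const_mul (sin Y))
    refine h1.congr_deriv ?_
    simp [etaIm_zero_left A Y hA]
  refine ⟨1 - sin Y * p, ?_, hN⟩
  by_cases hY0 : Y = 0 ∨ Y = π
  · rcases hY0 with rfl | rfl <;> simp
  have hs := sin_pos_of_mem hY hY0
  push Not at hY0
  have hY1 : 0 < Y := lt_of_le_of_ne hY.1 (Ne.symm hY0.1)
  have hY2 : Y < π := lt_of_le_of_ne hY.2 hY0.2
  have hπ := Real.pi_pos
  set c := π / A with hc
  have hc0 : 0 < c := by positivity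
  set A' := π ^ 2 / A with hA'
  have hcA : c * A = π := by rw [hc]; field_simp
  have hcA' : c * π = A' := by rw [hc, hA']; ring
  have hcY : 0 < c * Y := mul_pos hc0 hY1
  have hcY' : c * Y < A' := by rw [← hcA']; exact mul_lt_mul_of_pos_left hY2 hc0
  obtain ⟨e, he0, he⟩ := etaIm_deriv_bottom hcY hcY'
  have hsh : 0 < sinh (c * Y) := Real.sinh_pos_iff.2 hcY
  have d1 : HasDerivAt (fun X => 2 / π * (arg (sinh X + sin Y * I) + etaIm A X Y))
      (2 / π * (-(1 / sin Y) + p)) 0 := by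
    refine (HasDerivAt.add ?_ hη).const_mul _
    refine (hasDerivAt_arg_curve (Real.hasDerivAt_sinh 0) (hasDerivAt_const 0 (sin Y))
      (Or.inr hs.ne')).congr_deriv ?_
    simp only [Real.sinh_zero, Real.cosh_zero, ofReal_zero, Complex.ofReal_one, zero_add,
      zero_mul, add_zero]
    rw [one_div, mul_inv, Complex.inv_I, ← Complex.ofReal_inv, im_ofReal_mul]
    simp
  have hcX : HasDerivAt (fun X : ℝ => c * X) c 0 := by simpa using (hasDerivAt_id (0 : ℝ)).const_mul c
  have d2 : HasDerivAt (fun X => 1 - 2 / π *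
      (arg (sinh (c * Y) + sin (c * X) * I) + etaIm A' (c * Y) (c * X)))
      (-(2 / π * (c / sinh (c * Y) + e * c))) 0 := by
    refine ((HasDerivAt.add ?_ ?_).const_mul _).const_sub _
    · refine (hasDerivAt_arg_curve (hasDerivAt_const 0 (sinh (c * Y))) hcX.sin
        (Or.inl hsh)).congr_deriv ?_
      simp only [mul_zero, Real.sin_zero, Real.cos_zero, ofReal_zero, zero_add,
        zero_mul, add_zero, one_mul]
      rw [Complex.div_ofReal_im]; simp
    · have he' : HasDerivAt (fun Y' => etaIm A' (c * Y) Y') e (c * 0) := by simpa using he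
      exact HasDerivAt.comp (h₂ := fun Y' => etaIm A' (c * Y) Y') 0 he' hcX
  -- the two sides of `stripH_swap` have equal derivatives at the left side
  have heq : (fun X => 2 / π * (arg (sinh X + sin Y * I) + etaIm A X Y)) =ᶠ[𝓝[>] 0]
      (fun X => 1 - 2 / π *
      (arg (sinh (c * Y) + sin (c * X) * I) + etaIm A' (c * Y) (c * X))) := by
    filter_upwards [Ioo_mem_nhdsGT hA] with X hX
    have := stripH_swap hX.1 hX.2 hY1 hY2
    rw [stripH_eq_arg hX.1.le hX.2 (fun _ => hs),
      stripH_eq_arg hcY.le hcY' (fun h => absurd h hcY.ne')] at this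
    linarith
  have heq0 : (fun X => 2 / π * (arg (sinh X + sin Y * I) + etaIm A X Y)) 0 = (fun X => 1 - 2 / π *
      (arg (sinh (c * Y) + sin (c * X) * I) + etaIm A' (c * Y) (c * X))) 0 := by
    have t1 := d1.continuousAt.continuousWithinAt (s := Ioi 0)
    have t2 := d2.continuousAt.continuousWithinAt (s := Ioi 0)
    exact tendsto_nhds_unique (t1.congr' heq) t2
  have d3 := (d2.hasDerivWithinAt (s := Ioi 0)).congr_of_eventuallyEq heq heq0
  have := (uniqueDiffWithinAt_Ioi (0 : ℝ)).eq_deriv _ (d1.hasDerivWithinAt (s := Ioi 0)) d3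
  have h2 : -(1 / sin Y) + p < 0 := by
    refine neg_of_mul_neg_left (b := 2 / π) ?_ (by positivity)
    rw [mul_comm, this, neg_neg_iff_pos]
    positivity
  have h3 : sin Y * p < 1 := by
    have := mul_lt_mul_of_pos_left h2 hs
    rw [mul_add, mul_neg, mul_one_div_cancel hs.ne'] at this
    linarith
  linarith

lemma stripN_deriv_corner {A : ℝ} (hA : 0 < A) : HasDerivAt (fun X => stripN A X 0) 1 0 := by
  have : (fun X => stripN A X 0) =ᶠ[𝓝 0] sinh := by
    have : ∀ᶠ X : ℝ in 𝓝 0, |X| < A :=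
      continuous_abs.continuousAt.eventually_lt continuousAt_const (by simpa using hA)
    filter_upwards [this] with X hX using stripN_bottom hX
  simpa using (Real.hasDerivAt_sinh 0).congr_of_eventuallyEq this

lemma stripD_deriv_corner {A : ℝ} (hA : 0 < A) : HasDerivAt (fun Y => stripD A 0 Y) 1 0 := by
  have : (fun Y => stripD A 0 Y) = sin := by funext Y; exact stripD_left hA Y
  rw [this]
  simpa using Real.hasDerivAt_sin 0

section

/-! ### The height function -/

/-- The square of the modulus of the first complex coordinate of the points of a tile, as a function
of the value of `Rect.h`. -/
def mfun (h : ℝ) : ℝ := cos (π / 2 * h) / (cos (π / 2 * h) + sin (π / 2 * h))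

lemma cos_nonneg_sin_nonneg {h : ℝ} (hh : h ∈ Icc (0 : ℝ) 1) :
    0 ≤ cos (π / 2 * h) ∧ 0 ≤ sin (π / 2 * h) ∧ 0 < cos (π / 2 * h) + sin (π / 2 * h) := by
  have hπ := Real.pi_pos
  have h1 : 0 ≤ π / 2 * h := mul_nonneg (by positivity) hh.1
  have h2 : π / 2 * h ≤ π / 2 := by nlinarith [hh.2]
  have hc := Real.cos_nonneg_of_neg_pi_div_two_le_of_le (by linarith) h2
  have hs := Real.sin_nonneg_of_nonneg_of_le_pi h1 (by linarith)
  refine ⟨hc, hs, ?_⟩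
  rcases hc.eq_or_lt with h0 | h0
  · rcases hs.eq_or_lt with h3 | h3
    · have := Real.sin_sq_add_cos_sq (π / 2 * h)
      rw [← h0, ← h3] at this; norm_num at this
    · linarith
  · linarith

lemma eq_mfun_iff {h q : ℝ} (hh : h ∈ Icc (0 : ℝ) 1) : q = mfun h ↔
    (1 - q) * cos (π / 2 * h) = q * sin (π / 2 * h) := by
  have := (cos_nonneg_sin_nonneg hh).2.2
  rw [mfun, eq_div_iff this.ne']
  constructor <;> intro h <;> linarith

lemma mfun_mem {h : ℝ} (hh : h ∈ Icc (0 : ℝ) 1) : mfun h ∈ Icc (0 : ℝ) 1 := by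
  obtain ⟨h1, h2, h3⟩ := cos_nonneg_sin_nonneg hh
  refine ⟨div_nonneg h1 h3.le, (div_le_one h3).2 (by linarith)⟩

lemma mfun_zero : mfun 0 = 1 := by simp [mfun]

lemma mfun_one : mfun 1 = 0 := by simp [mfun]

lemma mfun_one_sub {h : ℝ} (hh : h ∈ Icc (0 : ℝ) 1) : mfun (1 - h) = 1 - mfun h := by
  have := (cos_nonneg_sin_nonneg hh).2.2
  have e : π / 2 * (1 - h) = π / 2 - π / 2 * h := by ring
  rw [mfun, mfun, e, Real.cos_pi_div_two_sub, Real.sin_pi_div_two_sub, eq_sub_iff_add_eq,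
    add_comm (sin _), ← add_div, add_comm (sin _), div_self this.ne']

lemma mfun_lt {h h' : ℝ} (h0 : 0 ≤ h) (hlt : h < h') (h1 : h' ≤ 1) : mfun h' < mfun h := by
  obtain ⟨-, -, p1⟩ := cos_nonneg_sin_nonneg ⟨h0, hlt.le.trans h1⟩
  obtain ⟨-, -, p2⟩ := cos_nonneg_sin_nonneg ⟨h0.trans hlt.le, h1⟩
  rw [mfun, mfun, div_lt_div_iff₀ p2 p1]
  have hπ := Real.pi_pos
  have : 0 < sin (π / 2 * h' - π / 2 * h) := by
    apply Real.sin_pos_of_pos_of_lt_pi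
    · nlinarith
    · nlinarith
  rw [Real.sin_sub] at this
  nlinarith

lemma mfun_injOn {h h' : ℝ} (hh : h ∈ Icc (0 : ℝ) 1) (hh' : h' ∈ Icc (0 : ℝ) 1)
    (he : mfun h = mfun h') : h = h' := by
  rcases lt_trichotomy h h' with hlt | hlt | hlt
  · exact absurd he (mfun_lt hh.1 hlt hh'.2).ne'
  · exact hlt
  · exact absurd he (mfun_lt hh'.1 hlt hh.2).ne

lemma continuousOn_mfun : ContinuousOn mfun (Icc 0 1) := by
  refine ContinuousOn.div (by fun_prop) (by fun_prop) fun h hh => (cos_nonneg_sin_nonneg hh).2.2.ne'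

lemma zeta_mem {h : ℝ} : zeta h ∈ Icc (0 : ℝ) 1 := by
  have hπ := Real.pi_pos
  rw [zeta]
  split_ifs with h1
  · simp
  · refine ⟨mul_nonneg (by positivity) (Real.arctan_nonneg.2 (Real.sqrt_nonneg _)), ?_⟩
    have := (Real.arctan_lt_pi_div_two (sqrt (Real.tan (π * h / 2)))).le
    calc _ ≤ 2 / π * (π / 2) := mul_le_mul_of_nonneg_left this (by positivity)
      _ = 1 := by field_simp

lemma cos_sq_zeta {h : ℝ} (hh : h ∈ Icc (0 : ℝ) 1) : cos (π * zeta h / 2) ^ 2 = mfun h := by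
  have hπ := Real.pi_pos
  rw [zeta]
  split_ifs with h1
  · rw [h1, mfun_one]; simp
  · have hlt : h < 1 := lt_of_le_of_ne hh.2 h1
    have e1 : π * h / 2 = π / 2 * h := by ring
    have e2 : π * (2 / π * arctan (sqrt (Real.tan (π * h / 2)))) / 2 =
      arctan (sqrt (Real.tan (π * h / 2))) := by field_simp
    have h3 : 0 < cos (π / 2 * h) := by
      apply Real.cos_pos_of_mem_Ioo
      constructor <;> nlinarith [hh.1]
    have h4 : 0 ≤ Real.tan (π / 2 * h) := by
      rw [Real.tan_eq_sin_div_cos]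
      exact div_nonneg (cos_nonneg_sin_nonneg hh).2.1 h3.le
    rw [e2, Real.cos_sq_arctan, e1, Real.sq_sqrt h4, Real.tan_eq_sin_div_cos, mfun]
    generalize cos (π / 2 * h) = c at *
    generalize sin (π / 2 * h) = s at *
    rw [one_add_div h3.ne', one_div_div]

/-! ### Rectangles of arbitrary size -/

/-- The function `Rect.h` for a rectangle of width `a` and height `b`, in real coordinates. -/
def rectH (a b x y : ℝ) : ℝ := stripH (π * a / b) (π * x / b) (π * y / b)

variable {a b x y : ℝ}

lemma scale_lt (hb : 0 < b) {s t : ℝ} (h : s < t) : π * s / b < π * t / b := by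
  have := Real.pi_pos
  gcongr

lemma scale_le (hb : 0 < b) {s t : ℝ} (h : s ≤ t) : π * s / b ≤ π * t / b := by
  have := Real.pi_pos
  gcongr

lemma scale_self (hb : 0 < b) : π * b / b = π := by field_simp

lemma scale_inj (hb : 0 < b) {s t : ℝ} : π * s / b = π * t / b ↔ s = t := by
  have := Real.pi_pos
  rw [div_left_inj' hb.ne', mul_right_inj' this.ne']

lemma scale_eq_zero (hb : 0 < b) {s : ℝ} : π * s / b = 0 ↔ s = 0 := by
  simpa using scale_inj hb (s := s) (t := 0)

lemma scale_eq_pi (hb : 0 < b) {s : ℝ} : π * s / b = π ↔ s = b := by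
  have := scale_inj hb (s := s) (t := b)
  rwa [scale_self hb] at this

lemma scale_pos (hb : 0 < b) {s : ℝ} (h : 0 < s) : 0 < π * s / b := by simpa using scale_lt hb h

lemma scale_nonneg (hb : 0 < b) {s : ℝ} (h : 0 ≤ s) : 0 ≤ π * s / b := by simpa using scale_le hb h

lemma scale_lt_pi (hb : 0 < b) {s : ℝ} (h : s < b) : π * s / b < π := by
  simpa [scale_self hb] using scale_lt hb h

lemma scale_mem (hb : 0 < b) {s : ℝ} (h : s ∈ Icc 0 b) : π * s / b ∈ Icc 0 π :=
  ⟨scale_nonneg hb h.1, by simpa [scale_self hb] using scale_le hb h.2⟩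

lemma scale_abs_lt (hb : 0 < b) {s t : ℝ} (h : |s| < t) : |π * s / b| < π * t / b := by
  rw [abs_lt] at h ⊢
  refine ⟨?_, scale_lt hb h.2⟩
  have := scale_lt hb h.1
  rw [mul_neg, neg_div] at this
  exact this

lemma rectH_reflect_left (a b x y : ℝ) : rectH a b (a - x) y = rectH a b x y := by
  rw [rectH, mul_sub, sub_div, stripH_reflect_left]; rfl

lemma rectH_reflect_right (hb : 0 < b) : rectH a b x (b - y) = rectH a b x y := by
  rw [rectH, mul_sub, sub_div, scale_self hb, stripH_reflect_right]; rfl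

lemma rectH_left (a b y : ℝ) : rectH a b 0 y = 1 := by simp [rectH, stripH_left]

lemma rectH_right (a b y : ℝ) : rectH a b a y = 1 := by rw [rectH, stripH_right]

lemma rectH_bottom (hb : 0 < b) (h0 : 0 < x) (h1 : x < a) : rectH a b x 0 = 0 := by
  rw [rectH, mul_zero, zero_div, stripH_bottom (scale_pos hb h0) (scale_lt hb h1)]

lemma rectH_top (hb : 0 < b) (h0 : 0 < x) (h1 : x < a) : rectH a b x b = 0 := by
  rw [rectH, scale_self hb, stripH_top (scale_pos hb h0) (scale_lt hb h1)]

lemma rectH_pos (h0 : 0 < x) (h1 : x < a) (h2 : 0 < y) (h3 : y < b) : 0 < rectH a b x y := by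
  have hb := h2.trans h3
  exact stripH_pos (scale_pos hb h0) (scale_lt hb h1) (scale_pos hb h2) (scale_lt_pi hb h3)

lemma rectH_lt_one (h0 : 0 < x) (h1 : x < a) (h2 : 0 < y) (h3 : y < b) : rectH a b x y < 1 := by
  have hb := h2.trans h3
  exact stripH_lt_one (scale_pos hb h0) (scale_lt hb h1) (scale_pos hb h2) (scale_lt_pi hb h3)

lemma rectH_mem (hb : 0 < b) (hx : x ∈ Icc 0 a) (hy : y ∈ Icc 0 b) :
    rectH a b x y ∈ Icc (0 : ℝ) 1 := by
  rcases hx.1.eq_or_lt with rfl | h0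
  · simp [rectH_left]
  rcases hx.2.eq_or_lt with rfl | h1
  · simp [rectH_right]
  rcases hy.1.eq_or_lt with rfl | h2
  · simp [rectH_bottom hb h0 h1]
  rcases hy.2.eq_or_lt with rfl | h3
  · simp [rectH_top hb h0 h1]
  exact ⟨(rectH_pos h0 h1 h2 h3).le, (rectH_lt_one h0 h1 h2 h3).le⟩

lemma rectH_swap (ha : 0 < a) (hb : 0 < b) (hx : x ∈ Icc 0 a) (hy : y ∈ Icc 0 b)
    (hc : ¬((x = 0 ∨ x = a) ∧ (y = 0 ∨ y = b))) : rectH b a y x = 1 - rectH a b x y := by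
  have hπ := Real.pi_pos
  rcases hx.1.eq_or_lt with rfl | h0
  · have hy' : 0 < y ∧ y < b := by
      refine ⟨lt_of_le_of_ne hy.1 fun h => hc ⟨by simp, by simp [h]⟩,
        lt_of_le_of_ne hy.2 fun h => hc ⟨by simp, by simp [h]⟩⟩
    rw [rectH_left, rectH_bottom ha hy'.1 hy'.2]; norm_num
  rcases hx.2.eq_or_lt with rfl | h1
  · have hy' : 0 < y ∧ y < b := by
      refine ⟨lt_of_le_of_ne hy.1 fun h => hc ⟨by simp, by simp [h]⟩,
        lt_of_le_of_ne hy.2 fun h => hc ⟨by simp, by simp [h]⟩⟩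
    rw [rectH_right, rectH_top ha hy'.1 hy'.2]; norm_num
  rcases hy.1.eq_or_lt with rfl | h2
  · rw [rectH_left, rectH_bottom hb h0 h1]; norm_num
  rcases hy.2.eq_or_lt with rfl | h3
  · rw [rectH_right, rectH_top hb h0 h1]; norm_num
  have := stripH_swap (scale_pos hb h0) (scale_lt hb h1) (scale_pos hb h2) (scale_lt_pi hb h3)
  rw [eq_sub_iff_add_eq, add_comm, ← this, rectH, rectH]
  congr 2
  · field_simp
  · field_simp
  · field_simp

/-- The closed rectangle without its vertices, in real coordinates. -/
def puncturedRect (a b : ℝ) : Set (ℝ²) :=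
  {p | p ∈ Icc 0 a ×ˢ Icc 0 b ∧ ¬((p.1 = 0 ∨ p.1 = a) ∧ (p.2 = 0 ∨ p.2 = b))}

lemma continuousOn_rectH (ha : 0 < a) (hb : 0 < b) :
    ContinuousOn (fun p : ℝ² => rectH a b p.1 p.2) (puncturedRect a b) := by
  refine (continuousOn_stripH (scale_pos hb ha)).comp
    (f := fun p : ℝ² => (π * p.1 / b, π * p.2 / b)) (by fun_prop) ?_
  rintro ⟨x, y⟩ ⟨⟨hx, hy⟩, hc⟩
  refine ⟨⟨⟨scale_nonneg hb hx.1, scale_le hb hx.2⟩, scale_mem hb hy⟩, ?_⟩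
  simp only
  rw [scale_eq_zero hb, scale_inj hb, scale_eq_zero hb, scale_eq_pi hb]
  exact hc

/-- If two rectangles cross, the function of the narrow one is the larger one on the intersection. -/
lemma rectH_lt_of_crossing {a1 b1 a2 b2 x0 y0 : ℝ} (ha2 : 0 < a2) (hb1 : 0 < b1)
    (hx0 : 0 < x0) (hx1 : x0 + a2 < a1) (hy0 : 0 < y0) (hy1 : y0 + b1 < b2)
    (hx : x ∈ Icc x0 (x0 + a2)) (hy : y ∈ Icc 0 b1) :
    rectH a1 b1 x y < rectH a2 b2 (x - x0) (y + y0) := by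
  have hπ := Real.pi_pos
  have ha1 : 0 < a1 := by linarith
  have hb2 : 0 < b2 := by linarith
  let v : ℝ² → ℝ := fun p => rectH a2 b2 (p.1 - x0) (p.2 + y0) - rectH a1 b1 p.1 p.2
  -- on the sides of the intersection one of the two functions is `0` or `1`
  have hfr : ∀ p ∈ Icc x0 (x0 + a2) ×ˢ Icc 0 b1, p ∉ Ioo x0 (x0 + a2) ×ˢ Ioo 0 b1 → 0 < v p := by
    rintro ⟨s, t⟩ ⟨⟨hs1, hs2⟩, ht1, ht2⟩ hn
    simp only [v] at *
    have hs3 : 0 < s := by linarith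
    have hs4 : s < a1 := by linarith
    have ht3 : 0 < t + y0 := by linarith
    have ht4 : t + y0 < b2 := by linarith
    have hle : rectH a1 b1 s t < 1 := by
      rcases ht1.eq_or_lt with rfl | ht1
      · rw [rectH_bottom hb1 hs3 hs4]; norm_num
      rcases ht2.eq_or_lt with rfl | ht2
      · rw [rectH_top hb1 hs3 hs4]; norm_num
      exact rectH_lt_one hs3 hs4 ht1 ht2
    rcases hs1.eq_or_lt with rfl | hs1
    · rw [sub_self, rectH_left]; linarith
    rcases hs2.eq_or_lt with rfl | hs2
    · rw [add_sub_cancel_left, rectH_right]; linarith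
    have hge := rectH_pos (x := s - x0) (a := a2) (y := t + y0) (b := b2) (by linarith)
      (by linarith) ht3 ht4
    rcases ht1.eq_or_lt with rfl | ht1
    · rw [rectH_bottom hb1 hs3 hs4]; linarith
    rcases ht2.eq_or_lt with rfl | ht2
    · rw [rectH_top hb1 hs3 hs4]; linarith
    exact absurd ⟨⟨hs1, hs2⟩, ht1, ht2⟩ hn
  by_cases hU : (x, y) ∈ Ioo x0 (x0 + a2) ×ˢ Ioo 0 b1
  swap
  · have := hfr (x, y) ⟨hx, hy⟩ hU
    simp only [v] at this
    linarith
  have hv : ContinuousOn v (Icc x0 (x0 + a2) ×ˢ Icc 0 b1) := by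
    refine ContinuousOn.sub ?_ ?_
    · refine (continuousOn_rectH ha2 hb2).comp (f := fun p : ℝ² => (p.1 - x0, p.2 + y0))
        (by fun_prop) ?_
      rintro ⟨s, t⟩ ⟨⟨hs1, hs2⟩, ht1, ht2⟩
      simp only at *
      refine ⟨⟨⟨by simp only; linarith, by simp only; linarith⟩,
        ⟨by simp only; linarith, by simp only; linarith⟩⟩, ?_⟩
      rintro ⟨_, h | h⟩ <;> simp only at h <;> linarith
    · refine (continuousOn_rectH ha1 hb1).mono ?_
      rintro ⟨s, t⟩ ⟨⟨hs1, hs2⟩, ht1, ht2⟩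
      simp only at *
      refine ⟨⟨⟨by simp only; linarith, by simp only; linarith⟩, ⟨ht1, ht2⟩⟩, ?_⟩
      rintro ⟨h | h, _⟩ <;> simp only at h <;> linarith
  let G : ℂ → ℂ := fun Z =>
    ((2 / π : ℝ) : ℂ) * psi (π * a2 / b2) (((π / b2 : ℝ) : ℂ) * (Z + (-x0 + y0 * I))) -
    ((2 / π : ℝ) : ℂ) * psi (π * a1 / b1) (((π / b1 : ℝ) : ℂ) * Z)
  have hG : DifferentiableOn ℂ G {Z | Z.re ∈ Ioo x0 (x0 + a2) ∧ Z.im ∈ Ioo 0 b1} := by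
    intro Z hZ
    have r1 : (((π / b2 : ℝ) : ℂ) * (Z + (-x0 + y0 * I))).re = π * (Z.re - x0) / b2 := by
      rw [Complex.re_ofReal_mul]; simp; ring
    have r2 : (((π / b1 : ℝ) : ℂ) * Z).re = π * Z.re / b1 := by rw [Complex.re_ofReal_mul]; ring
    have d1 := psi_differentiableAt (A := π * a2 / b2)
      (Z := ((π / b2 : ℝ) : ℂ) * (Z + (-x0 + y0 * I)))
      (by rw [r1]; exact scale_pos hb2 (by linarith [hZ.1.1]))
      (by rw [r1]; exact scale_lt hb2 (by linarith [hZ.1.2]))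
    have d2 := psi_differentiableAt (A := π * a1 / b1) (Z := ((π / b1 : ℝ) : ℂ) * Z)
      (by rw [r2]; exact scale_pos hb1 (by linarith [hZ.1.1]))
      (by rw [r2]; exact scale_lt hb1 (by linarith [hZ.1.2]))
    have l1 : DifferentiableAt ℂ
      (fun Z : ℂ => ((π / b2 : ℝ) : ℂ) * (Z + (-x0 + y0 * I))) Z := by fun_prop
    have l2 : DifferentiableAt ℂ (fun Z : ℂ => ((π / b1 : ℝ) : ℂ) * Z) Z := by fun_prop
    exact (((d1.comp Z l1).const_mul _).sub ((d2.comp Z l2).const_mul _)).differentiableWithinAt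
  have hvG : ∀ s ∈ Ioo x0 (x0 + a2), ∀ t ∈ Ioo 0 b1, v (s, t) = (G (s + t * I)).im := by
    intro s hs t ht
    have e1 : (((π / b2 : ℝ) : ℂ) * (s + t * I + (-x0 + y0 * I))) =
      ((π * (s - x0) / b2 : ℝ) : ℂ) + ((π * (t + y0) / b2 : ℝ) : ℂ) * I := by
      push_cast; ring
    have e2 : (((π / b1 : ℝ) : ℂ) * (s + t * I)) =
      ((π * s / b1 : ℝ) : ℂ) + ((π * t / b1 : ℝ) : ℂ) * I := by
      push_cast; ring
    have p1 : 0 < π * (s - x0) / b2 := scale_pos hb2 (by linarith [hs.1])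
    have p2 : π * (s - x0) / b2 < π * a2 / b2 := scale_lt hb2 (by linarith [hs.2])
    have p3 : 0 < π * s / b1 := scale_pos hb1 (by linarith [hs.1])
    have p4 : π * s / b1 < π * a1 / b1 := scale_lt hb1 (by linarith [hs.2])
    simp only [v, G]
    rw [Complex.sub_im, im_ofReal_mul, im_ofReal_mul, e1, e2,
      ← stripSeries_eq _ p1 p2, ← stripSeries_eq _ p3 p4, rectH, rectH, stripH_of_ne _ p1 p2,
      stripH_of_ne _ p3 p4]
  have := (min_principle hv.lowerSemicontinuousOn hG hvG (fun p hp hn => (hfr p hp hn).le) (x, y) hU).2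
    ⟨(x0, 0), ⟨⟨le_rfl, by linarith⟩, ⟨le_rfl, hb1.le⟩⟩, fun h => lt_irrefl _ h.1.1,
      hfr _ ⟨⟨le_rfl, by linarith⟩, ⟨le_rfl, hb1.le⟩⟩ fun h => lt_irrefl _ h.1.1⟩
  simp only [v] at this
  linarith

end

section

/-! ### The equation of a tile in coordinates -/

/-- `stripN` for a rectangle of arbitrary size. -/
def rectN (a b x y : ℝ) : ℝ := stripN (π * a / b) (π * x / b) (π * y / b)

/-- `stripD` for a rectangle of arbitrary size. -/
def rectD (a b x y : ℝ) : ℝ := stripD (π * a / b) (π * x / b) (π * y / b)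

/-- The left-hand side of the equation `(1 - q) N = q D` of a tile, as a function of `((y, q), x)`.
It is analytic up to and across the left side of the rectangle. -/
def tileEq (a b : ℝ) (p : ℝ³) : ℝ := (1 - p.1.2) * rectN a b p.2 p.1.1 - p.1.2 * rectD a b p.2 p.1.1

variable {a b x y q : ℝ}

lemma rectN_contDiffAt (hb : 0 < b) (h : |x| < a) :
    ContDiffAt ℝ ω (fun p : ℝ² => rectN a b p.1 p.2) (x, y) :=
  ContDiffAt.comp (g := fun p : ℝ² => stripN (π * a / b) p.1 p.2)
    (f := fun p : ℝ² => (π * p.1 / b, π * p.2 / b)) (x, y)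
    (stripN_contDiffAt (scale_abs_lt hb h)) (by fun_prop)

lemma rectD_contDiffAt (hb : 0 < b) (h : |x| < a) :
    ContDiffAt ℝ ω (fun p : ℝ² => rectD a b p.1 p.2) (x, y) :=
  ContDiffAt.comp (g := fun p : ℝ² => stripD (π * a / b) p.1 p.2)
    (f := fun p : ℝ² => (π * p.1 / b, π * p.2 / b)) (x, y)
    (stripD_contDiffAt (scale_abs_lt hb h)) (by fun_prop)

lemma tileEq_contDiffAt (hb : 0 < b) {p : ℝ³} (h : |p.2| < a) : ContDiffAt ℝ ω (tileEq a b) p := by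
  have hsw : ContDiffAt ℝ ω (fun p : ℝ³ => (p.2, p.1.1)) p := by fun_prop
  have hq : ContDiffAt ℝ ω (fun p : ℝ³ => p.1.2) p := by fun_prop
  have h1 := ContDiffAt.comp (g := fun p : ℝ² => rectN a b p.1 p.2) p
    (rectN_contDiffAt (y := p.1.1) hb h) hsw
  have h2 := ContDiffAt.comp (g := fun p : ℝ² => rectD a b p.1 p.2) p
    (rectD_contDiffAt (y := p.1.1) hb h) hsw
  exact ((contDiffAt_const.sub hq).mul h1).sub (hq.mul h2)

lemma rectND_eq (hb : 0 < b) (h0 : 0 ≤ x) (h1 : x < a) (hy : y ∈ Icc 0 b)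
    (hc : ¬(x = 0 ∧ (y = 0 ∨ y = b))) :
    ∃ R > 0, rectN a b x y = R * cos (π / 2 * rectH a b x y) ∧
      rectD a b x y = R * sin (π / 2 * rectH a b x y) :=
  stripND_eq (scale_nonneg hb h0) (scale_lt hb h1) (scale_mem hb hy) (by
    rw [scale_eq_zero hb, scale_eq_zero hb, scale_eq_pi hb]; exact hc)

lemma tileEq_corner (ha : 0 < a) (hb : 0 < b) (hy : y = 0 ∨ y = b) : tileEq a b ((y, q), 0) = 0 := by
  have hA : 0 < π * a / b := scale_pos hb ha
  rcases hy with rfl | rfl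
  · simp [tileEq, rectN, rectD, stripN_left hA, stripD_left hA]
  · simp [tileEq, rectN, rectD, stripN_left hA, stripD_left hA, scale_self hb]

lemma tileEq_left (ha : 0 < a) (hb : 0 < b) (y q : ℝ) :
    tileEq a b ((y, q), 0) = -(q * sin (π * y / b)) := by
  have hA : 0 < π * a / b := scale_pos hb ha
  simp [tileEq, rectN, rectD, stripN_left hA, stripD_left hA]

lemma tileEq_eq_zero_iff (ha : 0 < a) (hb : 0 < b) (h0 : 0 ≤ x) (h1 : x < a) (hy : y ∈ Icc 0 b) :
    tileEq a b ((y, q), x) = 0 ↔ (x = 0 ∧ (y = 0 ∨ y = b)) ∨ q = mfun (rectH a b x y) := by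
  by_cases hc : x = 0 ∧ (y = 0 ∨ y = b)
  · simp only [hc, and_self, true_or, iff_true]
    exact tileEq_corner ha hb hc.2
  obtain ⟨R, hR, hN, hD⟩ := rectND_eq hb h0 h1 hy hc
  rw [eq_mfun_iff (rectH_mem hb ⟨h0, h1.le⟩ hy)]
  simp only [hc, false_or, tileEq, hN, hD]
  generalize cos (π / 2 * rectH a b x y) = c
  generalize sin (π / 2 * rectH a b x y) = s
  have : (1 - q) * (R * c) - q * (R * s) = R * ((1 - q) * c - q * s) := by ring
  rw [this, mul_eq_zero, or_iff_right hR.ne', sub_eq_zero]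

lemma etaIm_neg_left {A X : ℝ} (Y : ℝ) (h : |X| < A) : etaIm A (-X) Y = -etaIm A X Y := by
  refine (etaIm_hasSum Y (by rwa [abs_neg])).unique ?_
  refine (etaIm_hasSum Y h).neg.congr_fun fun n => ?_
  rw [mul_neg, Real.sinh_neg]; ring

lemma rectN_neg (hb : 0 < b) (h : |x| < a) : rectN a b (-x) y = -rectN a b x y := by
  rw [rectN, mul_neg, neg_div, stripN, etaIm_neg_left _ (scale_abs_lt hb h), rectN, stripN]
  simp; ring

lemma rectD_neg (hb : 0 < b) (h : |x| < a) : rectD a b (-x) y = rectD a b x y := by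
  rw [rectD, mul_neg, neg_div, stripD, etaIm_neg_left _ (scale_abs_lt hb h), rectD, stripD]
  simp

/-- The equation of a tile has no solutions to the left of the rectangle, since `N` is odd and `D`
is even in `x`. -/
lemma nonneg_of_tileEq (hb : 0 < b) (hx : |x| < a) (hy : y ∈ Icc 0 b) (hq : q ∈ Ico (0 : ℝ) 1)
    (h : tileEq a b ((y, q), x) = 0) : 0 ≤ x := by
  by_contra hneg
  push Not at hneg
  have h0 : 0 < -x := by linarith
  have h1 : -x < a := by linarith [(abs_lt.1 hx).1]
  have hx' : |(-x)| < a := by rwa [abs_neg]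
  have hlt : rectH a b (-x) y < 1 := by
    rcases hy.1.eq_or_lt with rfl | ht1
    · rw [rectH_bottom hb h0 h1]; norm_num
    rcases hy.2.eq_or_lt with rfl | ht2
    · rw [rectH_top hb h0 h1]; norm_num
    exact rectH_lt_one h0 h1 ht1 ht2
  have hm := rectH_mem hb ⟨h0.le, h1.le⟩ hy
  obtain ⟨R, hR, hN, hD⟩ := rectND_eq hb h0.le h1 hy (fun h => h0.ne' h.1)
  have hc : 0 < cos (π / 2 * rectH a b (-x) y) := by
    apply Real.cos_pos_of_mem_Ioo
    have := Real.pi_pos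
    constructor <;> nlinarith [hm.1]
  have hs := (cos_nonneg_sin_nonneg hm).2.1
  have e1 : rectN a b x y = -rectN a b (-x) y := by rw [← rectN_neg hb hx', neg_neg]
  have e2 : rectD a b x y = rectD a b (-x) y := by rw [← rectD_neg hb hx', neg_neg]
  have hN0 : 0 < rectN a b (-x) y := by rw [hN]; positivity
  have hD0 : 0 ≤ rectD a b (-x) y := by rw [hD]; positivity
  simp only [tileEq, e1, e2] at h
  nlinarith [mul_pos (sub_pos.2 hq.2) hN0, mul_nonneg hq.1 hD0]

lemma fderiv_apply_of_line {E : Type*} [NormedAddCommGroup E] [NormedSpace ℝ E] {g : E → ℝ} {p v : E}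
    {c : ℝ} (hg : DifferentiableAt ℝ g p) (h : HasDerivAt (fun t : ℝ => g (p + t • v)) c 0) :
    fderiv ℝ g p v = c := by
  have h1 : HasDerivAt (fun t : ℝ => p + t • v) ((1 : ℝ) • v) 0 :=
    ((hasDerivAt_id (0 : ℝ)).smul_const v).const_add p
  have h2 : HasFDerivAt g (fderiv ℝ g p) (p + (0 : ℝ) • v) := by simpa using hg.hasFDerivAt
  have h3 := HasFDerivAt.comp_hasDerivAt (0 : ℝ) h2 h1
  simpa using h3.unique h

lemma hasDerivAt_comp_scale {f : ℝ → ℝ} {e : ℝ} (b : ℝ) (h : HasDerivAt f e 0) :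
    HasDerivAt (fun t => f (π * t / b)) (e * (π / b)) 0 := by
  have h1 : HasDerivAt (fun t : ℝ => π * t / b) (π / b) 0 := by
    simpa using ((hasDerivAt_id (0 : ℝ)).const_mul π).div_const b
  have h2 : HasDerivAt f e (π * 0 / b) := by simpa using h
  exact HasDerivAt.comp (h₂ := f) 0 h2 h1

lemma tileEq_deriv_left (ha : 0 < a) (hb : 0 < b) (hy : y ∈ Icc 0 b) :
    0 < fderiv ℝ (tileEq a b) ((y, 0), 0) (0, 1) := by
  obtain ⟨e, he, hd⟩ := stripN_deriv_left (scale_pos hb ha) (scale_mem hb hy)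
  have hd' := hasDerivAt_comp_scale b hd
  have := fderiv_apply_of_line (g := tileEq a b) (p := ((y, 0), 0)) (v := (0, 1)) (c := e * (π / b))
    ((tileEq_contDiffAt hb (by simpa using ha)).differentiableAt (by simp)) (by
      refine hd'.congr_of_eventuallyEq (.of_forall fun t => ?_)
      simp [tileEq, rectN])
  rw [this]
  have := Real.pi_pos
  positivity

lemma tileEq_deriv_corner (ha : 0 < a) (hb : 0 < b) (q : ℝ) :
    fderiv ℝ (tileEq a b) ((0, q), 0) (0, 1) = (1 - q) * (π / b) ∧
    fderiv ℝ (tileEq a b) ((0, q), 0) ((1, 0), 0) = -(q * (π / b)) ∧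
    fderiv ℝ (tileEq a b) ((0, q), 0) ((0, 1), 0) = 0 := by
  have hA := scale_pos hb ha
  have hdiff : DifferentiableAt ℝ (tileEq a b) ((0, q), 0) :=
    (tileEq_contDiffAt hb (by simpa using ha)).differentiableAt (by simp)
  refine ⟨fderiv_apply_of_line hdiff ?_, fderiv_apply_of_line hdiff ?_,
    fderiv_apply_of_line hdiff ?_⟩
  · have h1 := (hasDerivAt_comp_scale b (stripN_deriv_corner hA)).const_mul (1 - q)
    rw [one_mul] at h1
    refine h1.congr_of_eventuallyEq ?_
    have : ∀ᶠ t : ℝ in 𝓝 0, |t| < a :=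
      continuous_abs.continuousAt.eventually_lt continuousAt_const (by simpa using ha)
    filter_upwards [this] with t ht
    simp [tileEq, rectN, rectD, stripD_bottom (scale_abs_lt hb ht)]
  · have h1 := ((hasDerivAt_comp_scale b (stripD_deriv_corner hA)).const_mul q).neg
    rw [one_mul] at h1
    refine h1.congr_of_eventuallyEq (.of_forall fun t => ?_)
    simp [tileEq, rectN, rectD, stripN_left hA]
  · refine (hasDerivAt_const (0 : ℝ) (0 : ℝ)).congr_of_eventuallyEq (.of_forall fun t => ?_)
    have := tileEq_corner (y := 0) (q := q + t) ha hb (Or.inl rfl)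
    simpa using this

/-! ### Solving the equation for the distance from the vertical side -/

lemma exists_implicit {g : ℝ³ → ℝ} {w : ℝ²} {x : ℝ} (hg : ContDiffAt ℝ ω g (w, x))
    (h0 : g (w, x) = 0) (hx : fderiv ℝ g (w, x) (0, 1) ≠ 0) :
    ∃ ψ : ℝ² → ℝ, ContDiffAt ℝ 1 ψ w ∧ ψ w = x ∧ (∀ᶠ p in 𝓝 (w, x), g p = 0 ↔ ψ p.1 = p.2) ∧
      ∀ᶠ w' in 𝓝 w, g (w', ψ w') = 0 := by
  have hg1 : ContDiffAt ℝ 1 g (w, x) := hg.of_le (by simp)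
  have hinv : (fderiv ℝ g (w, x) ∘L .inr ℝ (ℝ²) ℝ).IsInvertible := by
    refine ⟨ContinuousLinearEquiv.unitsEquivAut ℝ (Units.mk0 _ hx), ?_⟩
    ext
    simp
  refine ⟨hg1.implicitFunction one_ne_zero hinv, hg1.contDiffAt_implicitFunction one_ne_zero hinv,
    hg1.implicitFunction_apply_self one_ne_zero hinv, ?_, ?_⟩
  · simpa [h0] using hg1.eventually_apply_eq_iff_implicitFunction one_ne_zero hinv
  · simpa [h0] using hg1.eventually_apply_implicitFunction one_ne_zero hinv

lemma implicit_deriv {g : ℝ³ → ℝ} {ψ : ℝ² → ℝ} {w : ℝ²} {ψ' : ℝ² →L[ℝ] ℝ}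
    (hg : DifferentiableAt ℝ g (w, ψ w)) (hψ : HasFDerivAt ψ ψ' w)
    (h : ∀ᶠ w' in 𝓝 w, g (w', ψ w') = 0) (v : ℝ²) :
    fderiv ℝ g (w, ψ w) (v, 0) + ψ' v * fderiv ℝ g (w, ψ w) (0, 1) = 0 := by
  have h1 := HasFDerivAt.comp (g := g) w hg.hasFDerivAt ((hasFDerivAt_id w).prodMk hψ)
  have h2 : HasFDerivAt (g ∘ fun w' => (w', ψ w')) (0 : ℝ² →L[ℝ] ℝ) w :=
    (hasFDerivAt_const (0 : ℝ) w).congr_of_eventuallyEq h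
  have h3 := DFunLike.congr_fun (h1.unique h2) v
  have e : ((v, ψ' v) : ℝ³) = (v, 0) + ψ' v • (0, 1) := by simp
  simp only [comp_apply, prod_apply, ContinuousLinearMap.id_apply, zero_apply] at h3
  rw [e, map_add, map_smul, smul_eq_mul] at h3
  exact h3

/-- Near a vertex and for `0 < q < 1`, the tile is a graph over the `(y, q)`-plane whose tangent
plane at the vertex depends on `q` only. -/
lemma exists_corner_graph (ha : 0 < a) (hb : 0 < b) (hq : q ∈ Ioo (0 : ℝ) 1) :
    ∃ ψ : ℝ² → ℝ, ContDiffAt ℝ 1 ψ (0, q) ∧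
      (∀ᶠ p in 𝓝 (((0, q), 0) : ℝ³), tileEq a b p = 0 ↔ ψ p.1 = p.2) ∧
      ∀ᶠ t in 𝓝 q, ψ (0, t) = 0 ∧ HasFDerivAt ψ ((t / (1 - t)) • fst ℝ ℝ ℝ) (0, t) := by
  have hπ := Real.pi_pos
  obtain ⟨d1, -, -⟩ := tileEq_deriv_corner ha hb q
  have hq1 : 0 < 1 - q := by linarith [hq.2]
  obtain ⟨ψ, h1, h2, h3, h4⟩ := exists_implicit (g := tileEq a b) (w := (0, q)) (x := 0)
    (tileEq_contDiffAt hb (by simpa using ha)) (tileEq_corner ha hb (Or.inl rfl))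
    (by rw [d1]; positivity)
  refine ⟨ψ, h1, h3, ?_⟩
  have c1 : Tendsto (fun t : ℝ => (((0 : ℝ), t) : ℝ²)) (𝓝 q) (𝓝 (0, q)) :=
    Continuous.tendsto (by fun_prop) q
  have c2 : Tendsto (fun t : ℝ => ((((0 : ℝ), t), (0 : ℝ)) : ℝ³)) (𝓝 q) (𝓝 ((0, q), 0)) :=
    Continuous.tendsto (by fun_prop) q
  have hdiff : ∀ᶠ w in 𝓝 ((0 : ℝ), q), DifferentiableAt ℝ ψ w := by
    filter_upwards [h1.eventually (by simp)] with w hw using hw.differentiableAt (by simp)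
  filter_upwards [c2.eventually h3, c1.eventually h4.eventually_nhds, c1.eventually hdiff,
    isOpen_Ioo.mem_nhds hq] with t t1 t2 t3 t4
  have hz : ψ (0, t) = 0 := t1.1 (tileEq_corner ha hb (Or.inl rfl))
  refine ⟨hz, ?_⟩
  obtain ⟨e1, e2, e3⟩ := tileEq_deriv_corner ha hb t
  have ht : 0 < 1 - t := by linarith [t4.2]
  have hg : DifferentiableAt ℝ (tileEq a b) ((0, t), ψ (0, t)) := by
    rw [hz]; exact (tileEq_contDiffAt hb (by simpa using ha)).differentiableAt (by simp)
  have r1 := implicit_deriv hg t3.hasFDerivAt t2 (1, 0)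
  have r2 := implicit_deriv hg t3.hasFDerivAt t2 (0, 1)
  rw [hz, e1, e2] at r1
  rw [hz, e1, e3] at r2
  have hpb : π / b ≠ 0 := by positivity
  refine t3.hasFDerivAt.congr_fderiv ?_
  have s1 : fderiv ℝ ψ (0, t) (1, 0) = t / (1 - t) := by
    rw [eq_div_iff ht.ne']
    apply mul_right_cancel₀ hpb
    linarith
  have s2 : fderiv ℝ ψ (0, t) (0, 1) = 0 := by
    have : (1 - t) * (π / b) ≠ 0 := by positivity
    rw [zero_add] at r2
    exact (mul_eq_zero.1 r2).resolve_right this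
  ext
  · simp [s1]
  · simp [s2]

lemma contDiffAt_mfun_rectH (hx0 : 0 < x) (hxa : x < a) (hy0 : 0 < y) (hyb : y < b) :
    ContDiffAt ℝ 1 (fun p : ℝ² => mfun (rectH a b p.1 p.2)) (x, y) := by
  have hb := hy0.trans hyb
  have habs : |x| < a := by rwa [abs_of_pos hx0]
  have hN := (rectN_contDiffAt (y := y) hb habs).of_le (m := 1) (by simp)
  have hD := (rectD_contDiffAt (y := y) hb habs).of_le (m := 1) (by simp)
  have key : ∀ p : ℝ², p ∈ Ioo 0 a ×ˢ Ioo 0 b → 0 < rectN a b p.1 p.2 + rectD a b p.1 p.2 ∧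
      mfun (rectH a b p.1 p.2) = rectN a b p.1 p.2 / (rectN a b p.1 p.2 + rectD a b p.1 p.2) := by
    rintro ⟨s, t⟩ ⟨⟨h1, h2⟩, h3, h4⟩
    simp only at *
    obtain ⟨R, hR, e1, e2⟩ := rectND_eq hb h1.le h2 ⟨h3.le, h4.le⟩ fun h => h1.ne' h.1
    have := (cos_nonneg_sin_nonneg (rectH_mem hb ⟨h1.le, h2.le⟩ ⟨h3.le, h4.le⟩)).2.2
    rw [e1, e2, ← mul_add, mfun, mul_div_mul_left _ _ hR.ne']
    exact ⟨by positivity, rfl⟩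
  refine (hN.div (hN.add hD) (key (x, y) ⟨⟨hx0, hxa⟩, hy0, hyb⟩).1.ne').congr_of_eventuallyEq ?_
  filter_upwards [(isOpen_Ioo.prod isOpen_Ioo).mem_nhds
    (show (x, y) ∈ Ioo 0 a ×ˢ Ioo 0 b from ⟨⟨hx0, hxa⟩, hy0, hyb⟩)] with p hp using (key p hp).2

lemma tileEq_partial_lipschitz (ha : 0 < a) (hb : 0 < b) (v : ℝ³) :
    ∃ C > 0, ∀ y ∈ Icc 0 b, ∀ q ∈ Icc (0 : ℝ) 1, ∀ x ∈ Icc (-(a / 2)) (a / 2),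
      |fderiv ℝ (tileEq a b) ((y, q), x) v - fderiv ℝ (tileEq a b) ((y, 0), 0) v| ≤ C * max q |x| := by
  let K : Set ℝ³ := (Icc 0 b ×ˢ Icc 0 1) ×ˢ Icc (-(a / 2)) (a / 2)
  have hc : ContDiffOn ℝ 1 (fun p => fderiv ℝ (tileEq a b) p v) K := by
    rintro p ⟨-, h1, h2⟩
    have h : ContDiffAt ℝ ω (tileEq a b) p :=
      tileEq_contDiffAt hb (abs_lt.2 ⟨by linarith, by linarith⟩)
    have h' : ContDiffAt ℝ 1 (fderiv ℝ (tileEq a b)) p := h.fderiv_right (by simp)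
    exact (h'.clm_apply contDiffAt_const).contDiffWithinAt
  have hloc : LocallyLipschitzOn K (fun p => fderiv ℝ (tileEq a b) p v) :=
    hc.locallyLipschitzOn (((convex_Icc _ _).prod (convex_Icc _ _)).prod (convex_Icc _ _))
  obtain ⟨C, hC⟩ := hloc.exists_lipschitzOnWith_of_compact
    ((isCompact_Icc.prod isCompact_Icc).prod isCompact_Icc)
  refine ⟨C + 1, by positivity, fun y hy q hq x hx => ?_⟩
  have h := hC.dist_le_mul ((y, q), x) ⟨⟨hy, hq⟩, hx⟩ ((y, 0), 0) ⟨⟨hy, by simp⟩, by simp; linarith⟩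
  rw [Real.dist_eq] at h
  refine h.trans ?_
  have e : dist ((y, q), x) ((y, (0 : ℝ)), (0 : ℝ)) = max q |x| := by
    simp [Prod.dist_eq, abs_of_nonneg hq.1, hq.1]
  rw [e]
  have : 0 ≤ max q |x| := le_max_of_le_left hq.1
  nlinarith

/-- Near the vertical side the tile is, for all sufficiently small `q`, a graph over the
`(y, q)`-strip; the first estimates on this graph are uniform up to the vertices. -/
lemma exists_side_bounds (ha : 0 < a) (hb : 0 < b) : ∃ δ C q0 : ℝ, 0 < δ ∧ δ < a ∧ 0 < C ∧
    0 < q0 ∧ q0 < 1 ∧ ∀ y ∈ Icc 0 b, ∀ q ∈ Icc (0 : ℝ) q0,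
      (∃ x ∈ Ico (0 : ℝ) δ, x ≤ C * q ∧ tileEq a b ((y, q), x) = 0) ∧
      (∀ x x', |x| < δ → |x'| < δ → tileEq a b ((y, q), x) = 0 → tileEq a b ((y, q), x') = 0 →
        x = x') ∧
      ∀ x, |x| < δ → 1 ≤ C * fderiv ℝ (tileEq a b) ((y, q), x) (0, 1) ∧
        (tileEq a b ((y, q), x) = 0 → |fderiv ℝ (tileEq a b) ((y, q), x) ((1, 0), 0)| ≤ C * q) ∧
        |fderiv ℝ (tileEq a b) ((y, q), x) ((0, 1), 0)| ≤ C := by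
  obtain ⟨C1, hC1, h1⟩ := tileEq_partial_lipschitz ha hb (0, 1)
  obtain ⟨C2, hC2, h2⟩ := tileEq_partial_lipschitz ha hb ((1, 0), 0)
  obtain ⟨C3, hC3, h3⟩ := tileEq_partial_lipschitz ha hb ((0, 1), 0)
  have hdiff : ∀ p : ℝ³, |p.2| < a → DifferentiableAt ℝ (tileEq a b) p :=
    fun p hp => (tileEq_contDiffAt hb hp).differentiableAt (by simp)
  have hcont : ContinuousOn (fun y : ℝ => fderiv ℝ (tileEq a b) ((y, 0), 0) (0, 1)) (Icc 0 b) := by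
    intro y _
    have h : ContDiffAt ℝ ω (tileEq a b) ((y, 0), 0) := tileEq_contDiffAt hb (by simpa using ha)
    have h' : ContDiffAt ℝ 0 (fderiv ℝ (tileEq a b)) ((y, 0), 0) := h.fderiv_right (by simp)
    have h'' := (h'.continuousAt.clm_apply (continuousAt_const (y := ((0 : ℝ²), (1 : ℝ)))))
    exact (ContinuousAt.comp (f := fun y : ℝ => ((y, (0 : ℝ)), (0 : ℝ))) h''
      (by fun_prop)).continuousWithinAt
  -- compactness of the side turns the Hopf lemma into a uniform bound
  obtain ⟨y0, hy0, hmin⟩ := isCompact_Icc.exists_isMinOn (nonempty_Icc.2 hb.le) hcont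
  set e := fderiv ℝ (tileEq a b) ((y0, 0), 0) (0, 1) with he
  have he0 : 0 < e := tileEq_deriv_left ha hb hy0
  have hz2 : ∀ y : ℝ, fderiv ℝ (tileEq a b) ((y, 0), 0) ((1, 0), 0) = 0 := fun y =>
    fderiv_apply_of_line (hdiff _ (by simpa using ha))
      ((hasDerivAt_const (0 : ℝ) (0 : ℝ)).congr_of_eventuallyEq (.of_forall fun t => by
        simp [tileEq_left ha hb]))
  have hz3 : ∀ y : ℝ, |fderiv ℝ (tileEq a b) ((y, 0), 0) ((0, 1), 0)| ≤ 1 := by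
    intro y
    rw [fderiv_apply_of_line (c := -sin (π * y / b)) (hdiff _ (by simpa using ha)) ?_]
    · rw [abs_neg]; exact Real.abs_sin_le_one _
    · have : HasDerivAt (fun t : ℝ => -(t * sin (π * y / b)))
        (-(1 * sin (π * y / b))) 0 := ((hasDerivAt_id (0 : ℝ)).mul_const _).neg
      rw [one_mul] at this
      refine this.congr_of_eventuallyEq (.of_forall fun t => ?_)
      simp [tileEq_left ha hb]
  -- the size of the neighbourhood on which the derivative across the side is at least `e / 2`
  set m := min (min (a / 2) (e / (2 * C1))) (1 / 2) with hm
  have hm0 : 0 < m := by positivity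
  have hma : m ≤ a / 2 := (min_le_left _ _).trans (min_le_left _ _)
  have hme : C1 * m ≤ e / 2 := by
    have : m ≤ e / (2 * C1) := (min_le_left _ _).trans (min_le_right _ _)
    calc C1 * m ≤ C1 * (e / (2 * C1)) := by gcongr
      _ = e / 2 := by field_simp
  have hm1 : m ≤ 1 / 2 := min_le_right _ _
  have hder : ∀ y ∈ Icc 0 b, ∀ q ∈ Icc (0 : ℝ) m, ∀ x : ℝ, |x| ≤ m →
      e / 2 ≤ fderiv ℝ (tileEq a b) ((y, q), x) (0, 1) := by
    intro y hy q hq x hx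
    have k1 := h1 y hy q ⟨hq.1, by linarith [hq.2]⟩ x
      ⟨by linarith [(abs_le.1 hx).1], by linarith [(abs_le.1 hx).2]⟩
    have k2 : e ≤ fderiv ℝ (tileEq a b) ((y, 0), 0) (0, 1) := hmin hy
    have k3 : C1 * max q |x| ≤ C1 * m := by gcongr; exact max_le hq.2 hx
    linarith [(abs_le.1 k1).1]
  have hgrow : ∀ y ∈ Icc 0 b, ∀ q ∈ Icc (0 : ℝ) m, ∀ x x', -m ≤ x → x ≤ x' → x' ≤ m →
      e / 2 * (x' - x) ≤ tileEq a b ((y, q), x') - tileEq a b ((y, q), x) := by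
    intro y hy q hq x x' hx hxx' hx'
    have hd : ∀ s : ℝ, |s| ≤ m → HasDerivAt (fun s => tileEq a b ((y, q), s))
        (fderiv ℝ (tileEq a b) ((y, q), s) (0, 1)) s := by
      intro s hs
      have k := (hdiff ((y, q), s) (by simp only; linarith)).hasFDerivAt
      exact HasFDerivAt.comp_hasDerivAt s k ((hasDerivAt_const s (y, q)).prodMk (hasDerivAt_id s))
    refine (convex_Icc x x').mul_sub_le_image_sub_of_le_deriv (f := fun s => tileEq a b ((y, q), s))
      ?_ ?_ ?_ x (left_mem_Icc.2 hxx') x' (right_mem_Icc.2 hxx') hxx'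
    · intro s hs
      exact (hd s (abs_le.2 ⟨hx.trans hs.1, hs.2.trans hx'⟩)).continuousAt.continuousWithinAt
    · intro s hs
      rw [interior_Icc] at hs
      exact (hd s (abs_le.2 ⟨hx.trans hs.1.le, hs.2.le.trans hx'⟩)).differentiableAt.differentiableWithinAt
    · intro s hs
      rw [interior_Icc] at hs
      have hs' := abs_le.2 ⟨hx.trans hs.1.le, hs.2.le.trans hx'⟩
      rw [(hd s hs').deriv]
      exact hder y hy q hq s hs'
  set q0 := min (m / 2) (e / 2 * m / 2) with hq0
  have hq00 : 0 < q0 := by positivity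
  refine ⟨m, max (2 / e) (max (C2 * max 1 (2 / e)) (C3 + 1)), q0, hm0, by linarith,
    by positivity, hq00, by linarith [min_le_left (m / 2) (e / 2 * m / 2)], fun y hy q hq => ?_⟩
  set C := max (2 / e) (max (C2 * max 1 (2 / e)) (C3 + 1)) with hC
  have c1 : 2 / e ≤ C := le_max_left _ _
  have c2 : C2 * max 1 (2 / e) ≤ C := (le_max_left _ _).trans (le_max_right _ _)
  have c3 : C3 + 1 ≤ C := (le_max_right _ _).trans (le_max_right _ _)
  have hqm : q ∈ Icc 0 m := ⟨hq.1, by linarith [hq.2, min_le_left (m / 2) (e / 2 * m / 2)]⟩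
  have hq1 : q ∈ Icc (0 : ℝ) 1 := ⟨hq.1, by linarith [hqm.2]⟩
  have hleft : -q ≤ tileEq a b ((y, q), 0) ∧ tileEq a b ((y, q), 0) ≤ 0 := by
    rw [tileEq_left ha hb]
    have s0 := Real.sin_nonneg_of_nonneg_of_le_pi (scale_nonneg hb hy.1) (scale_mem hb hy).2
    have s1 := Real.sin_le_one (π * y / b)
    constructor <;> nlinarith [hq.1]
  have hsol : ∀ x, |x| ≤ m → tileEq a b ((y, q), x) = 0 → |x| ≤ 2 / e * q := by
    intro x hx h0
    rw [div_mul_eq_mul_div, le_div_iff₀ he0]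
    rw [abs_le] at hx
    rcases le_total 0 x with h | h
    · have := hgrow y hy q hqm 0 x (by linarith) h hx.2
      rw [abs_of_nonneg h]; linarith
    · have := hgrow y hy q hqm x 0 hx.1 h (by linarith)
      rw [abs_of_nonpos h]; nlinarith [hq.1]
  refine ⟨?_, ?_, fun x hx => ⟨?_, fun h0 => ?_, ?_⟩⟩
  · have hct : ContinuousOn (fun s => tileEq a b ((y, q), s)) (Icc 0 m) := by
      intro s hs
      refine (ContinuousAt.comp (f := fun s : ℝ => ((y, q), s))
        (hdiff ((y, q), s) ?_).continuousAt (by fun_prop)).continuousWithinAt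
      simp only
      rw [abs_of_nonneg hs.1]; linarith [hs.2]
    have hm2 : 0 < tileEq a b ((y, q), m) := by
      have := hgrow y hy q hqm 0 m (by linarith) hm0.le le_rfl
      have h2 : q ≤ e / 2 * m / 2 := hq.2.trans (min_le_right _ _)
      nlinarith
    obtain ⟨x, hx, h0⟩ := intermediate_value_Icc hm0.le hct ⟨hleft.2, hm2.le⟩
    simp only at h0
    have hxm : x ≠ m := by rintro rfl; exact hm2.ne' h0
    refine ⟨x, ⟨hx.1, lt_of_le_of_ne hx.2 hxm⟩, ?_, h0⟩
    have := hsol x (abs_le.2 ⟨by linarith [hx.1], hx.2⟩) h0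
    rw [abs_of_nonneg hx.1] at this
    exact this.trans (by gcongr; exact hq.1)
  · have key : ∀ x x', |x| < m → |x'| < m → tileEq a b ((y, q), x) = 0 →
        tileEq a b ((y, q), x') = 0 → x ≤ x' → x = x' := by
      intro x x' hx hx' h0 h0' hxx'
      have := hgrow y hy q hqm x x' (abs_lt.1 hx).1.le hxx' (abs_lt.1 hx').2.le
      nlinarith
    intro x x' hx hx' h0 h0'
    rcases le_total x x' with h | h
    · exact key x x' hx hx' h0 h0' h
    · exact (key x' x hx' hx h0' h0 h).symm
  · have k1 := hder y hy q hqm x hx.le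
    have k2 : 0 ≤ C := by linarith
    calc (1 : ℝ) = 2 / e * (e / 2) := by field_simp
      _ ≤ C * _ := mul_le_mul c1 k1 (by positivity) k2
  · have k1 := h2 y hy q hq1 x ⟨by linarith [(abs_lt.1 hx).1], by linarith [(abs_lt.1 hx).2]⟩
    rw [hz2, sub_zero] at k1
    have k2 : max q |x| ≤ max 1 (2 / e) * q := by
      refine max_le ?_ ((hsol x hx.le h0).trans ?_)
      · nlinarith [le_max_left 1 (2 / e), hq.1]
      · gcongr
        · exact hq.1
        · exact le_max_right _ _
    calc _ ≤ C2 * max q |x| := k1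
      _ ≤ C2 * (max 1 (2 / e) * q) := by gcongr
      _ = C2 * max 1 (2 / e) * q := by ring
      _ ≤ C * q := by gcongr; exact hq.1
  · have k1 := h3 y hy q hq1 x ⟨by linarith [(abs_lt.1 hx).1], by linarith [(abs_lt.1 hx).2]⟩
    have k2 : max q |x| ≤ 1 := max_le hq1.2 (by linarith)
    have k3 := hz3 y
    have k4 : |fderiv ℝ (tileEq a b) ((y, q), x) ((0, 1), 0)| ≤
        |fderiv ℝ (tileEq a b) ((y, q), x) ((0, 1), 0) -
          fderiv ℝ (tileEq a b) ((y, 0), 0) ((0, 1), 0)| +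
        |fderiv ℝ (tileEq a b) ((y, 0), 0) ((0, 1), 0)| := by
      have := abs_add_le (fderiv ℝ (tileEq a b) ((y, q), x) ((0, 1), 0) -
          fderiv ℝ (tileEq a b) ((y, 0), 0) ((0, 1), 0))
          (fderiv ℝ (tileEq a b) ((y, 0), 0) ((0, 1), 0))
      rwa [sub_add_cancel] at this
    nlinarith

end

/-! ### Charts of the three-sphere -/

lemma contMDiffAt_sphere_of_coe {f : E³ → S3} {x : E³}
    (hf : ContDiffAt ℝ 1 (fun y => (f y : E⁴)) x) :
    ContMDiffAt (𝓡 3) (𝓡 3) 1 f x := by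
  rw [contMDiffAt_iff_target]
  refine ⟨Topology.IsInducing.subtypeVal.continuousAt_iff.2 hf.continuousAt, ?_⟩
  have : Fact (Module.finrank ℝ E⁴ = 3 + 1) := ⟨by simp⟩
  let U : _ ≃ₗᵢ[ℝ] _ :=
    (OrthonormalBasis.fromOrthogonalSpanSingleton (𝕜 := ℝ)
        3 (ne_zero_of_mem_unit_sphere (-(f x)))).repr
  have h : ContDiffOn ℝ ω U Set.univ := U.contDiff.contDiffOn
  have H₁ := (h.comp_inter (contDiffOn_stereoToFun (v := ((-(f x) : S3) : E⁴))))
  have hopen : IsOpen {y : E⁴ | inner ℝ ((-(f x) : S3) : E⁴) y ≠ (1 : ℝ)} := by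
    exact isOpen_ne_fun (by fun_prop) continuous_const
  have hmem : (f x : E⁴) ∈ {y : E⁴ | inner ℝ ((-(f x) : S3) : E⁴) y ≠ (1 : ℝ)} := by
    have hn : ‖(f x : E⁴)‖ = 1 := norm_eq_of_mem_sphere (f x)
    rw [mem_ofPred_eq]
    simp only [Metric.sphere, coe_neg_sphere, inner_neg_left]
    rw [real_inner_self_eq_norm_sq, hn]
    norm_num
  have H₂ := (H₁.contDiffAt (inter_mem (hopen.mem_nhds hmem) (by simp))).of_le
    (show (1 : WithTop ℕ∞) ≤ ω by simp)
  have H₃ := ContDiffAt.comp (f := fun y => (f y : E⁴)) x H₂ hf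
  exact H₃.contMDiffAt

/-- The cone over a set of directions in the plane. -/
def Sector (A : Set Angle) : Set (ℝ²) := {u | ∃ s : ℝ, 0 ≤ s ∧ ∃ α ∈ A, u = (s * α.cos, s * α.sin)}

/-- `G` is a coordinate system near `p` on the three-sphere, with inverse `Gi` and centre `p`. -/
structure LocalCoords (p : S3) (G : E⁴ → ℝ³)
    (Gi : ℝ³ → S3) : Prop where
  contDiff : ContDiffAt ℝ 1 G p
  contDiff_inv : ContDiffAt ℝ 1 (fun u => (Gi u : E⁴)) 0
  inv_zero : Gi 0 = p
  right_inv : ∀ᶠ u in 𝓝 0, G (Gi u) = u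
  left_inv : ∀ᶠ z : S3 in 𝓝 p, Gi (G z) = z

/-- The identification of `ℝ³` with a triple product of lines. -/
def toE3 (u : ℝ³) : E³ := !₂[u.1.1, u.1.2, u.2]

/-- The inverse of `toE3`. -/
def ofE3 (w : E³) : ℝ³ := ((w 0, w 1), w 2)

lemma ofE3_toE3 (u : ℝ³) : ofE3 (toE3 u) = u := by simp [ofE3, toE3]

lemma toE3_ofE3 (w : E³) : toE3 (ofE3 w) = w := by ext i; fin_cases i <;> simp [ofE3, toE3]

lemma norm_cone {s : ℝ} (hs : 0 ≤ s) (α : Angle) : ‖(!₂[s * α.cos, s * α.sin, 0] : E³)‖ = s := by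
  rw [EuclideanSpace.norm_eq]
  have : ∑ i, ‖(!₂[s * α.cos, s * α.sin, 0] : E³) i‖ ^ 2 = s ^ 2 := by
    simp only [Fin.sum_univ_three, Real.norm_eq_abs, sq_abs]
    simp
    linear_combination s ^ 2 * α.cos_sq_add_sin_sq
  rw [this, Real.sqrt_sq hs]

lemma contDiff_toE3 : ContDiff ℝ 1 toE3 := by
  refine contDiff_euclidean.2 fun i => ?_
  fin_cases i <;> simp [toE3] <;> fun_prop

lemma contDiff_ofE3 : ContDiff ℝ 1 ofE3 := by unfold ofE3; fun_prop

lemma LocalCoords.shear {p : S3} {G : E⁴ → ℝ³}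
    {Gi : ℝ³ → S3} (h : LocalCoords p G Gi) {k : ℝ² → ℝ} (hk : ContDiffAt ℝ 1 k 0)
    (hk0 : k 0 = 0) : LocalCoords p (fun z => ((G z).1, (G z).2 - k (G z).1))
      (fun u => Gi (u.1, u.2 + k u.1)) := by
  have hG0 : G p = 0 := by have := h.right_inv.self_of_nhds; rwa [h.inv_zero] at this
  have hkG : ContDiffAt ℝ 1 (fun z => k (G z).1) (p : E⁴) :=
    ContDiffAt.comp (g := k) _ (by rw [hG0]; exact hk) (contDiffAt_fst.comp _ h.contDiff)
  have hs : ContDiffAt ℝ 1 (fun u : ℝ³ => (u.1, u.2 + k u.1)) 0 :=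
    contDiffAt_fst.prodMk (contDiffAt_snd.add (ContDiffAt.comp (g := k) _ hk contDiffAt_fst))
  have hs0 : ((0 : ℝ³).1, (0 : ℝ³).2 + k (0 : ℝ³).1) = 0 := by simp [hk0]
  have ht : Tendsto (fun u : ℝ³ => (u.1, u.2 + k u.1)) (𝓝 0) (𝓝 0) := by
    have := hs.continuousAt.tendsto; rwa [hs0] at this
  refine ⟨?_, ?_, ?_, ?_, ?_⟩
  · exact (contDiffAt_fst.comp _ h.contDiff).prodMk ((contDiffAt_snd.comp _ h.contDiff).sub hkG)
  · exact ContDiffAt.comp (g := fun u => (Gi u : E⁴))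
      (0 : ℝ³) (by rw [hs0]; exact h.contDiff_inv) hs
  · rw [hs0, h.inv_zero]
  · filter_upwards [ht.eventually h.right_inv] with u hu
    rw [hu]; simp
  · filter_upwards [h.left_inv] with z hz
    simpa using hz

/-- A subset of the three-sphere that is, in a coordinate system, a part of the graph of a `C¹`
function lying over a sector has a cone chart; its vertical coordinate is the height over the
graph up to a positive factor. -/
lemma LocalCoords.exists_isConeChart {p : S3} {G : E⁴ → ℝ³}
    {Gi : ℝ³ → S3} (h : LocalCoords p G Gi) {k : ℝ² → ℝ} (hk : ContDiffAt ℝ 1 k 0)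
    (hk0 : k 0 = 0) {E : Set S3} {A : Set Angle}
    (hE : ∀ᶠ u in 𝓝 (0 : ℝ³), Gi u ∈ E ↔ u.2 = k u.1 ∧ u.1 ∈ Sector A) :
    ∃ f, IsConeChart E p A f ∧ ∃ c > 0, ∀ z : S3, f z 2 = c * ((G z).2 - k (G z).1) := by
  -- subtracting `k` from the last coordinate flattens the graph
  have hL := h.shear hk hk0
  obtain ⟨G', hG'⟩ : ∃ G' : E⁴ → ℝ³, G' = fun z => ((G z).1, (G z).2 - k (G z).1) := ⟨_, rfl⟩
  obtain ⟨Gi', hGi'⟩ : ∃ Gi' : ℝ³ → S3, Gi' = fun u => Gi (u.1, u.2 + k u.1) := ⟨_, rfl⟩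
  rw [← hG', ← hGi'] at hL
  have hfz : ∀ z, (G' z).2 = (G z).2 - k (G z).1 := fun z => by rw [hG']
  have hE' : ∀ᶠ u in 𝓝 (0 : ℝ³), Gi' u ∈ E ↔ u.2 = 0 ∧ u.1 ∈ Sector A := by
    have ht : Tendsto (fun u : ℝ³ => (u.1, u.2 + k u.1)) (𝓝 0) (𝓝 0) := by
      have hs : ContinuousAt (fun u : ℝ³ => (u.1, u.2 + k u.1)) 0 :=
        continuousAt_fst.prodMk (continuousAt_snd.add
          (ContinuousAt.comp (g := k) hk.continuousAt continuousAt_fst))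
      have := hs.tendsto
      have hs0 : ((0 : ℝ³).1, (0 : ℝ³).2 + k (0 : ℝ³).1) = 0 := by simp [hk0]
      rwa [hs0] at this
    filter_upwards [ht.eventually hE] with u hu
    rw [hGi']
    simp only [hu, add_eq_right]
  clear hE hG' hGi'
  have hcontG : ContinuousAt (fun z : S3 => G' z) p :=
    ContinuousAt.comp (g := G') (f := fun z : S3 => (z : E⁴))
      hL.contDiff.continuousAt continuous_subtype_val.continuousAt
  have hG0 : G' p = 0 := by
    have := hL.right_inv.self_of_nhds; rwa [hL.inv_zero] at this
  -- an open neighbourhood of `p` on which everything is defined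
  have hV : ∀ᶠ z : S3 in 𝓝 p, Gi' (G' z) = z ∧ ContDiffAt ℝ 1 G' (z : E⁴) :=
    hL.left_inv.and (continuous_subtype_val.continuousAt.eventually (hL.contDiff.eventually (by simp)))
  obtain ⟨V, hVs, hVo, hpV⟩ := eventually_nhds_iff.1 hV
  have hcontGi : ContinuousAt Gi' 0 := Topology.IsInducing.subtypeVal.continuousAt_iff.2 hL.contDiff_inv.continuousAt
  have hU : ∀ᶠ u in 𝓝 (0 : ℝ³), G' (Gi' u) = u ∧
      ContDiffAt ℝ 1 (fun u => (Gi' u : E⁴)) u ∧ Gi' u ∈ V ∧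
      (Gi' u ∈ E ↔ u.2 = 0 ∧ u.1 ∈ Sector A) := by
    refine hL.right_inv.and ((hL.contDiff_inv.eventually (by simp)).and
      ((hcontGi.eventually (hVo.mem_nhds ?_)).and hE'))
    rw [hL.inv_zero]; exact hpV
  have hU' : ∀ᶠ w in 𝓝 (0 : E³), G' (Gi' (ofE3 w)) = ofE3 w ∧
      ContDiffAt ℝ 1 (fun u => (Gi' u : E⁴)) (ofE3 w) ∧
      Gi' (ofE3 w) ∈ V ∧ (Gi' (ofE3 w) ∈ E ↔ (ofE3 w).2 = 0 ∧ (ofE3 w).1 ∈ Sector A) := by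
    refine (contDiff_ofE3.continuous.tendsto' 0 0 ?_).eventually hU
    simp [ofE3]
  obtain ⟨ρ, hρ, hball⟩ := Metric.eventually_nhds_iff_ball.1 hU'
  have hscale : ∀ w ∈ Metric.ball (0 : E³) 1, ρ • w ∈ Metric.ball (0 : E³) ρ := by
    intro w hw
    rw [mem_ball_zero_iff] at hw ⊢
    rw [norm_smul, Real.norm_of_nonneg hρ.le]
    nlinarith
  have hcontV : ContinuousOn (fun z : S3 => toE3 (G' z)) V := fun z hz =>
    (contDiff_toE3.continuous.continuousAt.comp
      (ContinuousAt.comp (g := G') (f := fun z : S3 => (z : E⁴))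
      (hVs z hz).2.continuousAt continuous_subtype_val.continuousAt)).continuousWithinAt
  -- the coordinates rescaled to the unit ball
  let f : OpenPartialHomeomorph S3 (E³) :=
    { toFun := fun z => ρ⁻¹ • toE3 (G' z)
      invFun := fun w => Gi' (ofE3 (ρ • w))
      source := V ∩ (fun z : S3 => toE3 (G' z)) ⁻¹' Metric.ball 0 ρ
      target := Metric.ball 0 1
      map_source' := by
        rintro z ⟨-, hz⟩
        rw [mem_preimage, mem_ball_zero_iff] at hz
        rw [mem_ball_zero_iff, norm_smul, Real.norm_of_nonneg (inv_nonneg.2 hρ.le),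
          inv_mul_lt_iff₀ hρ, mul_one]
        exact hz
      map_target' := by
        intro w hw
        obtain ⟨h1, -, h2, -⟩ := hball _ (hscale w hw)
        refine ⟨h2, ?_⟩
        rw [mem_preimage, h1, toE3_ofE3]
        exact hscale w hw
      left_inv' := by
        rintro z ⟨hz, -⟩
        simp only [smul_smul, mul_inv_cancel₀ hρ.ne', one_smul, ofE3_toE3]
        exact (hVs z hz).1
      right_inv' := by
        intro w hw
        obtain ⟨h1, -⟩ := hball _ (hscale w hw)
        simp only [h1, toE3_ofE3, smul_smul, inv_mul_cancel₀ hρ.ne', one_smul]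
      open_source := hcontV.isOpen_inter_preimage hVo Metric.isOpen_ball
      open_target := Metric.isOpen_ball
      continuousOn_toFun := (hcontV.mono inter_subset_left).const_smul ρ⁻¹
      continuousOn_invFun := by
        intro w hw
        obtain ⟨-, h2, -⟩ := hball _ (hscale w hw)
        have : ContinuousAt Gi' (ofE3 (ρ • w)) :=
          Topology.IsInducing.subtypeVal.continuousAt_iff.2 h2.continuousAt
        refine (ContinuousAt.comp (f := fun w => ofE3 (ρ • w)) this ?_).continuousWithinAt
        exact (contDiff_ofE3.continuous.comp (continuous_const_smul ρ)).continuousAt }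
  have hat : f ∈ IsManifold.maximalAtlas (𝓡 3) 1 S3 := by
    have : Fact (Module.finrank ℝ E⁴ = 3 + 1) := ⟨by simp⟩
    refine OpenPartialHomeomorph.mem_maximalAtlas_of_contMDiffOn f ?_ ?_
    · rintro z ⟨hz, -⟩
      have h1 : ContDiffAt ℝ 1 (fun z => ρ⁻¹ • toE3 (G' z)) (z : E⁴) :=
        (contDiff_toE3.contDiffAt.comp _ (hVs z hz).2).const_smul _
      exact (h1.contMDiffAt.comp z (contMDiff_coe_sphere (n := 3) z)).contMDiffWithinAt
    · intro w hw
      obtain ⟨-, h2, -⟩ := hball _ (hscale w hw)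
      refine (contMDiffAt_sphere_of_coe ?_).contMDiffWithinAt
      exact ContDiffAt.comp (f := fun w => ofE3 (ρ • w)) w h2
        (contDiff_ofE3.contDiffAt.comp _ (contDiffAt_id.const_smul ρ))
  have hfp : f p = 0 := by
    change ρ⁻¹ • toE3 (G' p) = 0
    rw [hG0]
    ext i; fin_cases i <;> simp [toE3]
  have hps : p ∈ f.source := by
    refine ⟨hpV, ?_⟩
    rw [mem_preimage, hG0, mem_ball_zero_iff]
    have : toE3 0 = 0 := by ext i; fin_cases i <;> simp [toE3]
    rw [this, norm_zero]; exact hρ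
  refine ⟨f, ⟨hat, hps, hfp, rfl, ?_⟩, ρ⁻¹, inv_pos.2 hρ, fun z => ?_⟩
  · have himg : f '' (f.source ∩ E) = f.target ∩ f.symm ⁻¹' E := f.image_source_inter_eq' E
    rw [himg]
    ext w
    constructor
    · rintro ⟨hw, hwE⟩
      obtain ⟨-, -, -, h4⟩ := hball _ (hscale w hw)
      obtain ⟨e1, s, hs, α, hα, e2⟩ := h4.1 hwE
      have e3 : w 2 = 0 := by
        simp only [ofE3, PiLp.smul_apply, smul_eq_mul, mul_eq_zero] at e1
        exact e1.resolve_left hρ.ne'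
      simp only [ofE3, PiLp.smul_apply, smul_eq_mul, Prod.mk.injEq] at e2
      have hw' : w = !₂[ρ⁻¹ * s * α.cos, ρ⁻¹ * s * α.sin, 0] := by
        ext i
        fin_cases i
        · simp; rw [mul_assoc, ← e2.1]; field_simp
        · simp; rw [mul_assoc, ← e2.2]; field_simp
        · simpa using e3
      refine ⟨ρ⁻¹ * s, ⟨by positivity, ?_⟩, α, hα, hw'⟩
      have hn : ‖w‖ = ρ⁻¹ * s := by rw [hw']; exact norm_cone (by positivity) α
      rw [← hn]
      exact mem_ball_zero_iff.1 hw
    · rintro ⟨s, hs, α, hα, rfl⟩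
      have hn : ‖(!₂[s * α.cos, s * α.sin, 0] : E³)‖ = s := norm_cone hs.1 α
      have hw : (!₂[s * α.cos, s * α.sin, 0] : E³) ∈ Metric.ball 0 1 := by
        rw [mem_ball_zero_iff, hn]; exact hs.2
      refine ⟨hw, ?_⟩
      obtain ⟨-, -, -, h4⟩ := hball _ (hscale _ hw)
      refine h4.2 ⟨by simp [ofE3], ρ * s, mul_nonneg hρ.le hs.1, α, hα, ?_⟩
      simp [ofE3, mul_assoc]
  · change (ρ⁻¹ • toE3 (G' z)) 2 = _
    rw [← hfz]
    simp [toE3]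

/-! ### Points of the three-sphere -/

/-- The point of the join with angles `θ`, `φ` for which the first complex coordinate has the squared
modulus `q`. -/
def pt (θ φ : Angle) (q : ℝ) : S3 := joinPt θ φ (2 / π * Real.arccos (sqrt q))

lemma pt_coe (θ φ : Angle) {q : ℝ} (hq : q ∈ Icc (0 : ℝ) 1) :
    (pt θ φ q : E⁴) = !₂[sqrt q * φ.cos, sqrt q * φ.sin,
      sqrt (1 - q) * θ.cos, sqrt (1 - q) * θ.sin] := by
  have hπ := Real.pi_pos
  have e : π * (2 / π * Real.arccos (sqrt q)) / 2 = Real.arccos (sqrt q) := by field_simp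
  have h1 : sqrt q ≤ 1 := Real.sqrt_le_one.2 hq.2
  have h0 : -1 ≤ sqrt q := by linarith [Real.sqrt_nonneg q]
  simp only [pt, joinPt, e, Real.cos_arccos h0 h1, Real.sin_arccos, Real.sq_sqrt hq.1]

lemma cos_sq_mem (x : ℝ) : cos x ^ 2 ∈ Icc (0 : ℝ) 1 := ⟨sq_nonneg _, Real.cos_sq_le_one x⟩

lemma joinPt_eq_pt (θ φ : Angle) {τ : ℝ} (hτ : τ ∈ Icc (0 : ℝ) 1) :
    joinPt θ φ τ = pt θ φ (cos (π * τ / 2) ^ 2) := by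
  have hπ := Real.pi_pos
  apply Subtype.ext
  rw [pt_coe θ φ (cos_sq_mem _)]
  have h1 : 0 ≤ π * τ / 2 := by have := hτ.1; positivity
  have h2 : π * τ / 2 ≤ π / 2 := by nlinarith [hτ.2]
  have hc := Real.cos_nonneg_of_neg_pi_div_two_le_of_le (by linarith) h2
  have hs := Real.sin_nonneg_of_nonneg_of_le_pi h1 (by linarith)
  have e : 1 - cos (π * τ / 2) ^ 2 = sin (π * τ / 2) ^ 2 := by
    rw [← Real.sin_sq_add_cos_sq (π * τ / 2)]; ring
  rw [e, Real.sqrt_sq hc, Real.sqrt_sq hs]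
  rfl

lemma exists_joinPt_eq_pt (θ φ : Angle) (q : ℝ) : ∃ τ ∈ Icc (0 : ℝ) 1, pt θ φ q = joinPt θ φ τ := by
  have hπ := Real.pi_pos
  refine ⟨2 / π * Real.arccos (sqrt q), ⟨?_, ?_⟩, rfl⟩
  · have := Real.arccos_nonneg (sqrt q); positivity
  · have := Real.arccos_le_pi_div_two.2 (Real.sqrt_nonneg q)
    calc _ ≤ 2 / π * (π / 2) := by gcongr
      _ = 1 := by field_simp

lemma angle_eq_of_cos_sin {r : ℝ} (hr : r ≠ 0) {α β : Angle} (h1 : r * α.cos = r * β.cos)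
    (h2 : r * α.sin = r * β.sin) : α = β := by
  induction α using Angle.induction_on
  induction β using Angle.induction_on
  exact Angle.cos_sin_inj (mul_left_cancel₀ hr h1) (mul_left_cancel₀ hr h2)

lemma pt_eq_iff {θ φ θ' φ' : Angle} {q q' : ℝ} (hq : q ∈ Icc (0 : ℝ) 1) (hq' : q' ∈ Icc (0 : ℝ) 1) :
    pt θ φ q = pt θ' φ' q' ↔ q = q' ∧ (q = 1 ∨ θ = θ') ∧ (q = 0 ∨ φ = φ') := by
  rw [Subtype.ext_iff, pt_coe θ φ hq, pt_coe θ' φ' hq']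
  constructor
  · intro h
    have h0 := congrArg (fun z : E⁴ => z 0) h
    have h1 := congrArg (fun z : E⁴ => z 1) h
    have h2 := congrArg (fun z : E⁴ => z 2) h
    have h3 := congrArg (fun z : E⁴ => z 3) h
    simp at h0 h1 h2 h3
    have hqq : q = q' := by
      have a1 := φ.cos_sq_add_sin_sq
      have a2 := φ'.cos_sq_add_sin_sq
      have b1 := Real.sq_sqrt hq.1
      have b2 := Real.sq_sqrt hq'.1
      have c1 : (sqrt q * φ.cos) ^ 2 + (sqrt q * φ.sin) ^ 2 = q := by
        rw [mul_pow, mul_pow, ← mul_add, a1, b1, mul_one]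
      have c2 : (sqrt q' * φ'.cos) ^ 2 + (sqrt q' * φ'.sin) ^ 2 = q' := by
        rw [mul_pow, mul_pow, ← mul_add, a2, b2, mul_one]
      rw [← c1, ← c2, h0, h1]
    subst hqq
    refine ⟨rfl, ?_, ?_⟩
    · by_cases h : q = 1
      · exact Or.inl h
      · have : 0 < 1 - q := by have := lt_of_le_of_ne hq.2 h; linarith
        exact Or.inr (angle_eq_of_cos_sin (Real.sqrt_pos.2 this).ne' h2 h3)
    · by_cases h : q = 0
      · exact Or.inl h
      · have : 0 < q := lt_of_le_of_ne hq.1 (Ne.symm h)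
        exact Or.inr (angle_eq_of_cos_sin (Real.sqrt_pos.2 this).ne' h0 h1)
  · rintro ⟨rfl, h1, h2⟩
    rcases h1 with h1 | rfl <;> rcases h2 with h2 | rfl
    · rw [h1] at h2; norm_num at h2
    · simp [h1]
    · simp [h2]
    · rfl

lemma continuous_pt : Continuous fun p : (Angle × Angle) × ℝ => pt p.1.1 p.1.2 p.2 := by
  have h : Continuous fun p : (Angle × Angle) × ℝ => π * (2 / π * Real.arccos (sqrt p.2)) / 2 :=
    ((Real.continuous_arccos.comp (Real.continuous_sqrt.comp continuous_snd)).const_mul _).const_mul _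
      |>.div_const _
  refine Continuous.subtype_mk ?_ _
  refine (PiLp.continuous_toLp 2 _).comp (continuous_pi fun i => ?_)
  have c1 := Angle.continuous_cos.comp (continuous_fst.comp
    (continuous_fst (X := Angle × Angle) (Y := ℝ)))
  have c2 := Angle.continuous_sin.comp (continuous_fst.comp
    (continuous_fst (X := Angle × Angle) (Y := ℝ)))
  have c3 := Angle.continuous_cos.comp (continuous_snd.comp
    (continuous_fst (X := Angle × Angle) (Y := ℝ)))
  have c4 := Angle.continuous_sin.comp (continuous_snd.comp
    (continuous_fst (X := Angle × Angle) (Y := ℝ)))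
  have d1 := Real.continuous_cos.comp h
  have d2 := Real.continuous_sin.comp h
  fin_cases i
  · exact d1.mul c3
  · exact d1.mul c4
  · exact d2.mul c1
  · exact d2.mul c2

/-! ### Coordinate systems on the three-sphere -/

lemma polar_arctan {c s : ℝ} (hc : 0 < c) :
    sqrt (c ^ 2 + s ^ 2) * cos (arctan (s / c)) = c ∧
      sqrt (c ^ 2 + s ^ 2) * sin (arctan (s / c)) = s := by
  have e : sqrt (c ^ 2 + s ^ 2) = c * sqrt (1 + (s / c) ^ 2) := by
    rw [← Real.sqrt_sq hc.le, ← Real.sqrt_mul (sq_nonneg _), Real.sqrt_sq hc.le]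
    congr 1; field_simp
  have h : 0 < sqrt (1 + (s / c) ^ 2) := Real.sqrt_pos.2 (by positivity)
  rw [e, Real.cos_arctan, Real.sin_arctan]
  constructor <;> field_simp

lemma arctan_polar {r t : ℝ} (hr : 0 < r) (ht : |t| < π / 2) :
    arctan (r * sin t / (r * cos t)) = t := by
  rw [mul_div_mul_left _ _ hr.ne', ← Real.tan_eq_sin_div_cos,
    Real.arctan_tan (abs_lt.1 ht).1 (abs_lt.1 ht).2]

/-- The angle of the vector `(u, v)` relative to `α`, valid on the half-plane around `α`. -/
def angleCoord (α : Angle) (u v : ℝ) : ℝ :=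
  arctan ((-u * α.sin + v * α.cos) / (u * α.cos + v * α.sin))

lemma angleCoord_polar (α : Angle) {r t : ℝ} (hr : 0 < r) (ht : |t| < π / 2) :
    angleCoord α (r * (α + (t : Angle)).cos) (r * (α + (t : Angle)).sin) = t := by
  have h := α.cos_sq_add_sin_sq
  rw [angleCoord, Angle.cos_add, Angle.sin_add, Angle.cos_coe, Angle.sin_coe]
  rw [← arctan_polar hr ht]
  congr 2
  · rw [arctan_polar hr ht]; linear_combination (r * sin t) * h
  · rw [arctan_polar hr ht]; linear_combination (r * cos t) * h

lemma polar_angleCoord (α : Angle) {u v : ℝ} (h : 0 < u * α.cos + v * α.sin) :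
    sqrt (u ^ 2 + v ^ 2) * (α + (angleCoord α u v : Angle)).cos = u ∧
      sqrt (u ^ 2 + v ^ 2) * (α + (angleCoord α u v : Angle)).sin = v := by
  have h1 := α.cos_sq_add_sin_sq
  obtain ⟨p1, p2⟩ := polar_arctan (s := -u * α.sin + v * α.cos) h
  have e : (u * α.cos + v * α.sin) ^ 2 + (-u * α.sin + v * α.cos) ^ 2 = u ^ 2 + v ^ 2 := by
    linear_combination (u ^ 2 + v ^ 2) * h1
  rw [e] at p1 p2
  rw [angleCoord, Angle.cos_add, Angle.sin_add, Angle.cos_coe, Angle.sin_coe]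
  constructor
  · linear_combination α.cos * p1 - α.sin * p2 + u * h1
  · linear_combination α.sin * p1 + α.cos * p2 + v * h1

lemma contDiffAt_angleCoord {α : Angle} {E : Type*} [NormedAddCommGroup E] [NormedSpace ℝ E]
    {u v : E → ℝ} {z : E} (hu : ContDiffAt ℝ 1 u z) (hv : ContDiffAt ℝ 1 v z)
    (h : 0 < u z * α.cos + v z * α.sin) : ContDiffAt ℝ 1 (fun z => angleCoord α (u z) (v z)) z :=
  Real.contDiff_arctan.contDiffAt.comp z
    (((hu.neg.mul contDiffAt_const).add (hv.mul contDiffAt_const)).div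
      ((hu.mul contDiffAt_const).add (hv.mul contDiffAt_const)) h.ne')

lemma contDiff_angle_cos (α : Angle) (σ : ℝ) : ContDiff ℝ 1 fun t : ℝ => (α + (σ * t : ℝ)).cos := by
  simp only [Angle.cos_add, Angle.cos_coe, Angle.sin_coe]
  fun_prop

lemma contDiff_angle_sin (α : Angle) (σ : ℝ) : ContDiff ℝ 1 fun t : ℝ => (α + (σ * t : ℝ)).sin := by
  simp only [Angle.sin_add, Angle.cos_coe, Angle.sin_coe]
  fun_prop

lemma contDiffAt_coord (i : Fin (3 + 1)) (z : E⁴) :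
    ContDiffAt ℝ 1 (fun z : E⁴ => z i) z := by fun_prop

lemma sum_sq_eq_one (z : S3) : z.1 0 ^ 2 + z.1 1 ^ 2 + z.1 2 ^ 2 + z.1 3 ^ 2 = 1 := by
  have h : ‖(z : E⁴)‖ = 1 := norm_eq_of_mem_sphere z
  rw [EuclideanSpace.norm_eq, Real.sqrt_eq_one, Fin.sum_univ_four] at h
  simpa only [Real.norm_eq_abs, sq_abs] using h

lemma sign_eq {σ : ℝ} (hσ : σ = 1 ∨ σ = -1) : σ * σ = 1 ∧ |σ| = 1 := by
  rcases hσ with rfl | rfl <;> simp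

lemma eventually_abs_lt {E : Type*} [TopologicalSpace E] {f : E → ℝ} {z : E} {c : ℝ}
    (hf : ContinuousAt f z) (h : |f z| < c) : ∀ᶠ w in 𝓝 z, |f w| < c :=
  hf.abs.eventually_lt continuousAt_const h

lemma polar_dot (ρ : ℝ) (θ : Angle) : ρ * θ.cos * θ.cos + ρ * θ.sin * θ.sin = ρ := by
  linear_combination ρ * θ.cos_sq_add_sin_sq

lemma eventually_coord_pos {p : S3} {i j : Fin (3 + 1)} {θ : Angle}
    (h : 0 < p.1 i * θ.cos + p.1 j * θ.sin) : ∀ᶠ z : S3 in 𝓝 p, 0 < z.1 i * θ.cos + z.1 j * θ.sin :=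
  continuousAt_const.eventually_lt
    (Continuous.continuousAt (f := fun z : S3 => z.1 i * θ.cos + z.1 j * θ.sin) (by fun_prop)) h

lemma eventually_abs_lt_zero {c : ℝ} (hc : 0 < c) : ∀ᶠ t in 𝓝 (0 : ℝ), |t| < c :=
  eventually_abs_lt continuousAt_id (by simpa using hc)

lemma eventually_add_mem_Ioo {q : ℝ} (hq : q ∈ Ioo (0 : ℝ) 1) :
    ∀ᶠ u in 𝓝 (0 : ℝ³), q + u.2 ∈ Ioo (0 : ℝ) 1 :=
  ContinuousAt.eventually_mem (f := fun u : ℝ³ => q + u.2) (by fun_prop)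
    (isOpen_Ioo.mem_nhds (by simpa using hq))

lemma eventually_sq_add_sq_lt {c : ℝ} (hc : 0 < c) :
    ∀ᶠ u in 𝓝 (0 : ℝ³), u.1.1 ^ 2 + u.1.2 ^ 2 < c :=
  ContinuousAt.eventually_lt (f := fun u : ℝ³ => u.1.1 ^ 2 + u.1.2 ^ 2) (by fun_prop)
    continuousAt_const (by simpa using hc)

/-- Coordinates away from the two circles of the join. -/
lemma localCoords_torus (θ φ : Angle) {q σ ε : ℝ} (hq : q ∈ Ioo (0 : ℝ) 1)
    (hσ : σ = 1 ∨ σ = -1) (hε : ε = 1 ∨ ε = -1) :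
    LocalCoords (pt θ φ q)
      (fun z => ((σ * angleCoord θ (z 2) (z 3), ε * angleCoord φ (z 0) (z 1)),
        z 0 ^ 2 + z 1 ^ 2 - q))
      (fun u => pt (θ + (σ * u.1.1 : ℝ)) (φ + (ε * u.1.2 : ℝ)) (q + u.2)) := by
  have hπ := Real.pi_pos
  obtain ⟨hσ1, hσ2⟩ := sign_eq hσ
  obtain ⟨hε1, hε2⟩ := sign_eq hε
  have hq' : q ∈ Icc (0 : ℝ) 1 := ⟨hq.1.le, hq.2.le⟩
  have hs1 : 0 < sqrt q := Real.sqrt_pos.2 hq.1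
  have hs2 : 0 < sqrt (1 - q) := Real.sqrt_pos.2 (by linarith [hq.2])
  have hp := pt_coe θ φ hq'
  have hp1 : 0 < (pt θ φ q).1 0 * φ.cos + (pt θ φ q).1 1 * φ.sin := by
    rw [hp]; simpa [polar_dot] using hs1
  have hp2 : 0 < (pt θ φ q).1 2 * θ.cos + (pt θ φ q).1 3 * θ.sin := by
    rw [hp]; simpa [polar_dot] using hs2
  have hev := eventually_add_mem_Ioo hq
  refine ⟨?_, ?_, by simp, ?_, ?_⟩
  · refine ((contDiffAt_const.mul (contDiffAt_angleCoord (contDiffAt_coord 2 _)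
      (contDiffAt_coord 3 _) hp2)).prodMk (contDiffAt_const.mul (contDiffAt_angleCoord
      (contDiffAt_coord 0 _) (contDiffAt_coord 1 _) hp1))).prodMk ?_
    exact (((contDiffAt_coord 0 _).pow 2).add ((contDiffAt_coord 1 _).pow 2)).sub contDiffAt_const
  · have heq : (fun u : ℝ³ => (pt (θ + (σ * u.1.1 : ℝ))
        (φ + (ε * u.1.2 : ℝ)) (q + u.2) : E⁴)) =ᶠ[𝓝 0]
        (fun u => !₂[sqrt (q + u.2) * (φ + (ε * u.1.2 : ℝ)).cos,
          sqrt (q + u.2) * (φ + (ε * u.1.2 : ℝ)).sin,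
          sqrt (1 - (q + u.2)) * (θ + (σ * u.1.1 : ℝ)).cos,
          sqrt (1 - (q + u.2)) * (θ + (σ * u.1.1 : ℝ)).sin]) := by
      filter_upwards [hev] with u hu
      exact pt_coe _ _ ⟨hu.1.le, hu.2.le⟩
    refine ContDiffAt.congr_of_eventuallyEq ?_ heq
    have hf : ContDiffAt ℝ 1 (fun u : ℝ³ => u.1.1) 0 := by fun_prop
    have hg : ContDiffAt ℝ 1 (fun u : ℝ³ => u.1.2) 0 := by fun_prop
    have c1 : ContDiffAt ℝ 1 (fun u : ℝ³ => sqrt (q + u.2)) 0 :=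
      ContDiffAt.sqrt (by fun_prop) (by simpa using hq.1.ne')
    have c2 : ContDiffAt ℝ 1 (fun u : ℝ³ => sqrt (1 - (q + u.2))) 0 :=
      ContDiffAt.sqrt (by fun_prop) (by simp; linarith [hq.2])
    refine contDiffAt_euclidean.2 fun i => ?_
    fin_cases i
    · exact c1.mul ((contDiff_angle_cos φ ε).contDiffAt.comp _ hg)
    · exact c1.mul ((contDiff_angle_sin φ ε).contDiffAt.comp _ hg)
    · exact c2.mul ((contDiff_angle_cos θ σ).contDiffAt.comp _ hf)
    · exact c2.mul ((contDiff_angle_sin θ σ).contDiffAt.comp _ hf)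
  · have e1 : ∀ᶠ u in 𝓝 (0 : ℝ³), |u.1.1| < π / 2 :=
      eventually_abs_lt (f := fun u : ℝ³ => u.1.1) (by fun_prop) (by simpa using hπ)
    have e2 : ∀ᶠ u in 𝓝 (0 : ℝ³), |u.1.2| < π / 2 :=
      eventually_abs_lt (f := fun u : ℝ³ => u.1.2) (by fun_prop) (by simpa using hπ)
    filter_upwards [hev, e1, e2] with u hu h1 h2
    rw [pt_coe _ _ ⟨hu.1.le, hu.2.le⟩]
    have a1 := angleCoord_polar φ (r := sqrt (q + u.2)) (t := ε * u.1.2)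
      (Real.sqrt_pos.2 hu.1) (by rw [abs_mul, hε2, one_mul]; exact h2)
    have a2 := angleCoord_polar θ (r := sqrt (1 - (q + u.2))) (t := σ * u.1.1)
      (Real.sqrt_pos.2 (by linarith [hu.2])) (by rw [abs_mul, hσ2, one_mul]; exact h1)
    have a3 : (√(q + u.2) * (φ + (ε * u.1.2 : ℝ)).cos) ^ 2 +
        (√(q + u.2) * (φ + (ε * u.1.2 : ℝ)).sin) ^ 2 = q + u.2 := by
      rw [mul_pow, mul_pow, ← mul_add, Angle.cos_sq_add_sin_sq, mul_one, Real.sq_sqrt hu.1.le]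
    ext
    · change σ * angleCoord θ _ _ = _
      simp
      rw [a2, ← mul_assoc, hσ1, one_mul]
    · change ε * angleCoord φ _ _ = _
      simp
      rw [a1, ← mul_assoc, hε1, one_mul]
    · change _ + _ - q = _
      simp
      rw [a3]; ring
  · filter_upwards [eventually_coord_pos hp1, eventually_coord_pos hp2] with z h1 h2
    have hz := sum_sq_eq_one z
    have hm : q + (z.1 0 ^ 2 + z.1 1 ^ 2 - q) ∈ Icc (0 : ℝ) 1 := by
      constructor
      · nlinarith [sq_nonneg (z.1 0), sq_nonneg (z.1 1)]
      · nlinarith [sq_nonneg (z.1 2), sq_nonneg (z.1 3)]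
    apply Subtype.ext
    rw [pt_coe _ _ hm]
    simp only [← mul_assoc, hσ1, hε1, one_mul]
    obtain ⟨p1, p2⟩ := polar_angleCoord φ h1
    obtain ⟨p3, p4⟩ := polar_angleCoord θ h2
    have m1 : q + (z.1 0 ^ 2 + z.1 1 ^ 2 - q) = z.1 0 ^ 2 + z.1 1 ^ 2 := by ring
    have m2 : 1 - (z.1 0 ^ 2 + z.1 1 ^ 2) = z.1 2 ^ 2 + z.1 3 ^ 2 := by linarith
    rw [m1, m2, p1, p2, p3, p4]
    ext i
    fin_cases i <;> rfl

lemma LocalCoords.rotate {p : S3} {G : E⁴ → ℝ³} {Gi : ℝ³ → S3} (h : LocalCoords p G Gi) :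
    LocalCoords p (fun z => (((G z).1.2, (G z).2), (G z).1.1))
      (fun u => Gi ((u.2, u.1.1), u.1.2)) := by
  have hc : Continuous fun u : ℝ³ => (((u.2, u.1.1), u.1.2) : ℝ³) := by fun_prop
  have ht : Tendsto (fun u : ℝ³ => (((u.2, u.1.1), u.1.2) : ℝ³)) (𝓝 0) (𝓝 0) := hc.tendsto' 0 0 rfl
  refine ⟨?_, ?_, h.inv_zero, ?_, ?_⟩
  · exact ContDiffAt.comp (g := fun u : ℝ³ => (((u.1.2, u.2), u.1.1) : ℝ³)) _
      (by fun_prop) h.contDiff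
  · exact ContDiffAt.comp (g := fun u => (Gi u : E⁴))
      (f := fun u : ℝ³ => (((u.2, u.1.1), u.1.2) : ℝ³)) _ h.contDiff_inv
      (by fun_prop)
  · filter_upwards [ht.eventually h.right_inv] with u hu
    simp only [hu]
  · filter_upwards [h.left_inv] with z hz using hz

lemma polar_arg (u v : ℝ) : sqrt (u ^ 2 + v ^ 2) * (arg (u + v * I) : Angle).cos = u ∧
    sqrt (u ^ 2 + v ^ 2) * (arg (u + v * I) : Angle).sin = v := by
  have hn : sqrt (u ^ 2 + v ^ 2) = ‖(u + v * I : ℂ)‖ := (Complex.norm_add_mul_I u v).symm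
  rw [hn, Angle.cos_coe, Angle.sin_coe, Complex.norm_mul_cos_arg, Complex.norm_mul_sin_arg,
    re_add_mul_I, im_add_mul_I]
  exact ⟨rfl, rfl⟩

/-- Coordinates near the circle on which the first complex coordinate vanishes. -/
lemma localCoords_circle (θ φ : Angle) :
    LocalCoords (pt θ φ 0) (fun z => ((z 0, z 1), angleCoord θ (z 2) (z 3)))
      (fun u => pt (θ + (u.2 : Angle)) (arg (u.1.1 + u.1.2 * I) : Angle)
        (u.1.1 ^ 2 + u.1.2 ^ 2)) := by
  have hπ := Real.pi_pos
  have hp := pt_coe θ φ (q := 0) (by simp)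
  have hp2 : 0 < (pt θ φ 0).1 2 * θ.cos + (pt θ φ 0).1 3 * θ.sin := by
    rw [hp]; simpa using (polar_dot 1 θ).ge.trans_lt' one_pos
  have hpol := polar_arg
  have hev := eventually_sq_add_sq_lt one_pos
  have hco : ∀ u : ℝ³, u.1.1 ^ 2 + u.1.2 ^ 2 < 1 →
      (pt (θ + (u.2 : Angle)) (arg (u.1.1 + u.1.2 * I) : Angle)
        (u.1.1 ^ 2 + u.1.2 ^ 2) : E⁴) = !₂[u.1.1, u.1.2,
          sqrt (1 - (u.1.1 ^ 2 + u.1.2 ^ 2)) * (θ + (u.2 : Angle)).cos,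
          sqrt (1 - (u.1.1 ^ 2 + u.1.2 ^ 2)) * (θ + (u.2 : Angle)).sin] := by
    intro u hu
    rw [pt_coe _ _ ⟨by positivity, hu.le⟩, (hpol _ _).1, (hpol _ _).2]
  refine ⟨?_, ?_, ?_, ?_, ?_⟩
  · exact ((contDiffAt_coord 0 _).prodMk (contDiffAt_coord 1 _)).prodMk
      (contDiffAt_angleCoord (contDiffAt_coord 2 _) (contDiffAt_coord 3 _) hp2)
  · refine ContDiffAt.congr_of_eventuallyEq (f := fun u : ℝ³ => !₂[u.1.1, u.1.2,
          sqrt (1 - (u.1.1 ^ 2 + u.1.2 ^ 2)) * (θ + (1 * u.2 : ℝ)).cos,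
          sqrt (1 - (u.1.1 ^ 2 + u.1.2 ^ 2)) * (θ + (1 * u.2 : ℝ)).sin]) ?_ (by
        filter_upwards [hev] with u hu
        rw [hco u hu, one_mul])
    have hf : ContDiffAt ℝ 1 (fun u : ℝ³ => u.2) 0 := by fun_prop
    have c1 : ContDiffAt ℝ 1 (fun u : ℝ³ => sqrt (1 - (u.1.1 ^ 2 + u.1.2 ^ 2))) 0 :=
      ContDiffAt.sqrt (by fun_prop) (by simp)
    refine contDiffAt_euclidean.2 fun i => ?_
    fin_cases i
    · change ContDiffAt ℝ 1 (fun u : ℝ³ => u.1.1) 0; fun_prop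
    · change ContDiffAt ℝ 1 (fun u : ℝ³ => u.1.2) 0; fun_prop
    · exact c1.mul ((contDiff_angle_cos θ 1).contDiffAt.comp _ hf)
    · exact c1.mul ((contDiff_angle_sin θ 1).contDiffAt.comp _ hf)
  · rw [pt_eq_iff (by simp) (by simp)]
    simp
  · have e1 : ∀ᶠ u in 𝓝 (0 : ℝ³), |u.2| < π / 2 :=
      eventually_abs_lt (f := fun u : ℝ³ => u.2) (by fun_prop) (by simpa using hπ)
    filter_upwards [hev, e1] with u hu h1
    rw [hco u hu]
    have a2 := angleCoord_polar θ (r := sqrt (1 - (u.1.1 ^ 2 + u.1.2 ^ 2))) (t := u.2)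
      (Real.sqrt_pos.2 (by linarith)) h1
    ext
    · rfl
    · rfl
    · exact a2
  · filter_upwards [eventually_coord_pos hp2] with z h2
    have hz := sum_sq_eq_one z
    obtain ⟨p3, p4⟩ := polar_angleCoord θ h2
    have hlt : z.1 0 ^ 2 + z.1 1 ^ 2 < 1 := by
      by_contra hcon
      have z2 : z.1 2 = 0 := by
        rw [← sq_eq_zero_iff]; nlinarith [sq_nonneg (z.1 2), sq_nonneg (z.1 3)]
      have z3 : z.1 3 = 0 := by
        rw [← sq_eq_zero_iff]; nlinarith [sq_nonneg (z.1 2), sq_nonneg (z.1 3)]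
      simp [z2, z3] at h2
    apply Subtype.ext
    have := hco ((z.1 0, z.1 1), angleCoord θ (z.1 2) (z.1 3)) hlt
    simp only at this
    rw [this]
    have m2 : 1 - (z.1 0 ^ 2 + z.1 1 ^ 2) = z.1 2 ^ 2 + z.1 3 ^ 2 := by linarith
    rw [m2, p3, p4]
    ext i
    fin_cases i <;> rfl

/-! ### Exchanging the two circles -/

/-- The isometry of `E⁴` that exchanges the two complex coordinates. -/
def swapE (z : E⁴) : E⁴ := !₂[z 2, z 3, z 0, z 1]

/-- The isometry of the three-sphere that exchanges the two complex coordinates. -/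
def swapS (z : S3) : S3 := ⟨swapE z, by
  have h := sum_sq_eq_one z
  rw [mem_sphere_zero_iff_norm, EuclideanSpace.norm_eq, Real.sqrt_eq_one]
  rw [Fin.sum_univ_four]
  simp only [Real.norm_eq_abs, sq_abs]
  change z.1 2 ^ 2 + z.1 3 ^ 2 + z.1 0 ^ 2 + z.1 1 ^ 2 = 1
  linarith⟩

lemma swapE_swapE (z : E⁴) : swapE (swapE z) = z := by ext i; fin_cases i <;> rfl

lemma swapS_swapS (z : S3) : swapS (swapS z) = z := Subtype.ext (swapE_swapE z)

lemma contDiff_swapE : ContDiff ℝ 1 swapE := by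
  refine contDiff_euclidean.2 fun i => ?_
  fin_cases i <;> simp [swapE] <;> fun_prop

lemma continuous_swapS : Continuous swapS :=
  (contDiff_swapE.continuous.comp continuous_subtype_val).subtype_mk _

lemma swapS_pt (θ φ : Angle) {q : ℝ} (hq : q ∈ Icc (0 : ℝ) 1) :
    swapS (pt θ φ q) = pt φ θ (1 - q) := by
  apply Subtype.ext
  rw [pt_coe _ _ ⟨by linarith [hq.2], by linarith [hq.1]⟩]
  simp only [swapS, pt_coe θ φ hq, swapE, sub_sub_cancel]
  rfl

lemma LocalCoords.swap {p : S3} {G : E⁴ → ℝ³} {Gi : ℝ³ → S3} (h : LocalCoords p G Gi) :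
    LocalCoords (swapS p) (fun z => G (swapE z)) (fun u => swapS (Gi u)) := by
  refine ⟨?_, contDiff_swapE.contDiffAt.comp _ h.contDiff_inv, by rw [h.inv_zero], ?_, ?_⟩
  · refine ContDiffAt.comp _ ?_ contDiff_swapE.contDiffAt
    have : swapE (swapS p) = p := swapE_swapE p
    rw [this]; exact h.contDiff
  · filter_upwards [h.right_inv] with u hu
    have : swapE (swapS (Gi u)) = Gi u := swapE_swapE (Gi u)
    rw [this, hu]
  · have := continuous_swapS.continuousAt.tendsto (x := swapS p)
    rw [swapS_swapS] at this
    filter_upwards [this.eventually h.left_inv] with z hz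
    have e : Gi (G (swapE z)) = swapS z := hz
    rw [e, swapS_swapS]

/-! ### Gluing functions of class `C¹` -/

/-- A `C¹` function that vanishes to first order along a line may be replaced by zero on one side.
-/
lemma contDiffAt_zero_piece {d : ℝ² → ℝ} {t : ℝ} (hd : ContDiffAt ℝ 1 d (0, t))
    (h : ∀ᶠ s in 𝓝 t, d (0, s) = 0 ∧ HasFDerivAt d (0 : ℝ² →L[ℝ] ℝ) (0, s)) :
    ContDiffAt ℝ 1 (fun w => if 0 ≤ w.1 then d w else 0) (0, t) := by
  have hprop : ∀ᶠ w in 𝓝 ((0 : ℝ), t), ContDiffAt ℝ 1 d w ∧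
      (d (0, w.2) = 0 ∧ HasFDerivAt d (0 : ℝ² →L[ℝ] ℝ) (0, w.2)) := by
    refine (hd.eventually (by simp)).and ?_
    have : Tendsto (fun w : ℝ² => w.2) (𝓝 ((0 : ℝ), t)) (𝓝 t) := continuous_snd.tendsto _
    exact this.eventually h
  obtain ⟨U, hU, hUo, htU⟩ := eventually_nhds_iff.1 hprop
  rw [contDiffAt_one_iff]
  have hcd : ∀ w ∈ U, ContinuousAt (fderiv ℝ d) w := fun w hw =>
    ((hU w hw).1.fderiv_right (m := 0) (by simp)).continuousAt
  refine ⟨fun w => if 0 ≤ w.1 then fderiv ℝ d w else 0, U, hUo.mem_nhds htU, ?_, ?_⟩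
  · intro w hw
    refine ContinuousAt.continuousWithinAt ?_
    rcases lt_trichotomy w.1 0 with h0 | h0 | h0
    · refine (continuousAt_const (y := (0 : ℝ² →L[ℝ] ℝ))).congr ?_
      filter_upwards [continuous_fst.continuousAt.eventually_lt continuousAt_const h0] with z hz
      rw [if_neg (by simpa using hz)]
    · have hw' : w = (0, w.2) := Prod.ext h0 rfl
      have hz : fderiv ℝ d w = 0 := by rw [hw']; exact (hU w hw).2.2.fderiv
      rw [ContinuousAt, if_pos h0.ge, hz]
      have := (hcd w hw).tendsto
      rw [hz] at this
      refine squeeze_zero_norm (a := fun z => ‖fderiv ℝ d z‖) (fun z => ?_) (by simpa using this.norm)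
      split_ifs
      · exact le_rfl
      · simp
    · refine (hcd w hw).congr ?_
      filter_upwards [continuousAt_const.eventually_lt continuous_fst.continuousAt h0] with z hz
      rw [if_pos (le_of_lt hz)]
  · intro w hw
    beta_reduce
    rcases lt_trichotomy w.1 0 with h0 | h0 | h0
    · rw [if_neg (not_le.2 h0)]
      refine (hasFDerivAt_const (0 : ℝ) w).congr_of_eventuallyEq ?_
      filter_upwards [continuous_fst.continuousAt.eventually_lt continuousAt_const h0] with z hz
      rw [if_neg (by simpa using hz)]
    · have hw' : w = (0, w.2) := Prod.ext h0 rfl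
      have hz : HasFDerivAt d (0 : ℝ² →L[ℝ] ℝ) w := by rw [hw']; exact (hU w hw).2.2
      have hz0 : d w = 0 := by rw [hw']; exact (hU w hw).2.1
      rw [if_pos h0.ge, hz.fderiv]
      rw [hasFDerivAt_iff_isLittleO] at hz ⊢
      refine Asymptotics.IsBigO.trans_isLittleO (.of_bound 1 (.of_forall fun z => ?_)) hz
      simp only [hz0, zero_apply, sub_zero, one_mul]
      split_ifs <;> simp
    · rw [if_pos h0.le]
      refine ((hU w hw).1.differentiableAt (by simp)).hasFDerivAt.congr_of_eventuallyEq ?_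
      filter_upwards [continuousAt_const.eventually_lt continuous_fst.continuousAt h0] with z hz
      rw [if_pos (le_of_lt hz)]

/-- Two `C¹` functions that agree to first order along a line glue to a `C¹` function. -/
lemma contDiffAt_glue {f g : ℝ² → ℝ} {t : ℝ} (hf : ContDiffAt ℝ 1 f (0, t))
    (hg : ContDiffAt ℝ 1 g (0, t))
    (h : ∀ᶠ s in 𝓝 t, f (0, s) = g (0, s) ∧
      ∃ L : ℝ² →L[ℝ] ℝ, HasFDerivAt f L (0, s) ∧ HasFDerivAt g L (0, s)) :
    ContDiffAt ℝ 1 (fun w => if 0 ≤ w.1 then f w else g w) (0, t) := by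
  have h1 := contDiffAt_zero_piece (hf.sub hg) (by
    filter_upwards [h] with s hs
    obtain ⟨h1, L, h2, h3⟩ := hs
    have h4 := h2.sub h3
    rw [sub_self] at h4
    exact ⟨by simp [h1], h4⟩)
  refine (hg.add h1).congr_of_eventuallyEq (.of_forall fun w => ?_)
  change _ = g w + _
  by_cases hw : 0 ≤ w.1
  · simp [hw]
  · simp [hw]

/-- A function on the plane that is `C¹` off the origin, with the derivative tending to zero at the
origin and of quadratic size there, is `C¹`. -/
lemma contDiffAt_zero_of_bounds {k : ℝ² → ℝ} {C : ℝ}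
    (h : ∀ᶠ z in 𝓝 (0 : ℝ²), |k z| ≤ C * ‖z‖ ^ 2 ∧
      (z ≠ 0 → ContDiffAt ℝ 1 k z ∧ ‖fderiv ℝ k z‖ ≤ C * ‖z‖)) : ContDiffAt ℝ 1 k 0 := by
  have h0 : k 0 = 0 := by simpa using h.self_of_nhds.1
  have hd0 : HasFDerivAt k (0 : ℝ² →L[ℝ] ℝ) 0 := by
    rw [hasFDerivAt_iff_isLittleO]
    simp only [h0, sub_zero, zero_apply]
    have h1 : (fun z => k z) =O[𝓝 (0 : ℝ²)] (fun z => ‖z‖ ^ 2) := by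
      refine .of_bound C ?_
      filter_upwards [h] with z hz
      simpa using hz.1
    exact h1.trans_isLittleO (Asymptotics.isLittleO_norm_pow_id one_lt_two)
  obtain ⟨U, hU, hUo, h0U⟩ := eventually_nhds_iff.1 h
  rw [contDiffAt_one_iff]
  refine ⟨fderiv ℝ k, U, hUo.mem_nhds h0U, fun z hz => ContinuousAt.continuousWithinAt ?_,
    fun z hz => ?_⟩
  · by_cases hz0 : z = 0
    · subst hz0
      rw [ContinuousAt, hd0.fderiv]
      refine squeeze_zero_norm' (a := fun z => C * ‖z‖) ?_ ?_
      · filter_upwards [h] with z hz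
        by_cases hz0 : z = 0
        · rw [hz0, hd0.fderiv]; simp
        · exact (hz.2 hz0).2
      · have : Tendsto (fun z : ℝ² => C * ‖z‖) (𝓝 0) (𝓝 (C * ‖(0 : ℝ²)‖)) :=
          (continuous_norm.const_mul C).tendsto _
        simpa using this
    · exact (((hU z hz).2 hz0).1.fderiv_right (m := 0) (by simp)).continuousAt
  · by_cases hz0 : z = 0
    · subst hz0; rw [hd0.fderiv]; exact hd0
    · exact (((hU z hz).2 hz0).1.differentiableAt (by simp)).hasFDerivAt

section

/-! ### Tiles in coordinates -/

namespace Rect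

/-- The width of a rectangle. -/
def wid (r : Rect) : ℝ := arcLen r.θ₁ r.θ₂

/-- The height of a rectangle. -/
def hei (r : Rect) : ℝ := arcLen r.φ₁ r.φ₂

lemma wid_pos (r : Rect) : 0 < r.wid := arcLen_pos r.θ_ne

lemma hei_pos (r : Rect) : 0 < r.hei := arcLen_pos r.φ_ne

lemma wid_lt (r : Rect) : r.wid < 2 * π := arcLen_lt _ _

lemma hei_lt (r : Rect) : r.hei < 2 * π := arcLen_lt _ _

/-- `α` is the `θ`-coordinate of a vertical side of `r`, and `r` lies from this side in the direction
of the sign `σ`. -/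
def Vert (r : Rect) (α : Angle) (σ : ℝ) : Prop := IsEnd r.θ₁ r.θ₂ α σ

/-- `β` is the `φ`-coordinate of a horizontal side of `r`, and `r` lies from this side in the
direction of the sign `ε`. -/
def Horiz (r : Rect) (β : Angle) (ε : ℝ) : Prop := IsEnd r.φ₁ r.φ₂ β ε

end Rect

variable {r : Rect} {α β : Angle} {σ ε x y q : ℝ}

lemma h_coord_one (hx : x ∈ Icc 0 r.wid) (hy : y ∈ Icc 0 r.hei) :
    r.h (r.θ₁ + (x : Angle), r.φ₁ + (y : Angle)) = rectH r.wid r.hei x y := by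
  have hb := r.hei_pos
  have hw := r.wid_lt
  have hh := r.hei_lt
  have e1 : arcLen r.θ₁ (r.θ₁ + (x : Angle)) = x := arcLen_add_coe _ hx.1 (by linarith [hx.2])
  have e2 : arcLen r.φ₁ (r.φ₁ + (y : Angle)) = y := arcLen_add_coe _ hy.1 (by linarith [hy.2])
  have e0 : r.θ₂ = r.θ₁ + (x : Angle) + (r.wid - x : ℝ) := by
    rw [add_assoc, ← Angle.coe_add, add_sub_cancel]
    exact (add_arcLen _ _).symm
  have e3 : arcLen (r.θ₁ + (x : Angle)) r.θ₂ = r.wid - x := by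
    rw [e0]; exact arcLen_add_coe _ (by linarith [hx.2]) (by linarith [hx.1])
  have c1 : r.θ₁ + (x : Angle) = r.θ₁ ↔ x = 0 := by
    constructor
    · intro h
      have := e1; rw [h, arcLen_self] at this; exact this.symm
    · rintro rfl; simp
  have c2 : r.θ₁ + (x : Angle) = r.θ₂ ↔ x = r.wid := by
    constructor
    · intro h
      have := e1; rw [h] at this; exact this.symm
    · rintro rfl; exact add_arcLen _ _
  rw [Rect.h, rectH, stripH]
  simp only [c1, c2, e1, e2, e3, scale_eq_zero hb, scale_inj hb]
  split_ifs with h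
  · rfl
  · have ew : arcLen r.θ₁ r.θ₂ = r.wid := rfl
    have eh : arcLen r.φ₁ r.φ₂ = r.hei := rfl
    have m : ∀ (k : ℝ) (s : ℝ), k * π / r.hei * s = k * (π * s / r.hei) := by intro k s; ring
    have d : π * r.wid / r.hei - π * x / r.hei = π * (r.wid - x) / r.hei := by ring
    rw [stripSeries]
    simp only [ew, eh, m, d]

lemma h_coord (hθ : r.Vert α σ) (hφ : r.Horiz β ε) (hx : x ∈ Icc 0 r.wid) (hy : y ∈ Icc 0 r.hei) :
    r.h (α + (σ * x : ℝ), β + (ε * y : ℝ)) = rectH r.wid r.hei x y := by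
  have key : ∀ {p q α : Angle} {σ x : ℝ}, IsEnd p q α σ →
      α + (σ * x : ℝ) = p + (if σ = 1 then x else arcLen p q - x : ℝ) := by
    rintro p q α σ x (⟨rfl, rfl⟩ | ⟨rfl, rfl⟩)
    · simp
    · have h := add_arcLen p α
      conv_lhs => lhs; rw [← h]
      rw [add_assoc, ← Angle.coe_add]
      norm_num
      congr 2
  rw [key hθ, key hφ]
  have hx' : (if σ = 1 then x else r.wid - x) ∈ Icc 0 r.wid := by
    split_ifs
    · exact hx
    · exact ⟨by linarith [hx.2], by linarith [hx.1]⟩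
  have hy' : (if ε = 1 then y else r.hei - y) ∈ Icc 0 r.hei := by
    split_ifs
    · exact hy
    · exact ⟨by linarith [hy.2], by linarith [hy.1]⟩
  refine (h_coord_one hx' hy').trans ?_
  split_ifs
  · rfl
  · exact rectH_reflect_right r.hei_pos
  · exact rectH_reflect_left _ _ _ _
  · rw [rectH_reflect_left, rectH_reflect_right r.hei_pos]

lemma mem_carrier_iff (hθ : r.Vert α σ) (hφ : r.Horiz β ε) {v : Torus} : v ∈ r.carrier ↔
    ∃ x ∈ Icc 0 r.wid, ∃ y ∈ Icc 0 r.hei, v = (α + (σ * x : ℝ), β + (ε * y : ℝ)) := by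
  rw [Rect.carrier, mem_prod, IsEnd.mem_arc_iff hθ, IsEnd.mem_arc_iff hφ]
  constructor
  · rintro ⟨⟨x, hx, h1⟩, y, hy, h2⟩
    exact ⟨x, hx, y, hy, Prod.ext h1 h2⟩
  · rintro ⟨x, hx, y, hy, rfl⟩
    exact ⟨⟨x, hx, rfl⟩, y, hy, rfl⟩

lemma exists_vert_horiz (r : Rect) : r.Vert r.θ₁ 1 ∧ r.Horiz r.φ₁ 1 :=
  ⟨Or.inl ⟨rfl, rfl⟩, Or.inl ⟨rfl, rfl⟩⟩

lemma mem_vertices_iff (hθ : r.Vert α σ) (hφ : r.Horiz β ε) (hx : x ∈ Icc 0 r.wid)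
    (hy : y ∈ Icc 0 r.hei) :
    (α + (σ * x : ℝ), β + (ε * y : ℝ)) ∈ r.vertices ↔
      (x = 0 ∨ x = r.wid) ∧ (y = 0 ∨ y = r.hei) := by
  have key : ∀ {p q α : Angle} {σ x : ℝ}, IsEnd p q α σ → x ∈ Icc 0 (arcLen p q) →
      (α + (σ * x : ℝ) ∈ ({p, q} : Set Angle) ↔ x = 0 ∨ x = arcLen p q) := by
    intro p q α σ x h hx
    constructor
    · intro hm; exact h.coord_eq hm hx.1 hx.2
    · rintro (rfl | rfl)
      · simpa using h.end_eq
      · exact h.other.end_eq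
  rw [Rect.vertices, mem_prod]
  exact and_congr (key hθ hx) (key hφ hy)

/-- The point of the join with parameters `v` and `q` is on the tile of `r`; the condition is on the
parameters, and `v` is required to be in the rectangle. -/
def Over (r : Rect) (v : Torus) (q : ℝ) : Prop :=
  v ∈ r.carrier ∧ q ∈ Icc (0 : ℝ) 1 ∧ (v ∈ r.vertices ∨ q = mfun (r.h v))

lemma over_coord_iff (hθ : r.Vert α σ) (hφ : r.Horiz β ε) (hx : x ∈ Icc 0 r.wid)
    (hy : y ∈ Icc 0 r.hei) :
    Over r (α + (σ * x : ℝ), β + (ε * y : ℝ)) q ↔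
      q ∈ Icc (0 : ℝ) 1 ∧ (((x = 0 ∨ x = r.wid) ∧ (y = 0 ∨ y = r.hei)) ∨
        q = mfun (rectH r.wid r.hei x y)) := by
  rw [Over, mem_vertices_iff hθ hφ hx hy, h_coord hθ hφ hx hy,
    and_iff_right ((mem_carrier_iff hθ hφ).2 ⟨x, hx, y, hy, rfl⟩)]

/-- A point of a tile, in the coordinates of any of its vertices. -/
lemma Over.exists_coord {v : Torus} (h : Over r v q) (hθ : r.Vert α σ) (hφ : r.Horiz β ε) :
    ∃ x ∈ Icc 0 r.wid, ∃ y ∈ Icc 0 r.hei, v = (α + (σ * x : ℝ), β + (ε * y : ℝ)) ∧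
      (((x = 0 ∨ x = r.wid) ∧ (y = 0 ∨ y = r.hei)) ∨ q = mfun (rectH r.wid r.hei x y)) := by
  obtain ⟨x, hx, y, hy, rfl⟩ := (mem_carrier_iff hθ hφ).1 h.1
  exact ⟨x, hx, y, hy, rfl, ((over_coord_iff hθ hφ hx hy).1 h).2⟩

lemma over_iff_tileEq (hθ : r.Vert α σ) (hφ : r.Horiz β ε) (hx : x ∈ Ico 0 r.wid)
    (hy : y ∈ Icc 0 r.hei) :
    Over r (α + (σ * x : ℝ), β + (ε * y : ℝ)) q ↔
      q ∈ Icc (0 : ℝ) 1 ∧ tileEq r.wid r.hei ((y, q), x) = 0 := by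
  rw [over_coord_iff hθ hφ ⟨hx.1, hx.2.le⟩ hy, tileEq_eq_zero_iff r.wid_pos r.hei_pos hx.1 hx.2 hy]
  have : x ≠ r.wid := hx.2.ne
  simp [this]

lemma mfun_rectH_eq_zero {a b x y : ℝ} (hb : 0 < b) (hx : x ∈ Icc 0 a) (hy : y ∈ Icc 0 b)
    (h : mfun (rectH a b x y) = 0) : x = 0 ∨ x = a := by
  have h1 : rectH a b x y = 1 := mfun_injOn (rectH_mem hb hx hy) (by simp) (by rw [h, mfun_one])
  by_contra hcon
  push Not at hcon
  have h2 := lt_of_le_of_ne hx.1 (Ne.symm hcon.1)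
  have h3 := lt_of_le_of_ne hx.2 hcon.2
  rcases hy.1.eq_or_lt with rfl | h4
  · rw [rectH_bottom hb h2 h3] at h1; norm_num at h1
  rcases hy.2.eq_or_lt with rfl | h5
  · rw [rectH_top hb h2 h3] at h1; norm_num at h1
  exact (rectH_lt_one h2 h3 h4 h5).ne h1

lemma mfun_rectH_eq_one {a b x y : ℝ} (ha : 0 < a) (hb : 0 < b) (hx : x ∈ Icc 0 a) (hy : y ∈ Icc 0 b)
    (h : mfun (rectH a b x y) = 1) : y = 0 ∨ y = b := by
  have h1 : rectH a b x y = 0 := mfun_injOn (rectH_mem hb hx hy) (by simp) (by rw [h, mfun_zero])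
  by_contra hcon
  push Not at hcon
  rcases hx.1.eq_or_lt with rfl | h2
  · rw [rectH_left] at h1; norm_num at h1
  rcases hx.2.eq_or_lt with rfl | h3
  · rw [rectH_right] at h1; norm_num at h1
  exact (rectH_pos h2 h3 (lt_of_le_of_ne hy.1 (Ne.symm hcon.1)) (lt_of_le_of_ne hy.2 hcon.2)).ne' h1

lemma mfun_rectH_interior {a b x y : ℝ} (hx : x ∈ Ioo 0 a) (hy : y ∈ Ioo 0 b) :
    mfun (rectH a b x y) ∈ Ioo (0 : ℝ) 1 := by
  have h0 := rectH_pos hx.1 hx.2 hy.1 hy.2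
  have h1 := rectH_lt_one hx.1 hx.2 hy.1 hy.2
  constructor
  · rw [← mfun_one]; exact mfun_lt h0.le h1 le_rfl
  · rw [← mfun_zero]; exact mfun_lt le_rfl h0 h1.le

/-! ### Blowing up a corner -/

/-- The limit of `rectN / s` and its continuation to `s = 0` along the ray `(c₁ s, c₂ s)`, up to a
constant factor. -/
def blowN (a b : ℝ) (p : ℝ³) : ℝ :=
  p.1.1 * shc (π * (p.2 * p.1.1) / b) *
    cos (etaIm (π * a / b) (π * (p.2 * p.1.1) / b) (π * (p.2 * p.1.2) / b)) -
  p.1.2 * snc (π * (p.2 * p.1.2) / b) *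
    sin (etaIm (π * a / b) (π * (p.2 * p.1.1) / b) (π * (p.2 * p.1.2) / b))

/-- The analogue of `blowN` for `rectD`. -/
def blowD (a b : ℝ) (p : ℝ³) : ℝ :=
  p.1.2 * snc (π * (p.2 * p.1.2) / b) *
    cos (etaIm (π * a / b) (π * (p.2 * p.1.1) / b) (π * (p.2 * p.1.2) / b)) +
  p.1.1 * shc (π * (p.2 * p.1.1) / b) *
    sin (etaIm (π * a / b) (π * (p.2 * p.1.1) / b) (π * (p.2 * p.1.2) / b))

lemma rectN_eq_blowN (a b c₁ c₂ s : ℝ) :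
    rectN a b (s * c₁) (s * c₂) = π * s / b * blowN a b ((c₁, c₂), s) := by
  rw [rectN, stripN, ← mul_shc, ← mul_snc, blowN]
  ring

lemma rectD_eq_blowD (a b c₁ c₂ s : ℝ) :
    rectD a b (s * c₁) (s * c₂) = π * s / b * blowD a b ((c₁, c₂), s) := by
  rw [rectD, stripD, ← mul_shc, ← mul_snc, blowD]
  ring

lemma blowN_zero {a b : ℝ} (ha : 0 < a) (hb : 0 < b) (c₁ c₂ : ℝ) : blowN a b ((c₁, c₂), 0) = c₁ := by
  simp [blowN, etaIm_zero_left _ _ (scale_pos hb ha), shc_zero]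

lemma blowD_zero {a b : ℝ} (ha : 0 < a) (hb : 0 < b) (c₁ c₂ : ℝ) : blowD a b ((c₁, c₂), 0) = c₂ := by
  simp [blowD, etaIm_zero_left _ _ (scale_pos hb ha), snc_zero]

lemma continuousAt_blow {a b : ℝ} (hb : 0 < b) {p : ℝ³} (h : |p.2 * p.1.1| < a) :
    ContinuousAt (blowN a b) p ∧ ContinuousAt (blowD a b) p := by
  have h1 : ContinuousAt (fun p : ℝ³ => etaIm (π * a / b)
      (π * (p.2 * p.1.1) / b) (π * (p.2 * p.1.2) / b)) p :=
    ContinuousAt.comp (g := fun w : ℝ² => etaIm (π * a / b) w.1 w.2)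
      (f := fun p : ℝ³ => (π * (p.2 * p.1.1) / b, π * (p.2 * p.1.2) / b))
      (etaIm_contDiffAt (scale_abs_lt hb h)).continuousAt (by fun_prop)
  have h2 : ContinuousAt (fun p : ℝ³ => p.1.1 * shc (π * (p.2 * p.1.1) / b)) p := by
    have := continuous_shc
    fun_prop
  have h3 : ContinuousAt (fun p : ℝ³ => p.1.2 * snc (π * (p.2 * p.1.2) / b)) p := by
    have := continuous_snc
    fun_prop
  have hc := Real.continuous_cos.continuousAt.comp h1
  have hs := Real.continuous_sin.continuousAt.comp h1
  exact ⟨(h2.mul hc).sub (h3.mul hs), (h3.mul hc).add (h2.mul hs)⟩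

/-- The height of a tile along rays starting at a vertex, continued to the vertex. -/
def blowHeight (a b : ℝ) (p : ℝ³) : ℝ := blowN a b p / (blowN a b p + blowD a b p)

lemma blowHeight_zero {a b : ℝ} (ha : 0 < a) (hb : 0 < b) (c₁ c₂ : ℝ) :
    blowHeight a b ((c₁, c₂), 0) = c₁ / (c₁ + c₂) := by
  rw [blowHeight, blowN_zero ha hb, blowD_zero ha hb]

lemma blowHeight_eq {a b c₁ c₂ s : ℝ} (ha : 0 < a) (hb : 0 < b) (h1 : 0 ≤ c₁) (h2 : 0 ≤ c₂)
    (h12 : 0 < c₁ + c₂) (hs : 0 ≤ s) (hxa : s * c₁ < a) (hyb : s * c₂ < b) :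
    0 < blowN a b ((c₁, c₂), s) + blowD a b ((c₁, c₂), s) ∧
    (0 < s → blowHeight a b ((c₁, c₂), s) = mfun (rectH a b (s * c₁) (s * c₂))) := by
  rcases hs.eq_or_lt with rfl | hs
  · rw [blowN_zero ha hb, blowD_zero ha hb]
    exact ⟨h12, fun h => absurd h (lt_irrefl _)⟩
  have hx : 0 ≤ s * c₁ := mul_nonneg hs.le h1
  have hy : 0 ≤ s * c₂ := mul_nonneg hs.le h2
  have hc : ¬(s * c₁ = 0 ∧ (s * c₂ = 0 ∨ s * c₂ = b)) := by
    rintro ⟨e1, e2⟩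
    have e2 : s * c₂ = 0 := e2.resolve_right hyb.ne
    have : 0 < s * (c₁ + c₂) := mul_pos hs h12
    rw [mul_add, e1, e2] at this
    norm_num at this
  obtain ⟨R, hR, e1, e2⟩ := rectND_eq hb hx hxa ⟨hy, hyb.le⟩ hc
  have h3 := (cos_nonneg_sin_nonneg (rectH_mem hb ⟨hx, hxa.le⟩ ⟨hy, hyb.le⟩)).2.2
  have hπ := Real.pi_pos
  have hk : 0 < π * s / b := by positivity
  have hsum : π * s / b * (blowN a b ((c₁, c₂), s) + blowD a b ((c₁, c₂), s)) =
      R * (cos (π / 2 * rectH a b (s * c₁) (s * c₂)) +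
        sin (π / 2 * rectH a b (s * c₁) (s * c₂))) := by
    rw [mul_add, mul_add, ← rectN_eq_blowN, ← rectD_eq_blowD, e1, e2]
  refine ⟨?_, fun _ => ?_⟩
  · refine pos_of_mul_pos_right ?_ hk.le
    rw [hsum]; positivity
  · rw [blowHeight, ← mul_div_mul_left _ _ hk.ne', hsum, ← rectN_eq_blowN, e1, mfun,
      mul_div_mul_left _ _ hR.ne']

/-! ### The tile as a set -/

lemma continuous_angle {E : Type*} [TopologicalSpace E] (α : Angle) {f : E → ℝ}
    (hf : Continuous f) : Continuous fun z => α + (f z : Angle) :=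
  continuous_const.add (Angle.continuous_coe.comp hf)

lemma continuousAt_pt {E : Type*} [TopologicalSpace E] {f g : E → Angle} {k : E → ℝ} {z : E}
    (hf : ContinuousAt f z) (hg : ContinuousAt g z) (hk : ContinuousAt k z) :
    ContinuousAt (fun z => pt (f z) (g z) (k z)) z :=
  ContinuousAt.comp (g := fun p : (Angle × Angle) × ℝ => pt p.1.1 p.1.2 p.2)
    (f := fun z => ((f z, g z), k z)) continuous_pt.continuousAt ((hf.prodMk hg).prodMk hk)

/-- The half of a tile next to one vertical side, including the segments over the vertices there, is
compact, as the image of a set of solutions of the equation. -/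
lemma closed_tile_half (r : Rect) (hθ : r.Vert α σ) :
    IsCompact {p : S3 | ∃ v q, p = pt v.1 v.2 q ∧ Over r v q ∧
      ∃ x ∈ Icc 0 (r.wid / 2), v.1 = α + (σ * x : ℝ)} := by
  have hb := r.hei_pos
  have ha := r.wid_pos
  obtain ⟨-, hφ⟩ := exists_vert_horiz r
  let B : Set ℝ³ := (Icc 0 r.hei ×ˢ Icc 0 1) ×ˢ Icc 0 (r.wid / 2)
  have hB : IsCompact B := (isCompact_Icc.prod isCompact_Icc).prod isCompact_Icc
  have hc : ContinuousOn (tileEq r.wid r.hei) B := by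
    rintro p ⟨-, h1, h2⟩
    exact (tileEq_contDiffAt hb (abs_lt.2 ⟨by linarith, by linarith⟩)).continuousAt.continuousWithinAt
  have hK : IsCompact (B ∩ tileEq r.wid r.hei ⁻¹' {0}) :=
    hB.of_isClosed_subset (hc.preimage_isClosed_of_isClosed hB.isClosed isClosed_singleton)
      inter_subset_left
  have hf : Continuous fun p : ℝ³ => pt (α + (σ * p.2 : ℝ)) (r.φ₁ + (1 * p.1.1 : ℝ)) p.1.2 := by
    have h1 : Continuous fun p : ℝ³ => α + (σ * p.2 : ℝ) := continuous_angle α (by fun_prop)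
    have h2 : Continuous fun p : ℝ³ => r.φ₁ + (1 * p.1.1 : ℝ) := continuous_angle _ (by fun_prop)
    have h3 : Continuous fun p : ℝ³ => p.1.2 := by fun_prop
    exact continuous_iff_continuousAt.2 fun p =>
      continuousAt_pt h1.continuousAt h2.continuousAt h3.continuousAt
  convert! hK.image hf using 1
  ext p
  constructor
  · rintro ⟨v, q, rfl, ho, x, hx, hv⟩
    obtain ⟨x', -, y, hy, hv', -⟩ := ho.exists_coord hθ hφ
    have e : v = (α + (σ * x : ℝ), r.φ₁ + (1 * y : ℝ)) := Prod.ext hv (by rw [hv'])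
    rw [e] at ho ⊢
    obtain ⟨h1, h2⟩ := (over_iff_tileEq hθ hφ ⟨hx.1, by linarith [hx.2]⟩ hy).1 ho
    exact ⟨((y, q), x), ⟨⟨⟨hy, h1⟩, hx⟩, h2⟩, rfl⟩
  · rintro ⟨⟨⟨y, q⟩, x⟩, ⟨⟨⟨hy, hq⟩, hx⟩, h⟩, rfl⟩
    exact ⟨(_, _), q, rfl, (over_iff_tileEq hθ hφ ⟨hx.1, by linarith [hx.2]⟩ hy).2 ⟨hq, h⟩,
      x, hx, rfl⟩

/-- Along a ray from a vertex the points of the tile converge to a point over the vertex, and every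
height arises in this way. -/
lemma vertex_mem_closure (hθ : r.Vert α σ) (hφ : r.Horiz β ε) {u : ℝ} (hu : u ∈ Ioo (0 : ℝ) 1) :
    pt α β (1 - u) ∈ r.tile := by
  have ha := r.wid_pos
  have hb := r.hei_pos
  have hu1 : 0 < 1 - u := by linarith [hu.2]
  have hu0 := hu.1
  let γ : ℝ → S3 := fun s => pt (α + ((σ * (s * (1 - u)) : ℝ) : Angle))
    (β + (ε * (s * u) : ℝ)) (blowHeight r.wid r.hei ((1 - u, u), s))
  have hev : ∀ᶠ s in 𝓝[>] (0 : ℝ), s * (1 - u) < r.wid ∧ s * u < r.hei := by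
    apply nhdsWithin_le_nhds
    exact (ContinuousAt.eventually_lt (f := fun s : ℝ => s * (1 - u)) (by fun_prop)
      continuousAt_const (by simpa using ha)).and
      (ContinuousAt.eventually_lt (f := fun s : ℝ => s * u) (by fun_prop)
      continuousAt_const (by simpa using hb))
  have hγ : Tendsto γ (𝓝[>] 0) (𝓝 (pt α β (1 - u))) := by
    have h0 : γ 0 = pt α β (1 - u) := by simp [γ, blowHeight_zero ha hb]
    rw [← h0]
    refine ContinuousAt.tendsto ?_ |>.mono_left nhdsWithin_le_nhds
    have h1 : ContinuousAt (fun s : ℝ => α + ((σ * (s * (1 - u)) : ℝ) : Angle)) 0 :=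
      (continuous_angle _ (by fun_prop)).continuousAt
    have h2 : ContinuousAt (fun s : ℝ => β + (ε * (s * u) : ℝ)) 0 :=
      (continuous_angle _ (by fun_prop)).continuousAt
    have h3 : ContinuousAt (fun s : ℝ => blowHeight r.wid r.hei ((1 - u, u), s)) 0 := by
      obtain ⟨c1, c2⟩ := continuousAt_blow (a := r.wid) hb (p := ((1 - u, u), 0)) (by simpa using ha)
      refine ContinuousAt.comp (g := blowHeight r.wid r.hei) (f := fun s : ℝ => (((1 - u, u), s) : ℝ³)) ?_
        (Continuous.continuousAt (by fun_prop))
      refine c1.div (c1.add c2) ?_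
      rw [blowN_zero ha hb, blowD_zero ha hb]; simp
    exact continuousAt_pt h1 h2 h3
  refine mem_closure_of_tendsto hγ ?_
  filter_upwards [hev, self_mem_nhdsWithin] with s hs hs0
  have hs0 : 0 < s := hs0
  have hx : s * (1 - u) ∈ Icc 0 r.wid := ⟨by positivity, hs.1.le⟩
  have hy : s * u ∈ Icc 0 r.hei := ⟨by positivity, hs.2.le⟩
  refine ⟨(α + ((σ * (s * (1 - u)) : ℝ) : Angle), β + (ε * (s * u) : ℝ)),
    ⟨(mem_carrier_iff hθ hφ).2 ⟨_, hx, _, hy, rfl⟩, ?_⟩, ?_⟩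
  · rw [mem_vertices_iff hθ hφ hx hy]
    rintro ⟨h | h, -⟩
    · have : 0 < s * (1 - u) := by positivity
      linarith
    · exact hs.1.ne h
  · simp only [γ]
    rw [joinPt_eq_pt _ _ zeta_mem, h_coord hθ hφ hx hy, cos_sq_zeta (rectH_mem hb hx hy),
      (blowHeight_eq ha hb hu1.le hu0.le (by linarith) hs0.le hs.1 hs.2).2 hs0]

/-- A point of the tile is given by a point over the rectangle; over a vertex the tile contains a
whole arc of the join. -/
theorem mem_tile_iff {p : S3} : p ∈ r.tile ↔ ∃ v q, Over r v q ∧ p = pt v.1 v.2 q := by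
  have ha := r.wid_pos
  have hb := r.hei_pos
  obtain ⟨hθ, hφ⟩ := exists_vert_horiz r
  constructor
  · have hθ' := hθ.other
    rw [one_mul] at hθ'
    set T : Set S3 := {p : S3 | ∃ v q, p = pt v.1 v.2 q ∧ Over r v q ∧
      ∃ x ∈ Icc 0 (r.wid / 2), v.1 = r.θ₁ + (1 * x : ℝ)} ∪
      {p : S3 | ∃ v q, p = pt v.1 v.2 q ∧ Over r v q ∧
      ∃ x ∈ Icc 0 (r.wid / 2), v.1 = (r.θ₁ + (arcLen r.θ₁ r.θ₂ : Angle)) +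
        ((-1 * x : ℝ) : Angle)} with hT
    have hTc : IsClosed T := ((closed_tile_half r hθ).union (closed_tile_half r hθ')).isClosed
    have hsub : r.tile ⊆ T := by
      refine closure_minimal ?_ hTc
      rintro _ ⟨v, ⟨hv, hvn⟩, rfl⟩
      obtain ⟨x, hx, y, hy, rfl⟩ := (mem_carrier_iff hθ hφ).1 hv
      have e : joinPt (r.θ₁ + (1 * x : ℝ)) (r.φ₁ + (1 * y : ℝ))
          (zeta (r.h (r.θ₁ + (1 * x : ℝ), r.φ₁ + (1 * y : ℝ)))) =
          pt (r.θ₁ + (1 * x : ℝ)) (r.φ₁ + (1 * y : ℝ)) (mfun (rectH r.wid r.hei x y)) := by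
        rw [joinPt_eq_pt _ _ zeta_mem, h_coord hθ hφ hx hy, cos_sq_zeta (rectH_mem hb hx hy)]
      have ho : Over r (r.θ₁ + (1 * x : ℝ), r.φ₁ + (1 * y : ℝ)) (mfun (rectH r.wid r.hei x y)) :=
        (over_coord_iff hθ hφ hx hy).2 ⟨mfun_mem (rectH_mem hb hx hy), Or.inr rfl⟩
      rcases le_total x (r.wid / 2) with h | h
      · exact Or.inl ⟨_, _, e, ho, x, ⟨hx.1, h⟩, rfl⟩
      · refine Or.inr ⟨_, _, e, ho, r.wid - x, ⟨by linarith [hx.2], by linarith⟩, ?_⟩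
        rw [add_assoc, ← Angle.coe_add]
        simp only [Rect.wid]
        congr 2; ring
    intro hp
    rcases hsub hp with ⟨v, q, h1, h2, -⟩ | ⟨v, q, h1, h2, -⟩
    · exact ⟨v, q, h2, h1⟩
    · exact ⟨v, q, h2, h1⟩
  · rintro ⟨v, q, ho, rfl⟩
    by_cases hv : v ∈ r.vertices
    · obtain ⟨σ, hσ⟩ := exists_isEnd (show v.1 = r.θ₁ ∨ v.1 = r.θ₂ from hv.1)
      obtain ⟨ε, hε⟩ := exists_isEnd (show v.2 = r.φ₁ ∨ v.2 = r.φ₂ from hv.2)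
      have hcl : IsClosed {q : ℝ | pt v.1 v.2 q ∈ r.tile} :=
        isClosed_closure.preimage (continuous_iff_continuousAt.2 fun q =>
          continuousAt_pt continuousAt_const continuousAt_const continuousAt_id)
      have hsub : Ioo (0 : ℝ) 1 ⊆ {q : ℝ | pt v.1 v.2 q ∈ r.tile} := by
        intro q hq
        have := vertex_mem_closure (r := r) hσ hε (u := 1 - q) ⟨by linarith [hq.2], by linarith [hq.1]⟩
        rwa [sub_sub_cancel] at this
      have := closure_minimal hsub hcl
      rw [closure_Ioo (by norm_num)] at this
      exact this ho.2.1
    · have hq : q = mfun (r.h v) := ho.2.2.resolve_left hv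
      refine subset_closure ⟨v, ⟨ho.1, hv⟩, ?_⟩
      obtain ⟨x, hx, y, hy, rfl⟩ := (mem_carrier_iff hθ hφ).1 ho.1
      simp only
      rw [joinPt_eq_pt _ _ zeta_mem, hq, h_coord hθ hφ hx hy, cos_sq_zeta (rectH_mem hb hx hy)]

lemma mem_surface_iff {P : Set Rect} {p : S3} :
    p ∈ surface P ↔ ∃ r ∈ P, ∃ v q, Over r v q ∧ p = pt v.1 v.2 q := by
  simp only [surface, mem_iUnion, mem_tile_iff, exists_prop]

/-! ### Exchanging the roles of the two factors -/

/-- The rectangle with the two factors of the torus exchanged. -/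
def Rect.swap (r : Rect) : Rect := ⟨r.φ₁, r.φ₂, r.θ₁, r.θ₂, r.φ_ne, r.θ_ne⟩

lemma mem_swap_carrier {v : Torus} : v.swap ∈ r.swap.carrier ↔ v ∈ r.carrier := by
  simp only [Rect.carrier, Rect.swap, mem_prod, Prod.fst_swap, Prod.snd_swap]
  exact and_comm

lemma mem_swap_vertices {v : Torus} : v.swap ∈ r.swap.vertices ↔ v ∈ r.vertices := by
  simp only [Rect.vertices, Rect.swap, mem_prod, Prod.fst_swap, Prod.snd_swap]
  exact and_comm

lemma over_swap {v : Torus} : Over r.swap v.swap (1 - q) ↔ Over r v q := by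
  have ha := r.wid_pos
  have hb := r.hei_pos
  rw [Over, Over, mem_swap_carrier, mem_swap_vertices]
  refine and_congr_right fun hv => and_congr ?_ ?_
  · constructor <;> rintro ⟨h1, h2⟩ <;> exact ⟨by linarith, by linarith⟩
  by_cases hvv : v ∈ r.vertices
  · simp [hvv]
  simp only [hvv, false_or]
  obtain ⟨hθ, hφ⟩ := exists_vert_horiz r
  obtain ⟨x, hx, y, hy, rfl⟩ := (mem_carrier_iff hθ hφ).1 hv
  rw [mem_vertices_iff hθ hφ hx hy] at hvv
  have e1 : r.swap.h (r.θ₁ + (1 * x : ℝ), r.φ₁ + (1 * y : ℝ)).swap =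
      rectH r.hei r.wid y x := h_coord (r := r.swap) (α := r.φ₁) (β := r.θ₁) hφ hθ hy hx
  rw [e1, h_coord hθ hφ hx hy, rectH_swap ha hb hx hy hvv, mfun_one_sub (rectH_mem hb hx hy)]
  constructor <;> intro h <;> linarith

lemma mem_surface_swap {P : Set Rect} {p : S3} :
    swapS p ∈ surface (Rect.swap '' P) ↔ p ∈ surface P := by
  rw [mem_surface_iff, mem_surface_iff]
  constructor
  · rintro ⟨_, ⟨r, hr, rfl⟩, v, q, ho, hp⟩
    have hq := ho.2.1
    refine ⟨r, hr, v.swap, 1 - q, ?_, ?_⟩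
    · rw [← over_swap, Prod.swap_swap, sub_sub_cancel]; exact ho
    · rw [← swapS_swapS p, hp, swapS_pt _ _ hq]; rfl
  · rintro ⟨r, hr, v, q, ho, rfl⟩
    exact ⟨r.swap, ⟨r, hr, rfl⟩, v.swap, 1 - q, over_swap.2 ho, swapS_pt _ _ ho.2.1⟩

end

section

/-! ### Closed diagrams -/

/-- A diagram all of whose vertices are shared by at least two rectangles, with the discreteness of
the sides spelled out. Contrary to the definition of a diagram of a surface this is symmetric under
the exchange of the two factors. -/
structure ClosedDiagram (P : Set Rect) : Prop where
  compat : P.Pairwise Compatible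
  gap_theta : ∀ α ∈ Thetas P, ∃ e > 0, ∀ t : ℝ, |t| < e → α + (t : Angle) ∈ Thetas P →
    α + (t : Angle) = α
  gap_phi : ∀ α ∈ Phis P, ∃ e > 0, ∀ t : ℝ, |t| < e → α + (t : Angle) ∈ Phis P → α + (t : Angle) = α
  finite_theta : ∀ α, {r ∈ P | ∃ σ, r.Vert α σ}.Finite
  finite_phi : ∀ β, {r ∈ P | ∃ ε, r.Horiz β ε}.Finite
  partner : ∀ r ∈ P, ∀ v ∈ r.vertices, ∃ s ∈ P, s ≠ r ∧ v ∈ s.vertices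

lemma IsQuasiSurfaceDiagram.closedDiagram {P : Set Rect} (hP : IsQuasiSurfaceDiagram P)
    (hbd : boundary P = ∅) : ClosedDiagram P := by
  refine ⟨hP.compatible, fun α hα => discrete_gap hP.discrete_Thetas hα,
    fun α hα => discrete_gap hP.discrete_Phis hα, fun α => ?_, fun β => ?_, fun r hr v hv => ?_⟩
  · refine (hP.finite_sides α).subset ?_
    rintro r ⟨hr, σ, hσ⟩
    refine ⟨hr, ?_⟩
    rcases hσ.end_eq with h | h
    · exact Or.inl h
    · exact Or.inr (Or.inl h)
  · refine (hP.finite_sides β).subset ?_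
    rintro r ⟨hr, σ, hσ⟩
    refine ⟨hr, ?_⟩
    rcases hσ.end_eq with h | h
    · exact Or.inr (Or.inr (Or.inl h))
    · exact Or.inr (Or.inr (Or.inr h))
  · by_contra hcon
    push Not at hcon
    have : v ∈ boundary P := by
      refine ⟨r, ⟨hr, hv⟩, ?_⟩
      rintro s ⟨hs, hvs⟩
      by_contra hne
      exact hcon s hs hne hvs
    rw [hbd] at this
    exact this

lemma mem_swap_carrier' {r : Rect} {v : Torus} : v ∈ r.swap.carrier ↔ v.swap ∈ r.carrier := by
  have := mem_swap_carrier (r := r) (v := v.swap)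
  rwa [Prod.swap_swap] at this

lemma mem_swap_vertices' {r : Rect} {v : Torus} : v ∈ r.swap.vertices ↔ v.swap ∈ r.vertices := by
  have := mem_swap_vertices (r := r) (v := v.swap)
  rwa [Prod.swap_swap] at this

lemma Compatible.swap {r s : Rect} (h : Compatible r s) : Compatible r.swap s.swap := by
  rcases h with h | h | ⟨q, h1, h2, h3⟩
  · left
    ext v
    have := congrArg (fun A : Set Torus => v.swap ∈ A) h
    simpa [mem_swap_carrier'] using this
  · right; left
    rintro v ⟨h1, h2⟩
    have := h ⟨mem_swap_carrier'.1 h1, mem_swap_carrier'.1 h2⟩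
    exact ⟨mem_swap_vertices'.2 this.1, mem_swap_vertices'.2 this.2⟩
  · right; right
    refine ⟨q.swap, ?_, ?_, ?_⟩
    · ext v
      have := congrArg (fun A : Set Torus => v.swap ∈ A) h1
      simpa [mem_swap_carrier'] using this
    · rw [Set.disjoint_left] at h2 ⊢
      intro v hv; rw [mem_swap_vertices']; exact h2 (mem_swap_carrier'.1 hv)
    · rw [Set.disjoint_left] at h3 ⊢
      intro v hv; rw [mem_swap_vertices']; exact h3 (mem_swap_carrier'.1 hv)

lemma thetas_swap (P : Set Rect) : Thetas (Rect.swap '' P) = Phis P := by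
  simp only [Thetas, Phis, biUnion_image]; rfl

lemma phis_swap (P : Set Rect) : Phis (Rect.swap '' P) = Thetas P := by
  simp only [Thetas, Phis, biUnion_image]; rfl

variable {P : Set Rect}

lemma ClosedDiagram.swap (hP : ClosedDiagram P) : ClosedDiagram (Rect.swap '' P) := by
  refine ⟨?_, ?_, ?_, fun α => ?_, fun β => ?_, ?_⟩
  · rintro _ ⟨r, hr, rfl⟩ _ ⟨s, hs, rfl⟩ hne
    exact (hP.compat hr hs fun h => hne (by rw [h])).swap
  · rw [thetas_swap]; exact hP.gap_phi
  · rw [phis_swap]; exact hP.gap_theta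
  · refine ((hP.finite_phi α).image Rect.swap).subset ?_
    rintro _ ⟨⟨r, hr, rfl⟩, σ, hσ⟩
    exact ⟨r, ⟨hr, σ, hσ⟩, rfl⟩
  · refine ((hP.finite_theta β).image Rect.swap).subset ?_
    rintro _ ⟨⟨r, hr, rfl⟩, σ, hσ⟩
    exact ⟨r, ⟨hr, σ, hσ⟩, rfl⟩
  · rintro _ ⟨r, hr, rfl⟩ v hv
    obtain ⟨s, hs, hne, hvs⟩ := hP.partner r hr _ (mem_swap_vertices'.1 hv)
    refine ⟨s.swap, ⟨s, hs, rfl⟩, fun h => hne ?_, mem_swap_vertices'.2 hvs⟩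
    exact congrArg Rect.swap h

lemma mem_thetas {r : Rect} (hr : r ∈ P) {α : Angle} (h : α = r.θ₁ ∨ α = r.θ₂) : α ∈ Thetas P := by
  simp only [Thetas, mem_iUnion]
  exact ⟨r, hr, h⟩

lemma mem_phis {r : Rect} (hr : r ∈ P) {α : Angle} (h : α = r.φ₁ ∨ α = r.φ₂) : α ∈ Phis P := by
  simp only [Phis, mem_iUnion]
  exact ⟨r, hr, h⟩

lemma exists_of_mem_thetas {α : Angle} (h : α ∈ Thetas P) : ∃ r ∈ P, ∃ σ, r.Vert α σ := by
  simp only [Thetas, mem_iUnion] at h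
  obtain ⟨r, hr, h⟩ := h
  exact ⟨r, hr, exists_isEnd h⟩

lemma exists_frame_of_vertex {r : Rect} {v : Torus} (h : v ∈ r.vertices) :
    ∃ σ ε, r.Vert v.1 σ ∧ r.Horiz v.2 ε := by
  obtain ⟨σ, hσ⟩ := exists_isEnd (show v.1 = r.θ₁ ∨ v.1 = r.θ₂ from h.1)
  obtain ⟨ε, hε⟩ := exists_isEnd (show v.2 = r.φ₁ ∨ v.2 = r.φ₂ from h.2)
  exact ⟨σ, ε, hσ, hε⟩

lemma vertex_of_frame {r : Rect} {α β : Angle} {σ ε : ℝ} (hθ : r.Vert α σ) (hφ : r.Horiz β ε) :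
    (α, β) ∈ r.vertices := ⟨hθ.end_eq, hφ.end_eq⟩

lemma vertices_subset_carrier (r : Rect) : r.vertices ⊆ r.carrier := by
  intro v hv
  obtain ⟨σ, ε, h1, h2⟩ := exists_frame_of_vertex hv
  exact ⟨h1.self_mem_arc, h2.self_mem_arc⟩

lemma eq_neg_of_sign_ne {s t : ℝ} (hs : s = 1 ∨ s = -1) (ht : t = 1 ∨ t = -1) (h : t ≠ s) :
    t = -s := by
  rcases hs with rfl | rfl <;> rcases ht with rfl | rfl <;> simp_all

lemma vertex_of_mem_inter (hP : ClosedDiagram P) {r s : Rect} (hr : r ∈ P) (hs : s ∈ P)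
    {v : Torus} (hvr : v ∈ r.vertices) (hvs : v ∈ s.carrier) :
    v ∈ s.vertices := by
  by_cases hrs : r = s
  · rw [← hrs]; exact hvr
  have hm : v ∈ r.carrier ∩ s.carrier := ⟨vertices_subset_carrier r hvr, hvs⟩
  rcases hP.compat hr hs hrs with h | h | ⟨q, h1, h2, -⟩
  · rw [h] at hm; exact hm.elim
  · exact (h hm).2
  · rw [h1] at hm; exact absurd hvr (Set.disjoint_left.1 h2 hm)

lemma inter_subset_vertices (hP : ClosedDiagram P) {r s : Rect} (hr : r ∈ P) (hs : s ∈ P)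
    (hrs : r ≠ s) {v : Torus} (hvr : v ∈ r.vertices) (hvs : v ∈ s.carrier) :
    r.carrier ∩ s.carrier ⊆ r.vertices ∩ s.vertices := by
  have hm : v ∈ r.carrier ∩ s.carrier := ⟨vertices_subset_carrier r hvr, hvs⟩
  rcases hP.compat hr hs hrs with h | h | ⟨q, h1, h2, -⟩
  · rw [h] at hm; exact hm.elim
  · exact h
  · rw [h1] at hm; exact absurd hvr (Set.disjoint_left.1 h2 hm)

/-- Rectangles with a common point that is not a vertex cross each other. -/
lemma crossing_of_mem_inter (hP : ClosedDiagram P) {r s : Rect} (hr : r ∈ P) (hs : s ∈ P)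
    (hrs : r ≠ s) {v : Torus} (hvr : v ∈ r.carrier) (hvs : v ∈ s.carrier)
    (hv : v ∉ r.vertices) :
    (Inside r.θ₁ r.θ₂ s.θ₁ s.θ₂ ∧ Inside s.φ₁ s.φ₂ r.φ₁ r.φ₂) ∨
      (Inside s.θ₁ s.θ₂ r.θ₁ r.θ₂ ∧ Inside r.φ₁ r.φ₂ s.φ₁ s.φ₂) := by
  have h1 : ∀ w ∈ r.vertices, w ∉ s.carrier := fun w hw hws =>
    hv (inter_subset_vertices hP hr hs hrs hw hws ⟨hvr, hvs⟩).1
  have h2 : ∀ w ∈ s.vertices, w ∉ r.carrier := fun w hw hwr =>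
    hv (inter_subset_vertices hP hs hr (Ne.symm hrs) hw hwr ⟨hvs, hvr⟩).2
  -- either a vertical side of `r` passes over `s`, or the arc of `s` contains no end of that of `r`
  by_cases hc : ∃ α, (α = r.θ₁ ∨ α = r.θ₂) ∧ α ∈ arc s.θ₁ s.θ₂
  · obtain ⟨α, hα, hαs⟩ := hc
    have h3 : ∀ β, (β = r.φ₁ ∨ β = r.φ₂) → β ∉ arc s.φ₁ s.φ₂ := fun β hβ hβs =>
      h1 (α, β) ⟨hα, hβ⟩ ⟨hαs, hβs⟩
    have h4 : Inside r.φ₁ r.φ₂ s.φ₁ s.φ₂ :=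
      inside_of_inter hvr.2 hvs.2 (h3 _ (Or.inl rfl)) (h3 _ (Or.inr rfl))
    have h5 : s.φ₁ ∈ arc r.φ₁ r.φ₂ := by
      obtain ⟨t, ht, e, hlt⟩ := h4
      refine mem_arc_iff_left.2 ⟨t, ⟨ht.le, ?_⟩, e⟩
      linarith [arcLen_nonneg s.φ₁ s.φ₂]
    have h6 : ∀ α, (α = s.θ₁ ∨ α = s.θ₂) → α ∉ arc r.θ₁ r.θ₂ := fun α hα hαr =>
      h2 (α, s.φ₁) ⟨hα, Or.inl rfl⟩ ⟨hαr, h5⟩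
    exact Or.inr ⟨inside_of_inter hvs.1 hvr.1 (h6 _ (Or.inl rfl)) (h6 _ (Or.inr rfl)), h4⟩
  · push Not at hc
    have h4 : Inside r.θ₁ r.θ₂ s.θ₁ s.θ₂ :=
      inside_of_inter hvr.1 hvs.1 (hc _ (Or.inl rfl)) (hc _ (Or.inr rfl))
    have h5 : s.θ₁ ∈ arc r.θ₁ r.θ₂ := by
      obtain ⟨t, ht, e, hlt⟩ := h4
      refine mem_arc_iff_left.2 ⟨t, ⟨ht.le, ?_⟩, e⟩
      linarith [arcLen_nonneg s.θ₁ s.θ₂]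
    have h6 : ∀ β, (β = s.φ₁ ∨ β = s.φ₂) → β ∉ arc r.φ₁ r.φ₂ := fun β hβ hβr =>
      h2 (s.θ₁, β) ⟨Or.inl rfl, hβ⟩ ⟨h5, hβr⟩
    exact Or.inl ⟨h4, inside_of_inter hvs.2 hvr.2 (h6 _ (Or.inl rfl)) (h6 _ (Or.inr rfl))⟩

lemma opposite_sign (hP : ClosedDiagram P) {r s : Rect} (hr : r ∈ P) (hs : s ∈ P) (hrs : r ≠ s)
    {α β : Angle} {σ ε σ' ε' : ℝ} (h1 : r.Vert α σ) (h2 : r.Horiz β ε) (h3 : s.Vert α σ')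
    (h4 : s.Horiz β ε') : σ' = -σ := by
  have hsub := inter_subset_vertices hP hr hs hrs (vertex_of_frame h1 h2)
    (vertices_subset_carrier s (vertex_of_frame h3 h4))
  have ha := r.wid_pos
  have ha' := s.wid_pos
  -- otherwise the horizontal sides at the common vertex overlap
  refine eq_neg_of_sign_ne h1.sign h3.sign fun h => ?_
  subst h
  set t := min (r.wid / 2) (s.wid / 2) with ht
  have ht0 : 0 < t := by positivity
  have ht1 : t < r.wid := by linarith [min_le_left (r.wid / 2) (s.wid / 2)]
  have ht2 : t < s.wid := by linarith [min_le_right (r.wid / 2) (s.wid / 2)]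
  have hz : (0 : ℝ) ∈ Icc 0 r.hei := ⟨le_rfl, r.hei_pos.le⟩
  have m1 := (mem_carrier_iff h1 h2).2 ⟨t, ⟨ht0.le, ht1.le⟩, 0, hz, rfl⟩
  have m2 := (mem_carrier_iff h3 h4).2 ⟨t, ⟨ht0.le, ht2.le⟩, 0, ⟨le_rfl, s.hei_pos.le⟩, rfl⟩
  have e : (α + (σ' * t : ℝ), β + (ε * 0 : ℝ)) = (α + (σ' * t : ℝ), β + (ε' * 0 : ℝ)) := by simp
  rw [← e] at m2
  have := ((mem_vertices_iff h1 h2 ⟨ht0.le, ht1.le⟩ hz).1 (hsub ⟨m1, m2⟩).1).1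
  rcases this with h | h <;> linarith

lemma Rect.swap_injective : Function.Injective Rect.swap :=
  Function.LeftInverse.injective (g := Rect.swap) fun _ => rfl

/-- Two rectangles that share a vertex lie in opposite quadrants at this vertex. -/
lemma opposite_frames (hP : ClosedDiagram P) {r s : Rect} (hr : r ∈ P) (hs : s ∈ P)
    (hrs : r ≠ s) {α β : Angle} {σ ε σ' ε' : ℝ} (h1 : r.Vert α σ)
    (h2 : r.Horiz β ε) (h3 : s.Vert α σ') (h4 : s.Horiz β ε') : σ' = -σ ∧ ε' = -ε :=
  ⟨opposite_sign hP hr hs hrs h1 h2 h3 h4, opposite_sign hP.swap (r := r.swap) (s := s.swap)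
    ⟨r, hr, rfl⟩ ⟨s, hs, rfl⟩ (Rect.swap_injective.ne hrs) h2 h1 h4 h3⟩

lemma vertex_of_common_side (hP : ClosedDiagram P) {r s : Rect} (hr : r ∈ P) (hs : s ∈ P)
    (hrs : r ≠ s) {α φ : Angle} {σ σ' : ℝ} (h1 : r.Vert α σ)
    (h2 : s.Vert α σ') (h3 : φ ∈ arc r.φ₁ r.φ₂) (h4 : φ ∈ arc s.φ₁ s.φ₂) :
    (α, φ) ∈ r.vertices ∧ (α, φ) ∈ s.vertices := by
  have hmr : (α, φ) ∈ r.carrier := ⟨h1.self_mem_arc, h3⟩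
  have hms : (α, φ) ∈ s.carrier := ⟨h2.self_mem_arc, h4⟩
  have key : (α, φ) ∈ r.vertices := by
    by_contra hv
    rcases crossing_of_mem_inter hP hr hs hrs hmr hms hv with ⟨h, -⟩ | ⟨h, -⟩
    · rcases h1.end_eq with rfl | rfl
      · exact h.left_not_mem hms.1
      · exact h.right_not_mem hms.1
    · rcases h2.end_eq with rfl | rfl
      · exact h.left_not_mem hmr.1
      · exact h.right_not_mem hmr.1
  exact ⟨key, vertex_of_mem_inter hP hr hs key hms⟩

lemma isClosed_arc (p q : Angle) : IsClosed (arc p q) := by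
  have : arc p q = (fun t : ℝ => p + (t : Angle)) '' Icc 0 (arcLen p q) := by
    ext x
    rw [mem_arc_iff_left]
    constructor
    · rintro ⟨t, ht, rfl⟩; exact ⟨t, ht, rfl⟩
    · rintro ⟨t, ht, rfl⟩; exact ⟨t, ht, rfl⟩
  rw [this]
  exact (isCompact_Icc.image (continuous_angle p continuous_id)).isClosed

lemma preconnectedSpace_angle : PreconnectedSpace Angle := by
  refine ⟨?_⟩
  have h : (univ : Set Angle) = (fun t : ℝ => (t : Angle)) '' univ := by
    refine (eq_univ_of_forall fun x => ?_).symm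
    induction x using Angle.induction_on with
    | h t => exact ⟨t, mem_univ _, rfl⟩
  rw [h]
  exact isPreconnected_univ.image _ Angle.continuous_coe.continuousOn

lemma eventually_angle {p : Angle → Prop} {θ : Angle} :
    (∀ᶠ x in 𝓝 θ, p x) ↔ ∀ᶠ t : ℝ in 𝓝 0, p (θ + (t : Angle)) := by
  rw [nhds_angle, eventually_map]

lemma eventually_mem_arc {θ a b : Angle} (h : θ ∈ arc a b) (ha : θ ≠ a) (hb : θ ≠ b) :
    ∀ᶠ x in 𝓝 θ, x ∈ arc a b := by
  obtain ⟨t0, ⟨h0, h1⟩, rfl⟩ := mem_arc_iff_left.1 h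
  have h0 : 0 < t0 := by
    refine lt_of_le_of_ne h0 ?_
    rintro rfl; simp at ha
  have h1 : t0 < arcLen a b := by
    refine lt_of_le_of_ne h1 ?_
    rintro rfl; exact hb (add_arcLen _ _)
  rw [eventually_angle]
  filter_upwards [eventually_abs_lt_zero h0, eventually_abs_lt_zero (sub_pos.2 h1)] with t h3 h4
  rw [abs_lt] at h3 h4
  refine mem_arc_iff_left.2 ⟨t0 + t, ⟨by linarith, by linarith⟩, ?_⟩
  rw [Angle.coe_add, add_assoc]

/-- The sides over `α` cover the whole circle `{α} × 𝕊¹`. -/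
lemma exists_side_over (hP : ClosedDiagram P) {α : Angle} (hα : α ∈ Thetas P)
    (φ : Angle) : ∃ r ∈ P, (∃ σ, r.Vert α σ) ∧ φ ∈ arc r.φ₁ r.φ₂ := by
  have := preconnectedSpace_angle
  let S : Set Angle := ⋃ r ∈ {r ∈ P | ∃ σ, r.Vert α σ}, arc r.φ₁ r.φ₂
  have hcl : IsClosed S := (hP.finite_theta α).isClosed_biUnion fun r _ => isClosed_arc _ _
  have hop : IsOpen S := by
    rw [isOpen_iff_eventually]
    intro φ hφ
    simp only [S, mem_iUnion] at hφ
    obtain ⟨r, ⟨hr, σ, hσ⟩, hφr⟩ := hφ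
    rw [eventually_angle]
    have hev : ∀ c : ℝ, 0 < c → ∀ᶠ t : ℝ in 𝓝 0, |t| < c := fun c hc =>
      eventually_abs_lt continuousAt_id (by simpa using hc)
    by_cases he : φ = r.φ₁ ∨ φ = r.φ₂
    · obtain ⟨ε, hε⟩ := exists_isEnd he
      have hε : r.Horiz φ ε := hε
      obtain ⟨s, hs, hsr, hvs⟩ := hP.partner r hr _ (vertex_of_frame hσ hε)
      obtain ⟨σ', ε', h3, h4⟩ := exists_frame_of_vertex hvs
      obtain ⟨-, e2⟩ := opposite_frames hP hr hs (Ne.symm hsr) hσ hε h3 h4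
      filter_upwards [hev _ r.hei_pos, hev _ s.hei_pos] with t h5 h6
      simp only [S, mem_iUnion]
      by_cases ht : 0 ≤ ε * t
      · refine ⟨r, ⟨hr, σ, hσ⟩, hε.mem_arc_iff.2 ⟨ε * t, ⟨ht, ?_⟩, ?_⟩⟩
        · exact (le_abs_self _).trans ((hε.abs_sign_mul _).trans_le h5.le)
        · rw [← mul_assoc, hε.mul_self, one_mul]
      · refine ⟨s, ⟨hs, σ', h3⟩, h4.mem_arc_iff.2 ⟨ε' * t, ⟨?_, ?_⟩, ?_⟩⟩
        · rw [e2]; linarith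
        · exact (le_abs_self _).trans ((h4.abs_sign_mul _).trans_le h6.le)
        · rw [← mul_assoc, h4.mul_self, one_mul]
    · push Not at he
      filter_upwards [eventually_angle.1 (eventually_mem_arc hφr he.1 he.2)] with t ht
      simp only [S, mem_iUnion]
      exact ⟨r, ⟨hr, σ, hσ⟩, ht⟩
  have hne : S.Nonempty := by
    obtain ⟨r, hr, σ, hσ⟩ := exists_of_mem_thetas hα
    refine ⟨r.φ₁, ?_⟩
    simp only [S, mem_iUnion]
    exact ⟨r, ⟨hr, σ, hσ⟩, (exists_vert_horiz r).2.self_mem_arc⟩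
  have hu := IsClopen.eq_univ ⟨hcl, hop⟩ hne
  have hm : φ ∈ S := by rw [hu]; trivial
  simp only [S, mem_iUnion] at hm
  obtain ⟨r, ⟨hr, h⟩, hφ⟩ := hm
  exact ⟨r, hr, h, hφ⟩

/-! ### The tiles near a point of the surface -/

lemma end_or_deep_theta (hP : ClosedDiagram P) {α : Angle} (hα : α ∈ Thetas P) :
    ∃ e > 0, ∀ r ∈ P, ∀ x : ℝ, |x| < e → α + (x : Angle) ∈ arc r.θ₁ r.θ₂ →
      (∃ σ, r.Vert α σ) ∨ ∃ T : ℝ, α = r.θ₁ + (T : Angle) ∧ e ≤ T ∧ T ≤ r.wid - e := by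
  obtain ⟨e, he, hg⟩ := hP.gap_theta α hα
  refine ⟨e, he, fun r hr x hx hm => ?_⟩
  rcases end_or_deep hx hm (fun t ht h => by rw [h]; exact hg t ht (h ▸ mem_thetas hr (Or.inl rfl)))
    (fun t ht h => by rw [h]; exact hg t ht (h ▸ mem_thetas hr (Or.inr rfl))) with h | h
  · exact Or.inl (exists_isEnd h)
  · exact Or.inr h

/-- Close to a vertex there are only the two rectangles that have this vertex. -/
lemma eventually_vertex (hP : ClosedDiagram P) {r0 : Rect} (hr0 : r0 ∈ P) {v : Torus}
    (hv : v ∈ r0.vertices) : ∀ᶠ w in 𝓝 v, ∀ r ∈ P, w ∈ r.carrier → v ∈ r.vertices := by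
  obtain ⟨e1, he1, h1⟩ := end_or_deep_theta hP (mem_thetas hr0 hv.1)
  obtain ⟨e2, he2, h2⟩ := end_or_deep_theta hP.swap (α := v.2)
    (by rw [thetas_swap]; exact mem_phis hr0 hv.2)
  have k1 : ∀ᶠ θ in 𝓝 v.1, ∀ r ∈ P, θ ∈ arc r.θ₁ r.θ₂ → v.1 ∈ arc r.θ₁ r.θ₂ := by
    rw [eventually_angle]
    filter_upwards [eventually_abs_lt (c := e1) continuousAt_id (by simpa using he1)] with t ht r hr hm
    rcases h1 r hr t ht hm with ⟨σ, hσ⟩ | ⟨T, hT, h3, h4⟩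
    · exact hσ.self_mem_arc
    · exact mem_arc_iff_left.2 ⟨T, ⟨by linarith, h4.trans (by simp only [Rect.wid]; linarith)⟩, hT⟩
  have k2 : ∀ᶠ θ in 𝓝 v.2, ∀ r ∈ P, θ ∈ arc r.φ₁ r.φ₂ → v.2 ∈ arc r.φ₁ r.φ₂ := by
    rw [eventually_angle]
    filter_upwards [eventually_abs_lt (c := e2) continuousAt_id (by simpa using he2)] with t ht r hr hm
    rcases h2 r.swap ⟨r, hr, rfl⟩ t ht hm with ⟨σ, hσ⟩ | ⟨T, hT, h3, h4⟩
    · exact hσ.self_mem_arc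
    · exact mem_arc_iff_left.2 ⟨T, ⟨by linarith, h4.trans (sub_le_self _ he2.le)⟩, hT⟩
  rw [nhds_prod_eq (x := v.1) (y := v.2)]
  filter_upwards [k1.prod_mk k2] with w hw r hr hm
  exact vertex_of_mem_inter hP hr0 hr hv ⟨hw.1 r hr hm.1, hw.2 r hr hm.2⟩

/-- Close to the point `α` of the circle `q = 0` there are only the tiles of the rectangles with a
side over `α`: any other rectangle is much wider than the neighbourhood, and its tile stays away
from the circle, as is seen from a comparison with a narrow and high rectangle. -/
lemma eventually_side (hP : ClosedDiagram P) {α : Angle} (hα : α ∈ Thetas P) :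
    ∀ᶠ w in 𝓝 (α, (0 : ℝ)), ∀ r ∈ P, ∀ φ, Over r (w.1, φ) w.2 → ∃ σ, r.Vert α σ := by
  have hπ := Real.pi_pos
  obtain ⟨e, he, hg⟩ := end_or_deep_theta hP hα
  -- all rectangles that contain `α` at depth `e` are compared with one rectangle, which is narrower
  -- and higher than any of them and is placed symmetrically around `α`
  have hcont : ContinuousOn (fun p : ℝ² => mfun (rectH (3 * e / 2) (2 * π + 2) p.1 p.2))
      (Icc (e / 4) (5 * e / 4) ×ˢ Icc 1 (2 * π + 1)) := by
    rintro ⟨s, t⟩ ⟨⟨h1, h2⟩, h3, h4⟩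
    simp only at h1 h2 h3 h4
    exact (contDiffAt_mfun_rectH (by linarith) (by linarith) (by linarith)
      (by linarith)).continuousAt.continuousWithinAt
  obtain ⟨⟨s0, t0⟩, ⟨⟨m1, m2⟩, m3, m4⟩, hmin⟩ := (isCompact_Icc.prod isCompact_Icc).exists_isMinOn
    ⟨(e / 2, 1), ⟨⟨by simp only; linarith, by simp only; linarith⟩,
      ⟨le_rfl, by simp only; linarith⟩⟩⟩ hcont
  simp only at m1 m2 m3 m4
  set q0 := mfun (rectH (3 * e / 2) (2 * π + 2) s0 t0) with hq0
  have hq0pos : 0 < q0 := (mfun_rectH_interior ⟨by linarith, by linarith⟩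
    ⟨by linarith, by linarith⟩).1
  have k1 : ∀ᶠ θ in 𝓝 α, ∃ x : ℝ, |x| < e / 2 ∧ θ = α + (x : Angle) := by
    rw [eventually_angle]
    filter_upwards [eventually_abs_lt (c := e / 2) continuousAt_id (by simpa using he)] with t ht
    exact ⟨t, ht, rfl⟩
  have k2 : ∀ᶠ q in 𝓝 (0 : ℝ), q < q0 := continuousAt_id.eventually_lt continuousAt_const hq0pos
  rw [nhds_prod_eq]
  filter_upwards [k1.prod_mk k2] with w hw r hr φ ho
  obtain ⟨⟨x, hx, hwx⟩, hq⟩ := hw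
  rw [hwx] at ho
  rcases hg r hr x (by linarith) ho.1.1 with h | ⟨T, hT, h1, h2⟩
  · exact h
  exfalso
  obtain ⟨hθ, hφ⟩ := exists_vert_horiz r
  obtain ⟨y, hy, hy'⟩ := hφ.mem_arc_iff.1 ho.1.2
  have hy : y ∈ Icc 0 r.hei := hy
  simp only at hy'
  rw [abs_lt] at hx
  have hxm : T + x ∈ Icc 0 r.wid := ⟨by linarith, by linarith⟩
  have hv : ((α + (x : Angle), φ) : Torus) = (r.θ₁ + (1 * (T + x) : ℝ), r.φ₁ + (1 * y : ℝ)) := by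
    rw [hT, hy', add_assoc, ← Angle.coe_add, one_mul (T + x)]
  rw [hv, over_coord_iff hθ hφ hxm hy] at ho
  have hw2 : w.2 = mfun (rectH r.wid r.hei (T + x) y) := by
    refine ho.2.resolve_left ?_
    rintro ⟨h | h, -⟩ <;> linarith
  have hcmp := rectH_lt_of_crossing (a1 := r.wid) (b1 := r.hei) (a2 := 3 * e / 2)
    (b2 := 2 * π + 2) (x0 := T - 3 * e / 4) (y0 := 1) (x := T + x) (y := y) (by linarith)
    r.hei_pos (by linarith) (by linarith) one_pos (by linarith [r.hei_lt])
    ⟨by linarith, by linarith⟩ hy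
  have hmem : (T + x - (T - 3 * e / 4), y + 1) ∈ Icc (e / 4) (5 * e / 4) ×ˢ Icc 1 (2 * π + 1) :=
    ⟨⟨by simp only; linarith, by simp only; linarith⟩,
      ⟨by simp only; linarith [hy.1], by simp only; linarith [hy.2, r.hei_lt]⟩⟩
  have h3 := hmin hmem
  simp only [mem_ofPred_eq] at h3
  have h4 := mfun_lt (rectH_mem r.hei_pos hxm hy).1 hcmp
    (rectH_mem (by linarith) ⟨by linarith, by linarith⟩ ⟨by linarith [hy.1],
      by linarith [hy.2, r.hei_lt]⟩).2
  linarith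

lemma gap_lt {A : Set Angle} {α : Angle} {e t : ℝ} {n : ℝ}
    (hg : ∀ t : ℝ, |t| < e → α + (t : Angle) ∈ A → α + (t : Angle) = α)
    (hn : n = 1 ∨ n = -1) (ht : 0 < t) (ht2 : t < 2 * π)
    (hm : α + (n * t : ℝ) ∈ A) : e ≤ t := by
  by_contra hcon
  push Not at hcon
  have habs : |n * t| = t := by rw [abs_mul, (sign_eq hn).2, one_mul, abs_of_pos ht]
  have h1 := hg (n * t) (by rw [habs]; exact hcon) hm
  have h2 : α + (n * t : ℝ) = α + (0 : ℝ) := by simpa using h1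
  have h3 := add_coe_inj_of_abs_lt h2 (by rw [sub_zero, habs]; exact ht2)
  rw [h3] at habs
  simp at habs
  linarith

/-- Close to an interior point of the tile of `s`, the tiles of the wider and thinner rectangles are
strictly above the tile of `s`. -/
lemma exists_lower_bound_of_crossing (hP : ClosedDiagram P) {s : Rect} (hs : s ∈ P) {x0 y0 : ℝ}
    (hx0 : x0 ∈ Ioo 0 s.wid) (hy0 : y0 ∈ Ioo 0 s.hei) :
    ∃ q1 > mfun (rectH s.wid s.hei x0 y0), ∀ᶠ w in 𝓝 (x0, y0), ∀ r ∈ P,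
      Inside r.θ₁ r.θ₂ s.θ₁ s.θ₂ → Inside s.φ₁ s.φ₂ r.φ₁ r.φ₂ → ∀ q,
      Over r (s.θ₁ + (w.1 : Angle), s.φ₁ + (w.2 : Angle)) q → q1 ≤ q := by
  obtain ⟨e1, he1, g1⟩ := hP.gap_theta s.θ₁ (mem_thetas hs (Or.inl rfl))
  obtain ⟨e2, he2, g2⟩ := hP.gap_theta s.θ₂ (mem_thetas hs (Or.inr rfl))
  obtain ⟨e3, he3, g3⟩ := hP.gap_phi s.φ₁ (mem_phis hs (Or.inl rfl))
  obtain ⟨e4, he4, g4⟩ := hP.gap_phi s.φ₂ (mem_phis hs (Or.inr rfl))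
  -- a lower bound for the distances between the sides of `s` and those of crossing rectangles
  set m := min (min (min e1 e2) (min e3 e4)) (min y0 (s.hei - y0)) with hm
  have hm0 : 0 < m := by
    have h1 := hy0.1
    have h2 : 0 < s.hei - y0 := by linarith [hy0.2]
    positivity
  have k1 : m ≤ e1 := (min_le_left _ _).trans ((min_le_left _ _).trans (min_le_left _ _))
  have k2 : m ≤ e2 := (min_le_left _ _).trans ((min_le_left _ _).trans (min_le_right _ _))
  have k3 : m ≤ e3 := (min_le_left _ _).trans ((min_le_right _ _).trans (min_le_left _ _))
  have k4 : m ≤ e4 := (min_le_left _ _).trans ((min_le_right _ _).trans (min_le_right _ _))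
  have k5 : m ≤ y0 := (min_le_right _ _).trans (min_le_left _ _)
  have k6 : m ≤ s.hei - y0 := (min_le_right _ _).trans (min_le_right _ _)
  set e := m / 2 with he
  have he0 : 0 < e := by positivity
  have hhm : 0 < s.hei - 2 * e := by linarith [hy0.1]
  -- the rectangle `s`, widened and lowered by `e` on each side, lies between `s` and all rectangles
  -- `r`
  have hlt : rectH (s.wid + 2 * e) (s.hei - 2 * e) (x0 + e) (y0 - e) < rectH s.wid s.hei x0 y0 := by
    have := rectH_lt_of_crossing (a1 := s.wid + 2 * e) (b1 := s.hei - 2 * e) (a2 := s.wid)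
      (b2 := s.hei) (x0 := e) (y0 := e) (x := x0 + e) (y := y0 - e) s.wid_pos hhm he0 (by linarith)
      he0 (by linarith) ⟨by linarith [hx0.1], by linarith [hx0.2]⟩ ⟨by linarith, by linarith⟩
    simpa using this
  have hmem : rectH s.wid s.hei x0 y0 ∈ Icc (0 : ℝ) 1 :=
    rectH_mem s.hei_pos ⟨hx0.1.le, hx0.2.le⟩ ⟨hy0.1.le, hy0.2.le⟩
  have hmem' : rectH (s.wid + 2 * e) (s.hei - 2 * e) (x0 + e) (y0 - e) ∈ Icc (0 : ℝ) 1 :=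
    rectH_mem hhm ⟨by linarith [hx0.1], by linarith [hx0.2]⟩ ⟨by linarith, by linarith⟩
  have hqlt := mfun_lt hmem'.1 hlt hmem.2
  obtain ⟨q1, hq1, hq1'⟩ := exists_between hqlt
  refine ⟨q1, hq1, ?_⟩
  have hcont : ContinuousAt (fun p : ℝ² => mfun (rectH (s.wid + 2 * e) (s.hei - 2 * e)
      (p.1 + e) (p.2 - e))) (x0, y0) :=
    ContinuousAt.comp (g := fun p : ℝ² => mfun (rectH (s.wid + 2 * e) (s.hei - 2 * e) p.1 p.2))
      (f := fun p : ℝ² => (p.1 + e, p.2 - e)) (contDiffAt_mfun_rectH (by simp only; linarith [hx0.1])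
      (by simp only; linarith [hx0.2]) (by simp only; linarith) (by simp only; linarith)).continuousAt
      (by fun_prop)
  have hev1 := continuousAt_const.eventually_lt hcont hq1'
  have hev2 : ∀ᶠ w in 𝓝 (x0, y0), w ∈ Ioo 0 s.wid ×ˢ Ioo e (s.hei - e) :=
    (isOpen_Ioo.prod isOpen_Ioo).mem_nhds ⟨hx0, by simp only; linarith, by simp only; linarith⟩
  filter_upwards [hev1, hev2] with w hw hw2 r hr hI1 hI2 q ho
  obtain ⟨⟨hw3, hw4⟩, hw5, hw6⟩ := hw2
  obtain ⟨t, ht, et, hlt1⟩ := hI1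
  obtain ⟨u, hu, eu, hlt2⟩ := hI2
  have ews : arcLen s.θ₁ s.θ₂ = s.wid := rfl
  have ewr : arcLen r.θ₁ r.θ₂ = r.wid := rfl
  have ehs : arcLen s.φ₁ s.φ₂ = s.hei := rfl
  have ehr : arcLen r.φ₁ r.φ₂ = r.hei := rfl
  rw [ews, ewr] at hlt1
  rw [ehs, ehr] at hlt2
  have p1 := s.wid_pos
  have p2 := r.wid_lt
  have p3 := s.hei_lt
  have p4 := r.hei_pos
  have d1 : e1 ≤ t := by
    refine gap_lt g1 (Or.inr rfl) ht (by linarith) ?_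
    have : s.θ₁ + (-1 * t : ℝ) = r.θ₁ := by rw [et, add_assoc, ← Angle.coe_add]; simp
    rw [this]; exact mem_thetas hr (Or.inl rfl)
  have d2 : e2 ≤ r.wid - (t + s.wid) := by
    refine gap_lt g2 (Or.inl rfl) (by linarith) (by linarith) ?_
    have : s.θ₂ + ((1 * (r.wid - (t + s.wid)) : ℝ) : Angle) = r.θ₂ := by
      have h := add_arcLen s.θ₁ s.θ₂
      have h' := add_arcLen r.θ₁ r.θ₂
      rw [ews] at h
      rw [ewr] at h'
      rw [← h, et, add_assoc, add_assoc, ← Angle.coe_add, ← Angle.coe_add, ← h']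
      congr 2; ring
    rw [this]; exact mem_thetas hr (Or.inr rfl)
  have d3 : e3 ≤ u := by
    refine gap_lt g3 (Or.inl rfl) hu (by linarith) ?_
    rw [one_mul, ← eu]; exact mem_phis hr (Or.inl rfl)
  have d4 : e4 ≤ s.hei - (u + r.hei) := by
    refine gap_lt g4 (Or.inr rfl) (by linarith) (by linarith) ?_
    have : s.φ₂ + ((-1 * (s.hei - (u + r.hei)) : ℝ) : Angle) = r.φ₂ := by
      have h := add_arcLen s.φ₁ s.φ₂
      have h' := add_arcLen r.φ₁ r.φ₂
      rw [ehs] at h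
      rw [ehr] at h'
      rw [← h', eu, ← h, add_assoc, add_assoc, ← Angle.coe_add, ← Angle.coe_add]
      congr 2; ring
    rw [this]; exact mem_phis hr (Or.inr rfl)
  obtain ⟨hθ, hφ⟩ := exists_vert_horiz r
  obtain ⟨y, hy, hy'⟩ := hφ.mem_arc_iff.1 ho.1.2
  have hy : y ∈ Icc 0 r.hei := hy
  have hwy : w.2 = u + y := by
    simp only at hy'
    rw [eu, one_mul, add_assoc, ← Angle.coe_add] at hy'
    refine add_coe_inj_of_abs_lt hy' ?_
    rw [abs_lt]
    constructor <;> linarith [hy.1, hy.2]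
  have hxm : t + w.1 ∈ Icc 0 r.wid := ⟨by linarith, by linarith⟩
  have hv : ((s.θ₁ + (w.1 : Angle), s.φ₁ + (w.2 : Angle)) : Torus) =
      (r.θ₁ + (1 * (t + w.1) : ℝ), r.φ₁ + (1 * y : ℝ)) := by
    refine Prod.ext ?_ hy'
    simp only
    rw [et, add_assoc, ← Angle.coe_add, one_mul]
  rw [hv, over_coord_iff hθ hφ hxm hy] at ho
  have hq : q = mfun (rectH r.wid r.hei (t + w.1) y) := by
    refine ho.2.resolve_left ?_
    rintro ⟨h | h, -⟩ <;> linarith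
  have hcmp := rectH_lt_of_crossing (a1 := r.wid) (b1 := r.hei) (a2 := s.wid + 2 * e)
    (b2 := s.hei - 2 * e) (x0 := t - e) (y0 := u - e) (x := t + w.1) (y := y) (by linarith) p4
    (by linarith) (by linarith) (by linarith) (by linarith) ⟨by linarith, by linarith⟩ hy
  have ex : t + w.1 - (t - e) = w.1 + e := by ring
  have ey : y + (u - e) = w.2 - e := by rw [hwy]; ring
  rw [ex, ey] at hcmp
  have h4 := mfun_lt (rectH_mem r.hei_pos hxm hy).1 hcmp
    (rectH_mem hhm ⟨by linarith, by linarith⟩ ⟨by linarith, by linarith⟩).2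
  rw [hq]
  linarith

/-- A point of the tile away from the two circles and the vertices is over an interior point. -/
lemma interior_of_over {s : Rect} {α β : Angle} {σ ε x y q : ℝ} (hθ : s.Vert α σ) (hφ : s.Horiz β ε) (hx : x ∈ Icc 0 s.wid)
    (hy : y ∈ Icc 0 s.hei)
    (ho : Over s (α + (σ * x : ℝ), β + (ε * y : ℝ)) q)
    (hv : (α + (σ * x : ℝ), β + (ε * y : ℝ)) ∉ s.vertices)
    (hq : q ∈ Ioo (0 : ℝ) 1) :
    x ∈ Ioo 0 s.wid ∧ y ∈ Ioo 0 s.hei ∧ q = mfun (rectH s.wid s.hei x y) := by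
  rw [mem_vertices_iff hθ hφ hx hy] at hv
  have hq' := ((over_coord_iff hθ hφ hx hy).1 ho).2.resolve_left hv
  have hpx : ¬(x = 0 ∨ x = s.wid) := by
    intro hc
    have : rectH s.wid s.hei x y = 1 := by
      rcases hc with rfl | rfl
      · exact rectH_left _ _ _
      · exact rectH_right _ _ _
    rw [hq', this, mfun_one] at hq
    exact lt_irrefl _ hq.1
  push Not at hpx
  have hx' : x ∈ Ioo 0 s.wid := ⟨lt_of_le_of_ne hx.1 (Ne.symm hpx.1), lt_of_le_of_ne hx.2 hpx.2⟩
  have hpy : ¬(y = 0 ∨ y = s.hei) := by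
    intro hc
    have : rectH s.wid s.hei x y = 0 := by
      rcases hc with rfl | rfl
      · exact rectH_bottom s.hei_pos hx'.1 hx'.2
      · exact rectH_top s.hei_pos hx'.1 hx'.2
    rw [hq', this, mfun_zero] at hq
    exact lt_irrefl _ hq.2
  push Not at hpy
  exact ⟨hx', ⟨lt_of_le_of_ne hy.1 (Ne.symm hpy.1), lt_of_le_of_ne hy.2 hpy.2⟩, hq'⟩

/-- Close to an interior point of a tile there is no other tile. -/
lemma eventually_eq_of_interior (hP : ClosedDiagram P) {s : Rect} (hs : s ∈ P) {v : Torus} {q : ℝ}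
    (ho : Over s v q) (hv : v ∉ s.vertices) (hq : q ∈ Ioo (0 : ℝ) 1) :
    ∀ᶠ w in 𝓝 (v, q), ∀ r ∈ P, Over r w.1 w.2 → r = s := by
  obtain ⟨hθ, hφ⟩ := exists_vert_horiz s
  obtain ⟨x0, hx0, y0, hy0, rfl, -⟩ := ho.exists_coord hθ hφ
  obtain ⟨hx0', hy0', hq'⟩ := interior_of_over hθ hφ hx0 hy0 ho hv hq
  rw [mem_vertices_iff hθ hφ hx0 hy0] at hv
  obtain ⟨q1, hq1, hev1⟩ := exists_lower_bound_of_crossing hP hs hx0' hy0'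
  obtain ⟨q2, hq2, hev2⟩ := exists_lower_bound_of_crossing hP.swap (s := s.swap) ⟨s, hs, rfl⟩
    (x0 := y0) (y0 := x0) hy0' hx0'
  have e2 : mfun (rectH s.swap.wid s.swap.hei y0 x0) = 1 - q := by
    have e3 : rectH s.swap.wid s.swap.hei y0 x0 = 1 - rectH s.wid s.hei x0 y0 :=
      rectH_swap s.wid_pos s.hei_pos hx0 hy0 hv
    rw [e3, mfun_one_sub (rectH_mem s.hei_pos hx0 hy0), ← hq']
  rw [e2] at hq2
  rw [← hq'] at hq1
  have hsw : Tendsto (fun w : ℝ² => (w.2, w.1)) (𝓝 (x0, y0)) (𝓝 (y0, x0)) :=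
    Continuous.tendsto' (by fun_prop) _ _ rfl
  have hin : ∀ᶠ w in 𝓝 (x0, y0), w ∈ Ioo 0 s.wid ×ˢ Ioo 0 s.hei :=
    (isOpen_Ioo.prod isOpen_Ioo).mem_nhds ⟨hx0', hy0'⟩
  have hev3 := hev1.and ((hsw.eventually hev2).and hin)
  have hT : 𝓝 ((s.θ₁ + (1 * x0 : ℝ), s.φ₁ + (1 * y0 : ℝ)) : Torus) =
      map (fun w : ℝ² => ((s.θ₁ + (w.1 : Angle), s.φ₁ + (w.2 : Angle)) : Torus)) (𝓝 (x0, y0)) := by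
    have hopen : ∀ α : Angle, IsOpenMap (fun x : ℝ => α + (x : Angle)) := fun α =>
      (isOpenMap_add_left α).comp QuotientAddGroup.isOpenMap_coe
    have h1 : IsOpenMap (fun w : ℝ² => ((s.θ₁ + (w.1 : Angle), s.φ₁ + (w.2 : Angle)) : Torus)) :=
      (hopen s.θ₁).prodMap (hopen s.φ₁)
    have h2 : Continuous (fun w : ℝ² => ((s.θ₁ + (w.1 : Angle), s.φ₁ + (w.2 : Angle)) : Torus)) :=
      (continuous_angle _ continuous_fst).prodMk (continuous_angle _ continuous_snd)
    have := h1.map_nhds_eq (x := (x0, y0)) h2.continuousAt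
    simp only [one_mul]
    exact this.symm
  rw [nhds_prod_eq, hT]
  have hqev : ∀ᶠ t in 𝓝 q, t < q1 ∧ 1 - t < q2 :=
    (continuousAt_id.eventually_lt continuousAt_const hq1).and
      (ContinuousAt.eventually_lt (f := fun t : ℝ => 1 - t) (by fun_prop) continuousAt_const hq2)
  have hev4 : ∀ᶠ v in map (fun w : ℝ² =>
      ((s.θ₁ + (w.1 : Angle), s.φ₁ + (w.2 : Angle)) : Torus)) (𝓝 (x0, y0)),
      v ∈ s.carrier ∧ v ∉ s.vertices ∧ ∀ r ∈ P, (Inside r.θ₁ r.θ₂ s.θ₁ s.θ₂ →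
        Inside s.φ₁ s.φ₂ r.φ₁ r.φ₂ → ∀ q, Over r v q → q1 ≤ q) ∧
        (Inside s.θ₁ s.θ₂ r.θ₁ r.θ₂ → Inside r.φ₁ r.φ₂ s.φ₁ s.φ₂ → ∀ q, Over r v q →
          q2 ≤ 1 - q) := by
    rw [eventually_map]
    filter_upwards [hev3] with w hw
    obtain ⟨h1, h2, ⟨h3, h4⟩, h5, h6⟩ := hw
    have hwx : w.1 ∈ Icc 0 s.wid := ⟨h3.le, h4.le⟩
    have hwy : w.2 ∈ Icc 0 s.hei := ⟨h5.le, h6.le⟩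
    have hm := (mem_carrier_iff hθ hφ).2 ⟨w.1, hwx, w.2, hwy, rfl⟩
    have hn := (mem_vertices_iff hθ hφ hwx hwy).not.2 (by rintro ⟨h | h, -⟩ <;> linarith)
    rw [one_mul, one_mul] at hm hn
    refine ⟨hm, hn, fun r hr => ⟨fun i1 i2 q ho => h1 r hr i1 i2 q ho, fun i1 i2 q ho => ?_⟩⟩
    exact h2 r.swap ⟨r, hr, rfl⟩ i2 i1 (1 - q) (over_swap.2 ho)
  filter_upwards [hev4.prod_mk hqev] with w hw r hr hor
  by_contra hne
  obtain ⟨⟨h1, h2, h3⟩, h4, h5⟩ := hw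
  have hnr : w.1 ∉ r.vertices := fun h => h2 (vertex_of_mem_inter hP hr hs h h1)
  rcases crossing_of_mem_inter hP hr hs hne hor.1 h1 hnr with ⟨i1, i2⟩ | ⟨i1, i2⟩
  · have := (h3 r hr).1 i1 i2 _ hor
    linarith
  · have := (h3 r hr).2 i1 i2 _ hor
    linarith

end

section

variable {P : Set Rect} {r s : Rect} {α β : Angle} {σ ε x y q : ℝ}

/-! ### Local equations of the surface away from the two circles -/

lemma pt_mem_surface_iff {θ φ : Angle} (hq : q ∈ Ioo (0 : ℝ) 1) :
    pt θ φ q ∈ surface P ↔ ∃ r ∈ P, Over r (θ, φ) q := by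
  rw [mem_surface_iff]
  constructor
  · rintro ⟨r, hr, v, q', ho, h⟩
    obtain ⟨e1, e2, e3⟩ := (pt_eq_iff (Ioo_subset_Icc_self hq) ho.2.1).1 h
    have e2 := e2.resolve_left hq.2.ne
    have e3 := e3.resolve_left hq.1.ne'
    subst e1 e2 e3
    exact ⟨r, hr, ho⟩
  · rintro ⟨r, hr, ho⟩
    exact ⟨r, hr, _, q, ho, rfl⟩

lemma over_near_side_iff (hθ : r.Vert α σ) (hφ : r.Horiz β ε) (hq : q ∈ Ico (0 : ℝ) 1)
    (hx : |x| < r.wid) (hx' : |x| < 2 * π - r.wid) (hy : y ∈ Icc 0 r.hei) :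
    Over r (α + (σ * x : ℝ), β + (ε * y : ℝ)) q ↔ tileEq r.wid r.hei ((y, q), x) = 0 := by
  have hw := r.wid_lt
  rw [abs_lt] at hx'
  constructor
  · intro h
    have h0 := hθ.coord_mem h.1.1 (by change r.wid - _ < _; linarith) (by linarith [r.wid_pos])
    exact ((over_iff_tileEq hθ hφ ⟨h0.1, (le_abs_self x).trans_lt hx⟩ hy).1 h).2
  · intro h
    exact (over_iff_tileEq hθ hφ ⟨nonneg_of_tileEq r.hei_pos hx hy hq h,
      (le_abs_self x).trans_lt hx⟩ hy).2 ⟨Ico_subset_Icc_self hq, h⟩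

lemma over_near_vertex_iff (hθ : r.Vert α σ) (hφ : r.Horiz β ε) (hq : q ∈ Ico (0 : ℝ) 1)
    (hx : |x| < r.wid) (hx' : |x| < 2 * π - r.wid) (hy : |y| < r.hei)
    (hy' : |y| < 2 * π - r.hei) :
    Over r (α + (σ * x : ℝ), β + (ε * y : ℝ)) q ↔ 0 ≤ y ∧ tileEq r.wid r.hei ((y, q), x) = 0 := by
  have hy1 := (le_abs_self y).trans_lt hy
  rw [abs_lt] at hy'
  constructor
  · intro h
    have h0 := hφ.coord_mem h.1.2 (by change r.hei - _ < _; linarith) (by linarith [r.hei_pos])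
    exact ⟨h0.1, (over_near_side_iff hθ hφ hq hx hx' ⟨h0.1, hy1.le⟩).1 h⟩
  · rintro ⟨h0, h⟩
    exact (over_near_side_iff hθ hφ hq hx hx' ⟨h0, hy1.le⟩).2 h

/-- The two tiles with a common vertical segment fit together to the graph of a function of
class `C¹`. -/
lemma exists_vertex_graph {a b a' b' : ℝ} (ha : 0 < a) (hb : 0 < b) (ha' : 0 < a') (hb' : 0 < b')
    (hq : q ∈ Ioo (0 : ℝ) 1) : ∃ K : ℝ² → ℝ, ContDiffAt ℝ 1 K (0, q) ∧
      HasFDerivAt K ((q / (1 - q)) • fst ℝ ℝ ℝ) (0, q) ∧ K (0, q) = 0 ∧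
      ∀ᶠ p in 𝓝 (((0, q), 0) : ℝ³), ((0 ≤ p.1.1 ∧ tileEq a b p = 0) ∨
        (p.1.1 ≤ 0 ∧ tileEq a' b' ((-p.1.1, p.1.2), -p.2) = 0)) ↔ K p.1 = p.2 := by
  obtain ⟨f, hf, hf0, hf1⟩ := exists_corner_graph ha hb hq
  obtain ⟨g, hg, hg0, hg1⟩ := exists_corner_graph ha' hb' hq
  have hneg : ContDiff ℝ 1 (fun w : ℝ² => (-w.1, w.2)) := by fun_prop
  have hneg' : ∀ t : ℝ, HasFDerivAt (fun w : ℝ² => (-w.1, w.2))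
      ((-fst ℝ ℝ ℝ).prod (snd ℝ ℝ ℝ)) (0, t) := fun t =>
    hasFDerivAt_fst.neg.prodMk hasFDerivAt_snd
  have hg2 : ContDiffAt ℝ 1 (fun w : ℝ² => -g (-w.1, w.2)) (0, q) := by
    refine (ContDiffAt.comp (g := g) (f := fun w : ℝ² => (-w.1, w.2)) (0, q) ?_ hneg.contDiffAt).neg
    simpa using hg
  have hg3 : ∀ᶠ t in 𝓝 q, -g (-0, t) = 0 ∧ HasFDerivAt (fun w : ℝ² => -g (-w.1, w.2))
      ((t / (1 - t)) • fst ℝ ℝ ℝ) (0, t) := by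
    filter_upwards [hg1] with t ht
    refine ⟨by simp [ht.1], ?_⟩
    have h1 : HasFDerivAt g ((t / (1 - t)) • fst ℝ ℝ ℝ) (-0, t) := by simpa using ht.2
    have h2 := (HasFDerivAt.comp (g := g) (f := fun w : ℝ² => (-w.1, w.2)) (0, t) h1 (hneg' t)).neg
    exact h2.congr_fderiv (by ext <;> simp)
  have e0 : f (0, q) = 0 := hf1.self_of_nhds.1
  have e1 : g (0, q) = 0 := hg1.self_of_nhds.1
  -- the second tile lies in the opposite quadrant
  refine ⟨fun w => if 0 ≤ w.1 then f w else -g (-w.1, w.2), ?_, ?_, by simp [e0], ?_⟩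
  · refine contDiffAt_glue hf hg2 ?_
    filter_upwards [hf1, hg3] with t h1 h2
    exact ⟨by rw [h1.1, h2.1], _, h1.2, h2.2⟩
  · have h1 := hf1.self_of_nhds.2
    have h2 := hg3.self_of_nhds.2
    rw [hasFDerivAt_iff_isLittleO, Asymptotics.isLittleO_iff] at h1 h2 ⊢
    intro c hc
    filter_upwards [h1 hc, h2 hc] with w hw1 hw2
    simp only [le_refl, if_true]
    split_ifs with h
    · exact hw1
    · simpa [e0, e1] using hw2
  · have hneg3 : Tendsto (fun p : ℝ³ => ((-p.1.1, p.1.2), -p.2)) (𝓝 ((0, q), 0))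
        (𝓝 ((0, q), 0)) := Continuous.tendsto' (by fun_prop) _ _ (by simp)
    have hs : Tendsto (fun p : ℝ³ => p.1.2) (𝓝 ((0, q), 0)) (𝓝 q) :=
      Continuous.tendsto' (by fun_prop) _ _ (by simp)
    filter_upwards [hf0, hneg3.eventually hg0, hs.eventually hf1, hs.eventually hg1]
      with p h1 h2 h3 h4
    rw [h1, h2]
    rcases lt_trichotomy p.1.1 0 with h | h | h
    · rw [if_neg h.not_ge]
      constructor
      · rintro (⟨h5, -⟩ | ⟨-, h5⟩)
        · linarith
        · rw [h5, neg_neg]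
      · intro h5
        exact Or.inr ⟨h.le, by linarith⟩
    · have e : p.1 = (0, p.1.2) := Prod.ext h rfl
      rw [e]
      simp [h3.1, h4.1, eq_comm]
    · rw [if_pos h.le]
      constructor
      · rintro (⟨-, h5⟩ | ⟨h5, -⟩)
        · exact h5
        · linarith
      · intro h5
        exact Or.inl ⟨h.le, h5⟩

lemma eq_or_eq_of_vertex (hP : ClosedDiagram P) (hr : r ∈ P) (hs : s ∈ P) (hrs : r ≠ s) {v : Torus}
    (hvr : v ∈ r.vertices) (hvs : v ∈ s.vertices) {t : Rect} (ht : t ∈ P) (hvt : v ∈ t.vertices) :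
    t = r ∨ t = s := by
  by_contra hcon
  push Not at hcon
  obtain ⟨σ, ε, h1, h2⟩ := exists_frame_of_vertex hvr
  obtain ⟨σ', ε', h3, h4⟩ := exists_frame_of_vertex hvs
  obtain ⟨σ'', ε'', h5, h6⟩ := exists_frame_of_vertex hvt
  have e1 := (opposite_frames hP hr hs hrs h1 h2 h3 h4).1
  have e2 := (opposite_frames hP hr ht hcon.1.symm h1 h2 h5 h6).1
  have e3 := (opposite_frames hP hs ht hcon.2.symm h3 h4 h5 h6).1
  rcases h1.sign with h | h <;> rw [e1, h] at e3 <;> rw [e2, h] at e3 <;> norm_num at e3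

lemma exists_partner (hP : ClosedDiagram P) (hr : r ∈ P) (hθ : r.Vert α σ) (hφ : r.Horiz β ε) :
    ∃ s ∈ P, r ≠ s ∧ s.Vert α (-σ) ∧ s.Horiz β (-ε) := by
  obtain ⟨s, hs, hsr, hvs⟩ := hP.partner r hr _ (vertex_of_frame hθ hφ)
  obtain ⟨σ', ε', h3, h4⟩ := exists_frame_of_vertex hvs
  obtain ⟨e1, e2⟩ := opposite_frames hP hr hs hsr.symm hθ hφ h3 h4
  subst e1 e2
  exact ⟨s, hs, hsr.symm, h3, h4⟩

lemma eventually_small_abs {E : Type*} [TopologicalSpace E] {f : E → ℝ} {z : E}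
    (hf : ContinuousAt f z) (h : f z = 0) {c : ℝ} (hc : 0 < c) : ∀ᶠ w in 𝓝 z, |f w| < c :=
  eventually_abs_lt hf (by rw [h]; simpa using hc)

/-- Near a point over a vertex the surface is given by the equations of the two tiles. -/
lemma eventually_over_vertex (hP : ClosedDiagram P) (hr : r ∈ P) (hs : s ∈ P) (hrs : r ≠ s)
    (h1 : r.Vert α σ) (h2 : r.Horiz β ε) (h3 : s.Vert α (-σ)) (h4 : s.Horiz β (-ε))
    (hq : q ∈ Ioo (0 : ℝ) 1) : ∀ᶠ p in 𝓝 (((0, q), 0) : ℝ³),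
      (∃ t ∈ P, Over t (α + (σ * p.2 : ℝ), β + (ε * p.1.1 : ℝ)) p.1.2)
        ↔ ((0 ≤ p.1.1 ∧ tileEq r.wid r.hei p = 0) ∨
        (p.1.1 ≤ 0 ∧ tileEq s.wid s.hei ((-p.1.1, p.1.2), -p.2) = 0)) := by
  have k1 : ∀ c : ℝ, 0 < c → ∀ᶠ p in 𝓝 (((0, q), 0) : ℝ³), |p.2| < c := fun c hc =>
    eventually_small_abs (f := fun p : ℝ³ => p.2) (by fun_prop) rfl hc
  have k2 : ∀ c : ℝ, 0 < c → ∀ᶠ p in 𝓝 (((0, q), 0) : ℝ³), |p.1.1| < c := fun c hc =>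
    eventually_small_abs (f := fun p : ℝ³ => p.1.1) (by fun_prop) rfl hc
  have k3 : ∀ᶠ p in 𝓝 (((0, q), 0) : ℝ³), p.1.2 ∈ Ioo (0 : ℝ) 1 :=
    ContinuousAt.eventually_mem (f := fun p : ℝ³ => p.1.2) (by fun_prop) (isOpen_Ioo.mem_nhds hq)
  have hc : Continuous (fun p : ℝ³ => ((α + (σ * p.2 : ℝ), β + (ε * p.1.1 : ℝ)) : Torus)) :=
    (continuous_angle _ (by fun_prop)).prodMk (continuous_angle _ (by fun_prop))
  have k4 : ∀ᶠ p in 𝓝 (((0, q), 0) : ℝ³), ∀ t ∈ P,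
      ((α + (σ * p.2 : ℝ), β + (ε * p.1.1 : ℝ)) : Torus) ∈ t.carrier →
      (α, β) ∈ t.vertices := by
    have := (hc.tendsto' ((0, q), 0) (α, β) (by simp)).eventually
      (eventually_vertex hP hr (vertex_of_frame h1 h2))
    exact this
  filter_upwards [k1 _ r.wid_pos, k1 _ s.wid_pos, k2 _ r.hei_pos, k2 _ s.hei_pos,
    k1 _ (sub_pos.2 r.wid_lt), k1 _ (sub_pos.2 s.wid_lt), k2 _ (sub_pos.2 r.hei_lt),
    k2 _ (sub_pos.2 s.hei_lt), k3, k4] with p a1 a2 a3 a4 a5 a6 a7 a8 a9 a10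
  have e1 := over_near_vertex_iff h1 h2 (Ioo_subset_Ico_self a9) a1 a5 a3 a7
  rw [← abs_neg] at a2 a4 a6 a8
  have e2 := over_near_vertex_iff h3 h4 (Ioo_subset_Ico_self a9) a2 a6 a4 a8
  rw [neg_mul_neg, neg_mul_neg, neg_nonneg] at e2
  constructor
  · rintro ⟨t, ht, ho⟩
    rcases eq_or_eq_of_vertex hP hr hs hrs (vertex_of_frame h1 h2) (vertex_of_frame h3 h4) ht
      (a10 t ht ho.1) with rfl | rfl
    · exact Or.inl (e1.1 ho)
    · exact Or.inr (e2.1 ho)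
  · rintro (h | h)
    · exact ⟨r, hr, e1.2 h⟩
    · exact ⟨s, hs, e2.2 h⟩

/-- Near a point on the segment over a vertex the surface is a graph over the plane of the
coordinates `φ` and `q`. -/
lemma exists_graph_vertex (hP : ClosedDiagram P) (hr : r ∈ P) (h1 : r.Vert α σ) (h2 : r.Horiz β ε)
    (hq : q ∈ Ioo (0 : ℝ) 1) : ∃ k : ℝ² → ℝ, ContDiffAt ℝ 1 k 0 ∧ k 0 = 0 ∧
      ∀ᶠ u in 𝓝 (0 : ℝ³), pt (α + (σ * u.2 : ℝ))
        (β + (ε * u.1.1 : ℝ)) (q + u.1.2) ∈ surface P ↔ u.2 = k u.1 := by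
  obtain ⟨s, hs, hrs, h3, h4⟩ := exists_partner hP hr h1 h2
  obtain ⟨K, hK, -, hK0, hK1⟩ := exists_vertex_graph r.wid_pos r.hei_pos s.wid_pos s.hei_pos hq
  refine ⟨fun w => K (w.1, q + w.2), ?_, by simpa using hK0, ?_⟩
  · refine ContDiffAt.comp (g := K) (f := fun w : ℝ² => (w.1, q + w.2)) 0 ?_ (by fun_prop)
    simpa using hK
  · have ht : Tendsto (fun u : ℝ³ => ((u.1.1, q + u.1.2), u.2)) (𝓝 0) (𝓝 ((0, q), 0)) :=
      Continuous.tendsto' (by fun_prop) _ _ (by simp)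
    have k3 : ∀ᶠ p in 𝓝 (((0, q), 0) : ℝ³), p.1.2 ∈ Ioo (0 : ℝ) 1 :=
      ContinuousAt.eventually_mem (f := fun p : ℝ³ => p.1.2) (by fun_prop) (isOpen_Ioo.mem_nhds hq)
    filter_upwards [ht.eventually (hK1.and
      (k3.and (eventually_over_vertex hP hr hs hrs h1 h2 h3 h4 hq)))] with u hu
    obtain ⟨hu1, hu2, hu3⟩ := hu
    rw [pt_mem_surface_iff hu2, hu3, hu1]
    exact eq_comm

/-- Near an interior point of a tile the surface is the graph of the height function. -/
lemma exists_graph_interior (hP : ClosedDiagram P) (hs : s ∈ P) {v : Torus} (ho : Over s v q)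
    (hv : v ∉ s.vertices) (hq : q ∈ Ioo (0 : ℝ) 1) (σ ε : ℝ) :
    ∃ k : ℝ² → ℝ, ContDiffAt ℝ 1 k 0 ∧ k 0 = 0 ∧
      ∀ᶠ u in 𝓝 (0 : ℝ³), pt (v.1 + (σ * u.1.1 : ℝ))
        (v.2 + (ε * u.1.2 : ℝ)) (q + u.2) ∈ surface P ↔ u.2 = k u.1 := by
  obtain ⟨hθ, hφ⟩ := exists_vert_horiz s
  obtain ⟨x0, hx0, y0, hy0, rfl, -⟩ := ho.exists_coord hθ hφ
  obtain ⟨hx, hy, hqe⟩ := interior_of_over hθ hφ hx0 hy0 ho hv hq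
  refine ⟨fun w => mfun (rectH s.wid s.hei (x0 + σ * w.1) (y0 + ε * w.2)) - q, ?_,
    by simp [← hqe], ?_⟩
  · refine ContDiffAt.sub (ContDiffAt.comp (g := fun p : ℝ² => mfun (rectH s.wid s.hei p.1 p.2))
      (f := fun w : ℝ² => (x0 + σ * w.1, y0 + ε * w.2)) 0 ?_ (by fun_prop)) contDiffAt_const
    exact contDiffAt_mfun_rectH (by simpa using hx.1) (by simpa using hx.2) (by simpa using hy.1)
      (by simpa using hy.2)
  · have k1 : ∀ᶠ u in 𝓝 (0 : ℝ³), x0 + σ * u.1.1 ∈ Ioo 0 s.wid :=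
      ContinuousAt.eventually_mem (f := fun u : ℝ³ => x0 + σ * u.1.1) (by fun_prop)
        (isOpen_Ioo.mem_nhds (by simpa using hx))
    have k2 : ∀ᶠ u in 𝓝 (0 : ℝ³), y0 + ε * u.1.2 ∈ Ioo 0 s.hei :=
      ContinuousAt.eventually_mem (f := fun u : ℝ³ => y0 + ε * u.1.2) (by fun_prop)
        (isOpen_Ioo.mem_nhds (by simpa using hy))
    have k3 := eventually_add_mem_Ioo hq
    have hc : Continuous (fun u : ℝ³ =>
        (((s.θ₁ + (1 * x0 : ℝ) + (σ * u.1.1 : ℝ),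
          s.φ₁ + (1 * y0 : ℝ) + (ε * u.1.2 : ℝ)), q + u.2) : Torus × ℝ)) :=
      ((continuous_angle _ (by fun_prop)).prodMk (continuous_angle _ (by fun_prop))).prodMk
        (by fun_prop)
    have k4 := (hc.tendsto' 0 ((s.θ₁ + (1 * x0 : ℝ),
      s.φ₁ + (1 * y0 : ℝ)), q) (by simp)).eventually (eventually_eq_of_interior hP hs ho hv hq)
    filter_upwards [k1, k2, k3, k4] with u h1 h2 h3 h4
    rw [pt_mem_surface_iff h3]
    have e : ((s.θ₁ + (1 * x0 : ℝ) + (σ * u.1.1 : ℝ),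
        s.φ₁ + (1 * y0 : ℝ) + (ε * u.1.2 : ℝ)) : Torus) =
        (s.θ₁ + (1 * (x0 + σ * u.1.1) : ℝ), s.φ₁ + (1 * (y0 + ε * u.1.2) : ℝ)) := by
      simp [add_assoc]
    have key : Over s (s.θ₁ + (1 * x0 : ℝ) + (σ * u.1.1 : ℝ),
        s.φ₁ + (1 * y0 : ℝ) + (ε * u.1.2 : ℝ)) (q + u.2) ↔
        u.2 = mfun (rectH s.wid s.hei (x0 + σ * u.1.1) (y0 + ε * u.1.2)) - q := by
      rw [e, over_coord_iff hθ hφ (Ioo_subset_Icc_self h1) (Ioo_subset_Icc_self h2)]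
      constructor
      · rintro ⟨-, ⟨h | h, -⟩ | h⟩
        · exact absurd h h1.1.ne'
        · exact absurd h h1.2.ne
        · linarith
      · intro h
        exact ⟨Ioo_subset_Icc_self h3, Or.inr (by linarith)⟩
    rw [← key]
    constructor
    · rintro ⟨r, hr, hor⟩
      have := h4 r hr hor
      rwa [this] at hor
    · intro h
      exact ⟨s, hs, h⟩

end

section

variable {P : Set Rect} {r s : Rect} {α β φ : Angle} {σ ε x x' y q t : ℝ} {δ C q0 : ℝ}

/-! ### Local equations of the surface near the circles -/

/-- Uniform control of the equation of the tile of `r` near the circle `q = 0`: close to a vertical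
side, for every `y` and every small `q` there is exactly one solution `x`, it is `O(q)`, and the
partial derivatives of the equation are controlled. -/
structure SideBound (r : Rect) (δ C q0 : ℝ) : Prop where
  lt_wid : δ < r.wid
  lt_compl : δ < 2 * π - r.wid
  exists_sol : ∀ y ∈ Icc 0 r.hei, ∀ q ∈ Icc (0 : ℝ) q0,
    ∃ x ∈ Ico (0 : ℝ) δ, x ≤ C * q ∧ tileEq r.wid r.hei ((y, q), x) = 0
  unique : ∀ y ∈ Icc 0 r.hei, ∀ q ∈ Icc (0 : ℝ) q0, ∀ x x', |x| < δ → |x'| < δ →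
    tileEq r.wid r.hei ((y, q), x) = 0 → tileEq r.wid r.hei ((y, q), x') = 0 → x = x'
  bound : ∀ y ∈ Icc 0 r.hei, ∀ q ∈ Icc (0 : ℝ) q0, ∀ x, |x| < δ →
    1 ≤ C * fderiv ℝ (tileEq r.wid r.hei) ((y, q), x) (0, 1) ∧
      (tileEq r.wid r.hei ((y, q), x) = 0 →
        |fderiv ℝ (tileEq r.wid r.hei) ((y, q), x) ((1, 0), 0)| ≤ C * q) ∧
      |fderiv ℝ (tileEq r.wid r.hei) ((y, q), x) ((0, 1), 0)| ≤ C

lemma exists_sideBound {S : Set Rect} (hS : S.Finite) : ∃ δ C q0 : ℝ, 0 < δ ∧ 0 < C ∧ 0 < q0 ∧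
    q0 < 1 ∧ ∀ r ∈ S, SideBound r δ C q0 := by
  have key : ∀ r ∈ S, ∀ᶠ δ in 𝓝[>] (0 : ℝ), ∀ᶠ C in atTop, ∀ᶠ q0 in 𝓝[>] (0 : ℝ),
      SideBound r δ C q0 := by
    intro r _
    obtain ⟨δ', C', q', h1, h2, h3, h4, h5, h6⟩ := exists_side_bounds r.wid_pos r.hei_pos
    have hπ := r.wid_lt
    filter_upwards [Ioo_mem_nhdsGT h1, Ioo_mem_nhdsGT (sub_pos.2 hπ)] with δ hδ hδ2
    filter_upwards [eventually_ge_atTop C'] with C hC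
    have hC0 : 0 < C := h3.trans_le hC
    filter_upwards [Ioo_mem_nhdsGT h4, Ioo_mem_nhdsGT (div_pos hδ.1 hC0)] with q0 hq0 hq1
    have hmem : ∀ q ∈ Icc (0 : ℝ) q0, q ∈ Icc (0 : ℝ) q' := fun q hq => ⟨hq.1, hq.2.trans hq0.2.le⟩
    refine ⟨hδ.2.trans h2, hδ2.2, fun y hy q hq => ?_, fun y hy q hq x x' hx hx' => ?_,
      fun y hy q hq x hx => ?_⟩
    · obtain ⟨x, hx, hxq, he⟩ := (h6 y hy q (hmem q hq)).1
      have h7 : C * q0 < δ := by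
        have := hq1.2
        rwa [lt_div_iff₀ hC0, mul_comm] at this
      have h8 : x ≤ C * q := hxq.trans (mul_le_mul_of_nonneg_right hC hq.1)
      exact ⟨x, ⟨hx.1, h8.trans_lt ((mul_le_mul_of_nonneg_left hq.2 hC0.le).trans_lt h7)⟩, h8, he⟩
    · exact (h6 y hy q (hmem q hq)).2.1 x x' (hx.trans hδ.2) (hx'.trans hδ.2)
    · obtain ⟨k1, k2, k3⟩ := (h6 y hy q (hmem q hq)).2.2 x (hx.trans hδ.2)
      have hpos : 0 < fderiv ℝ (tileEq r.wid r.hei) ((y, q), x) (0, 1) := by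
        by_contra hcon
        push Not at hcon
        have := mul_nonpos_of_nonneg_of_nonpos h3.le hcon
        linarith
      exact ⟨k1.trans (mul_le_mul_of_nonneg_right hC hpos.le),
        fun h => (k2 h).trans (mul_le_mul_of_nonneg_right hC hq.1), k3.trans hC⟩
  have h1 := (eventually_all_finite hS).2 key
  obtain ⟨δ, h2, hδ⟩ := (h1.and self_mem_nhdsWithin).exists
  obtain ⟨C, h3, hC⟩ := (((eventually_all_finite hS).2 h2).and (eventually_gt_atTop 0)).exists
  obtain ⟨q0, h4, hq0, hq1⟩ := (((eventually_all_finite hS).2 h3).and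
    (Ioo_mem_nhdsGT one_pos)).exists
  exact ⟨δ, C, q0, hδ, hC, hq0, hq1, h4⟩

/-- The points of the tiles with a side over `α`, in the coordinates `x`, `φ` and `t` centred at the
point `α` of the circle `q = 0`. -/
def SideRel (P : Set Rect) (α : Angle) (δ : ℝ) (φ : Angle) (t x : ℝ) : Prop :=
  |x| < δ ∧ ∃ r ∈ P, (∃ σ, r.Vert α σ) ∧ Over r (α + (x : Angle), φ) t

lemma SideBound.over_iff (hB : SideBound r δ C q0) (hq0 : q0 < 1) (hθ : r.Vert α σ)
    (hφ : r.Horiz β ε) (hx : |x| < δ) (ht : t ∈ Icc 0 q0) (hy : y ∈ Icc 0 r.hei) :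
    Over r (α + (x : Angle), β + (ε * y : ℝ)) t ↔ tileEq r.wid r.hei ((y, t), σ * x) = 0 := by
  rw [← over_near_side_iff hθ hφ ⟨ht.1, ht.2.trans_lt hq0⟩ (by rw [hθ.abs_sign_mul]; exact hx.trans hB.lt_wid)
    (by rw [hθ.abs_sign_mul]; exact hx.trans hB.lt_compl) hy, ← mul_assoc, hθ.mul_self, one_mul]

lemma SideBound.eq_zero_of_vertex (hB : SideBound r δ C q0) (hq0 : q0 < 1) (hθ : r.Vert α σ)
    (hv : (α, φ) ∈ r.vertices) (hx : |x| < δ) (ht : t ∈ Icc 0 q0)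
    (ho : Over r (α + (x : Angle), φ) t) : x = 0 := by
  obtain ⟨-, ε, -, hφ⟩ := exists_frame_of_vertex hv
  have hz : (0 : ℝ) ∈ Icc 0 r.hei := ⟨le_rfl, r.hei_pos.le⟩
  have h1 := (hB.over_iff hq0 hθ hφ hx ht hz).1 (by simpa using ho)
  refine hθ.sign_mul_inj ((hB.unique 0 hz t ht _ 0 (by rwa [hθ.abs_sign_mul])
    (by rw [abs_zero]; exact (abs_nonneg x).trans_lt hx) h1
    (tileEq_corner r.wid_pos r.hei_pos (Or.inl rfl))).trans (mul_zero σ).symm)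

lemma SideRel.unique (hP : ClosedDiagram P)
    (hB : ∀ r ∈ {r ∈ P | ∃ σ, r.Vert α σ}, SideBound r δ C q0) (hq0 : q0 < 1) (ht : t ∈ Icc 0 q0)
    (h : SideRel P α δ φ t x) (h' : SideRel P α δ φ t x') : x = x' := by
  obtain ⟨hx, r, hr, ⟨σ, hσ⟩, ho⟩ := h
  obtain ⟨hx', s, hs, ⟨σ', hσ'⟩, ho'⟩ := h'
  by_cases hrs : r = s
  · subst hrs
    have hφ := (exists_vert_horiz r).2
    obtain ⟨y, hy, e⟩ := hφ.mem_arc_iff.1 ho.1.2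
    simp only at e
    rw [e] at ho ho'
    have hb := hB r ⟨hr, σ, hσ⟩
    have h1 := (hb.over_iff hq0 hσ hφ hx ht hy).1 ho
    have h2 := (hb.over_iff hq0 hσ hφ hx' ht hy).1 ho'
    exact hσ.sign_mul_inj
      (hb.unique y hy t ht _ _ (by rwa [hσ.abs_sign_mul]) (by rwa [hσ.abs_sign_mul]) h1 h2)
  · obtain ⟨v1, v2⟩ := vertex_of_common_side hP hr hs hrs hσ hσ' ho.1.2 ho'.1.2
    rw [(hB r ⟨hr, σ, hσ⟩).eq_zero_of_vertex hq0 hσ v1 hx ht ho,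
      (hB s ⟨hs, σ', hσ'⟩).eq_zero_of_vertex hq0 hσ' v2 hx' ht ho']

lemma exists_sideRel (hP : ClosedDiagram P) (hα : α ∈ Thetas P)
    (hB : ∀ r ∈ {r ∈ P | ∃ σ, r.Vert α σ}, SideBound r δ C q0) (hq0 : q0 < 1) (ht : t ∈ Icc 0 q0)
    (φ : Angle) : ∃ x, SideRel P α δ φ t x ∧ |x| ≤ C * t := by
  obtain ⟨r, hr, ⟨σ, hσ⟩, hφr⟩ := exists_side_over hP hα φ
  have hφ := (exists_vert_horiz r).2
  obtain ⟨y, hy, rfl⟩ := hφ.mem_arc_iff.1 hφr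
  have hb := hB r ⟨hr, σ, hσ⟩
  obtain ⟨x, hx, hxC, he⟩ := hb.exists_sol y hy t ht
  have habs : |σ * x| = x := by rw [hσ.abs_sign_mul, abs_of_nonneg hx.1]
  have hlt : |σ * x| < δ := by rw [habs]; exact hx.2
  refine ⟨σ * x, ⟨hlt, r, hr, ⟨σ, hσ⟩, (hb.over_iff hq0 hσ hφ hlt ht hy).2 ?_⟩, by rw [habs]; exact hxC⟩
  rwa [← mul_assoc, hσ.mul_self, one_mul]

/-- The solution of `SideRel` as a function of class `C¹` of the angle and of the height, with its
partial derivatives. -/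
lemma exists_side_graph (hP : ClosedDiagram P) (hα : α ∈ Thetas P)
    (hB : ∀ r ∈ {r ∈ P | ∃ σ, r.Vert α σ}, SideBound r δ C q0) (hδ : 0 < δ) (hC : 0 < C)
    (hq0 : q0 < 1) (φ : Angle) (hq : q ∈ Ioo 0 q0) :
    ∃ K : ℝ² → ℝ, ContDiffAt ℝ 1 K (0, q) ∧
      |fderiv ℝ K (0, q) (1, 0)| ≤ (C * C + 1 / (1 - q0)) * q ∧
      |fderiv ℝ K (0, q) (0, 1)| ≤ C * C + 1 / (1 - q0) ∧
      ∀ᶠ w in 𝓝 (0, q), SideRel P α δ (φ + (w.1 : Angle)) w.2 (K w) := by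
  obtain ⟨r, hr, ⟨σ, hσ⟩, hφr⟩ := exists_side_over hP hα φ
  have hq1 : 0 < 1 - q0 := by linarith
  have hinv : 0 < 1 / (1 - q0) := by positivity
  have k3 : ∀ᶠ w in 𝓝 ((0, q) : ℝ²), w.2 ∈ Ioo 0 q0 :=
    ContinuousAt.eventually_mem (f := fun w : ℝ² => w.2) (by fun_prop) (isOpen_Ioo.mem_nhds hq)
  have hb := hB r ⟨hr, σ, hσ⟩
  -- at a vertex two tiles are glued, elsewhere the equation of one tile is solved
  by_cases hv : φ = r.φ₁ ∨ φ = r.φ₂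
  · obtain ⟨ε, hε⟩ := exists_isEnd hv
    have hε : r.Horiz φ ε := hε
    obtain ⟨s, hs, hrs, h3, h4⟩ := exists_partner hP hr hσ hε
    have hq' : q ∈ Ioo (0 : ℝ) 1 := ⟨hq.1, hq.2.trans hq0⟩
    obtain ⟨K, hK, hK', hK0, hK1⟩ := exists_vertex_graph r.wid_pos r.hei_pos s.wid_pos s.hei_pos hq'
    have hlin : HasFDerivAt (fun w : ℝ² => (ε * w.1, w.2))
        ((ε • fst ℝ ℝ ℝ).prod (snd ℝ ℝ ℝ)) (0, q) :=
      (hasFDerivAt_fst.const_mul ε).prodMk hasFDerivAt_snd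
    have hder : HasFDerivAt (fun w : ℝ² => σ * K (ε * w.1, w.2))
        (σ • ((q / (1 - q)) • fst ℝ ℝ ℝ).comp ((ε • fst ℝ ℝ ℝ).prod (snd ℝ ℝ ℝ))) (0, q) := by
      refine HasFDerivAt.const_mul (HasFDerivAt.comp (g := K)
        (f := fun w : ℝ² => (ε * w.1, w.2)) (0, q) ?_ hlin) σ
      simpa using hK'
    have hKc : ContDiffAt ℝ 1 (fun w : ℝ² => K (ε * w.1, w.2)) (0, q) := by
      refine ContDiffAt.comp (g := K) (f := fun w : ℝ² => (ε * w.1, w.2)) (0, q) ?_ (by fun_prop)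
      simpa using hK
    refine ⟨fun w => σ * K (ε * w.1, w.2), contDiffAt_const.mul hKc, ?_, ?_, ?_⟩
    · rw [hder.fderiv]
      have e1 : |q / (1 - q) * ε| ≤ 1 / (1 - q0) * q := by
        have h1q : 0 < 1 - q := by linarith [hq.2]
        rw [abs_mul, (sign_eq hε.sign).2, mul_one, abs_of_nonneg (div_nonneg hq.1.le h1q.le), div_eq_mul_one_div,
          mul_comm]
        exact mul_le_mul_of_nonneg_right (one_div_le_one_div_of_le hq1 (by linarith [hq.2])) hq.1.le
      have e2 : 0 ≤ C * C * q := by have := hq.1; positivity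
      simp only [smul_apply, comp_apply, prod_apply, coe_fst', coe_snd', smul_eq_mul, mul_one]
      rw [hσ.abs_sign_mul]
      linarith
    · rw [hder.fderiv]
      simp
      positivity
    · have ht : Tendsto (fun w : ℝ² => ((ε * w.1, w.2), K (ε * w.1, w.2))) (𝓝 (0, q))
          (𝓝 ((0, q), 0)) := by
        have hc : ContinuousAt (fun w : ℝ² => ((ε * w.1, w.2), K (ε * w.1, w.2))) (0, q) :=
          ContinuousAt.prodMk (by fun_prop) hKc.continuousAt
        have := hc.tendsto
        simpa [hK0] using this
      have hc : Continuous (fun p : ℝ³ => ((α + (σ * p.2 : ℝ), φ + (ε * p.1.1 : ℝ)) : Torus)) :=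
        (continuous_angle _ (by fun_prop)).prodMk (continuous_angle _ (by fun_prop))
      have k4 := (hc.tendsto' ((0, q), 0) (α, φ) (by simp)).eventually
        (eventually_vertex hP hr (vertex_of_frame hσ hε))
      have k5 : ∀ᶠ w in 𝓝 ((0, q) : ℝ²), |K (ε * w.1, w.2)| < δ :=
        eventually_small_abs (f := fun w : ℝ² => K (ε * w.1, w.2)) hKc.continuousAt
          (by simpa using hK0) hδ
      filter_upwards [ht.eventually (hK1.and
        ((eventually_over_vertex hP hr hs hrs hσ hε h3 h4 hq').and k4)), k5] with w hw hw5
      obtain ⟨w1, w2, w3⟩ := hw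
      obtain ⟨t, ht, ho⟩ := w2.2 (w1.2 rfl)
      refine ⟨by rw [hσ.abs_sign_mul]; exact hw5, t, ht, exists_isEnd (w3 t ht ho.1).1, ?_⟩
      rw [← mul_assoc, hε.mul_self, one_mul] at ho
      exact ho
  · have hφ := (exists_vert_horiz r).2
    obtain ⟨y, hy, e⟩ := hφ.mem_arc_iff.1 hφr
    have hy : y ∈ Icc 0 r.hei := hy
    push Not at hv
    have hy0 : y ≠ 0 := by rintro rfl; exact hv.1 (by simpa using e)
    have hy1 : y ≠ r.hei := by
      rintro rfl
      rw [one_mul, Rect.hei, add_arcLen] at e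
      exact hv.2 e
    have hyo : y ∈ Ioo 0 r.hei := ⟨lt_of_le_of_ne hy.1 hy0.symm, lt_of_le_of_ne hy.2 hy1⟩
    obtain ⟨x, hx, hxC, he⟩ := hb.exists_sol y hy q (Ioo_subset_Icc_self hq)
    have hxa : |x| < δ := by rw [abs_of_nonneg hx.1]; exact hx.2
    obtain ⟨b1, b2, b3⟩ := hb.bound y hy q (Ioo_subset_Icc_self hq) x hxa
    set D := fderiv ℝ (tileEq r.wid r.hei) ((y, q), x) with hD
    have hgC : ContDiffAt ℝ ω (tileEq r.wid r.hei) ((y, q), x) :=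
      tileEq_contDiffAt r.hei_pos (hxa.trans hb.lt_wid)
    have hpos : 0 < D (0, 1) := by
      by_contra hcon
      push Not at hcon
      have := mul_nonpos_of_nonneg_of_nonpos hC.le hcon
      linarith
    obtain ⟨ψ, hψ, hψ0, -, hψ2⟩ := exists_implicit hgC he hpos.ne'
    have hψd := (hψ.differentiableAt one_ne_zero).hasFDerivAt
    have himp := implicit_deriv (g := tileEq r.wid r.hei) (ψ := ψ) (w := (y, q))
      (by rw [hψ0]; exact hgC.differentiableAt (by simp)) hψd hψ2
    rw [hψ0, ← hD] at himp
    have hbd : ∀ (v : ℝ²) (M : ℝ), |D (v, 0)| ≤ M → |fderiv ℝ ψ (y, q) v| ≤ C * M := by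
      intro v M hM
      have h1 := himp v
      have h2 : |fderiv ℝ ψ (y, q) v| * D (0, 1) = |D (v, 0)| := by
        have h3 : D (v, 0) = -(fderiv ℝ ψ (y, q) v * D (0, 1)) := by linarith
        rw [h3, abs_neg, abs_mul, abs_of_pos hpos]
      calc |fderiv ℝ ψ (y, q) v| ≤ |fderiv ℝ ψ (y, q) v| * (C * D (0, 1)) :=
            le_mul_of_one_le_right (abs_nonneg _) b1
        _ = C * |D (v, 0)| := by rw [← h2]; ring
        _ ≤ C * M := mul_le_mul_of_nonneg_left hM hC.le
    have hlin : HasFDerivAt (fun w : ℝ² => (y + w.1, w.2)) ((fst ℝ ℝ ℝ).prod (snd ℝ ℝ ℝ)) (0, q) :=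
      (hasFDerivAt_fst.const_add y).prodMk hasFDerivAt_snd
    have hder : HasFDerivAt (fun w : ℝ² => σ * ψ (y + w.1, w.2))
        (σ • (fderiv ℝ ψ (y, q)).comp ((fst ℝ ℝ ℝ).prod (snd ℝ ℝ ℝ))) (0, q) := by
      refine HasFDerivAt.const_mul (HasFDerivAt.comp (g := ψ)
        (f := fun w : ℝ² => (y + w.1, w.2)) (0, q) ?_ hlin) σ
      simpa using hψd
    have hψc : ContDiffAt ℝ 1 (fun w : ℝ² => ψ (y + w.1, w.2)) (0, q) := by
      refine ContDiffAt.comp (g := ψ) (f := fun w : ℝ² => (y + w.1, w.2)) (0, q) ?_ (by fun_prop)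
      simpa using hψ
    refine ⟨fun w => σ * ψ (y + w.1, w.2), contDiffAt_const.mul hψc, ?_, ?_, ?_⟩
    · rw [hder.fderiv]
      have h1 := hbd (1, 0) _ (b2 he)
      have h2 : 0 ≤ 1 / (1 - q0) * q := mul_nonneg hinv.le hq.1.le
      simp only [smul_apply, comp_apply, prod_apply, coe_fst', coe_snd', smul_eq_mul]
      rw [hσ.abs_sign_mul]
      linarith
    · rw [hder.fderiv]
      have h1 := hbd (0, 1) _ b3
      simp only [smul_apply, comp_apply, prod_apply, coe_fst', coe_snd', smul_eq_mul]
      rw [hσ.abs_sign_mul]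
      linarith
    · have ht : Tendsto (fun w : ℝ² => (y + w.1, w.2)) (𝓝 (0, q)) (𝓝 (y, q)) :=
        Continuous.tendsto' (by fun_prop) _ _ (by simp)
      have k1 : ∀ᶠ w in 𝓝 ((0, q) : ℝ²), y + w.1 ∈ Ioo 0 r.hei :=
        ContinuousAt.eventually_mem (f := fun w : ℝ² => y + w.1) (by fun_prop)
          (isOpen_Ioo.mem_nhds (by simpa using hyo))
      have k5 : ∀ᶠ w in 𝓝 ((0, q) : ℝ²), |ψ (y + w.1, w.2)| < δ :=
        eventually_abs_lt hψc.continuousAt (by simpa [hψ0] using hxa)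
      filter_upwards [ht.eventually hψ2, k1, k3, k5] with w w1 w2 w3 w4
      have habs : |σ * ψ (y + w.1, w.2)| < δ := by rwa [hσ.abs_sign_mul]
      refine ⟨habs, r, hr, ⟨σ, hσ⟩, ?_⟩
      have e2 : φ + (w.1 : Angle) = r.φ₁ + (1 * (y + w.1) : ℝ) := by
        rw [e]; exact add_coe_add (by ring)
      rw [e2, hb.over_iff hq0 hσ hφ habs (Ioo_subset_Icc_self w3) (Ioo_subset_Icc_self w2),
        ← mul_assoc, hσ.mul_self, one_mul]
      exact w1

lemma hasFDerivAt_angleCoord (α : Angle) {ρ : ℝ} (hρ : 0 < ρ) :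
    HasFDerivAt (fun z : ℝ² => angleCoord α z.1 z.2)
      (ρ⁻¹ • (-α.sin • fst ℝ ℝ ℝ + α.cos • snd ℝ ℝ ℝ))
      (ρ * α.cos, ρ * α.sin) := by
  have hn : HasFDerivAt (fun z : ℝ² => -z.1 * α.sin + z.2 * α.cos)
      (-α.sin • fst ℝ ℝ ℝ + α.cos • snd ℝ ℝ ℝ)
      (ρ * α.cos, ρ * α.sin) := by
    have := (-α.sin • fst ℝ ℝ ℝ + α.cos • snd ℝ ℝ ℝ).hasFDerivAt (x := (ρ * α.cos, ρ * α.sin))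
    refine this.congr_of_eventuallyEq (Eventually.of_forall fun z => ?_)
    simp; ring
  have hd0 : (ρ * α.cos) * α.cos + (ρ * α.sin) * α.sin = ρ := by
    linear_combination ρ * α.cos_sq_add_sin_sq
  have hn0 : -(ρ * α.cos) * α.sin + (ρ * α.sin) * α.cos = 0 := by ring
  have hi : DifferentiableAt ℝ (fun z : ℝ² => (z.1 * α.cos + z.2 * α.sin)⁻¹)
      (ρ * α.cos, ρ * α.sin) :=
    DifferentiableAt.inv (by fun_prop) (by simp only; rw [hd0]; exact hρ.ne')
  have hm := (hn.mul hi.hasFDerivAt).arctan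
  refine (hm.congr_fderiv ?_).congr_of_eventuallyEq (Eventually.of_forall fun z => ?_)
  · have e0 : ((fun z : ℝ² => -z.1 * α.sin + z.2 * α.cos) *
        fun z : ℝ² => (z.1 * α.cos + z.2 * α.sin)⁻¹) (ρ * α.cos, ρ * α.sin) = 0 := by
      simp only [Pi.mul_apply, hn0, zero_mul]
    rw [e0]
    simp only [hn0, hd0]
    ext <;> simp
  · rfl

lemma sq_add_sq_le (z : ℝ²) : z.1 ^ 2 + z.2 ^ 2 ≤ 2 * ‖z‖ ^ 2 := by
  have h1 : |z.1| ≤ ‖z‖ := norm_fst_le z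
  have h2 : |z.2| ≤ ‖z‖ := norm_snd_le z
  have h3 := sq_le_sq' (by linarith [abs_nonneg z.1, norm_nonneg z]) h1
  have h4 := sq_le_sq' (by linarith [abs_nonneg z.2, norm_nonneg z]) h2
  rw [sq_abs] at h3 h4
  linarith
/-- The norm of a derivative in polar coordinates, transformed to Cartesian coordinates. -/
lemma norm_polar_comp_le (φ : Angle) {ρ M : ℝ} (hρ0 : 0 < ρ) {z0 : ℝ²}
    (ez0 : z0 = (ρ * φ.cos, ρ * φ.sin)) (hM : 0 ≤ M) {L : ℝ² →L[ℝ] ℝ}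
    (hL1 : |L (1, 0)| ≤ M * ρ ^ 2) (hL2 : |L (0, 1)| ≤ M) :
    ‖L.comp ((ρ⁻¹ • (-φ.sin • fst ℝ ℝ ℝ + φ.cos • snd ℝ ℝ ℝ)).prod
      ((2 * z0.1) • fst ℝ ℝ ℝ + (2 * z0.2) • snd ℝ ℝ ℝ))‖ ≤ 8 * M * ‖z0‖ := by
  refine ContinuousLinearMap.opNorm_le_bound _ (by positivity) fun v => ?_
  have hLdec : ∀ a b : ℝ, L (a, b) = a * L (1, 0) + b * L (0, 1) := by
    intro a b
    have : ((a, b) : ℝ²) = a • (1, 0) + b • (0, 1) := by simp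
    rw [this, map_add, map_smul, map_smul]; rfl
  simp only [comp_apply, prod_apply, smul_apply, add_apply, coe_fst', coe_snd', smul_eq_mul]
  rw [hLdec, Real.norm_eq_abs]
  have hv1 : |v.1| ≤ ‖v‖ := norm_fst_le v
  have hv2 : |v.2| ≤ ‖v‖ := norm_snd_le v
  have hz1 : |z0.1| ≤ ‖z0‖ := norm_fst_le z0
  have hz2 : |z0.2| ≤ ‖z0‖ := norm_snd_le z0
  have hs1 : |φ.sin| ≤ 1 := by
    rw [← sq_le_one_iff_abs_le_one]; nlinarith [φ.cos_sq_add_sin_sq, sq_nonneg φ.cos]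
  have hc1 : |φ.cos| ≤ 1 := by
    rw [← sq_le_one_iff_abs_le_one]; nlinarith [φ.cos_sq_add_sin_sq, sq_nonneg φ.sin]
  have hn := norm_nonneg v
  have hnz := norm_nonneg z0
  have hρle : ρ ≤ 2 * ‖z0‖ := by
    refine (abs_le_of_sq_le_sq' (a := ρ) ?_ (by positivity)).2
    have h1 : z0.1 ^ 2 + z0.2 ^ 2 = ρ ^ 2 := by
      rw [ez0]; linear_combination ρ ^ 2 * φ.cos_sq_add_sin_sq
    nlinarith [sq_add_sq_le z0, sq_nonneg ‖z0‖]
  have t1 : |ρ⁻¹ * (-φ.sin * v.1 + φ.cos * v.2)| ≤ ρ⁻¹ * (2 * ‖v‖) := by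
    rw [abs_mul, abs_of_pos (inv_pos.2 hρ0)]
    refine mul_le_mul_of_nonneg_left ?_ (inv_pos.2 hρ0).le
    refine (abs_add_le _ _).trans ?_
    rw [abs_mul, abs_mul, abs_neg]
    nlinarith [mul_le_mul hs1 hv1 (abs_nonneg _) zero_le_one,
      mul_le_mul hc1 hv2 (abs_nonneg _) zero_le_one]
  have t2 : |2 * z0.1 * v.1 + 2 * z0.2 * v.2| ≤ 4 * ‖z0‖ * ‖v‖ := by
    refine (abs_add_le _ _).trans ?_
    rw [abs_mul, abs_mul, abs_mul, abs_mul, abs_two]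
    nlinarith [mul_le_mul hz1 hv1 (abs_nonneg _) hnz, mul_le_mul hz2 hv2 (abs_nonneg _) hnz]
  calc |ρ⁻¹ * (-φ.sin * v.1 + φ.cos * v.2) * L (1, 0) +
        (2 * z0.1 * v.1 + 2 * z0.2 * v.2) * L (0, 1)|
      ≤ |ρ⁻¹ * (-φ.sin * v.1 + φ.cos * v.2)| * |L (1, 0)| +
        |2 * z0.1 * v.1 + 2 * z0.2 * v.2| * |L (0, 1)| := by
        rw [← abs_mul, ← abs_mul]; exact abs_add_le _ _
    _ ≤ ρ⁻¹ * (2 * ‖v‖) * (M * ρ ^ 2) + 4 * ‖z0‖ * ‖v‖ * M := by gcongr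
    _ = M * ‖v‖ * (2 * ρ + 4 * ‖z0‖) := by field_simp
    _ ≤ M * ‖v‖ * (8 * ‖z0‖) := mul_le_mul_of_nonneg_left (by linarith) (mul_nonneg hM hn)
    _ = 8 * M * ‖z0‖ * ‖v‖ := by ring

/-- Near a point of the circle `q = 0` the surface is a graph over the disc of the first complex
coordinate. -/
lemma exists_graph_circle (hP : ClosedDiagram P) (hα : α ∈ Thetas P) :
    ∃ k : ℝ² → ℝ, ContDiffAt ℝ 1 k 0 ∧ k 0 = 0 ∧
      ∀ᶠ u in 𝓝 (0 : ℝ³), pt (α + (u.2 : Angle))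
        (arg (u.1.1 + u.1.2 * I) : Angle) (u.1.1 ^ 2 + u.1.2 ^ 2) ∈ surface P ↔
        u.2 = k u.1 := by
  obtain ⟨δ, C, q0, hδ, hC, hq0, hq1, hB⟩ := exists_sideBound (hP.finite_theta α)
  set A : ℝ² → Angle := fun z => (arg (z.1 + z.2 * I) : Angle) with hA
  have hAcos : ∀ z : ℝ², sqrt (z.1 ^ 2 + z.2 ^ 2) * (A z).cos = z.1 := fun z => (polar_arg _ _).1
  have hAsin : ∀ z : ℝ², sqrt (z.1 ^ 2 + z.2 ^ 2) * (A z).sin = z.2 := fun z => (polar_arg _ _).2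
  -- the solution of the equation for the angle and the squared modulus of `z`; at `z = 0` the angle
  -- is irrelevant, as `k` is of quadratic size
  set k : ℝ² → ℝ := fun z => Classical.epsilon (SideRel P α δ (A z) (z.1 ^ 2 + z.2 ^ 2)) with hk
  have hspec : ∀ z : ℝ², z.1 ^ 2 + z.2 ^ 2 ≤ q0 →
      SideRel P α δ (A z) (z.1 ^ 2 + z.2 ^ 2) (k z) ∧ |k z| ≤ C * (z.1 ^ 2 + z.2 ^ 2) := by
    intro z hz
    have hz' : z.1 ^ 2 + z.2 ^ 2 ∈ Icc 0 q0 := ⟨by positivity, hz⟩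
    obtain ⟨x, hx, hxC⟩ := exists_sideRel hP hα hB hq1 hz' (A z)
    have h1 := Classical.epsilon_spec (p := SideRel P α δ (A z) (z.1 ^ 2 + z.2 ^ 2)) ⟨x, hx⟩
    refine ⟨h1, ?_⟩
    have h2 := SideRel.unique hP hB hq1 hz' h1 hx
    change |Classical.epsilon (SideRel P α δ (A z) (z.1 ^ 2 + z.2 ^ 2))| ≤ _
    rw [h2]; exact hxC
  have hsq := sq_add_sq_le
  set M := C * C + 1 / (1 - q0) with hM
  have hM0 : 0 < M := by
    have : 0 < 1 - q0 := by linarith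
    positivity
  have hk0 : k 0 = 0 := by
    have := (hspec 0 (by simpa using hq0.le)).2
    simpa using this
  have hsmall : ∀ᶠ z : ℝ² in 𝓝 0, z.1 ^ 2 + z.2 ^ 2 < q0 :=
    ContinuousAt.eventually_lt (f := fun z : ℝ² => z.1 ^ 2 + z.2 ^ 2) (by fun_prop)
      continuousAt_const (by simpa using hq0)
  refine ⟨k, contDiffAt_zero_of_bounds (C := 2 * C + 8 * M) ?_, hk0, ?_⟩
  · filter_upwards [hsmall] with z0 hz0
    constructor
    · refine (hspec z0 hz0.le).2.trans ?_
      calc C * (z0.1 ^ 2 + z0.2 ^ 2) ≤ C * (2 * ‖z0‖ ^ 2) := mul_le_mul_of_nonneg_left (hsq z0) hC.le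
        _ ≤ (2 * C + 8 * M) * ‖z0‖ ^ 2 := by
          have : 0 ≤ M * ‖z0‖ ^ 2 := by positivity
          linarith
    · intro hne
      set ρ := sqrt (z0.1 ^ 2 + z0.2 ^ 2) with hρ
      have hpos : 0 < z0.1 ^ 2 + z0.2 ^ 2 := by
        rcases eq_or_ne z0.1 0 with h1 | h1
        · have h2 : z0.2 ≠ 0 := fun h2 => hne (Prod.ext h1 h2)
          positivity
        · positivity
      have hρ0 : 0 < ρ := Real.sqrt_pos.2 hpos
      have hρ2 : ρ * ρ = z0.1 ^ 2 + z0.2 ^ 2 := Real.mul_self_sqrt hpos.le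
      obtain ⟨K, hK, hK1, hK2, hK3⟩ := exists_side_graph hP hα hB hδ hC hq1 (A z0) ⟨hpos, hz0⟩
      have ez0 : z0 = (ρ * (A z0).cos, ρ * (A z0).sin) := Prod.ext (hAcos z0).symm (hAsin z0).symm
      have hda := hasFDerivAt_angleCoord (A z0) hρ0
      rw [← ez0] at hda
      have hdpos : 0 < z0.1 * (A z0).cos + z0.2 * (A z0).sin := by
        have : z0.1 * (A z0).cos + z0.2 * (A z0).sin = ρ := by
          have h1 := hAcos z0
          have h2 := hAsin z0
          rw [← hρ] at h1 h2
          linear_combination ρ * (A z0).cos_sq_add_sin_sq - (A z0).cos * h1 - (A z0).sin * h2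
        rw [this]; exact hρ0
      have hca : ContDiffAt ℝ 1 (fun z : ℝ² => angleCoord (A z0) z.1 z.2) z0 :=
        contDiffAt_angleCoord contDiffAt_fst contDiffAt_snd hdpos
      have ha0 : angleCoord (A z0) z0.1 z0.2 = 0 := by
        have h := angleCoord_polar (A z0) hρ0 (t := 0) (by simpa using Real.pi_pos)
        simp only [Angle.coe_zero, add_zero] at h
        rw [hAcos, hAsin] at h
        exact h
      -- polar coordinates around the direction of `z0`
      set W : ℝ² → ℝ² := fun z => (angleCoord (A z0) z.1 z.2, z.1 ^ 2 + z.2 ^ 2) with hW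
      have hWc : ContDiffAt ℝ 1 W z0 := hca.prodMk (by fun_prop)
      have hW0 : W z0 = (0, z0.1 ^ 2 + z0.2 ^ 2) := by simp [hW, ha0]
      have heq : ∀ᶠ z in 𝓝 z0, k z = K (W z) := by
        have h1 : ∀ᶠ z in 𝓝 z0, W z ∈ {w | SideRel P α δ (A z0 + (w.1 : Angle)) w.2 (K w)} := by
          refine hWc.continuousAt.eventually ?_
          rw [hW0]; exact hK3
        have h2 : ∀ᶠ z : ℝ² in 𝓝 z0, 0 < z.1 * (A z0).cos + z.2 * (A z0).sin :=
          ContinuousAt.eventually_lt (f := fun _ => (0 : ℝ)) continuousAt_const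
            (g := fun z : ℝ² => z.1 * (A z0).cos + z.2 * (A z0).sin) (by fun_prop) hdpos
        have h3 : ∀ᶠ z : ℝ² in 𝓝 z0, z.1 ^ 2 + z.2 ^ 2 < q0 :=
          ContinuousAt.eventually_lt (f := fun z : ℝ² => z.1 ^ 2 + z.2 ^ 2) (by fun_prop)
            continuousAt_const hz0
        have h4 : ∀ᶠ z : ℝ² in 𝓝 z0, 0 < z.1 ^ 2 + z.2 ^ 2 :=
          ContinuousAt.eventually_lt (f := fun _ => (0 : ℝ)) continuousAt_const
            (g := fun z : ℝ² => z.1 ^ 2 + z.2 ^ 2) (by fun_prop) hpos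
        filter_upwards [h1, h2, h3, h4] with z z1 z2 z3 z4
        have e1 := polar_angleCoord (A z0) z2
        have e2 : A z = A z0 + (angleCoord (A z0) z.1 z.2 : Angle) :=
          angle_eq_of_cos_sin (Real.sqrt_pos.2 z4).ne' (by rw [hAcos, e1.1]) (by rw [hAsin, e1.2])
        have h5 := (hspec z z3.le).1
        rw [e2] at h5
        exact SideRel.unique hP hB hq1 ⟨z4.le, z3.le⟩ h5 z1
      have hK' : ContDiffAt ℝ 1 K (W z0) := by rw [hW0]; exact hK
      have hcomp : ContDiffAt ℝ 1 (fun z => K (W z)) z0 :=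
        ContDiffAt.comp (g := K) (f := W) z0 hK' hWc
      refine ⟨hcomp.congr_of_eventuallyEq heq, ?_⟩
      have hsqd : HasFDerivAt (fun z : ℝ² => z.1 ^ 2 + z.2 ^ 2)
          ((2 * z0.1) • fst ℝ ℝ ℝ + (2 * z0.2) • snd ℝ ℝ ℝ)
          z0 := by
        have := (hasFDerivAt_fst (𝕜 := ℝ) (p := z0)).pow 2 |>.add
          ((hasFDerivAt_snd (𝕜 := ℝ) (p := z0)).pow 2)
        refine this.congr_fderiv ?_
        ext <;> simp
      have hKd : HasFDerivAt K (fderiv ℝ K (0, z0.1 ^ 2 + z0.2 ^ 2)) (W z0) := by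
        rw [hW0]; exact (hK.differentiableAt one_ne_zero).hasFDerivAt
      have hkd := (HasFDerivAt.comp (g := K) (f := W) z0 hKd (hda.prodMk hsqd)).congr_of_eventuallyEq
        heq
      rw [hkd.fderiv]
      refine (norm_polar_comp_le (A z0) hρ0 ez0 hM0.le (by rw [pow_two ρ, hρ2]; exact hK1) hK2).trans ?_
      have := mul_nonneg hC.le (norm_nonneg z0)
      linarith
  · have e1 : ∀ᶠ u in 𝓝 (0 : ℝ³), |u.2| < δ :=
      eventually_small_abs (f := fun u : ℝ³ => u.2) (by fun_prop) rfl hδ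
    have e2 := eventually_sq_add_sq_lt hq0
    have hc : Continuous (fun u : ℝ³ => (α + (u.2 : Angle), u.1.1 ^ 2 + u.1.2 ^ 2)) :=
      (continuous_angle _ (by fun_prop)).prodMk (by fun_prop)
    have e3 := (hc.tendsto' 0 (α, 0) (by simp)).eventually (eventually_side hP hα)
    filter_upwards [e1, e2, e3] with u u1 u2 u3
    have hmem : u.1.1 ^ 2 + u.1.2 ^ 2 ∈ Icc 0 q0 := ⟨by positivity, u2.le⟩
    have hmem1 : u.1.1 ^ 2 + u.1.2 ^ 2 ∈ Icc (0 : ℝ) 1 := ⟨hmem.1, by linarith⟩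
    obtain ⟨s1, s2⟩ := hspec u.1 u2.le
    constructor
    · intro h
      rw [mem_surface_iff] at h
      obtain ⟨r, hr, v, q', ho, hpt⟩ := h
      obtain ⟨h1, h2, h3⟩ := (pt_eq_iff hmem1 ho.2.1).1 hpt
      have h2 := h2.resolve_left (by linarith)
      rw [← h1] at ho
      have ho : Over r (α + (u.2 : Angle), v.2) (u.1.1 ^ 2 + u.1.2 ^ 2) := by rw [h2]; exact ho
      have hrel : SideRel P α δ v.2 (u.1.1 ^ 2 + u.1.2 ^ 2) u.2 := ⟨u1, r, hr, u3 r hr _ ho, ho⟩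
      rcases h3 with h3 | h3
      · -- on the circle itself both solutions vanish
        obtain ⟨x, hx, hxC⟩ := exists_sideRel hP hα hB hq1 hmem v.2
        have h4 := SideRel.unique hP hB hq1 hmem hrel hx
        rw [h3, mul_zero] at hxC s2
        rw [h4, abs_nonpos_iff.1 hxC, abs_nonpos_iff.1 s2]
      · rw [← h3] at hrel
        exact SideRel.unique hP hB hq1 hmem hrel s1
    · intro h
      obtain ⟨-, r, hr, -, ho⟩ := s1
      rw [← h] at ho
      exact mem_surface_iff.2 ⟨r, hr, _, _, ho, rfl⟩

end

section

variable {P : Set Rect} {Δ r s : Rect} {θ φ α β : Angle} {σ ε x y q t : ℝ}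

/-! ### Sectors of the plane -/

lemma sector_eq (A : Set Angle) (z : ℝ²) : z ∈ Sector A ↔
    (z = 0 ∧ A.Nonempty) ∨ (z ≠ 0 ∧ (arg (z.1 + z.2 * I) : Angle) ∈ A) := by
  set c : ℂ := z.1 + z.2 * I with hc
  have h1 : ‖c‖ * cos c.arg = z.1 := by rw [Complex.norm_mul_cos_arg]; simp [hc]
  have h2 : ‖c‖ * sin c.arg = z.2 := by rw [Complex.norm_mul_sin_arg]; simp [hc]
  constructor
  · rintro ⟨s, hs, α, hα, e⟩
    by_cases hz : z = 0
    · exact Or.inl ⟨hz, α, hα⟩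
    · refine Or.inr ⟨hz, ?_⟩
      have hs0 : 0 < s := by
        refine lt_of_le_of_ne hs fun h => hz ?_
        rw [e, ← h]; simp
      have e1 : z.1 = s * α.cos := congrArg Prod.fst e
      have e2 : z.2 = s * α.sin := congrArg Prod.snd e
      have hn : ‖c‖ = s := by
        rw [hc, Complex.norm_add_mul_I, e1, e2]
        have : (s * α.cos) ^ 2 + (s * α.sin) ^ 2 = s ^ 2 := by
          linear_combination s ^ 2 * α.cos_sq_add_sin_sq
        rw [this, Real.sqrt_sq hs]
      have : (c.arg : Angle) = α := by
        refine angle_eq_of_cos_sin hs0.ne' ?_ ?_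
        · rw [Angle.cos_coe, ← e1, ← hn, h1]
        · rw [Angle.sin_coe, ← e2, ← hn, h2]
      rwa [this]
  · rintro (⟨h, α, hα⟩ | ⟨-, h⟩)
    · exact ⟨0, le_rfl, α, hα, by rw [h, zero_mul, zero_mul]; rfl⟩
    · exact ⟨‖c‖, norm_nonneg _, _, h, by rw [Angle.cos_coe, Angle.sin_coe, h1, h2]⟩

lemma sector_univ (z : ℝ²) : z ∈ Sector univ := by
  rw [sector_eq]
  by_cases h : z = 0
  · exact Or.inl ⟨h, univ_nonempty⟩
  · exact Or.inr ⟨h, mem_univ _⟩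

lemma coe_mem_arc_iff {c d t : ℝ} (hcd : c ≤ d) (hd : d - c < 2 * π) (h1 : d - 2 * π < t)
    (h2 : t < c + 2 * π) :
    (t : Angle) ∈ arc (c : Angle) (d : Angle) ↔ c ≤ t ∧ t ≤ d := by
  have hlen : arcLen (c : Angle) (d : Angle) = d - c := by
    have := arcLen_add_coe (c : Angle) (sub_nonneg.2 hcd) hd
    rwa [← Angle.coe_add, add_sub_cancel] at this
  have hE : IsEnd (c : Angle) (d : Angle) c 1 := Or.inl ⟨rfl, rfl⟩
  have e : (t : Angle) = c + (1 * (t - c) : ℝ) := by rw [one_mul, ← Angle.coe_add, add_sub_cancel]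
  rw [e]
  constructor
  · intro h
    have := hE.coord_mem h (by rw [hlen]; linarith) (by linarith)
    rw [hlen] at this
    constructor <;> linarith
  · rintro ⟨h3, h4⟩
    exact hE.mem_arc (by linarith) (by rw [hlen]; linarith)

lemma angle_coe_ne {c d : ℝ} (h : c < d) (h' : d - c < 2 * π) :
    (c : Angle) ≠ (d : Angle) := fun e => by
  have := coe_inj_of_abs_lt e (by rw [abs_lt]; constructor <;> linarith)
  linarith

lemma sector_arc {s t : ℝ} (hs : -π < s) (hst : s < t) (ht : t ≤ π) :
    IsCornerBase (arc (s : Angle) (t : Angle)) ∧ ∀ z : ℝ², z ∈ Sector (arc (s : Angle) (t : Angle)) ↔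
      z = 0 ∨ s ≤ arg (z.1 + z.2 * I) ∧ arg (z.1 + z.2 * I) ≤ t := by
  refine ⟨Or.inr ⟨_, _, angle_coe_ne (by linarith) (by linarith), rfl⟩, fun z => ?_⟩
  have hne : (arc (s : Angle) (t : Angle)).Nonempty := ⟨_, (coe_mem_arc_iff (t := s) (by linarith)
    (by linarith) (by linarith) (by linarith)).2 ⟨le_rfl, hst.le⟩⟩
  rw [sector_eq, coe_mem_arc_iff (by linarith) (by linarith)
    (by linarith [Complex.neg_pi_lt_arg (z.1 + z.2 * I)])
    (by linarith [Complex.arg_le_pi (z.1 + z.2 * I)])]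
  by_cases hz : z = 0 <;> simp [hz, hne]

lemma sector_right : IsCornerBase (arc ((-(π / 2) : ℝ) : Angle) ((π / 2 : ℝ) : Angle)) ∧
    ∀ z : ℝ², z ∈ Sector (arc ((-(π / 2) : ℝ) : Angle) ((π / 2 : ℝ) : Angle)) ↔ 0 ≤ z.1 := by
  have hπ := Real.pi_pos
  refine (sector_arc (by linarith) (by linarith) (by linarith)).imp_right fun h z => ?_
  rw [h, ← abs_le, Complex.abs_arg_le_pi_div_two_iff, re_add_mul_I]
  exact or_iff_right_of_imp (by rintro rfl; simp)

lemma sector_upper : IsCornerBase (arc ((0 : ℝ) : Angle) (π : Angle)) ∧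
    ∀ z : ℝ², z ∈ Sector (arc ((0 : ℝ) : Angle) (π : Angle)) ↔ 0 ≤ z.2 := by
  have hπ := Real.pi_pos
  refine (sector_arc (by linarith) (by linarith) le_rfl).imp_right fun h z => ?_
  rw [h, and_iff_left (Complex.arg_le_pi _), Complex.arg_nonneg_iff, im_add_mul_I]
  exact or_iff_right_of_imp (by rintro rfl; simp)

lemma sector_quadrant : IsCornerBase (arc ((0 : ℝ) : Angle) ((π / 2 : ℝ) : Angle)) ∧
    ∀ z : ℝ², z ∈ Sector (arc ((0 : ℝ) : Angle) ((π / 2 : ℝ) : Angle)) ↔ 0 ≤ z.1 ∧ 0 ≤ z.2 := by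
  have hπ := Real.pi_pos
  refine (sector_arc (by linarith) (by linarith) (by linarith)).imp_right fun h z => ?_
  have h1 := Complex.abs_arg_le_pi_div_two_iff (z := z.1 + z.2 * I)
  have h2 := Complex.arg_nonneg_iff (z := z.1 + z.2 * I)
  rw [re_add_mul_I] at h1
  rw [im_add_mul_I] at h2
  rw [h, ← h1, ← h2, abs_le]
  constructor
  · rintro (rfl | ⟨h3, h4⟩)
    · simp; positivity
    · exact ⟨⟨by linarith, h4⟩, h3⟩
  · rintro ⟨⟨-, h3⟩, h4⟩; exact Or.inr ⟨h4, h3⟩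

/-! ### Local forms of a surface with corners -/

/-- In the coordinates `G`, with inverse `Gi`, the set `E` is near `p` the graph of `k` over the
sector with base `A`. -/
structure LocalForm (E : Set S3) (p : S3) (G : E⁴ → ℝ³)
    (Gi : ℝ³ → S3) (k : ℝ² → ℝ) (A : Set Angle) : Prop where
  coords : LocalCoords p G Gi
  contDiffAt : ContDiffAt ℝ 1 k 0
  zero : k 0 = 0
  base : IsCornerBase A
  eventually_iff : ∀ᶠ u in 𝓝 (0 : ℝ³), Gi u ∈ E ↔ u.2 = k u.1 ∧ u.1 ∈ Sector A

section LocalForm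

variable {E E' : Set S3} {p : S3} {G : E⁴ → ℝ³}
  {Gi : ℝ³ → S3} {k : ℝ² → ℝ} {A : Set Angle}

lemma LocalCoords.tendsto_inv (h : LocalCoords p G Gi) : Tendsto Gi (𝓝 0) (𝓝 p) := by
  have h1 : ContinuousAt Gi 0 :=
    Topology.IsInducing.subtypeVal.continuousAt_iff.2 h.contDiff_inv.continuousAt
  rw [← h.inv_zero]
  exact h1

lemma LocalCoords.eventually_of_inv (h : LocalCoords p G Gi) {Q : ℝ³ → Prop}
    (hQ : ∀ᶠ u in 𝓝 0, Q u) : ∀ᶠ z in 𝓝 p, ∃ u, Q u ∧ z = Gi u := by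
  have h0 : G p = 0 := by
    have := h.right_inv.self_of_nhds
    rwa [h.inv_zero] at this
  have hc : Tendsto (fun z : S3 => G z) (𝓝 p) (𝓝 0) := by
    rw [← h0]
    exact ContinuousAt.comp (g := G) (f := fun z : S3 => (z : E⁴))
      h.contDiff.continuousAt continuous_subtype_val.continuousAt
  filter_upwards [hc.eventually hQ, h.left_inv] with z h1 h2
  exact ⟨G z, h1, h2.symm⟩

lemma LocalForm.congr (h : LocalForm E p G Gi k A) (hE : ∀ᶠ z in 𝓝 p, z ∈ E ↔ z ∈ E') :
    LocalForm E' p G Gi k A := by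
  refine ⟨h.coords, h.contDiffAt, h.zero, h.base, ?_⟩
  filter_upwards [h.eventually_iff, h.coords.tendsto_inv.eventually hE] with u h1 h2
  rw [← h2, h1]

lemma LocalForm.inter (h : LocalForm E p G Gi k univ) {S : Set S3} (hA : IsCornerBase A)
    (hS : ∀ᶠ u in 𝓝 (0 : ℝ³), Gi u ∈ S ↔ u.1 ∈ Sector A) :
    LocalForm (E ∩ S) p G Gi k A := by
  refine ⟨h.coords, h.contDiffAt, h.zero, hA, ?_⟩
  filter_upwards [h.eventually_iff, hS] with u h1 h2
  rw [mem_inter_iff, h1, h2]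
  simp [sector_univ]

lemma LocalForm.swap (h : LocalForm E p G Gi k A) :
    LocalForm (swapS ⁻¹' E) (swapS p) (fun z => G (swapE z)) (fun u => swapS (Gi u)) k A := by
  refine ⟨h.coords.swap, h.contDiffAt, h.zero, h.base, ?_⟩
  filter_upwards [h.eventually_iff] with u h1
  rw [mem_preimage, swapS_swapS, h1]

lemma LocalForm.exists_isConeChart (h : LocalForm E p G Gi k A) :
    ∃ f, IsConeChart E p A f ∧ ∃ c > 0, ∀ z : S3, f z 2 = c * ((G z).2 - k (G z).1) :=
  h.coords.exists_isConeChart h.contDiffAt h.zero h.eventually_iff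

/-- The curve `γ` runs along the third axis of the coordinates `G`, with a speed different from
zero. -/
def RunsAlong (G : E⁴ → ℝ³) (γ : ℝ → S3) (t : ℝ) : Prop :=
  (∀ᶠ s in 𝓝 t, (G (γ s)).1 = 0) ∧ ∃ c : ℝ, c ≠ 0 ∧ HasDerivAt (fun s => (G (γ s)).2) c t

lemma LocalForm.transverseAt {γ : ℝ → S3} (h : LocalForm E (γ t) G Gi k A) (hγ : RunsAlong G γ t) :
    TransverseAt E γ t := by
  obtain ⟨f, hf, c, hc, hfc⟩ := h.exists_isConeChart
  obtain ⟨h1, d, hd, hder⟩ := hγ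
  refine ⟨A, f, h.base, hf, c * d, mul_ne_zero hc.ne' hd, ?_⟩
  refine (hder.const_mul c).congr_of_eventuallyEq ?_
  filter_upwards [h1] with s hs
  rw [hfc, hs, h.zero, sub_zero]

end LocalForm

lemma localForm_vertex (hP : ClosedDiagram P) (hr : r ∈ P) (h1 : r.Vert α σ) (h2 : r.Horiz β ε)
    (hq : q ∈ Ioo (0 : ℝ) 1) : ∃ G Gi k, LocalForm (surface P) (pt α β q) G Gi k univ := by
  obtain ⟨k, hk, hk0, hk1⟩ := exists_graph_vertex hP hr h1 h2 hq
  refine ⟨_, _, k, (localCoords_torus α β hq h1.sign h2.sign).rotate, hk, hk0, Or.inl rfl, ?_⟩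
  filter_upwards [hk1] with u hu
  rw [hu]
  simp [sector_univ]

lemma localForm_interior (hP : ClosedDiagram P) (hs : s ∈ P) (ho : Over s (θ, φ) q)
    (hv : (θ, φ) ∉ s.vertices) (hq : q ∈ Ioo (0 : ℝ) 1) (hσ : σ = 1 ∨ σ = -1)
    (hε : ε = 1 ∨ ε = -1) : ∃ k, LocalForm (surface P) (pt θ φ q)
      (fun z => ((σ * angleCoord θ (z 2) (z 3), ε * angleCoord φ (z 0) (z 1)),
        z 0 ^ 2 + z 1 ^ 2 - q))
      (fun u => pt (θ + (σ * u.1.1 : ℝ)) (φ + (ε * u.1.2 : ℝ)) (q + u.2)) k univ := by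
  obtain ⟨k, hk, hk0, hk1⟩ := exists_graph_interior hP hs ho hv hq σ ε
  refine ⟨k, localCoords_torus θ φ hq hσ hε, hk, hk0, Or.inl rfl, ?_⟩
  filter_upwards [hk1] with u hu
  rw [hu]
  simp [sector_univ]

lemma localForm_circle (hP : ClosedDiagram P) (hα : α ∈ Thetas P) (φ : Angle) :
    ∃ k, LocalForm (surface P) (pt α φ 0) (fun z => ((z 0, z 1), angleCoord α (z 2) (z 3)))
      (fun u => pt (α + (u.2 : Angle)) (arg (u.1.1 + u.1.2 * I) : Angle)
        (u.1.1 ^ 2 + u.1.2 ^ 2)) k univ := by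
  obtain ⟨k, hk, hk0, hk1⟩ := exists_graph_circle hP hα
  refine ⟨k, localCoords_circle α φ, hk, hk0, Or.inl rfl, ?_⟩
  filter_upwards [hk1] with u hu
  rw [hu]
  simp [sector_univ]

/-! ### The surface is embedded -/

lemma Over.mem_thetas (ho : Over r (θ, φ) 0) (hr : r ∈ P) : θ ∈ Thetas P := by
  obtain ⟨hθ, hφ⟩ := exists_vert_horiz r
  obtain ⟨x, hx, y, hy, e, h⟩ := ho.exists_coord hθ hφ
  have hx' : x = 0 ∨ x = r.wid := by
    rcases h with h | h
    · exact h.1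
    · exact mfun_rectH_eq_zero r.hei_pos hx hy h.symm
  refine RectDiagram.mem_thetas hr ?_
  have e1 : θ = r.θ₁ + (1 * x : ℝ) := congrArg Prod.fst e
  rcases hx' with rfl | rfl
  · left; simpa using e1
  · right; rw [e1, one_mul]; exact add_arcLen _ _

lemma surface_swap : surface P = swapS ⁻¹' surface (Rect.swap '' P) := by
  ext p; rw [mem_preimage, mem_surface_swap]

/-- The position of a point of the surface: it lies on one of the two circles, on the segment over a
vertex, or over an interior point of a tile. -/
lemma surface_cases {p : S3} (hp : p ∈ surface P) :
    (∃ α ∈ Thetas P, ∃ φ, p = pt α φ 0) ∨ (∃ β ∈ Phis P, ∃ θ, p = pt θ β 1) ∨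
      ∃ r ∈ P, ∃ θ φ, ∃ q ∈ Ioo (0 : ℝ) 1, Over r (θ, φ) q ∧ p = pt θ φ q := by
  obtain ⟨r, hr, ⟨θ, φ⟩, q, ho, rfl⟩ := mem_surface_iff.1 hp
  rcases ho.2.1.1.eq_or_lt with h0 | h0
  · subst h0
    exact Or.inl ⟨θ, ho.mem_thetas hr, φ, rfl⟩
  rcases ho.2.1.2.eq_or_lt with h1 | h1
  · subst h1
    refine Or.inr (Or.inl ⟨φ, ?_, θ, rfl⟩)
    have := over_swap.2 ho
    rw [sub_self] at this
    rw [← thetas_swap]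
    exact Over.mem_thetas (r := r.swap) this ⟨r, hr, rfl⟩
  · exact Or.inr (Or.inr ⟨r, hr, θ, φ, q, ⟨h0, h1⟩, ho, rfl⟩)

lemma localForm_circle_swap (hP : ClosedDiagram P) (hβ : β ∈ Phis P) (θ : Angle) :
    ∃ Gi k, LocalForm (surface P) (pt θ β 1) (fun z => ((z 2, z 3), angleCoord β (z 0) (z 1)))
      Gi k univ ∧ Gi = fun u => swapS (pt (β + (u.2 : Angle))
        (arg (u.1.1 + u.1.2 * I) : Angle) (u.1.1 ^ 2 + u.1.2 ^ 2)) := by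
  obtain ⟨k, hk⟩ := localForm_circle hP.swap (α := β) (by rw [thetas_swap]; exact hβ) θ
  have := hk.swap
  rw [← surface_swap, swapS_pt _ _ (by simp), sub_zero] at this
  exact ⟨_, k, this, rfl⟩

theorem ClosedDiagram.isEmbeddedSurface (hP : ClosedDiagram P) : IsEmbeddedSurface (surface P) := by
  intro p hp
  have key : ∃ G Gi k, LocalForm (surface P) p G Gi k univ := by
    rcases surface_cases hp with ⟨α, hα, φ, rfl⟩ | ⟨β, hβ, θ, rfl⟩ | ⟨r, hr, θ, φ, q, hq, ho, rfl⟩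
    · obtain ⟨k, hk⟩ := localForm_circle hP hα φ
      exact ⟨_, _, k, hk⟩
    · obtain ⟨Gi, k, hk, -⟩ := localForm_circle_swap hP hβ θ
      exact ⟨_, _, k, hk⟩
    · by_cases hv : (θ, φ) ∈ r.vertices
      · obtain ⟨σ, ε, h1, h2⟩ := exists_frame_of_vertex hv
        exact localForm_vertex hP hr h1 h2 hq
      · obtain ⟨k, hk⟩ := localForm_interior hP hr ho hv hq (Or.inl rfl) (Or.inl rfl)
        exact ⟨_, _, k, hk⟩
  obtain ⟨G, Gi, k, hk⟩ := key
  obtain ⟨f, hf, -⟩ := hk.exists_isConeChart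
  exact ⟨f, hf⟩

end

section

variable {P : Set Rect} {Δ r s : Rect} {θ φ α β : Angle} {σ ε x y q t : ℝ}

/-! ### The simplex in coordinates -/

lemma pt_mem_simplex_iff (hq : q ∈ Icc (0 : ℝ) 1) : pt θ φ q ∈ Δ.simplex ↔
    (q = 1 ∨ θ ∈ arc Δ.θ₁ Δ.θ₂) ∧ (q = 0 ∨ φ ∈ arc Δ.φ₁ Δ.φ₂) := by
  constructor
  · rintro ⟨v, hv, τ, hτ, e⟩
    rw [joinPt_eq_pt _ _ hτ, pt_eq_iff hq (cos_sq_mem _)] at e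
    obtain ⟨-, h1, h2⟩ := e
    exact ⟨h1.imp_right fun h => by rw [h]; exact hv.1, h2.imp_right fun h => by rw [h]; exact hv.2⟩
  · rintro ⟨h1, h2⟩
    obtain ⟨θ', hθ', e1⟩ : ∃ θ' ∈ arc Δ.θ₁ Δ.θ₂, q = 1 ∨ θ = θ' := by
      rcases h1 with h | h
      · exact ⟨_, (exists_vert_horiz Δ).1.self_mem_arc, Or.inl h⟩
      · exact ⟨θ, h, Or.inr rfl⟩
    obtain ⟨φ', hφ', e2⟩ : ∃ φ' ∈ arc Δ.φ₁ Δ.φ₂, q = 0 ∨ φ = φ' := by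
      rcases h2 with h | h
      · exact ⟨_, (exists_vert_horiz Δ).2.self_mem_arc, Or.inl h⟩
      · exact ⟨φ, h, Or.inr rfl⟩
    obtain ⟨τ, hτ, e⟩ := exists_joinPt_eq_pt θ' φ' q
    exact ⟨(θ', φ'), ⟨hθ', hφ'⟩, τ, hτ, by rw [← e, pt_eq_iff hq hq]; exact ⟨rfl, e1, e2⟩⟩

lemma pt_mem_simplexBoundary_iff (hq : q ∈ Icc (0 : ℝ) 1) (hθ : θ ∈ arc Δ.θ₁ Δ.θ₂)
    (hφ : φ ∈ arc Δ.φ₁ Δ.φ₂) : pt θ φ q ∈ Δ.simplexBoundary ↔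
      q = 0 ∨ q = 1 ∨ (θ = Δ.θ₁ ∨ θ = Δ.θ₂) ∨ (φ = Δ.φ₁ ∨ φ = Δ.φ₂) := by
  have hs1 := (exists_vert_horiz Δ).1.self_mem_arc
  have hs2 := (exists_vert_horiz Δ).2.self_mem_arc
  constructor
  · rintro ⟨v, hv, hb, τ, hτ, e⟩
    rw [joinPt_eq_pt _ _ hτ, pt_eq_iff hq (cos_sq_mem _)] at e
    obtain ⟨-, h1, h2⟩ := e
    rcases h2 with h2 | h2
    · exact Or.inl h2
    rcases h1 with h1 | h1
    · exact Or.inr (Or.inl h1)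
    · rw [h1, h2]; tauto
  · intro h
    obtain ⟨θ', φ', h1, h2, h3, h4⟩ : ∃ θ' φ', (θ' ∈ arc Δ.θ₁ Δ.θ₂ ∧ φ' ∈ arc Δ.φ₁ Δ.φ₂) ∧
        (θ' = Δ.θ₁ ∨ θ' = Δ.θ₂ ∨ φ' = Δ.φ₁ ∨ φ' = Δ.φ₂) ∧ (q = 1 ∨ θ = θ') ∧ (q = 0 ∨ φ = φ') := by
      rcases h with h | h | h | h
      · exact ⟨θ, Δ.φ₁, ⟨hθ, hs2⟩, by tauto, Or.inr rfl, Or.inl h⟩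
      · exact ⟨Δ.θ₁, φ, ⟨hs1, hφ⟩, by tauto, Or.inl h, Or.inr rfl⟩
      · exact ⟨θ, φ, ⟨hθ, hφ⟩, by tauto, Or.inr rfl, Or.inr rfl⟩
      · exact ⟨θ, φ, ⟨hθ, hφ⟩, by tauto, Or.inr rfl, Or.inr rfl⟩
    obtain ⟨τ, hτ, e⟩ := exists_joinPt_eq_pt θ' φ' q
    exact ⟨(θ', φ'), h1, h2, τ, hτ, by rw [← e, pt_eq_iff hq hq]; exact ⟨rfl, h3, h4⟩⟩

lemma swapS_joinPt (θ φ : Angle) {τ : ℝ} (hτ : τ ∈ Icc (0 : ℝ) 1) :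
    ∃ τ' ∈ Icc (0 : ℝ) 1, swapS (joinPt θ φ τ) = joinPt φ θ τ' := by
  obtain ⟨τ', h, e⟩ := exists_joinPt_eq_pt φ θ (1 - cos (π * τ / 2) ^ 2)
  exact ⟨τ', h, by rw [joinPt_eq_pt _ _ hτ, swapS_pt _ _ (cos_sq_mem _), e]⟩

lemma swapS_mem_simplex {p : S3} : swapS p ∈ Δ.swap.simplex ↔ p ∈ Δ.simplex := by
  have key : ∀ (Δ : Rect) (p : S3), p ∈ Δ.simplex → swapS p ∈ Δ.swap.simplex := by
    rintro Δ p ⟨v, hv, τ, hτ, rfl⟩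
    obtain ⟨τ', hτ', e⟩ := swapS_joinPt v.1 v.2 hτ
    exact ⟨v.swap, mem_swap_carrier.2 hv, τ', hτ', e⟩
  refine ⟨fun h => ?_, key Δ p⟩
  have := key _ _ h
  rwa [swapS_swapS] at this

lemma swapS_mem_simplexBoundary {p : S3} :
    swapS p ∈ Δ.swap.simplexBoundary ↔ p ∈ Δ.simplexBoundary := by
  have key : ∀ (Δ : Rect) (p : S3), p ∈ Δ.simplexBoundary → swapS p ∈ Δ.swap.simplexBoundary := by
    rintro Δ p ⟨v, hv, hb, τ, hτ, rfl⟩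
    obtain ⟨τ', hτ', e⟩ := swapS_joinPt v.1 v.2 hτ
    refine ⟨v.swap, mem_swap_carrier.2 hv, ?_, τ', hτ', e⟩
    change v.2 = Δ.φ₁ ∨ v.2 = Δ.φ₂ ∨ v.1 = Δ.θ₁ ∨ v.1 = Δ.θ₂
    tauto
  refine ⟨fun h => ?_, key Δ p⟩
  have := key _ _ h
  rwa [swapS_swapS] at this

/-! ### The surface in a simplex, locally -/

/-- The simplex `Δ` is in general position with respect to the closed diagram `P`, and no side of a
rectangle of `P` is contained in an arc of `Δ`. The latter is stated as the existence of the position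
of every side relative to the arc. -/
structure Window (P : Set Rect) (Δ : Rect) : Prop where
  closed : ClosedDiagram P
  theta : ∀ θ ∈ Thetas P, θ ≠ Δ.θ₁ ∧ θ ≠ Δ.θ₂
  phi : ∀ φ ∈ Phis P, φ ≠ Δ.φ₁ ∧ φ ≠ Δ.φ₂
  pos_theta : ∀ r ∈ P, ∀ θ ∈ arc r.θ₁ r.θ₂, θ ∈ arc Δ.θ₁ Δ.θ₂ → ∃ α σ x0 x1 x,
    Position Δ.θ₁ Δ.θ₂ r.θ₁ r.θ₂ α σ x0 x1 ∧ x0 ≤ x ∧ x ≤ x1 ∧ θ = α + (σ * x : ℝ)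
  pos_phi : ∀ r ∈ P, ∀ φ ∈ arc r.φ₁ r.φ₂, φ ∈ arc Δ.φ₁ Δ.φ₂ → ∃ β ε y0 y1 y,
    Position Δ.φ₁ Δ.φ₂ r.φ₁ r.φ₂ β ε y0 y1 ∧ y0 ≤ y ∧ y ≤ y1 ∧ φ = β + (ε * y : ℝ)

lemma Window.swap (W : Window P Δ) : Window (Rect.swap '' P) Δ.swap := by
  refine ⟨W.closed.swap, ?_, ?_, ?_, ?_⟩
  · rw [thetas_swap]; exact W.phi
  · rw [phis_swap]; exact W.theta
  · rintro _ ⟨r, hr, rfl⟩; exact W.pos_phi r hr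
  · rintro _ ⟨r, hr, rfl⟩; exact W.pos_theta r hr

lemma exists_sign_arc {a b : Angle} (hab : a ≠ b) (h : θ ∈ arc a b) :
    ∃ σ : ℝ, (σ = 1 ∨ σ = -1) ∧
      ((∀ᶠ t : ℝ in 𝓝 0, θ + (σ * t : ℝ) ∈ arc a b) ∨
        ∀ᶠ t : ℝ in 𝓝 0, θ + (σ * t : ℝ) ∈ arc a b ↔ 0 ≤ t) := by
  by_cases he : θ = a ∨ θ = b
  · obtain ⟨σ, hσ⟩ := exists_isEnd he
    refine ⟨σ, hσ.sign, Or.inr ?_⟩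
    filter_upwards [eventually_abs_lt_zero (arcLen_pos hab),
      eventually_abs_lt_zero (sub_pos.2 (arcLen_lt a b))] with t h3 h4
    rw [abs_lt] at h3 h4
    constructor
    · intro hm
      exact (hσ.coord_mem hm (by linarith) (by linarith [arcLen_lt a b])).1
    · intro h0
      exact hσ.mem_arc h0 h3.2.le
  · push Not at he
    refine ⟨1, Or.inl rfl, Or.inl ?_⟩
    simp only [one_mul]
    exact eventually_angle.1 (eventually_mem_arc h he.1 he.2)

/-- Near a point outside the two circles the simplex is the product of a sector with a line. -/
lemma exists_sector_torus (hθ : θ ∈ arc Δ.θ₁ Δ.θ₂) (hφ : φ ∈ arc Δ.φ₁ Δ.φ₂)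
    (hq : q ∈ Ioo (0 : ℝ) 1) : ∃ σ ε A, (σ = 1 ∨ σ = -1) ∧ (ε = 1 ∨ ε = -1) ∧ IsCornerBase A ∧
      ∀ᶠ u in 𝓝 (0 : ℝ³), pt (θ + (σ * u.1.1 : ℝ))
        (φ + (ε * u.1.2 : ℝ)) (q + u.2) ∈ Δ.simplex ↔ u.1 ∈ Sector A := by
  obtain ⟨σ, hσ, h1⟩ := exists_sign_arc Δ.θ_ne hθ
  obtain ⟨ε, hε, h2⟩ := exists_sign_arc Δ.φ_ne hφ
  have k3 := eventually_add_mem_Ioo hq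
  have t1 : Tendsto (fun u : ℝ³ => u.1.1) (𝓝 0) (𝓝 0) := Continuous.tendsto' (by fun_prop) _ _ rfl
  have t2 : Tendsto (fun u : ℝ³ => u.1.2) (𝓝 0) (𝓝 0) := Continuous.tendsto' (by fun_prop) _ _ rfl
  suffices h : ∃ A, IsCornerBase A ∧ ∀ᶠ u in 𝓝 (0 : ℝ³), (θ + (σ * u.1.1 : ℝ) ∈ arc Δ.θ₁ Δ.θ₂ ∧
      φ + (ε * u.1.2 : ℝ) ∈ arc Δ.φ₁ Δ.φ₂) ↔ u.1 ∈ Sector A by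
    obtain ⟨A, hA, h⟩ := h
    refine ⟨σ, ε, A, hσ, hε, hA, ?_⟩
    filter_upwards [k3, h] with u u1 u2
    rw [pt_mem_simplex_iff (Ioo_subset_Icc_self u1), ← u2]
    simp only [u1.1.ne', u1.2.ne, false_or]
  rcases h1 with h1 | h1 <;> rcases h2 with h2 | h2 <;>
    have h3 := (t1.eventually h1).and (t2.eventually h2)
  · exact ⟨_, Or.inl rfl, h3.mono fun u hu => by simp only [hu.1, hu.2, sector_univ, and_self]⟩
  · exact ⟨_, sector_upper.1, h3.mono fun u hu => by simp only [hu.1, hu.2, sector_upper.2, true_and]⟩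
  · exact ⟨_, sector_right.1, h3.mono fun u hu => by simp only [hu.1, hu.2, sector_right.2, and_true]⟩
  · exact ⟨_, sector_quadrant.1, h3.mono fun u hu => by simp only [hu.1, hu.2, sector_quadrant.2]⟩

/-- Near an interior point of the edge `[θ₁; θ₂]` of the simplex, the simplex is the product of the
sector `[φ₁; φ₂]` with a line. -/
lemma eventually_sector_circle (hα : α ∈ arc Δ.θ₁ Δ.θ₂) (h1 : α ≠ Δ.θ₁) (h2 : α ≠ Δ.θ₂) :
    ∀ᶠ u in 𝓝 (0 : ℝ³), pt (α + (u.2 : Angle))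
      (arg (u.1.1 + u.1.2 * I) : Angle) (u.1.1 ^ 2 + u.1.2 ^ 2) ∈ Δ.simplex ↔
        u.1 ∈ Sector (arc Δ.φ₁ Δ.φ₂) := by
  have k1 := eventually_sq_add_sq_lt one_pos
  have t2 : Tendsto (fun u : ℝ³ => u.2) (𝓝 0) (𝓝 0) := Continuous.tendsto' (by fun_prop) _ _ rfl
  filter_upwards [k1, t2.eventually (eventually_angle.1 (eventually_mem_arc hα h1 h2))] with u u1 u2
  have hmem : u.1.1 ^ 2 + u.1.2 ^ 2 ∈ Icc (0 : ℝ) 1 := ⟨by positivity, u1.le⟩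
  have hz : u.1.1 ^ 2 + u.1.2 ^ 2 = 0 ↔ u.1 = 0 := by
    constructor
    · intro h
      have a := sq_nonneg u.1.1
      have b := sq_nonneg u.1.2
      exact Prod.ext (pow_eq_zero_iff two_ne_zero |>.1 (by linarith))
        (pow_eq_zero_iff two_ne_zero |>.1 (by linarith))
    · intro h; rw [h]; simp
  rw [pt_mem_simplex_iff hmem, sector_eq, hz]
  have hne : (arc Δ.φ₁ Δ.φ₂).Nonempty := ⟨_, (exists_vert_horiz Δ).2.self_mem_arc⟩
  by_cases h : u.1 = 0 <;> simp [h, u2, hne]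

lemma joinPt_coe (θ φ : Angle) (τ : ℝ) : (joinPt θ φ τ : E⁴) =
    !₂[cos (π * τ / 2) * φ.cos, cos (π * τ / 2) * φ.sin,
      sin (π * τ / 2) * θ.cos, sin (π * τ / 2) * θ.sin] := rfl

/-- The edges of the simplex that join the two circles run along the third axis of the coordinates
of the torus. -/
lemma runsAlong_torus (hq : q ∈ Ioo (0 : ℝ) 1) (ht : t ∈ Icc (0 : ℝ) 1)
    (h : joinPt θ φ t = pt θ φ q) (σ ε : ℝ) :
    RunsAlong (fun z => ((σ * angleCoord θ (z 2) (z 3), ε * angleCoord φ (z 0) (z 1)),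
        z 0 ^ 2 + z 1 ^ 2 - q)) (fun s => joinPt θ φ s) t := by
  have hπ := Real.pi_pos
  rw [joinPt_eq_pt _ _ ht, pt_eq_iff (cos_sq_mem _) (Ioo_subset_Icc_self hq)] at h
  have h0 : 0 < t := by
    refine lt_of_le_of_ne ht.1 ?_
    rintro rfl
    have := h.1; simp at this; exact hq.2.ne this.symm
  have h1 : t < 1 := by
    refine lt_of_le_of_ne ht.2 ?_
    rintro rfl
    have := h.1; simp at this; exact hq.1.ne this
  have hpos : ∀ s, 0 < s → s < 1 → 0 < sin (π * s / 2) ∧ 0 < cos (π * s / 2) := by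
    intro s hs0 hs1
    exact ⟨Real.sin_pos_of_pos_of_lt_pi (by positivity) (by nlinarith),
      Real.cos_pos_of_mem_Ioo ⟨by nlinarith [mul_pos hπ hs0], by nlinarith⟩⟩
  refine ⟨?_, -(π * cos (π * t / 2) * sin (π * t / 2)), ?_, ?_⟩
  · filter_upwards [isOpen_Ioo.mem_nhds (show t ∈ Ioo (0 : ℝ) 1 from ⟨h0, h1⟩)] with s hs
    obtain ⟨p1, p2⟩ := hpos s hs.1 hs.2
    have e1 := angleCoord_polar θ p1 (t := 0) (by simpa using hπ)
    have e2 := angleCoord_polar φ p2 (t := 0) (by simpa using hπ)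
    simp only [Angle.coe_zero, add_zero] at e1 e2
    rw [joinPt_coe]
    simp [e1, e2]
  · obtain ⟨p1, p2⟩ := hpos t h0 h1
    have : 0 < π * cos (π * t / 2) * sin (π * t / 2) := by positivity
    exact neg_ne_zero.2 this.ne'
  · have hl : HasDerivAt (fun s : ℝ => π * s / 2) (π / 2) t := by
      have := ((hasDerivAt_id t).const_mul π).div_const 2
      simpa using this
    have hd := ((hl.cos).pow 2).sub_const q
    have hd' := hd.congr_deriv (f' := _)
      (g' := -(π * cos (π * t / 2) * sin (π * t / 2))) (by simp; ring)
    refine hd'.congr_of_eventuallyEq (Eventually.of_forall fun s => ?_)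
    simp only [joinPt_coe]
    simp
    linear_combination cos (π * s / 2) ^ 2 * φ.cos_sq_add_sin_sq

lemma hasDerivAt_angleCoord_rotate {a α : Angle} {L t : ℝ} (h : a + (t * L : ℝ) = α) :
    HasDerivAt (fun s : ℝ => angleCoord α (a + (s * L : ℝ)).cos (a + (s * L : ℝ)).sin) L t := by
  have h1 : HasDerivAt (fun s : ℝ => (s - t) * L) L t := by
    simpa using ((hasDerivAt_id t).sub_const t).mul_const L
  refine h1.congr_of_eventuallyEq ?_
  have h2 : ∀ᶠ s in 𝓝 t, |(s - t) * L| < π / 2 :=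
    eventually_small_abs (f := fun s : ℝ => (s - t) * L) (by fun_prop) (by simp)
      (by have := Real.pi_pos; positivity)
  filter_upwards [h2] with s hs
  have := angleCoord_polar α one_pos hs
  rw [one_mul, one_mul, ← h, add_coe_add (show t * L + (s - t) * L = s * L by ring)] at this
  rw [← h]; exact this

/-- The edge `[θ₁; θ₂]` of the simplex runs along the third axis of the coordinates centred at one
of its points. -/
lemma runsAlong_circle (a α : Angle) (L : ℝ) (h : a + (t * L : ℝ) = α)
    (hL : L ≠ 0) : RunsAlong (fun z => ((z 0, z 1), angleCoord α (z 2) (z 3)))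
      (fun s => joinPt (a + (s * L : ℝ)) 0 1) t :=
  ⟨.of_forall fun s => by simp [joinPt_coe], L, hL,
    (hasDerivAt_angleCoord_rotate h).congr_of_eventuallyEq (.of_forall fun s => by simp [joinPt_coe])⟩

lemma runsAlong_circle_swap (a β : Angle) (L : ℝ) (h : a + (t * L : ℝ) = β)
    (hL : L ≠ 0) : RunsAlong (fun z => ((z 2, z 3), angleCoord β (z 0) (z 1)))
      (fun s => joinPt 0 (a + (s * L : ℝ)) 0) t :=
  ⟨.of_forall fun s => by simp [joinPt_coe], L, hL,
    (hasDerivAt_angleCoord_rotate h).congr_of_eventuallyEq (.of_forall fun s => by simp [joinPt_coe])⟩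

lemma joinPt_one_eq (θ φ φ' : Angle) : joinPt θ φ 1 = pt θ φ' 0 := by
  rw [joinPt_eq_pt _ _ (by simp), pt_eq_iff (cos_sq_mem _) (by simp)]
  simp

lemma joinPt_zero_eq (θ θ' φ : Angle) : joinPt θ φ 0 = pt θ' φ 1 := by
  rw [joinPt_eq_pt _ _ (by simp), pt_eq_iff (cos_sq_mem _) (by simp)]
  simp

lemma mem_thetas_of_pt_mem (h : pt θ φ 0 ∈ surface P) : θ ∈ Thetas P := by
  obtain ⟨r, hr, v, q, ho, e⟩ := mem_surface_iff.1 h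
  obtain ⟨rfl, e1, -⟩ := (pt_eq_iff (by simp) ho.2.1).1 e
  rw [e1.resolve_left zero_ne_one]
  exact ho.mem_thetas hr

lemma mem_phis_of_pt_mem (h : pt θ φ 1 ∈ surface P) : φ ∈ Phis P := by
  rw [← mem_surface_swap, swapS_pt _ _ (by simp), sub_self] at h
  exact thetas_swap P ▸ mem_thetas_of_pt_mem h

/-- A point of the surface on an edge of the simplex lies inside an edge that joins the two circles,
or it lies on one of the circles and on the edge along this circle. -/
lemma edge_cases (W : Window P Δ) {γ : ℝ → S3} (hγ : γ ∈ Δ.simplexEdges) (ht : t ∈ Icc (0 : ℝ) 1)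
    (hm : γ t ∈ surface P) :
    (∃ v ∈ Δ.vertices, ∃ q ∈ Ioo (0 : ℝ) 1, (γ = fun t => joinPt v.1 v.2 t) ∧ γ t = pt v.1 v.2 q) ∨
    (γ = (fun t => joinPt (Δ.θ₁ + (t * arcLen Δ.θ₁ Δ.θ₂ : ℝ)) 0 1) ∧
      ∀ φ, γ t = pt (Δ.θ₁ + (t * arcLen Δ.θ₁ Δ.θ₂ : ℝ)) φ 0) ∨
    (γ = (fun t => joinPt 0 (Δ.φ₁ + (t * arcLen Δ.φ₁ Δ.φ₂ : ℝ)) 0) ∧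
      ∀ θ, γ t = pt θ (Δ.φ₁ + (t * arcLen Δ.φ₁ Δ.φ₂ : ℝ)) 1) := by
  rcases hγ with ⟨v, hv, rfl⟩ | rfl | rfl
  · left
    have e : joinPt v.1 v.2 t = pt v.1 v.2 (cos (π * t / 2) ^ 2) := joinPt_eq_pt _ _ ht
    have hc := cos_sq_mem (π * t / 2)
    refine ⟨v, hv, _, ⟨hc.1.lt_of_ne' fun h0 => ?_, hc.2.lt_of_ne fun h1 => ?_⟩, rfl, e⟩
    · simp only [e, h0] at hm
      have := W.theta _ (mem_thetas_of_pt_mem hm)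
      exact hv.1.elim this.1 this.2
    · simp only [e, h1] at hm
      have := W.phi _ (mem_phis_of_pt_mem hm)
      exact hv.2.elim this.1 this.2
  · exact Or.inr (Or.inl ⟨rfl, fun φ => joinPt_one_eq _ _ _⟩)
  · exact Or.inr (Or.inr ⟨rfl, fun θ => joinPt_zero_eq _ _ _⟩)

/-- The local form of the part of the surface in the simplex. -/
lemma exists_localForm_simplex (W : Window P Δ) {p : S3} (hp : p ∈ surface P)
    (hΔ : p ∈ Δ.simplex) : ∃ G Gi k A, LocalForm (surface P ∩ Δ.simplex) p G Gi k A ∧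
      ∀ γ ∈ Δ.simplexEdges, ∀ t ∈ Icc (0 : ℝ) 1, γ t = p → RunsAlong G γ t := by
  have hL1 := (arcLen_pos Δ.θ_ne).ne'
  have hL2 := (arcLen_pos Δ.φ_ne).ne'
  rcases surface_cases hp with ⟨α, hα, φ, rfl⟩ | ⟨β, hβ, θ, rfl⟩ | ⟨r, hr, θ, φ, q, hq, ho, rfl⟩
  · obtain ⟨k, hk⟩ := localForm_circle W.closed hα φ
    obtain ⟨n1, n2⟩ := W.theta α hα
    have hm := ((pt_mem_simplex_iff (by simp)).1 hΔ).1.resolve_left (by norm_num)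
    refine ⟨_, _, k, _, hk.inter (Or.inr ⟨_, _, Δ.φ_ne, rfl⟩) (eventually_sector_circle hm n1 n2), ?_⟩
    intro γ hγ t ht e
    rcases edge_cases W hγ ht (e ▸ hp) with ⟨v, -, q, hq, -, h⟩ | ⟨h1, h2⟩ | ⟨h1, h2⟩
    · rw [e, pt_eq_iff (by simp) (Ioo_subset_Icc_self hq)] at h
      exact absurd h.1 hq.1.ne
    · rw [h1]
      refine runsAlong_circle _ _ _ ?_ hL1
      have := h2 φ
      rw [e, pt_eq_iff (by simp) (by simp)] at this
      exact (this.2.1.resolve_left (by norm_num)).symm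
    · have := h2 0
      rw [e, pt_eq_iff (by simp) (by simp)] at this
      exact absurd this.1 (by norm_num)
  · obtain ⟨Gi, k, hk, hGi⟩ := localForm_circle_swap W.closed hβ θ
    obtain ⟨n1, n2⟩ := W.phi β hβ
    have hm := ((pt_mem_simplex_iff (by simp)).1 hΔ).2.resolve_left (by norm_num)
    have hS : ∀ᶠ u in 𝓝 (0 : ℝ³), Gi u ∈ Δ.simplex ↔ u.1 ∈ Sector (arc Δ.θ₁ Δ.θ₂) := by
      filter_upwards [eventually_sector_circle (Δ := Δ.swap) hm n1 n2] with u hu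
      rw [hGi, ← swapS_mem_simplex, swapS_swapS, hu]
      rfl
    refine ⟨_, _, k, _, hk.inter (Or.inr ⟨_, _, Δ.θ_ne, rfl⟩) hS, ?_⟩
    intro γ hγ t ht e
    rcases edge_cases W hγ ht (e ▸ hp) with ⟨v, -, q, hq, -, h⟩ | ⟨h1, h2⟩ | ⟨h1, h2⟩
    · rw [e, pt_eq_iff (by simp) (Ioo_subset_Icc_self hq)] at h
      exact absurd h.1 hq.2.ne'
    · have := h2 0
      rw [e, pt_eq_iff (by simp) (by simp)] at this
      exact absurd this.1 (by norm_num)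
    · rw [h1]
      refine runsAlong_circle_swap _ _ _ ?_ hL2
      have := h2 θ
      rw [e, pt_eq_iff (by simp) (by simp)] at this
      exact (this.2.2.resolve_left (by norm_num)).symm
  · have hm := (pt_mem_simplex_iff (Ioo_subset_Icc_self hq)).1 hΔ
    have hm1 := hm.1.resolve_left hq.2.ne
    have hm2 := hm.2.resolve_left hq.1.ne'
    have hedge : ∀ γ ∈ Δ.simplexEdges, ∀ t ∈ Icc (0 : ℝ) 1, γ t = pt θ φ q →
        (θ, φ) ∈ Δ.vertices ∧ γ = fun t => joinPt θ φ t := by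
      intro γ hγ t ht e
      rcases edge_cases W hγ ht (e ▸ hp) with ⟨v, hv, q', hq', h1, h⟩ | ⟨h1, h2⟩ | ⟨h1, h2⟩
      · rw [e, pt_eq_iff (Ioo_subset_Icc_self hq) (Ioo_subset_Icc_self hq')] at h
        rw [h.2.1.resolve_left hq.2.ne, h.2.2.resolve_left hq.1.ne']
        exact ⟨hv, h1⟩
      · have := h2 0
        rw [e, pt_eq_iff (Ioo_subset_Icc_self hq) (by simp)] at this
        exact absurd this.1 hq.1.ne'
      · have := h2 0
        rw [e, pt_eq_iff (Ioo_subset_Icc_self hq) (by simp)] at this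
        exact absurd this.1 hq.2.ne
    by_cases hv : (θ, φ) ∈ r.vertices
    · obtain ⟨σ, ε, h1, h2⟩ := exists_frame_of_vertex hv
      obtain ⟨G, Gi, k, hk⟩ := localForm_vertex W.closed hr h1 h2 hq
      obtain ⟨n1, n2⟩ := W.theta θ (mem_thetas hr hv.1)
      obtain ⟨n3, n4⟩ := W.phi φ (mem_phis hr hv.2)
      refine ⟨G, Gi, k, univ, hk.congr ?_, ?_⟩
      · -- near the point the whole neighbourhood is in the simplex
        obtain ⟨σ', ε', A, hσ', hε', -, -⟩ := exists_sector_torus (Δ := Δ) hm1 hm2 hq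
        have hc := localCoords_torus θ φ hq hσ' hε'
        have t1 : Tendsto (fun u : ℝ³ => θ + (σ' * u.1.1 : ℝ)) (𝓝 0) (𝓝 θ) :=
          (continuous_angle _ (by fun_prop)).tendsto' _ _ (by simp)
        have t2 : Tendsto (fun u : ℝ³ => φ + (ε' * u.1.2 : ℝ)) (𝓝 0) (𝓝 φ) :=
          (continuous_angle _ (by fun_prop)).tendsto' _ _ (by simp)
        have k3 := eventually_add_mem_Ioo hq
        have k4 := (t1.eventually (eventually_mem_arc hm1 n1 n2)).and
          ((t2.eventually (eventually_mem_arc hm2 n3 n4)).and k3)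
        filter_upwards [hc.eventually_of_inv k4] with z hz
        obtain ⟨u, ⟨u1, u2, u3⟩, rfl⟩ := hz
        have : pt (θ + (σ' * u.1.1 : ℝ)) (φ + (ε' * u.1.2 : ℝ)) (q + u.2) ∈ Δ.simplex :=
          (pt_mem_simplex_iff (Ioo_subset_Icc_self u3)).2 ⟨Or.inr u1, Or.inr u2⟩
        simp [this]
      · intro γ hγ t ht e
        obtain ⟨h3, -⟩ := hedge γ hγ t ht e
        rcases h3.1 with h | h
        · exact absurd h n1
        · exact absurd h n2
    · obtain ⟨σ, ε, A, hσ, hε, hA, hS⟩ := exists_sector_torus (Δ := Δ) hm1 hm2 hq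
      obtain ⟨k, hk⟩ := localForm_interior W.closed hr ho hv hq hσ hε
      refine ⟨_, _, k, A, hk.inter hA hS, ?_⟩
      intro γ hγ t ht e
      obtain ⟨-, h⟩ := hedge γ hγ t ht e
      rw [h]
      rw [h] at e
      exact runsAlong_torus hq ht e σ ε

end

section

/-! ### Discs with collapsed sides -/

/-- The square on which the discs are parametrised. -/
def square : Set (ℝ²) := Icc 0 1 ×ˢ Icc (-1) 1

lemma isCompact_square : IsCompact square := isCompact_Icc.prod isCompact_Icc

/-- The region `|w| ≤ c u`, for `u` in the unit interval. -/
def region (c : ℝ → ℝ) : Set (E²) := {z | z 0 ∈ Icc (0 : ℝ) 1 ∧ |z 1| ≤ c (z 0)}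

/-- The map of the square onto the region `|w| ≤ c u` that collapses the segments over the zeros
of `c`. -/
def toRegion (c : ℝ → ℝ) (a : ℝ²) : E² := !₂[a.1, c a.1 * a.2]

variable {c : ℝ → ℝ}

lemma continuous_toRegion (hc : Continuous c) : Continuous (toRegion c) := by
  unfold toRegion
  refine (PiLp.continuous_toLp 2 _).comp (continuous_pi fun i => ?_)
  fin_cases i
  · exact continuous_fst
  · exact (hc.comp continuous_fst).mul continuous_snd

lemma image_toRegion (hnn : ∀ u ∈ Icc (0 : ℝ) 1, 0 ≤ c u) : toRegion c '' square = region c := by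
  ext z
  constructor
  · rintro ⟨⟨u, v⟩, ⟨hu, hv⟩, rfl⟩
    refine ⟨hu, ?_⟩
    change |c u * v| ≤ c u
    rw [abs_mul, abs_of_nonneg (hnn u hu)]
    exact mul_le_of_le_one_right (hnn u hu) (abs_le.2 hv)
  · rintro ⟨h0, h1⟩
    have hz : z = !₂[z 0, z 1] := by ext i; fin_cases i <;> rfl
    by_cases hcz : c (z 0) = 0
    · rw [hcz] at h1
      refine ⟨(z 0, 0), ⟨h0, by simp⟩, ?_⟩
      rw [hz, abs_nonpos_iff.1 h1]
      simp [toRegion]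
    · have hpos : 0 < c (z 0) := lt_of_le_of_ne (hnn _ h0) (Ne.symm hcz)
      refine ⟨(z 0, z 1 / c (z 0)), ⟨h0, ?_⟩, ?_⟩
      · rw [mem_Icc, ← abs_le, abs_div, abs_of_pos hpos, div_le_one hpos]
        exact h1
      · conv_rhs => rw [hz]
        simp only [toRegion]
        rw [mul_div_cancel₀ _ hcz]

lemma convex_region (hconc : ConcaveOn ℝ (Icc 0 1) c) : Convex ℝ (region c) := by
  rintro z ⟨hz0, hz1⟩ w ⟨hw0, hw1⟩ a b ha hb hab
  refine ⟨convex_Icc (0 : ℝ) 1 hz0 hw0 ha hb hab, ?_⟩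
  have h := hconc.2 hz0 hw0 ha hb hab
  simp only [smul_eq_mul] at h
  have h1 : |a * z 1 + b * w 1| ≤ a * c (z 0) + b * c (w 0) := by
    refine (abs_add_le _ _).trans ?_
    rw [abs_mul, abs_mul, abs_of_nonneg ha, abs_of_nonneg hb]
    gcongr
  exact h1.trans h

lemma mem_interior_region (hc : Continuous c) {z : E²} :
    z ∈ interior (region c) ↔ z 0 ∈ Ioo (0 : ℝ) 1 ∧ |z 1| < c (z 0) := by
  constructor
  · intro hz
    have key : ∀ v : E², ∀ᶠ t : ℝ in 𝓝 0, z + t • v ∈ region c := by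
      intro v
      have hcont : Tendsto (fun t : ℝ => z + t • v) (𝓝 0) (𝓝 z) :=
        Continuous.tendsto' (by fun_prop) _ _ (by simp)
      exact hcont.eventually (mem_interior_iff_mem_nhds.1 hz)
    have hgt : ∀ v, ∃ t > (0 : ℝ), z + t • v ∈ region c := fun v => by
      obtain ⟨t, h1, h2⟩ := (((key v).filter_mono nhdsWithin_le_nhds).and
        (self_mem_nhdsWithin (a := (0 : ℝ)) (s := Ioi 0))).exists
      exact ⟨t, h2, h1⟩
    have hlt : ∀ v, ∃ t < (0 : ℝ), z + t • v ∈ region c := fun v => by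
      obtain ⟨t, h1, h2⟩ := (((key v).filter_mono nhdsWithin_le_nhds).and
        (self_mem_nhdsWithin (a := (0 : ℝ)) (s := Iio 0))).exists
      exact ⟨t, h2, h1⟩
    obtain ⟨t1, ht1, m1⟩ := hgt !₂[1, 0]
    obtain ⟨t2, ht2, m2⟩ := hlt !₂[1, 0]
    obtain ⟨t3, ht3, m3⟩ := hgt !₂[0, 1]
    obtain ⟨t4, ht4, m4⟩ := hlt !₂[0, 1]
    simp only [region, mem_ofPred_eq, PiLp.add_apply, PiLp.smul_apply] at m1 m2 m3 m4
    simp at m1 m2 m3 m4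
    have h3 := abs_le.1 m3.2
    have h4 := abs_le.1 m4.2
    exact ⟨⟨by linarith [m2.1.1], by linarith [m1.1.2]⟩, abs_lt.2 ⟨by linarith, by linarith⟩⟩
  · intro hz
    have hopen : IsOpen {z : E² | z 0 ∈ Ioo (0 : ℝ) 1 ∧ |z 1| < c (z 0)} := by
      have h0 : Continuous fun z : E² => z 0 := by fun_prop
      have h1 : Continuous fun z : E² => z 1 := by fun_prop
      exact (isOpen_Ioo.preimage h0).inter (isOpen_lt h1.abs (hc.comp h0))
    refine interior_maximal (t := {z : E² | z 0 ∈ Ioo (0 : ℝ) 1 ∧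
      |z 1| < c (z 0)}) (fun w hw => ?_) hopen hz
    exact ⟨Ioo_subset_Icc_self hw.1, hw.2.le⟩

/-- A map of the square that is injective up to the collapse of the segments `{u} × [-1, 1]` with
`c u = 0`, where `c` is concave, is a parametrisation of a disc, whose boundary is the image of the
boundary of the square. -/
theorem exists_disc {E : ℝ² → S3} (hc : Continuous c) (hconc : ConcaveOn ℝ (Icc 0 1) c)
    (hnn : ∀ u ∈ Icc (0 : ℝ) 1, 0 ≤ c u) (hpos : ∀ u ∈ Ioo (0 : ℝ) 1, 0 < c u)
    (hE : ContinuousOn E square)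
    (hinj : ∀ a ∈ square, ∀ b ∈ square, E a = E b ↔ a.1 = b.1 ∧ (a.2 = b.2 ∨ c a.1 = 0))
    {B : Set S3} (hB : ∀ a ∈ square, E a ∈ B ↔ a.1 = 0 ∨ a.1 = 1 ∨ |a.2| = 1) :
    ∃ e : Metric.closedBall (0 : E²) 1 → S3, Topology.IsEmbedding e ∧
      range e = E '' square ∧ ∀ x, e x ∈ B ↔ ‖(x : E²)‖ = 1 := by
  have himg := image_toRegion hnn
  have hK : IsCompact (region c) := himg ▸ isCompact_square.image (continuous_toRegion hc)
  have hKne : (interior (region c)).Nonempty :=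
    ⟨!₂[1 / 2, 0], (mem_interior_region hc).2 ⟨⟨by simp, by simp; norm_num⟩, by
      simpa using hpos (1 / 2) (by norm_num)⟩⟩
  obtain ⟨h, -, h2, h3⟩ := exists_homeomorph_image_interior_closure_frontier_eq_unitBall
    (convex_region hconc) hKne hK.isBounded
  rw [hK.isClosed.closure_eq] at h2
  have hcs : CompactSpace square := isCompact_iff_compactSpace.1 isCompact_square
  let Q : square → region c := fun a => ⟨toRegion c a, himg ▸ mem_image_of_mem _ a.2⟩
  have hQc : Continuous Q := ((continuous_toRegion hc).comp continuous_subtype_val).subtype_mk _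
  have hQs : Function.Surjective Q := by
    rintro ⟨z, hz⟩
    rw [← himg] at hz
    obtain ⟨a, ha, rfl⟩ := hz
    exact ⟨⟨a, ha⟩, rfl⟩
  -- `E` and the collapsing map have the same fibres, and the latter is a quotient map
  have hQq : IsQuotientMap Q := hQc.isClosedMap.isQuotientMap hQc hQs
  have hQE : ∀ a b : square, E a = E b ↔ Q a = Q b := by
    intro a b
    rw [hinj a a.2 b b.2, Subtype.ext_iff]
    change _ ↔ toRegion c a = toRegion c b
    constructor
    · rintro ⟨e1, e2⟩
      have : c (a : ℝ²).1 * (a : ℝ²).2 = c (a : ℝ²).1 * (b : ℝ²).2 := by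
        rcases e2 with e2 | e2
        · rw [e2]
        · rw [e2, zero_mul, zero_mul]
      simp only [toRegion, ← e1, this]
    · intro e
      have e1 : (a : ℝ²).1 = (b : ℝ²).1 := congrArg (fun z => z 0) e
      have e2 : c (a : ℝ²).1 * (a : ℝ²).2 = c (b : ℝ²).1 * (b : ℝ²).2 := congrArg (fun z => z 1) e
      rw [← e1] at e2
      refine ⟨e1, ?_⟩
      rcases mul_eq_mul_left_iff.1 e2 with h | h
      · exact Or.inl h
      · exact Or.inr h
  let g : region c → S3 := fun z => E (Function.surjInv hQs z : square)
  have hgQ : ∀ a : square, g (Q a) = E a := fun a => (hQE _ _).2 (Function.surjInv_eq hQs (Q a))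
  have hgc : Continuous g := by
    rw [hQq.continuous_iff]
    have : g ∘ Q = fun a : square => E a := funext hgQ
    rw [this]
    exact continuousOn_iff_continuous_domRestrict.1 hE
  have hmem : ∀ x : Metric.closedBall (0 : E²) 1, h.symm x ∈ region c := by
    intro x
    obtain ⟨z, hz, e⟩ : (x : E²) ∈ h '' region c := (Set.ext_iff.1 h2 x).2 x.2
    rw [← e, h.symm_apply_apply]; exact hz
  let e : Metric.closedBall (0 : E²) 1 → S3 := fun x => g ⟨h.symm x, hmem x⟩
  have hec : Continuous e := hgc.comp ((h.symm.continuous.comp continuous_subtype_val).subtype_mk _)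
  have hei : Function.Injective e := by
    intro x y hxy
    obtain ⟨a, ha⟩ := hQs ⟨h.symm x, hmem x⟩
    obtain ⟨b, hb⟩ := hQs ⟨h.symm y, hmem y⟩
    simp only [e, ← ha, ← hb, hgQ] at hxy
    rw [hQE, ha, hb, Subtype.ext_iff] at hxy
    exact Subtype.ext (h.symm.injective hxy)
  have : CompactSpace (Metric.closedBall (0 : E²) 1) :=
    isCompact_iff_compactSpace.1 (isCompact_closedBall _ _)
  refine ⟨e, (hec.isClosedEmbedding hei).isEmbedding, ?_, ?_⟩
  · ext p
    constructor
    · rintro ⟨x, rfl⟩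
      obtain ⟨a, ha⟩ := hQs ⟨h.symm x, hmem x⟩
      exact ⟨a, a.2, by rw [← hgQ, ha]⟩
    · rintro ⟨a, ha, rfl⟩
      have hx : h (Q ⟨a, ha⟩) ∈ Metric.closedBall (0 : E²) 1 := by
        rw [← h2]; exact mem_image_of_mem _ (Q ⟨a, ha⟩).2
      refine ⟨⟨_, hx⟩, ?_⟩
      rw [← hgQ ⟨a, ha⟩]
      simp only [e]
      congr 1
      exact Subtype.ext (h.symm_apply_apply _)
  · intro x
    obtain ⟨a, ha⟩ := hQs ⟨h.symm x, hmem x⟩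
    have hx : (x : E²) = h (toRegion c a) := by
      have := congrArg (fun z : region c => h z) ha
      simp only [Homeomorph.apply_symm_apply] at this
      exact this.symm
    simp only [e, ← ha, hgQ]
    rw [hB a a.2, ← mem_sphere_zero_iff_norm, ← h3, hx, h.injective.mem_set_image,
      hK.isClosed.frontier_eq, Set.mem_sdiff, mem_interior_region hc]
    have hm : toRegion c a ∈ region c := (Q a).2
    have e1 : (toRegion c a) 0 = (a : ℝ²).1 := rfl
    have e2 : (toRegion c a) 1 = c (a : ℝ²).1 * (a : ℝ²).2 := rfl
    simp only [hm, true_and, e1, e2]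
    have hu := a.2.1
    have hv := abs_le.2 a.2.2
    constructor
    · rintro (h | h | h) ⟨h4, h5⟩
      · exact h4.1.ne' h
      · exact h4.2.ne h
      · rw [abs_mul, h, mul_one] at h5
        exact absurd h5 (le_abs_self _).not_gt
    · intro hn
      by_contra hcon
      push Not at hcon
      obtain ⟨n1, n2, n3⟩ := hcon
      have hu' : (a : ℝ²).1 ∈ Ioo (0 : ℝ) 1 := ⟨lt_of_le_of_ne hu.1 n1.symm, lt_of_le_of_ne hu.2 n2⟩
      refine hn ⟨hu', ?_⟩
      rw [abs_mul, abs_of_pos (hpos _ hu')]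
      exact mul_lt_of_lt_one_right (hpos _ hu') (lt_of_le_of_ne hv n3)

end

section

variable {P : Set Rect} {Δ r s : Rect} {θ φ α β : Angle} {σ ε x y q t : ℝ}

/-! ### Cells: the part of a tile in a simplex -/

section Position

variable {a b p p' α : Angle} {σ x0 x1 x : ℝ}

lemma Position.coe_eq (_h : Position a b p p' α σ x0 x1) (x : ℝ) :
    α + (σ * x : ℝ) = α + (σ * x1 : ℝ) + (-σ * (x1 - x) : ℝ) :=
  (add_coe_add (by ring)).symm

lemma Position.zero_mem (h : Position a b p p' α σ x0 x1) (h0 : x0 = 0) : (0 : ℝ) ∈ Icc x0 x1 :=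
  ⟨h0.le, h.nonneg.trans h.lt.le⟩

lemma Position.mem_window (h : Position a b p p' α σ x0 x1) (hx : x ∈ Icc x0 x1) :
    α + (σ * x : ℝ) ∈ arc a b := by
  rw [h.coe_eq]
  refine h.win1.mem_arc (by linarith [hx.2]) ?_
  rcases h.start with ⟨h1, h2⟩ | ⟨h1, h2⟩ <;> linarith [hx.1]

lemma Position.mem_len (h : Position a b p p' α σ x0 x1) (hx : x ∈ Icc x0 x1) :
    x ∈ Icc 0 (arcLen p p') := ⟨h.nonneg.trans hx.1, hx.2.trans h.lt_len.le⟩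

/-- The points of the side `[p; p']` in the window are those with coordinate in `[x0, x1]`. The
bound on `x` excludes that the window is met again after a full turn. -/
lemma Position.coord_mem (h : Position a b p p' α σ x0 x1) (hx : x ∈ Icc 0 (arcLen p p'))
    (hlt : x < x1 + (2 * π - arcLen a b)) (hm : α + (σ * x : ℝ) ∈ arc a b) :
    x ∈ Icc x0 x1 := by
  rw [h.coe_eq] at hm
  have h1 := h.win1.coord_mem hm (by linarith) (by linarith [hx.1, h.lt_len, arcLen_lt p p'])
  refine ⟨?_, by linarith [h1.1]⟩
  rcases h.start with ⟨h2, -⟩ | ⟨-, h2⟩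
  · rw [h2]; exact hx.1
  · linarith [h1.2]

lemma Position.eventually_coord (h : Position a b p p' α σ x0 x1) (hx : x ∈ Icc x0 x1) :
    ∀ᶠ θ in 𝓝 (α + (σ * x : ℝ)), θ ∈ arc p p' → θ ∈ arc a b →
      ∃ x' ∈ Icc x0 x1, θ = α + (σ * x' : ℝ) := by
  rw [eventually_angle]
  have hpos : 0 < 2 * π - arcLen a b := sub_pos.2 (arcLen_lt a b)
  have hl : 0 < 2 * π - arcLen p p' := sub_pos.2 (arcLen_lt p p')
  have hy : 0 < arcLen p p' - x1 := sub_pos.2 h.lt_len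
  filter_upwards [eventually_abs_lt_zero hpos, eventually_abs_lt_zero hl,
    eventually_abs_lt_zero hy] with t h1 h2 h3 hm hm'
  rw [← h.isEnd.abs_sign_mul, abs_lt] at h1 h2 h3
  have e : α + (σ * x : ℝ) + (t : Angle) = α + (σ * (x + σ * t) : ℝ) := by
    rw [add_assoc, ← Angle.coe_add]; congr 2
    linear_combination -t * h.isEnd.mul_self
  rw [e] at hm hm' ⊢
  have hx' := h.mem_len hx
  have h4 := h.isEnd.coord_mem hm (by linarith [hx'.1]) (by linarith [hx.2, arcLen_lt p p'])
  exact ⟨_, h.coord_mem h4 (by linarith [hx.2]) hm', rfl⟩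

lemma Position.end_iff (h : Position a b p p' α σ x0 x1) (hx : x ∈ Icc x0 x1) :
    (α + (σ * x : ℝ) = a ∨ α + (σ * x : ℝ) = b) ↔ x = x1 ∨ (0 < x0 ∧ x = x0) := by
  constructor
  · intro hm
    rw [h.coe_eq] at hm
    have h1 : x1 - x ≤ arcLen a b := by rcases h.start with ⟨h2, h3⟩ | ⟨h2, h3⟩ <;> linarith [hx.1]
    rcases h.win1.coord_eq hm (by linarith [hx.2]) h1 with h2 | h2
    · left; linarith
    · rcases h.start with ⟨h3, h4⟩ | ⟨h3, h4⟩
      · linarith [hx.1]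
      · right; exact ⟨h3, by linarith⟩
  · rintro (rfl | ⟨h1, rfl⟩)
    · exact h.win1.end_eq
    · rcases h.start with ⟨h3, h4⟩ | ⟨h3, h4⟩
      · linarith
      · rw [h.coe_eq, h4]; exact h.win1.other.end_eq

lemma Position.coord_inj (h : Position a b p p' α σ x0 x1) {x' : ℝ} (hx : x ∈ Icc x0 x1)
    (hx' : x' ∈ Icc x0 x1)
    (he : α + (σ * x : ℝ) = α + (σ * x' : ℝ)) : x = x' := by
  have h1 := h.mem_len hx
  have h2 := h.mem_len hx'
  have h3 := arcLen_lt p p'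
  exact h.isEnd.coord_inj he (by rw [abs_lt]; constructor <;> linarith [h1.1, h1.2, h2.1, h2.2])

/-- The two sides that start at a common end in the window, in opposite directions, cover the
window. -/
lemma Position.add_eq {x0' x1' : ℝ} {q q' : Angle} (h : Position a b p p' α σ x0 x1)
    (h' : Position a b q q' α (-σ) x0' x1') (h0 : x0 = 0) (h0' : x0' = 0) :
    x1 + x1' = arcLen a b := by
  have e1 := h.win1.other
  have e2 := h'.win1
  have hab := arcLen_lt a b
  have l1 : x1 < arcLen a b := by rcases h.start with ⟨-, h⟩ | ⟨h, -⟩ <;> linarith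
  have l2 : x1' < arcLen a b := by rcases h'.start with ⟨-, h⟩ | ⟨h, -⟩ <;> linarith
  have e : α + (-σ * x1' : ℝ) = α + (σ * x1 : ℝ) + (-σ * arcLen a b : ℝ) := by
    rcases e1 with ⟨s1, e1⟩ | ⟨s1, e1⟩ <;> rcases e2 with ⟨s2, e2⟩ | ⟨s2, e2⟩
    · rw [e1, e2]
    · linarith
    · linarith
    · rw [e1, e2]
  rw [add_assoc, ← Angle.coe_add,
    show σ * x1 + -σ * arcLen a b = -σ * (arcLen a b - x1) by ring] at e
  have := h'.isEnd.coord_inj e (by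
    rw [abs_lt]; constructor <;> linarith [h.lt, h'.lt, h.nonneg, h'.nonneg])
  linarith

end Position

/-- A cell: the part of a rectangle that lies in the window of a simplex, in the coordinates with
respect to the vertex `(α, β)` of the rectangle and the signs `σ` and `ε`. -/
structure Cell where
  r : Rect
  α : Angle
  β : Angle
  σ : ℝ
  ε : ℝ
  x0 : ℝ
  x1 : ℝ
  y0 : ℝ
  y1 : ℝ

/-- `c` is a cell of the diagram `P` in the window `Δ`. -/
structure Cell.Valid (P : Set Rect) (Δ : Rect) (c : Cell) : Prop where
  mem : c.r ∈ P
  posθ : Position Δ.θ₁ Δ.θ₂ c.r.θ₁ c.r.θ₂ c.α c.σ c.x0 c.x1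
  posφ : Position Δ.φ₁ Δ.φ₂ c.r.φ₁ c.r.φ₂ c.β c.ε c.y0 c.y1

/-- The point of the torus with coordinates `(x, y)` in a cell. -/
def Cell.at (c : Cell) (x y : ℝ) : Torus := (c.α + (c.σ * x : ℝ), c.β + (c.ε * y : ℝ))

/-- The part of the tile over a cell. -/
def Cell.patch (c : Cell) : Set S3 :=
  {p | ∃ x ∈ Icc c.x0 c.x1, ∃ y ∈ Icc c.y0 c.y1, ∃ q, Over c.r (c.at x y) q ∧
    p = pt (c.at x y).1 (c.at x y).2 q}

/-- The cell with the two factors of the torus exchanged. -/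
def Cell.swap (c : Cell) : Cell := ⟨c.r.swap, c.β, c.α, c.ε, c.σ, c.y0, c.y1, c.x0, c.x1⟩

/-- Two cells whose patches make up a component of the surface in a simplex: a single cell that does
not contain a vertex, or the two cells with a common vertex. -/
def Linked (c c' : Cell) : Prop :=
  (c' = c ∧ (0 < c.x0 ∨ 0 < c.y0)) ∨
    (c.x0 = 0 ∧ c.y0 = 0 ∧ c'.x0 = 0 ∧ c'.y0 = 0 ∧ c.r ≠ c'.r ∧ c'.α = c.α ∧ c'.β = c.β ∧
      c'.σ = -c.σ ∧ c'.ε = -c.ε)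

lemma Linked.symm {c c' : Cell} (h : Linked c c') : Linked c' c := by
  rcases h with ⟨rfl, h⟩ | ⟨h1, h2, h3, h4, h5, h6, h7, h8, h9⟩
  · exact Or.inl ⟨rfl, h⟩
  · exact Or.inr ⟨h3, h4, h1, h2, h5.symm, h6.symm, h7.symm, by rw [h8, neg_neg],
      by rw [h9, neg_neg]⟩

lemma Linked.swap {c c' : Cell} (h : Linked c c') : Linked c.swap c'.swap := by
  rcases h with ⟨rfl, h⟩ | ⟨h1, h2, h3, h4, h5, h6, h7, h8, h9⟩
  · exact Or.inl ⟨rfl, h.symm⟩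
  · exact Or.inr ⟨h2, h1, h4, h3, fun h => h5 (congrArg Rect.swap h), h7, h6, h9, h8⟩

lemma Cell.Valid.swap {c : Cell} (h : c.Valid P Δ) : c.swap.Valid (Rect.swap '' P) Δ.swap :=
  ⟨⟨_, h.mem, rfl⟩, h.posφ, h.posθ⟩

lemma Cell.swapS_mem_patch {c : Cell} {p : S3} : swapS p ∈ c.swap.patch ↔ p ∈ c.patch := by
  have key : ∀ (c : Cell) (p : S3), p ∈ c.patch → swapS p ∈ c.swap.patch := by
    rintro c p ⟨x, hx, y, hy, q, ho, rfl⟩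
    exact ⟨y, hy, x, hx, 1 - q, over_swap.2 ho, swapS_pt _ _ ho.2.1⟩
  refine ⟨fun h => ?_, key c p⟩
  have := key _ _ h
  rwa [swapS_swapS] at this

namespace Cell.Valid

variable {c : Cell}

lemma vert (h : c.Valid P Δ) : c.r.Vert c.α c.σ := h.posθ.isEnd

lemma horiz (h : c.Valid P Δ) : c.r.Horiz c.β c.ε := h.posφ.isEnd

lemma mem_wid (h : c.Valid P Δ) (hx : x ∈ Icc c.x0 c.x1) : x ∈ Ico 0 c.r.wid :=
  ⟨h.posθ.nonneg.trans hx.1, hx.2.trans_lt h.posθ.lt_len⟩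

lemma mem_hei (h : c.Valid P Δ) (hy : y ∈ Icc c.y0 c.y1) : y ∈ Ico 0 c.r.hei :=
  ⟨h.posφ.nonneg.trans hy.1, hy.2.trans_lt h.posφ.lt_len⟩

lemma over_iff (h : c.Valid P Δ) (hx : x ∈ Icc c.x0 c.x1) (hy : y ∈ Icc c.y0 c.y1) :
    Over c.r (c.at x y) q ↔ q ∈ Icc (0 : ℝ) 1 ∧ ((x = 0 ∧ y = 0) ∨
      q = mfun (rectH c.r.wid c.r.hei x y)) := by
  have h1 := h.mem_wid hx
  have h2 := h.mem_hei hy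
  rw [Cell.at, over_coord_iff h.vert h.horiz (Ico_subset_Icc_self h1) (Ico_subset_Icc_self h2)]
  have e1 : x ≠ c.r.wid := h1.2.ne
  have e2 : y ≠ c.r.hei := h2.2.ne
  simp only [e1, e2, or_false]

lemma mem_vertices_iff (h : c.Valid P Δ) (hx : x ∈ Icc c.x0 c.x1)
    (hy : y ∈ Icc c.y0 c.y1) : c.at x y ∈ c.r.vertices ↔ x = 0 ∧ y = 0 := by
  have h1 := h.mem_wid hx
  have h2 := h.mem_hei hy
  rw [Cell.at, RectDiagram.mem_vertices_iff h.vert h.horiz (Ico_subset_Icc_self h1)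
    (Ico_subset_Icc_self h2)]
  have e1 : x ≠ c.r.wid := h1.2.ne
  have e2 : y ≠ c.r.hei := h2.2.ne
  simp only [e1, e2, or_false]

lemma eq_zero_of_over_zero (h : c.Valid P Δ) (hx : x ∈ Icc c.x0 c.x1)
    (hy : y ∈ Icc c.y0 c.y1) (ho : Over c.r (c.at x y) 0) : x = 0 := by
  rcases ((h.over_iff hx hy).1 ho).2 with h1 | h1
  · exact h1.1
  · exact (mfun_rectH_eq_zero c.r.hei_pos (Ico_subset_Icc_self (h.mem_wid hx))
      (Ico_subset_Icc_self (h.mem_hei hy)) h1.symm).resolve_right (h.mem_wid hx).2.ne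

lemma eq_zero_of_over_one (h : c.Valid P Δ) (hx : x ∈ Icc c.x0 c.x1)
    (hy : y ∈ Icc c.y0 c.y1) (ho : Over c.r (c.at x y) 1) : y = 0 := by
  rcases ((h.over_iff hx hy).1 ho).2 with h1 | h1
  · exact h1.2
  · exact (mfun_rectH_eq_one c.r.wid_pos c.r.hei_pos (Ico_subset_Icc_self (h.mem_wid hx))
      (Ico_subset_Icc_self (h.mem_hei hy)) h1.symm).resolve_right (h.mem_hei hy).2.ne

lemma at_mem_window (h : c.Valid P Δ) (hx : x ∈ Icc c.x0 c.x1)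
    (hy : y ∈ Icc c.y0 c.y1) : c.at x y ∈ Δ.carrier :=
  ⟨h.posθ.mem_window hx, h.posφ.mem_window hy⟩

lemma patch_subset (h : c.Valid P Δ) : c.patch ⊆ surface P ∩ Δ.simplex := by
  rintro p ⟨x, hx, y, hy, q, ho, rfl⟩
  have hm := h.at_mem_window hx hy
  exact ⟨mem_surface_iff.2 ⟨c.r, h.mem, _, q, ho, rfl⟩,
    (pt_mem_simplex_iff ho.2.1).2 ⟨Or.inr hm.1, Or.inr hm.2⟩⟩

/-- A point over a point of the torus close to a cell belongs to the patch, if it lies in the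
window. -/
lemma eventually_mem_patch (h : c.Valid P Δ) (hx : x ∈ Icc c.x0 c.x1)
    (hy : y ∈ Icc c.y0 c.y1) : ∀ᶠ w in 𝓝 (c.at x y), ∀ q, w ∈ Δ.carrier → Over c.r w q →
      pt w.1 w.2 q ∈ c.patch := by
  rw [show c.at x y = (c.α + (c.σ * x : ℝ), c.β + (c.ε * y : ℝ)) from rfl, nhds_prod_eq]
  filter_upwards [(h.posθ.eventually_coord hx).prod_mk (h.posφ.eventually_coord hy)]
    with w hw q hm ho
  obtain ⟨x', hx', e1⟩ := hw.1 ho.1.1 hm.1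
  obtain ⟨y', hy', e2⟩ := hw.2 ho.1.2 hm.2
  have e : w = c.at x' y' := Prod.ext e1 e2
  rw [e] at ho ⊢
  exact ⟨x', hx', y', hy', q, ho, rfl⟩

end Cell.Valid

lemma eventually_nhds_pt {Q : Torus × ℝ → Prop} (hq : q ∈ Ioo (0 : ℝ) 1)
    (h : ∀ᶠ w in 𝓝 ((θ, φ), q), Q w) :
    ∀ᶠ z in 𝓝 (pt θ φ q), ∃ w : Torus × ℝ, Q w ∧ w.2 ∈ Ioo (0 : ℝ) 1 ∧ z = pt w.1.1 w.1.2 w.2 := by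
  have hc := localCoords_torus θ φ hq (Or.inl rfl) (Or.inl rfl)
  have t1 : Tendsto (fun u : ℝ³ => (((θ + (1 * u.1.1 : ℝ),
      φ + (1 * u.1.2 : ℝ)), q + u.2) : Torus × ℝ)) (𝓝 0) (𝓝 ((θ, φ), q)) :=
    Continuous.tendsto' (((continuous_angle _ (by fun_prop)).prodMk
      (continuous_angle _ (by fun_prop))).prodMk (by fun_prop)) _ _ (by simp)
  have k3 : ∀ᶠ w in 𝓝 (((θ, φ), q) : Torus × ℝ), w.2 ∈ Ioo (0 : ℝ) 1 :=
    ContinuousAt.eventually_mem (f := fun w : Torus × ℝ => w.2) (by fun_prop) (isOpen_Ioo.mem_nhds hq)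
  filter_upwards [hc.eventually_of_inv (t1.eventually (h.and k3))] with z hz
  obtain ⟨u, ⟨h1, h2⟩, rfl⟩ := hz
  exact ⟨_, h1, h2, rfl⟩

lemma eventually_nhds_circle {Q : Angle × ℝ → Prop} (φ : Angle) (h : ∀ᶠ w in 𝓝 (α, (0 : ℝ)), Q w) :
    ∀ᶠ z in 𝓝 (pt α φ 0), ∃ θ φ' q, Q (θ, q) ∧ q ∈ Ico (0 : ℝ) 1 ∧ z = pt θ φ' q := by
  have hc := localCoords_circle α φ
  have t1 : Tendsto (fun u : ℝ³ => (α + (u.2 : Angle), u.1.1 ^ 2 + u.1.2 ^ 2)) (𝓝 0) (𝓝 (α, 0)) :=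
    Continuous.tendsto' ((continuous_angle _ (by fun_prop)).prodMk (by fun_prop)) _ _ (by simp)
  have k3 : ∀ᶠ w in 𝓝 ((α, 0) : Angle × ℝ), w.2 < 1 :=
    ContinuousAt.eventually_lt (f := fun w : Angle × ℝ => w.2) (by fun_prop) continuousAt_const
      (by simp)
  filter_upwards [hc.eventually_of_inv (t1.eventually (h.and k3))] with z hz
  obtain ⟨u, ⟨h1, h2⟩, rfl⟩ := hz
  exact ⟨_, _, _, h1, ⟨by positivity, h2⟩, rfl⟩

/-- The `φ`-ranges of two linked cells with a side over `α` cover the window. -/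
lemma Linked.exists_coord {c c' : Cell} (hL : Linked c c') (h : c.Valid P Δ) (h' : c'.Valid P Δ)
    (hx0 : c.x0 = 0) (hφ : φ ∈ arc Δ.φ₁ Δ.φ₂) :
    (∃ y ∈ Icc c.y0 c.y1, φ = c.β + (c.ε * y : ℝ)) ∨
      ∃ y ∈ Icc c'.y0 c'.y1, φ = c'.β + (c'.ε * y : ℝ) := by
  obtain ⟨t, ht, e⟩ := h.posφ.win1.mem_arc_iff.1 hφ
  have e1 : φ = c.β + (c.ε * (c.y1 - t) : ℝ) := by rw [e]; exact add_coe_add (by ring)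
  by_cases hy : c.y0 ≤ c.y1 - t
  · exact Or.inl ⟨_, ⟨hy, by linarith [ht.1]⟩, e1⟩
  push Not at hy
  rcases h.posφ.start with ⟨h1, h2⟩ | ⟨h1, h2⟩
  · rcases hL with ⟨rfl, h3⟩ | ⟨h3, h4, h5, h6, h7, h8, h9, h10, h11⟩
    · rcases h3 with h3 | h3 <;> linarith
    · right
      have h12 := h.posφ.add_eq (h11 ▸ h9 ▸ h'.posφ) h4 h6
      refine ⟨t - c.y1, ⟨by linarith, by linarith [ht.2]⟩, ?_⟩
      rw [e1, h9, h11]; congr 2; ring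
  · linarith [ht.2]

lemma Linked.eventually_mem_of_zero (W : Window P Δ) {c c' : Cell} (hL : Linked c c')
    (h : c.Valid P Δ) (h' : c'.Valid P Δ) (hx0 : c.x0 = 0) (φ : Angle) :
    ∀ᶠ z in 𝓝 (pt c.α φ 0), z ∈ surface P ∩ Δ.simplex → z ∈ c.patch ∪ c'.patch := by
  have hP := W.closed
  have hα : c.α ∈ Thetas P := mem_thetas h.mem h.vert.end_eq
  have hxm := h.posθ.zero_mem hx0
  have hx0' : c'.x0 = 0 ∧ c'.α = c.α := by
    rcases hL with ⟨rfl, -⟩ | ⟨-, -, h3, -, -, h6, -⟩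
    · exact ⟨hx0, rfl⟩
    · exact ⟨h3, h6⟩
  have hxm' := h'.posθ.zero_mem hx0'.1
  obtain ⟨e, he, hg⟩ := hP.gap_theta c.α hα
  have k1 : ∀ᶠ θ in 𝓝 c.α, θ ∈ Thetas P → θ = c.α := by
    rw [eventually_angle]
    filter_upwards [eventually_abs_lt_zero he] with t ht
    exact hg t ht
  have k2 := h.posθ.eventually_coord hxm
  have k3 := h'.posθ.eventually_coord hxm'
  rw [hx0'.2] at k3
  rw [mul_zero, Angle.coe_zero, add_zero] at k2 k3
  have k4 : ∀ᶠ w in 𝓝 (c.α, (0 : ℝ)), (w.1 ∈ Thetas P → w.1 = c.α) ∧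
      (w.1 ∈ arc c.r.θ₁ c.r.θ₂ → w.1 ∈ arc Δ.θ₁ Δ.θ₂ →
        ∃ x' ∈ Icc c.x0 c.x1, w.1 = c.α + (c.σ * x' : ℝ)) ∧
      (w.1 ∈ arc c'.r.θ₁ c'.r.θ₂ → w.1 ∈ arc Δ.θ₁ Δ.θ₂ →
        ∃ x' ∈ Icc c'.x0 c'.x1, w.1 = c.α + (c'.σ * x' : ℝ)) := by
    have : Tendsto (fun w : Angle × ℝ => w.1) (𝓝 (c.α, (0 : ℝ))) (𝓝 c.α) :=
      Continuous.tendsto' continuous_fst _ _ rfl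
    exact this.eventually (k1.and (k2.and k3))
  -- near the circle only the tiles with a side over `c.α` matter
  filter_upwards [eventually_nhds_circle φ (k4.and (eventually_side hP hα))] with z hz hmem
  obtain ⟨θ, φ', q, ⟨⟨h1, h2, h3⟩, h4⟩, hq, rfl⟩ := hz
  obtain ⟨hF, hΔ⟩ := hmem
  rw [pt_mem_simplex_iff (Ico_subset_Icc_self hq)] at hΔ
  have hθ := hΔ.1.resolve_left hq.2.ne
  have hy0 : c.y0 ∈ Icc c.y0 c.y1 := ⟨le_rfl, h.posφ.lt.le⟩
  rcases hq.1.eq_or_lt with h0 | h0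
  · subst h0
    left
    refine ⟨0, hxm, c.y0, hy0, 0, (h.over_iff hxm hy0).2 ⟨by simp, Or.inr ?_⟩, ?_⟩
    · rw [rectH_left, mfun_one]
    · rw [pt_eq_iff (by simp) (by simp)]
      simp [Cell.at, h1 (mem_thetas_of_pt_mem hF)]
  · have hφ := hΔ.2.resolve_left h0.ne'
    rw [pt_mem_surface_iff ⟨h0, hq.2⟩] at hF
    obtain ⟨r, hr, ho⟩ := hF
    obtain ⟨σ, hσ⟩ := h4 r hr φ' ho
    -- the point belongs to the patch of its rectangle, if this is the rectangle of a linked cell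
    have fin : ∀ c1 : Cell, c1.α = c.α → (θ ∈ arc c1.r.θ₁ c1.r.θ₂ → θ ∈ arc Δ.θ₁ Δ.θ₂ →
        ∃ x' ∈ Icc c1.x0 c1.x1, θ = c.α + (c1.σ * x' : ℝ)) → ∀ y ∈ Icc c1.y0 c1.y1,
        φ' = c1.β + (c1.ε * y : ℝ) → r = c1.r → pt θ φ' q ∈ c1.patch := by
      intro c1 hα1 h2 y hy ey er
      subst er
      obtain ⟨x', hx', ex⟩ := h2 ho.1.1 hθ
      have e : (θ, φ') = c1.at x' y := Prod.ext (by rw [ex, Cell.at, hα1]) ey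
      exact ⟨x', hx', y, hy, q, e ▸ ho, by rw [← e]⟩
    -- a rectangle with the same side at the same height shares a vertex
    have key : ∀ c1 c2 : Cell, Linked c1 c2 → c1.Valid P Δ → c2.Valid P Δ → c1.x0 = 0 →
        c1.α = c.α → ∀ y ∈ Icc c1.y0 c1.y1, φ' = c1.β + (c1.ε * y : ℝ) →
        r = c1.r ∨ (r = c2.r ∧ ∃ y ∈ Icc c2.y0 c2.y1, φ' = c2.β + (c2.ε * y : ℝ)) := by
      intro c1 c2 hL v1 v2 hx hα1 y hy ey
      by_cases hne : r = c1.r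
      · exact Or.inl hne
      right
      have hV := v1.vert
      rw [hα1] at hV
      have hy' := v1.mem_hei hy
      have hφ1 : φ' ∈ arc c1.r.φ₁ c1.r.φ₂ := by rw [ey]; exact v1.horiz.mem_arc hy'.1 hy'.2.le
      obtain ⟨u1, u2⟩ := vertex_of_common_side hP hr v1.mem hne hσ hV ho.1.2 hφ1
      have e : (c.α, φ') = c1.at 0 y := by rw [ey, Cell.at, hα1]; simp
      rw [e, v1.mem_vertices_iff (v1.posθ.zero_mem hx) hy] at u2
      rcases hL with ⟨-, h5⟩ | ⟨-, l2, -, l4, l5, l6, l7, -, -⟩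
      · rcases h5 with h5 | h5
        · linarith
        · linarith [hy.1, u2.2]
      · have hβ : φ' = c1.β := by rw [ey, u2.2]; simp
        have w1 : (c.α, φ') ∈ c1.r.vertices := by
          rw [hβ, ← hα1]; exact vertex_of_frame v1.vert v1.horiz
        have w2 : (c.α, φ') ∈ c2.r.vertices := by
          rw [hβ, ← hα1, ← l6, ← l7]; exact vertex_of_frame v2.vert v2.horiz
        exact ⟨(eq_or_eq_of_vertex hP v1.mem v2.mem l5 w1 w2 hr u1).resolve_left hne, 0,
          v2.posφ.zero_mem l4, by rw [hβ, l7]; simp⟩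
    rcases hL.exists_coord h h' hx0 hφ with ⟨y, hy, ey⟩ | ⟨y, hy, ey⟩
    · rcases key c c' hL h h' hx0 rfl y hy ey with e1 | ⟨e1, y', hy', ey'⟩
      · exact Or.inl (fin c rfl h2 y hy ey e1)
      · exact Or.inr (fin c' hx0'.2 h3 y' hy' ey' e1)
    · rcases key c' c hL.symm h' h hx0'.1 hx0'.2 y hy ey with e1 | ⟨e1, y', hy', ey'⟩
      · exact Or.inr (fin c' hx0'.2 h3 y hy ey e1)
      · exact Or.inl (fin c rfl h2 y' hy' ey' e1)

/-- The union of the patches of two linked cells is open in the intersection of the surface and the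
simplex. -/
lemma Linked.eventually_mem (W : Window P Δ) {c c' : Cell} (hL : Linked c c')
    (h : c.Valid P Δ) (h' : c'.Valid P Δ) {p : S3} (hp : p ∈ c.patch) :
    ∀ᶠ z in 𝓝 p, z ∈ surface P ∩ Δ.simplex → z ∈ c.patch ∪ c'.patch := by
  obtain ⟨x, hx, y, hy, q, ho, rfl⟩ := hp
  have hP := W.closed
  rcases ho.2.1.1.eq_or_lt with h0 | h0
  · subst h0
    have hx' := h.eq_zero_of_over_zero hx hy ho
    subst hx'
    have hx0 : c.x0 = 0 := le_antisymm hx.1 h.posθ.nonneg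
    have := hL.eventually_mem_of_zero W h h' hx0 (c.at 0 y).2
    simpa [Cell.at] using this
  rcases ho.2.1.2.eq_or_lt with h1 | h1
  · subst h1
    have hy' := h.eq_zero_of_over_one hx hy ho
    subst hy'
    have hy0 : c.y0 = 0 := le_antisymm hy.1 h.posφ.nonneg
    have := hL.swap.eventually_mem_of_zero W.swap h.swap h'.swap hy0 (c.at x 0).1
    have e : swapS (pt (c.at x 0).1 (c.at x 0).2 1) = pt c.swap.α (c.at x 0).1 0 := by
      rw [swapS_pt _ _ (by simp), sub_self]
      simp [Cell.at, Cell.swap]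
    rw [← e] at this
    filter_upwards [continuous_swapS.continuousAt.eventually this] with z hz hm
    have := hz ⟨mem_surface_swap.2 hm.1, swapS_mem_simplex.2 hm.2⟩
    exact this.imp Cell.swapS_mem_patch.1 Cell.swapS_mem_patch.1
  -- away from the circles the point is over a vertex or over an interior point of the tile
  have hq : q ∈ Ioo (0 : ℝ) 1 := ⟨h0, h1⟩
  have hmem : ∀ w : Torus × ℝ, w.2 ∈ Ioo (0 : ℝ) 1 →
      pt w.1.1 w.1.2 w.2 ∈ surface P ∩ Δ.simplex → w.1 ∈ Δ.carrier ∧ ∃ r ∈ P, Over r w.1 w.2 := by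
    rintro w hw ⟨m1, m2⟩
    rw [pt_mem_simplex_iff (Ioo_subset_Icc_self hw)] at m2
    exact ⟨⟨m2.1.resolve_left hw.2.ne, m2.2.resolve_left hw.1.ne'⟩, (pt_mem_surface_iff hw).1 m1⟩
  have tf : Tendsto (fun w : Torus × ℝ => w.1) (𝓝 (c.at x y, q)) (𝓝 (c.at x y)) :=
    Continuous.tendsto' continuous_fst _ _ rfl
  by_cases hv : c.at x y ∈ c.r.vertices
  · obtain ⟨rfl, rfl⟩ := (h.mem_vertices_iff hx hy).1 hv
    rcases hL with ⟨-, h5⟩ | ⟨l1, l2, l3, l4, l5, l6, l7, -, -⟩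
    · rcases h5 with h5 | h5
      · linarith [hx.1]
      · linarith [hy.1]
    have hx' := h'.posθ.zero_mem l3
    have hy' := h'.posφ.zero_mem l4
    have e : c'.at 0 0 = c.at 0 0 := by simp [Cell.at, l6, l7]
    have hv' : c.at 0 0 ∈ c'.r.vertices := by rw [← e, h'.mem_vertices_iff hx' hy']; simp
    have m' := h'.eventually_mem_patch hx' hy'
    rw [e] at m'
    have k := tf.eventually ((eventually_vertex hP h.mem hv).and
      ((h.eventually_mem_patch hx hy).and m'))
    filter_upwards [eventually_nhds_pt hq k] with z hz hm
    obtain ⟨w, ⟨w1, w2, w3⟩, hw, rfl⟩ := hz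
    obtain ⟨m1, r, hr, hor⟩ := hmem w hw hm
    rcases eq_or_eq_of_vertex hP h.mem h'.mem l5 hv hv' hr (w1 r hr hor.1) with er | er
    · left; exact w2 _ m1 (er ▸ hor)
    · right; exact w3 _ m1 (er ▸ hor)
  · have k := (eventually_eq_of_interior hP h.mem ho hv hq).and
      (tf.eventually (h.eventually_mem_patch hx hy))
    filter_upwards [eventually_nhds_pt hq k] with z hz hm
    obtain ⟨w, ⟨w1, w2⟩, hw, rfl⟩ := hz
    obtain ⟨m1, r, hr, hor⟩ := hmem w hw hm
    left
    exact w2 _ m1 (w1 r hr hor ▸ hor)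

end

section

/-! ### The components of the surface in a simplex are discs -/

section Disc

variable {P : Set Rect} {Δ : Rect} {c c' : Cell} {u t : ℝ}

/-- `D` is an embedded disc whose boundary is its intersection with the boundary of the simplex. -/
def IsDiscIn (Δ : Rect) (D : Set S3) : Prop :=
  ∃ e : Metric.closedBall (0 : E²) 1 → S3, Topology.IsEmbedding e ∧
    range e = D ∧ ∀ x, e x ∈ Δ.simplexBoundary ↔ ‖(x : E²)‖ = 1

lemma IsDiscIn.of_swap (h : IsDiscIn Δ.swap c.swap.patch) : IsDiscIn Δ c.patch := by
  obtain ⟨e, he, hr, hb⟩ := h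
  have hs : Topology.IsEmbedding swapS :=
    (Homeomorph.mk ⟨swapS, swapS, swapS_swapS, swapS_swapS⟩ continuous_swapS
      continuous_swapS).isEmbedding
  refine ⟨swapS ∘ e, hs.comp he, ?_, fun x => ?_⟩
  · rw [range_comp, hr]
    ext p
    constructor
    · rintro ⟨z, hz, rfl⟩
      rwa [← Cell.swapS_mem_patch, swapS_swapS]
    · exact fun hp => ⟨swapS p, Cell.swapS_mem_patch.2 hp, swapS_swapS p⟩
  · rw [← hb, Function.comp, ← swapS_mem_simplexBoundary, swapS_swapS]

lemma isDiscIn_of_square {c : ℝ → ℝ} {E : ℝ² → S3} {D : Set S3} (hc : Continuous c)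
    (hconc : ConcaveOn ℝ (Icc 0 1) c) (hnn : ∀ u ∈ Icc (0 : ℝ) 1, 0 ≤ c u)
    (hpos : ∀ u ∈ Ioo (0 : ℝ) 1, 0 < c u) (hE : ContinuousOn E square) (hD : E '' square = D)
    (hinj : ∀ a ∈ square, ∀ b ∈ square, E a = E b ↔ a.1 = b.1 ∧ (a.2 = b.2 ∨ c a.1 = 0))
    (hB : ∀ a ∈ square, E a ∈ Δ.simplexBoundary ↔ a.1 = 0 ∨ a.1 = 1 ∨ |a.2| = 1) :
    IsDiscIn Δ D := by
  obtain ⟨e, he, hr, hb⟩ := exists_disc hc hconc hnn hpos hE hinj hB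
  exact ⟨e, he, hr.trans hD, hb⟩

/-- A cell away from the horizontal side of its coordinates is a disc: the graph of the height over
a rectangle, with the side `x = 0` collapsed to a point if it belongs to the cell. -/
lemma Cell.Valid.isDiscIn_of_pos (h : c.Valid P Δ) (hy : 0 < c.y0) : IsDiscIn Δ c.patch := by
  have h1 := h.posθ.lt
  have h2 := h.posφ.lt
  have hx0 := h.posθ.nonneg
  -- the affine parametrisation of the cell by the square
  let X : ℝ² → ℝ := fun a => c.x0 + a.1 * (c.x1 - c.x0)
  let Y : ℝ² → ℝ := fun a => c.y0 + (a.2 + 1) / 2 * (c.y1 - c.y0)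
  have hX : ∀ a ∈ square, X a ∈ Icc c.x0 c.x1 := fun a ha =>
    ⟨by simp only [X]; nlinarith [ha.1.1], by simp only [X]; nlinarith [ha.1.2]⟩
  have hY : ∀ a ∈ square, Y a ∈ Icc c.y0 c.y1 := fun a ha =>
    ⟨by simp only [Y]; nlinarith [ha.2.1], by simp only [Y]; nlinarith [ha.2.2]⟩
  have hXi : ∀ a b, X a = X b → a.1 = b.1 := fun a b e => by
    have : (a.1 - b.1) * (c.x1 - c.x0) = 0 := by simp only [X] at e; linear_combination e
    rcases mul_eq_zero.1 this with h | h <;> linarith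
  have hYi : ∀ a b, Y a = Y b → a.2 = b.2 := fun a b e => by
    have : (a.2 - b.2) * (c.y1 - c.y0) = 0 := by simp only [Y] at e; linear_combination 2 * e
    rcases mul_eq_zero.1 this with h | h <;> linarith
  let q : ℝ² → ℝ := fun a => mfun (rectH c.r.wid c.r.hei (X a) (Y a))
  have hov : ∀ a ∈ square, Over c.r (c.at (X a) (Y a)) (q a) := fun a ha =>
    (h.over_iff (hX a ha) (hY a ha)).2 ⟨mfun_mem (rectH_mem c.r.hei_pos
      (Ico_subset_Icc_self (h.mem_wid (hX a ha))) (Ico_subset_Icc_self (h.mem_hei (hY a ha)))),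
      Or.inr rfl⟩
  have hq1 : ∀ a ∈ square, q a ≠ 1 := fun a ha e => by
    have := h.eq_zero_of_over_one (hX a ha) (hY a ha) (e ▸ hov a ha)
    linarith [(hY a ha).1]
  have hq0 : ∀ a ∈ square, q a = 0 ↔ X a = 0 := fun a ha =>
    ⟨fun e => h.eq_zero_of_over_zero (hX a ha) (hY a ha) (e ▸ hov a ha),
      fun e => by simp only [q]; rw [e, rectH_left, mfun_one]⟩
  have hXc : Continuous X := by fun_prop
  have hYc : Continuous Y := by fun_prop
  have hqc : ContinuousOn q square := by
    refine continuousOn_mfun.comp ((continuousOn_rectH c.r.wid_pos c.r.hei_pos).comp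
      (f := fun a => (X a, Y a)) (hXc.prodMk hYc).continuousOn fun a ha => ⟨⟨Ico_subset_Icc_self
        (h.mem_wid (hX a ha)), Ico_subset_Icc_self (h.mem_hei (hY a ha))⟩, ?_⟩)
      fun a ha => rectH_mem c.r.hei_pos (Ico_subset_Icc_self (h.mem_wid (hX a ha)))
        (Ico_subset_Icc_self (h.mem_hei (hY a ha)))
    rintro ⟨-, e | e⟩
    · linarith [(hY a ha).1, show Y a = 0 from e]
    · exact (h.mem_hei (hY a ha)).2.ne e
  refine isDiscIn_of_square (c := fun u => c.x0 + u * (c.x1 - c.x0))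
    (E := fun a => pt (c.at (X a) (Y a)).1 (c.at (X a) (Y a)).2 (q a))
    (by fun_prop) ?_ (fun u hu => ?_) (fun u hu => ?_) ?_ ?_ ?_ ?_
  rotate_left 4
  · ext p
    constructor
    · rintro ⟨a, ha, rfl⟩
      exact ⟨X a, hX a ha, Y a, hY a ha, q a, hov a ha, rfl⟩
    · rintro ⟨x, hx, y, hy', q', ho, rfl⟩
      have hd1 : 0 < c.x1 - c.x0 := by linarith
      have hd2 : 0 < c.y1 - c.y0 := by linarith
      have e1 : X ((x - c.x0) / (c.x1 - c.x0), 2 * ((y - c.y0) / (c.y1 - c.y0)) - 1) = x := by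
        simp only [X]; field_simp; ring
      have e2 : Y ((x - c.x0) / (c.x1 - c.x0), 2 * ((y - c.y0) / (c.y1 - c.y0)) - 1) = y := by
        simp only [Y]; field_simp; ring
      have l1 : 0 ≤ (x - c.x0) / (c.x1 - c.x0) := div_nonneg (by linarith [hx.1]) hd1.le
      have l2 : (x - c.x0) / (c.x1 - c.x0) ≤ 1 := (div_le_one hd1).2 (by linarith [hx.2])
      have l3 : 0 ≤ (y - c.y0) / (c.y1 - c.y0) := div_nonneg (by linarith [hy'.1]) hd2.le
      have l4 : (y - c.y0) / (c.y1 - c.y0) ≤ 1 := (div_le_one hd2).2 (by linarith [hy'.2])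
      refine ⟨((x - c.x0) / (c.x1 - c.x0), 2 * ((y - c.y0) / (c.y1 - c.y0)) - 1),
        ⟨⟨l1, l2⟩, ⟨by linarith, by linarith⟩⟩, ?_⟩
      simp only [q]
      rw [e1, e2]
      have := ((h.over_iff hx hy').1 ho).2.resolve_left fun e => by linarith [hy'.1, e.2]
      rw [this]
  · intro a ha b hb
    rw [pt_eq_iff (hov a ha).2.1 (hov b hb).2.1, or_iff_right (hq1 a ha), hq0 a ha]
    constructor
    · rintro ⟨-, e1, e2⟩
      refine ⟨hXi _ _ (h.posθ.coord_inj (hX a ha) (hX b hb) e1), e2.symm.imp_left fun e2 => ?_⟩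
      exact hYi _ _ (h.posφ.coord_inj (hY a ha) (hY b hb) e2)
    · rintro ⟨e1, e2⟩
      have eX : X a = X b := by simp only [X, e1]
      refine ⟨?_, by simp only [Cell.at, eX], e2.symm.imp_right fun e2 => ?_⟩
      · rcases e2 with e2 | e2
        · rw [show a = b from Prod.ext e1 e2]
        · rw [(hq0 a ha).2 e2, (hq0 b hb).2 (eX ▸ e2)]
      · simp only [Cell.at, Y, e2]
  · intro a ha
    have m := h.at_mem_window (hX a ha) (hY a ha)
    rw [pt_mem_simplexBoundary_iff (hov a ha).2.1 m.1 m.2, hq0 a ha, or_iff_right (hq1 a ha)]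
    simp only [Cell.at]
    rw [h.posθ.end_iff (hX a ha), h.posφ.end_iff (hY a ha), abs_eq one_pos.le]
    have := hY a ha
    have ex : ∀ s, X a = c.x0 + s * (c.x1 - c.x0) ↔ a.1 = s := fun s =>
      ⟨fun e => hXi a (s, 0) e, fun e => by simp only [X, e]⟩
    have ey : ∀ s, Y a = c.y0 + (s + 1) / 2 * (c.y1 - c.y0) ↔ a.2 = s := fun s =>
      ⟨fun e => hYi a (0, s) e, fun e => by simp only [Y, e]⟩
    have e1 := ex 1
    have e2 := ex 0
    have e3 := ey 1
    have e4 := ey (-1)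
    ring_nf at e1 e2 e3 e4
    rw [← e1, ← e2, ← e3, ← e4]
    rcases hx0.eq_or_lt with h0 | h0
    · rw [← h0]; simp only [lt_irrefl, hy, true_and, false_and, or_false]
    · have : X a ≠ 0 := (h0.trans_le (hX a ha).1).ne'
      simp only [h0, hy, this, true_and, false_or]; tauto
  · exact (concaveOn_const _ (convex_Icc _ _)).add
      ⟨convex_Icc _ _, fun x _ y _ a b _ _ _ => le_of_eq (by simp only [smul_eq_mul]; ring)⟩
  · nlinarith [hu.1]
  · nlinarith [hu.1]
  · exact continuous_pt.comp_continuousOn (f := fun a => (c.at (X a) (Y a), q a))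
      (((continuous_angle _ (by fun_prop)).prodMk
        (continuous_angle _ (by fun_prop))).continuousOn.prodMk hqc)

/-- The length of the part in the cell of the ray from the vertex with direction `(1 - u, u)`, in
the norm `|x| + |y|`. -/
def Cell.len (c : Cell) (u : ℝ) : ℝ := (max ((1 - u) / c.x1) (u / c.y1))⁻¹

/-- The height of the tile on the ray with direction `(1 - u, u)`, at the distance `t` from the
vertex; at `t = 0` this is the limit along the ray. -/
def Cell.height (c : Cell) (u t : ℝ) : ℝ := blowHeight c.r.wid c.r.hei ((1 - u, u), t)

lemma Cell.Valid.max_pos (h : c.Valid P Δ) (u : ℝ) : 0 < max ((1 - u) / c.x1) (u / c.y1) := by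
  have h1 := h.posθ.nonneg.trans_lt h.posθ.lt
  have h2 := h.posφ.nonneg.trans_lt h.posφ.lt
  rcases le_or_gt u 0 with hu | hu
  · exact lt_max_of_lt_left (div_pos (by linarith) h1)
  · exact lt_max_of_lt_right (div_pos hu h2)

lemma Cell.Valid.len_pos (h : c.Valid P Δ) (u : ℝ) : 0 < c.len u := inv_pos.2 (h.max_pos u)

lemma Cell.Valid.continuous_len (h : c.Valid P Δ) : Continuous c.len :=
  Continuous.inv₀ (by fun_prop) fun u => (h.max_pos u).ne'

lemma Cell.Valid.len_mul (h : c.Valid P Δ) (u : ℝ) : c.len u * (1 - u) ≤ c.x1 ∧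
    c.len u * u ≤ c.y1 ∧ (c.len u * (1 - u) = c.x1 ∨ c.len u * u = c.y1) := by
  have h1 := h.posθ.nonneg.trans_lt h.posθ.lt
  have h2 := h.posφ.nonneg.trans_lt h.posφ.lt
  have h3 := h.max_pos u
  have e1 : ∀ z x : ℝ, 0 < x → (c.len u * z ≤ x ↔ z / x ≤ max ((1 - u) / c.x1) (u / c.y1)) :=
    fun z x hx => by rw [Cell.len, inv_mul_le_iff₀ h3, div_le_iff₀ hx]
  have e2 : ∀ z x : ℝ, 0 < x → (c.len u * z = x ↔ z / x = max ((1 - u) / c.x1) (u / c.y1)) :=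
    fun z x hx => by rw [Cell.len, inv_mul_eq_iff_eq_mul₀ h3.ne', div_eq_iff hx.ne']
  rw [e1 _ _ h1, e1 _ _ h2, e2 _ _ h1, e2 _ _ h2]
  exact ⟨le_max_left _ _, le_max_right _ _, (max_choice _ _).imp Eq.symm Eq.symm⟩

/-- The point at the distance `s * c.len u` from the vertex in the direction `(1 - u, u)`. -/
lemma Cell.Valid.mem_ray (h : c.Valid P Δ) (h0 : c.x0 = 0 ∧ c.y0 = 0) (hu : u ∈ Icc (0 : ℝ) 1)
    (ht : t ∈ Icc 0 (c.len u)) : t * (1 - u) ∈ Icc c.x0 c.x1 ∧ t * u ∈ Icc c.y0 c.y1 := by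
  obtain ⟨l1, l2, -⟩ := h.len_mul u
  have hu' : 0 ≤ 1 - u := by linarith [hu.2]
  rw [h0.1, h0.2]
  exact ⟨⟨mul_nonneg ht.1 hu', (mul_le_mul_of_nonneg_right ht.2 hu').trans l1⟩,
    ⟨mul_nonneg ht.1 hu.1, (mul_le_mul_of_nonneg_right ht.2 hu.1).trans l2⟩⟩

lemma Cell.Valid.ray_end_iff (h : c.Valid P Δ) (h0 : c.x0 = 0 ∧ c.y0 = 0)
    (ht : t ∈ Icc 0 (c.len u)) :
    (t * (1 - u) = c.x1 ∨ t * u = c.y1) ↔ t = c.len u := by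
  obtain ⟨l1, l2, l3⟩ := h.len_mul u
  have h1 := h.posθ.lt
  have h2 := h.posφ.lt
  rw [h0.1] at h1
  rw [h0.2] at h2
  refine ⟨fun e => le_antisymm ht.2 ?_, fun e => e ▸ l3⟩
  by_contra hlt
  push Not at hlt
  rcases e with e | e
  · have : 0 < 1 - u := pos_of_mul_pos_right (e ▸ h1) ht.1
    nlinarith
  · have : 0 < u := pos_of_mul_pos_right (e ▸ h2) ht.1
    nlinarith

lemma Cell.Valid.over_ray (h : c.Valid P Δ) (h0 : c.x0 = 0 ∧ c.y0 = 0) (hu : u ∈ Icc (0 : ℝ) 1)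
    (ht : t ∈ Icc 0 (c.len u)) : Over c.r (c.at (t * (1 - u)) (t * u)) (c.height u t) ∧
      (c.height u t = 0 ↔ u = 1) ∧ (c.height u t = 1 ↔ u = 0) := by
  obtain ⟨m1, m2⟩ := h.mem_ray h0 hu ht
  have hu' : 0 ≤ 1 - u := by linarith [hu.2]
  rw [h.over_iff m1 m2]
  rcases ht.1.eq_or_lt with rfl | hp
  · have e : c.height u 0 = 1 - u := by
      rw [Cell.height, blowHeight_zero c.r.wid_pos c.r.hei_pos]; simp
    rw [e]
    refine ⟨⟨⟨hu', by linarith [hu.1]⟩, by simp⟩, ?_, ?_⟩ <;> constructor <;> intro h <;> linarith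
  · have w1 := h.mem_wid m1
    have w2 := h.mem_hei m2
    have e : c.height u t = mfun (rectH c.r.wid c.r.hei (t * (1 - u)) (t * u)) :=
      (blowHeight_eq c.r.wid_pos c.r.hei_pos hu' hu.1 (by linarith) ht.1 w1.2 w2.2).2 hp
    have ho : Over c.r (c.at (t * (1 - u)) (t * u)) (c.height u t) := by
      rw [h.over_iff m1 m2, e]
      exact ⟨mfun_mem (rectH_mem c.r.hei_pos (Ico_subset_Icc_self w1) (Ico_subset_Icc_self w2)),
        Or.inr rfl⟩
    refine ⟨(h.over_iff m1 m2).1 ho, ⟨fun h1 => ?_, fun h1 => ?_⟩, ⟨fun h1 => ?_, fun h1 => ?_⟩⟩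
    · have := h.eq_zero_of_over_zero m1 m2 (h1 ▸ ho)
      rcases mul_eq_zero.1 this with h | h <;> linarith
    · rw [e, h1, sub_self, mul_zero, rectH_left, mfun_one]
    · have := h.eq_zero_of_over_one m1 m2 (h1 ▸ ho)
      rcases mul_eq_zero.1 this with h | h <;> linarith
    · rw [e, h1, mul_zero, rectH_bottom c.r.hei_pos (by simpa using hp) (h1 ▸ w1.2), mfun_zero]

lemma Cell.Valid.exists_ray (h : c.Valid P Δ) (h0 : c.x0 = 0 ∧ c.y0 = 0) {p : S3}
    (hp : p ∈ c.patch) : ∃ u ∈ Icc (0 : ℝ) 1, ∃ t ∈ Icc 0 (c.len u),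
      p = pt (c.at (t * (1 - u)) (t * u)).1 (c.at (t * (1 - u)) (t * u)).2 (c.height u t) := by
  obtain ⟨x, hx, y, hy, q, ho, rfl⟩ := hp
  have w1 := h.mem_wid hx
  have w2 := h.mem_hei hy
  have hq := (h.over_iff hx hy).1 ho
  by_cases hv : x = 0 ∧ y = 0
  · refine ⟨1 - q, ⟨by linarith [hq.1.2], by linarith [hq.1.1]⟩, 0, ⟨le_rfl, (h.len_pos _).le⟩, ?_⟩
    have e : c.height (1 - q) 0 = q := by
      rw [Cell.height, blowHeight_zero c.r.wid_pos c.r.hei_pos]; simp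
    rw [e, hv.1, hv.2, zero_mul, zero_mul]
  have hpos : 0 < x + y := by
    rcases w1.1.eq_or_lt with h1 | h1
    · exact add_pos_of_nonneg_of_pos w1.1 (lt_of_le_of_ne w2.1 fun h2 => hv ⟨h1.symm, h2.symm⟩)
    · linarith [w2.1]
  have hu : y / (x + y) ∈ Icc (0 : ℝ) 1 :=
    ⟨div_nonneg w2.1 hpos.le, (div_le_one hpos).2 (by linarith [w1.1])⟩
  have e1 : (x + y) * (1 - y / (x + y)) = x := by field_simp; ring
  have e2 : (x + y) * (y / (x + y)) = y := by field_simp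
  have ht : x + y ∈ Icc 0 (c.len (y / (x + y))) := by
    refine ⟨hpos.le, ?_⟩
    by_contra hlt
    push Not at hlt
    have hl := h.len_pos (y / (x + y))
    have hm : (x + y) / c.len (y / (x + y)) > 1 := (one_lt_div hl).2 hlt
    obtain ⟨-, -, l3⟩ := h.len_mul (y / (x + y))
    have hx1 := h.posθ.lt
    have hy1 := h.posφ.lt
    rw [h0.1] at hx1
    rw [h0.2] at hy1
    rcases l3 with l3 | l3
    · have : 0 < 1 - y / (x + y) := pos_of_mul_pos_right (l3 ▸ hx1) hl.le
      nlinarith [hx.2]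
    · have : 0 < y / (x + y) := pos_of_mul_pos_right (l3 ▸ hy1) hl.le
      nlinarith [hy.2]
  refine ⟨_, hu, _, ht, ?_⟩
  have e3 : c.height (y / (x + y)) (x + y) = q := by
    rw [Cell.height, (blowHeight_eq c.r.wid_pos c.r.hei_pos (by linarith [hu.2]) hu.1 (by linarith)
      ht.1 (e1.symm ▸ w1.2) (e2.symm ▸ w2.2)).2 hpos, e1, e2]
    exact (hq.2.resolve_left hv).symm
  rw [e3, e1, e2]

lemma Cell.Valid.continuousAt_height (h : c.Valid P Δ) (h0 : c.x0 = 0 ∧ c.y0 = 0) {a : ℝ²}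
    {S : ℝ² → ℝ} (hS : Continuous S) (hu : a.1 ∈ Icc (0 : ℝ) 1) (ht : S a ∈ Icc 0 (c.len a.1)) :
    ContinuousAt (fun a : ℝ² => c.height a.1 (S a)) a := by
  obtain ⟨m1, m2⟩ := h.mem_ray h0 hu ht
  have w1 := h.mem_wid m1
  have w2 := h.mem_hei m2
  obtain ⟨k1, k2⟩ := continuousAt_blow (a := c.r.wid) (b := c.r.hei) c.r.hei_pos
    (p := ((1 - a.1, a.1), S a)) (by rw [abs_of_nonneg w1.1]; exact w1.2)
  have k3 := (blowHeight_eq c.r.wid_pos c.r.hei_pos (by linarith [hu.2]) hu.1 (by linarith) ht.1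
    w1.2 w2.2).1
  exact ContinuousAt.comp (g := blowHeight c.r.wid c.r.hei)
    (f := fun a : ℝ² => ((1 - a.1, a.1), S a)) (k1.div (k1.add k2) k3.ne') (by fun_prop)

/-- Two cells with a common vertex make up a disc, parametrized by the directions of the rays from
the vertex and the distance on the ray, which is counted negative on the second cell. All points
of the same direction `0` or `1` have the same image. -/
lemma isDiscIn_of_vertex (h : c.Valid P Δ) (h' : c'.Valid P Δ) (h0 : c.x0 = 0 ∧ c.y0 = 0)
    (h0' : c'.x0 = 0 ∧ c'.y0 = 0) (hα : c'.α = c.α) (hβ : c'.β = c.β) (hσ : c'.σ = -c.σ)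
    (hε : c'.ε = -c.ε) : IsDiscIn Δ (c.patch ∪ c'.patch) := by
  -- the distances on the rays in the two cells, one of which is zero, and their difference `T`; at
  -- distance zero the heights are `1 - u`, so that `q` is the height in the cell in question
  let S : ℝ² → ℝ := fun a => max a.2 0 * c.len a.1
  let S' : ℝ² → ℝ := fun a => max (-a.2) 0 * c'.len a.1
  let T : ℝ² → ℝ := fun a => S a - S' a
  let q : ℝ² → ℝ := fun a => c.height a.1 (S a) + c'.height a.1 (S' a) - (1 - a.1)
  let E : ℝ² → S3 := fun a => pt (c.at (T a * (1 - a.1)) (T a * a.1)).1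
    (c.at (T a * (1 - a.1)) (T a * a.1)).2 (q a)
  have hz : ∀ c : Cell, ∀ u, c.height u 0 = 1 - u := fun c u => by
    rw [Cell.height, blowHeight_zero c.r.wid_pos c.r.hei_pos]; simp
  have hS : ∀ a ∈ square, S a ∈ Icc 0 (c.len a.1) := fun a ha =>
    ⟨mul_nonneg (le_max_right _ _) (h.len_pos _).le,
      mul_le_of_le_one_left (h.len_pos _).le (max_le ha.2.2 zero_le_one)⟩
  have hS' : ∀ a ∈ square, S' a ∈ Icc 0 (c'.len a.1) := fun a ha =>
    ⟨mul_nonneg (le_max_right _ _) (h'.len_pos _).le,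
      mul_le_of_le_one_left (h'.len_pos _).le (max_le (by linarith [ha.2.1]) zero_le_one)⟩
  -- the two halves of the square
  have hpos : ∀ a : ℝ², 0 ≤ a.2 → S a = a.2 * c.len a.1 ∧ S' a = 0 ∧ T a = S a ∧
      q a = c.height a.1 (S a) := fun a ha => by
    have e : S' a = 0 := by simp only [S', max_eq_right (neg_nonpos.2 ha), zero_mul]
    refine ⟨by simp only [S, max_eq_left ha], e, by simp only [T, e, sub_zero], ?_⟩
    simp only [q, e, hz]; ring
  have hneg : ∀ a : ℝ², a.2 ≤ 0 → S' a = -a.2 * c'.len a.1 ∧ S a = 0 ∧ T a = -S' a ∧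
      q a = c'.height a.1 (S' a) := fun a ha => by
    have e : S a = 0 := by simp only [S, max_eq_right ha, zero_mul]
    refine ⟨by simp only [S', max_eq_left (neg_nonneg.2 ha)], e, by simp only [T, e, zero_sub], ?_⟩
    simp only [q, e, hz]; ring
  have hat : ∀ x y, c.at (-x) (-y) = c'.at x y := fun x y => by
    simp only [Cell.at, hα, hβ, hσ, hε, neg_mul, mul_neg]
  have hE : ∀ a, 0 ≤ a.2 → E a = pt (c.at (S a * (1 - a.1)) (S a * a.1)).1
      (c.at (S a * (1 - a.1)) (S a * a.1)).2 (c.height a.1 (S a)) := fun a ha => by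
    obtain ⟨-, -, e1, e2⟩ := hpos a ha
    simp only [E, e1, e2]
  have hE' : ∀ a, a.2 ≤ 0 → E a = pt (c'.at (S' a * (1 - a.1)) (S' a * a.1)).1
      (c'.at (S' a * (1 - a.1)) (S' a * a.1)).2 (c'.height a.1 (S' a)) := fun a ha => by
    obtain ⟨-, -, e1, e2⟩ := hneg a ha
    simp only [E, e1, e2, neg_mul, hat]
  have hq : ∀ a ∈ square, q a ∈ Icc (0 : ℝ) 1 ∧ (q a = 0 ↔ a.1 = 1) ∧ (q a = 1 ↔ a.1 = 0) := by
    intro a ha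
    rcases le_total 0 a.2 with h2 | h2
    · rw [(hpos a h2).2.2.2]
      exact (h.over_ray h0 ha.1 (hS a ha)).imp_left fun h => h.2.1
    · rw [(hneg a h2).2.2.2]
      exact (h'.over_ray h0' ha.1 (hS' a ha)).imp_left fun h => h.2.1
  have hXY : ∀ a ∈ square, T a * (1 - a.1) ∈ Icc (-c'.x1) c.x1 ∧ T a * a.1 ∈ Icc (-c'.y1) c.y1 := by
    intro a ha
    obtain ⟨m1, m2⟩ := h.mem_ray h0 ha.1 (hS a ha)
    obtain ⟨m3, m4⟩ := h'.mem_ray h0' ha.1 (hS' a ha)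
    rw [h0.1] at m1
    rw [h0.2] at m2
    rw [h0'.1] at m3
    rw [h0'.2] at m4
    simp only [T, sub_mul]
    exact ⟨⟨by linarith [m1.1, m3.2], by linarith [m1.2, m3.1]⟩,
      ⟨by linarith [m2.1, m4.2], by linarith [m2.2, m4.1]⟩⟩
  have hlx := h.posθ.add_eq (x1' := c'.x1) (hσ ▸ hα ▸ h'.posθ) h0.1 h0'.1
  have hly := h.posφ.add_eq (x1' := c'.y1) (hε ▸ hβ ▸ h'.posφ) h0.2 h0'.2
  have hTi : ∀ a b : ℝ², a.1 = b.1 → T a = T b → a.2 = b.2 := by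
    have hlt : ∀ a b : ℝ², a.1 = b.1 → a.2 < b.2 → T a < T b := by
      intro a b e hlt
      have p1 := h.len_pos b.1
      have p2 := h'.len_pos b.1
      simp only [T, S, S', e]
      rcases le_or_gt b.2 0 with hb | hb
      · rw [max_eq_right hb, max_eq_right (hlt.le.trans hb), max_eq_left (by linarith),
          max_eq_left (by linarith)]
        nlinarith
      · have k1 : max a.2 0 < max b.2 0 := by rw [max_eq_left hb.le]; exact max_lt hlt hb
        have k2 : max (-b.2) 0 ≤ max (-a.2) 0 := max_le_max_right _ (by linarith)
        nlinarith
    intro a b e eT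
    rcases lt_trichotomy a.2 b.2 with h | h | h
    · exact absurd eT (hlt a b e h).ne
    · exact h
    · exact absurd eT (hlt b a e.symm h).ne'
  have hSc : Continuous S := (by fun_prop : Continuous fun a : ℝ² => max a.2 0).mul
    (h.continuous_len.comp continuous_fst)
  have hSc' : Continuous S' := (by fun_prop : Continuous fun a : ℝ² => max (-a.2) 0).mul
    (h'.continuous_len.comp continuous_fst)
  refine isDiscIn_of_square (c := fun u => u * (1 - u)) (E := E) (by fun_prop) ?_
    (fun u hu => mul_nonneg hu.1 (by linarith [hu.2]))
    (fun u hu => mul_pos hu.1 (by linarith [hu.2])) ?_ ?_ ?_ ?_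
  · refine ⟨convex_Icc _ _, fun x _ y _ a b ha hb hab => ?_⟩
    simp only [smul_eq_mul]
    have e : b = 1 - a := by linarith
    subst e
    nlinarith [mul_nonneg (mul_nonneg ha hb) (sq_nonneg (x - y))]
  · intro a ha
    have k1 := h.continuousAt_height h0 hSc ha.1 (hS a ha)
    have k2 := h'.continuousAt_height h0' hSc' ha.1 (hS' a ha)
    have k3 : Continuous T := hSc.sub hSc'
    have k4 : ContinuousAt q a := (k1.add k2).sub (continuousAt_const.sub continuousAt_fst)
    exact (continuousAt_pt (continuous_angle _ (continuous_const.mul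
      (k3.mul (continuous_const.sub continuous_fst)))).continuousAt (continuous_angle _
        (continuous_const.mul (k3.mul continuous_fst))).continuousAt k4).continuousWithinAt
  · ext p
    constructor
    · rintro ⟨a, ha, rfl⟩
      rcases le_total 0 a.2 with h2 | h2
      · left
        obtain ⟨m1, m2⟩ := h.mem_ray h0 ha.1 (hS a ha)
        exact ⟨_, m1, _, m2, _, (h.over_ray h0 ha.1 (hS a ha)).1, hE a h2⟩
      · right
        obtain ⟨m1, m2⟩ := h'.mem_ray h0' ha.1 (hS' a ha)
        exact ⟨_, m1, _, m2, _, (h'.over_ray h0' ha.1 (hS' a ha)).1, hE' a h2⟩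
    · rintro (hp | hp)
      · obtain ⟨u, hu, t, ht, rfl⟩ := h.exists_ray h0 hp
        have hl := h.len_pos u
        have h2 : 0 ≤ t / c.len u := div_nonneg ht.1 hl.le
        have e : S (u, t / c.len u) = t := by rw [(hpos _ h2).1]; exact div_mul_cancel₀ _ hl.ne'
        refine ⟨(u, t / c.len u), ⟨hu, by linarith, (div_le_one hl).2 ht.2⟩, ?_⟩
        rw [hE _ h2, e]
      · obtain ⟨u, hu, t, ht, rfl⟩ := h'.exists_ray h0' hp
        have hl := h'.len_pos u
        have h2 : 0 ≤ t / c'.len u := div_nonneg ht.1 hl.le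
        have h3 : t / c'.len u ≤ 1 := (div_le_one hl).2 ht.2
        have h4 : ((u, -(t / c'.len u)) : ℝ²).2 ≤ 0 := neg_nonpos.2 h2
        have e : S' (u, -(t / c'.len u)) = t := by
          rw [(hneg _ h4).1, neg_neg]; exact div_mul_cancel₀ _ hl.ne'
        refine ⟨(u, -(t / c'.len u)), ⟨hu, by linarith, by linarith⟩, ?_⟩
        rw [hE' _ h4, e]
  · intro a ha b hb
    obtain ⟨qa, qa0, qa1⟩ := hq a ha
    obtain ⟨qb, qb0, qb1⟩ := hq b hb
    have hc : a.1 * (1 - a.1) = 0 ↔ a.1 = 0 ∨ a.1 = 1 := by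
      rw [mul_eq_zero, sub_eq_zero, eq_comm (a := (1 : ℝ))]
    simp only [E]
    rw [pt_eq_iff qa qb, qa0, qa1, hc]
    have hπ1 := arcLen_lt Δ.θ₁ Δ.θ₂
    have hπ2 := arcLen_lt Δ.φ₁ Δ.φ₂
    constructor
    · rintro ⟨e1, e2, e3⟩
      by_cases ha0 : a.1 = 0
      · exact ⟨ha0.trans (qb1.1 (e1 ▸ qa1.2 ha0)).symm, Or.inr (Or.inl ha0)⟩
      by_cases ha1 : a.1 = 1
      · exact ⟨ha1.trans (qb0.1 (e1 ▸ qa0.2 ha1)).symm, Or.inr (Or.inr ha1)⟩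
      obtain ⟨x1, y1⟩ := hXY a ha
      obtain ⟨x2, y2⟩ := hXY b hb
      have k1 := h.posθ.isEnd.coord_inj (e2.resolve_left ha0) (by
        rw [abs_lt]; constructor <;> linarith [x1.1, x1.2, x2.1, x2.2])
      have k2 := h.posφ.isEnd.coord_inj (e3.resolve_left ha1) (by
        rw [abs_lt]; constructor <;> linarith [y1.1, y1.2, y2.1, y2.2])
      have kT : T a = T b := by linear_combination k1 + k2
      suffices hu : a.1 = b.1 from ⟨hu, Or.inl (hTi a b hu kT)⟩
      by_cases hT : T a = 0
      · -- at distance zero the height determines the direction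
        have hq0 : ∀ a, T a = 0 → q a = 1 - a.1 := by
          intro a hT
          rcases le_total 0 a.2 with h2 | h2
          · rw [(hpos a h2).2.2.2, ← (hpos a h2).2.2.1, hT, hz]
          · rw [(hneg a h2).2.2.2, show S' a = 0 by linarith [(hneg a h2).2.2.1], hz]
        have := hq0 a hT
        have := hq0 b (kT ▸ hT)
        linarith
      · rw [← kT] at k2
        exact mul_left_cancel₀ hT k2
    · rintro ⟨e1, e2 | e2 | e2⟩
      · rw [show a = b from Prod.ext e1 e2]; simp
      · refine ⟨(qa1.2 e2).trans (qb1.2 (e1 ▸ e2)).symm, Or.inl e2, Or.inr ?_⟩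
        rw [← e1, e2, mul_zero, mul_zero]; rfl
      · refine ⟨(qa0.2 e2).trans (qb0.2 (e1 ▸ e2)).symm, Or.inr ?_, Or.inl e2⟩
        rw [← e1, e2, sub_self, mul_zero, mul_zero]; rfl
  · -- on each half the boundary is reached on the sides `u = 0`, `u = 1` and at the end of the ray
    have key : ∀ c : Cell, c.Valid P Δ → c.x0 = 0 ∧ c.y0 = 0 → ∀ u ∈ Icc (0 : ℝ) 1, ∀ s, 0 ≤ s →
        s * c.len u ∈ Icc 0 (c.len u) →
        (pt (c.at (s * c.len u * (1 - u)) (s * c.len u * u)).1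
          (c.at (s * c.len u * (1 - u)) (s * c.len u * u)).2 (c.height u (s * c.len u)) ∈
          Δ.simplexBoundary ↔ u = 0 ∨ u = 1 ∨ s = 1) := by
      intro c h h0 u hu s hs hm
      obtain ⟨m1, m2⟩ := h.mem_ray h0 hu hm
      obtain ⟨ho, q0, q1⟩ := h.over_ray h0 hu hm
      have m := h.at_mem_window m1 m2
      rw [pt_mem_simplexBoundary_iff ho.2.1 m.1 m.2, q0, q1]
      simp only [Cell.at]
      rw [h.posθ.end_iff m1, h.posφ.end_iff m2, h0.1, h0.2]
      simp only [lt_irrefl, false_and, or_false]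
      rw [h.ray_end_iff h0 hm, mul_eq_right₀ (h.len_pos u).ne']
      tauto
    intro a ha
    rcases le_total 0 a.2 with h2 | h2
    · have := hS a ha
      rw [hE a h2, abs_of_nonneg h2]
      rw [(hpos a h2).1] at this ⊢
      exact key c h h0 _ ha.1 _ h2 this
    · have := hS' a ha
      rw [hE' a h2, abs_of_nonpos h2]
      rw [(hneg a h2).1] at this ⊢
      exact key c' h' h0' _ ha.1 _ (neg_nonneg.2 h2) this

lemma Linked.isDiscIn (hL : Linked c c') (h : c.Valid P Δ) (h' : c'.Valid P Δ) :
    IsDiscIn Δ (c.patch ∪ c'.patch) := by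
  rcases hL with ⟨rfl, h1 | h1⟩ | ⟨h1, h2, h3, h4, -, h6, h7, h8, h9⟩
  · rw [union_self]; exact (h.swap.isDiscIn_of_pos h1).of_swap
  · rw [union_self]; exact h.isDiscIn_of_pos h1
  · exact isDiscIn_of_vertex h h' ⟨h1, h2⟩ ⟨h3, h4⟩ h6 h7 h8 h9

end Disc

end

section

/-! ### The components of the surface in a simplex are normal -/

section Normal

variable {P : Set Rect} {Δ r : Rect} {c c' : Cell} {θ φ : Angle} {q : ℝ} {z : S3}

lemma connectedComponentIn_eq_of_isPreconnected {X : Type*} [TopologicalSpace X] {A D : Set X}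
    {p : X} (hp : p ∈ D) (hDA : D ⊆ A) (hD : IsPreconnected D) (hcl : IsClosed D)
    (hop : ∀ z ∈ D, ∀ᶠ w in 𝓝 z, w ∈ A → w ∈ D) : connectedComponentIn A p = D := by
  refine Subset.antisymm (fun z hz => ?_) (hD.subset_connectedComponentIn hp hDA)
  by_contra hzD
  obtain ⟨w, hw, hw1, hw2⟩ := isPreconnected_connectedComponentIn (F := A) (x := p)
    (interior {w | w ∈ A → w ∈ D}) Dᶜ isOpen_interior hcl.isOpen_compl
    (fun w _ => (em (w ∈ D)).imp_left fun h => mem_interior_iff_mem_nhds.2 (hop w h))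
    ⟨p, mem_connectedComponentIn (hDA hp), mem_interior_iff_mem_nhds.2 (hop p hp)⟩ ⟨z, hz, hzD⟩
  exact hw2 (interior_subset hw1 (connectedComponentIn_subset _ _ hw))

lemma IsDiscIn.isPreconnected {D : Set S3} (h : IsDiscIn Δ D) : IsPreconnected D := by
  obtain ⟨e, he, rfl, -⟩ := h
  have : PreconnectedSpace (Metric.closedBall (0 : E²) 1) :=
    Subtype.preconnectedSpace (convex_closedBall _ _).isPreconnected
  exact isPreconnected_range he.continuous

lemma IsDiscIn.isClosed {D : Set S3} (h : IsDiscIn Δ D) : IsClosed D := by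
  obtain ⟨e, he, rfl, -⟩ := h
  have : CompactSpace (Metric.closedBall (0 : E²) 1) :=
    isCompact_iff_compactSpace.1 (isCompact_closedBall _ _)
  exact (isCompact_range he.continuous).isClosed

lemma Position.of_end {a b p p' α : Angle} {τ : ℝ} (hE : IsEnd p p' α τ) (hne : p ≠ p')
    (h : ∃ α' σ x0 x1 x, Position a b p p' α' σ x0 x1 ∧ x0 ≤ x ∧ x ≤ x1 ∧
      α = α' + (σ * x : ℝ)) : ∃ x1, Position a b p p' α τ 0 x1 := by
  obtain ⟨α', σ, x0, x1, x, h, h0, h1, e⟩ := h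
  have hx : x = 0 := by
    rcases h.isEnd.coord_eq (e ▸ hE.end_eq) (h.nonneg.trans h0) (h1.trans h.lt_len.le) with h2 | h2
    · exact h2
    · linarith [h.lt_len]
  subst hx
  have hx0 : x0 = 0 := le_antisymm h0 h.nonneg
  have e' : α = α' := by rw [e]; simp
  subst hx0 e'
  have hτ : σ = τ := by
    rcases h.isEnd with ⟨rfl, k⟩ | ⟨rfl, k⟩ <;> rcases hE with ⟨rfl, k'⟩ | ⟨rfl, k'⟩ <;>
      first | rfl | exact absurd (k.symm.trans k') hne | exact absurd (k'.symm.trans k) hne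
  exact ⟨x1, hτ ▸ h⟩

lemma Window.exists_cell_of_over (W : Window P Δ) (hr : r ∈ P) (ho : Over r (θ, φ) q)
    (hm : (θ, φ) ∈ Δ.carrier) : ∃ c : Cell, c.Valid P Δ ∧ pt θ φ q ∈ c.patch := by
  obtain ⟨α, σ, x0, x1, x, h1, h2, h3, rfl⟩ := W.pos_theta r hr θ ho.1.1 hm.1
  obtain ⟨β, ε, y0, y1, y, h4, h5, h6, rfl⟩ := W.pos_phi r hr φ ho.1.2 hm.2
  exact ⟨⟨r, α, β, σ, ε, x0, x1, y0, y1⟩, ⟨hr, h1, h4⟩, x, ⟨h2, h3⟩, y, ⟨h5, h6⟩, q, ho, rfl⟩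

lemma Window.exists_cell_of_zero (W : Window P Δ) (h : pt θ φ 0 ∈ surface P)
    (hΔ : pt θ φ 0 ∈ Δ.simplex) : ∃ c : Cell, c.Valid P Δ ∧ pt θ φ 0 ∈ c.patch := by
  obtain ⟨r, hr, ⟨σ, hσ⟩, hφ⟩ := exists_side_over W.closed (mem_thetas_of_pt_mem h) Δ.φ₁
  have hv : (θ, Δ.φ₁) ∈ r.carrier := ⟨hσ.self_mem_arc, hφ⟩
  have ho : Over r (θ, Δ.φ₁) 0 := ⟨hv, by simp, Or.inr (by rw [Rect.h, if_pos hσ.end_eq, mfun_one])⟩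
  have := W.exists_cell_of_over hr ho
    ⟨((pt_mem_simplex_iff (by simp)).1 hΔ).1.resolve_left zero_ne_one,
      (exists_vert_horiz Δ).2.self_mem_arc⟩
  rwa [show pt θ Δ.φ₁ 0 = pt θ φ 0 from (pt_eq_iff (by simp) (by simp)).2 (by simp)] at this

lemma Window.exists_cell (W : Window P Δ) (hz : z ∈ surface P) (hΔ : z ∈ Δ.simplex) :
    ∃ c : Cell, c.Valid P Δ ∧ z ∈ c.patch := by
  rcases surface_cases hz with ⟨α, -, φ, rfl⟩ | ⟨β, -, θ, rfl⟩ | ⟨r, hr, θ, φ, q, hq, ho, rfl⟩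
  · exact W.exists_cell_of_zero hz hΔ
  · rw [← mem_surface_swap] at hz
    rw [← swapS_mem_simplex] at hΔ
    have e : swapS (pt θ β 1) = pt β θ 0 := by rw [swapS_pt _ _ (by simp), sub_self]
    rw [e] at hz hΔ
    obtain ⟨c, ⟨⟨r, hr, hm⟩, h1, h2⟩, h3⟩ := W.swap.exists_cell_of_zero hz hΔ
    have hm' : c.swap.r = r := by
      show c.r.swap = r
      rw [← hm]; rfl
    refine ⟨c.swap, ⟨hm' ▸ hr, h2, h1⟩, ?_⟩
    rw [← Cell.swapS_mem_patch, e]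
    exact h3
  · have := (pt_mem_simplex_iff (Ioo_subset_Icc_self hq)).1 hΔ
    exact W.exists_cell_of_over hr ho ⟨this.1.resolve_left hq.2.ne, this.2.resolve_left hq.1.ne'⟩

lemma Window.exists_linked (W : Window P Δ) (h : c.Valid P Δ) :
    ∃ c' : Cell, c'.Valid P Δ ∧ Linked c c' := by
  by_cases h0 : c.x0 = 0 ∧ c.y0 = 0
  · obtain ⟨s, hs, hrs, h1, h2⟩ := exists_partner W.closed h.mem h.vert h.horiz
    have hm := h.at_mem_window (x := 0) (y := 0) ⟨h0.1.le, h.posθ.nonneg.trans h.posθ.lt.le⟩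
      ⟨h0.2.le, h.posφ.nonneg.trans h.posφ.lt.le⟩
    simp only [Cell.at, mul_zero, Angle.coe_zero, add_zero] at hm
    obtain ⟨x1, h3⟩ := Position.of_end h1 s.θ_ne (W.pos_theta s hs _ h1.self_mem_arc hm.1)
    obtain ⟨y1, h4⟩ := Position.of_end h2 s.φ_ne (W.pos_phi s hs _ h2.self_mem_arc hm.2)
    exact ⟨⟨s, c.α, c.β, -c.σ, -c.ε, 0, x1, 0, y1⟩, ⟨hs, h3, h4⟩,
      Or.inr ⟨h0.1, h0.2, rfl, rfl, hrs, rfl, rfl, rfl, rfl⟩⟩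
  · refine ⟨c, h, Or.inl ⟨rfl, ?_⟩⟩
    by_contra hcon
    push Not at hcon
    exact h0 ⟨le_antisymm hcon.1 h.posθ.nonneg, le_antisymm hcon.2 h.posφ.nonneg⟩

lemma Cell.Valid.eq_of_pt_zero_mem (h : c.Valid P Δ) (hz : pt θ φ 0 ∈ c.patch) : θ = c.α := by
  obtain ⟨x, hx, y, hy, q, ho, e⟩ := hz
  obtain ⟨rfl, e1, -⟩ := (pt_eq_iff (by simp) ho.2.1).1 e
  rw [e1.resolve_left zero_ne_one, h.eq_zero_of_over_zero hx hy ho]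
  simp [Cell.at]

lemma Linked.eq_of_pt_zero_mem (hL : Linked c c') (h : c.Valid P Δ) (h' : c'.Valid P Δ)
    (hz : pt θ φ 0 ∈ c.patch ∪ c'.patch) : θ = c.α := by
  rcases hz with hz | hz
  · exact h.eq_of_pt_zero_mem hz
  · rw [h'.eq_of_pt_zero_mem hz]
    rcases hL with ⟨rfl, -⟩ | ⟨-, -, -, -, -, h6, -⟩
    · rfl
    · exact h6

lemma Linked.eq_of_pt_one_mem (hL : Linked c c') (h : c.Valid P Δ) (h' : c'.Valid P Δ)
    (hz : pt θ φ 1 ∈ c.patch ∪ c'.patch) : φ = c.β := by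
  rw [mem_union, ← Cell.swapS_mem_patch, ← Cell.swapS_mem_patch (c := c'), swapS_pt _ _ (by simp),
    sub_self] at hz
  exact hL.swap.eq_of_pt_zero_mem h.swap h'.swap hz

lemma Cell.over_of_mem (hq : q ∈ Ioo (0 : ℝ) 1) (hz : pt θ φ q ∈ c.patch) : Over c.r (θ, φ) q := by
  obtain ⟨x, hx, y, hy, q', ho, e⟩ := hz
  obtain ⟨rfl, e1, e2⟩ := (pt_eq_iff (Ioo_subset_Icc_self hq) ho.2.1).1 e
  rwa [show (θ, φ) = c.at x y from Prod.ext (e1.resolve_left hq.2.ne) (e2.resolve_left hq.1.ne')]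

/-- Over a point of the torus that is not a vertex there is at most one point of the disc: the
rectangles of two linked cells only meet in vertices. -/
lemma Linked.eq_of_pt_mem (W : Window P Δ) (hL : Linked c c') (h : c.Valid P Δ)
    (h' : c'.Valid P Δ) (hθ : θ ∉ Thetas P) {q' : ℝ} (hq : q ∈ Ioo (0 : ℝ) 1)
    (hq' : q' ∈ Ioo (0 : ℝ) 1) (hz : pt θ φ q ∈ c.patch ∪ c'.patch)
    (hz' : pt θ φ q' ∈ c.patch ∪ c'.patch) : q = q' := by
  have hv : ∀ r ∈ P, (θ, φ) ∉ r.vertices := fun r hr hv => hθ (mem_thetas hr hv.1)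
  have key : ∀ c1 c2 : Cell, Linked c1 c2 → c1.Valid P Δ → c2.Valid P Δ → pt θ φ q ∈ c1.patch →
      pt θ φ q' ∈ c1.patch ∪ c2.patch → q = q' := by
    intro c1 c2 hL v1 v2 hz hz'
    have o1 := Cell.over_of_mem hq hz
    have same : Over c1.r (θ, φ) q' → q = q' := fun o2 => by
      rw [o1.2.2.resolve_left (hv _ v1.mem), o2.2.2.resolve_left (hv _ v1.mem)]
    rcases hz' with hz' | hz'
    · exact same (Cell.over_of_mem hq' hz')
    rcases hL with ⟨rfl, -⟩ | ⟨-, -, -, -, hne, h6, h7, -, -⟩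
    · exact same (Cell.over_of_mem hq' hz')
    · have hcv : (c1.α, c1.β) ∈ c2.r.vertices := by
        rw [← h6, ← h7]; exact vertex_of_frame v2.vert v2.horiz
      exact absurd (inter_subset_vertices W.closed v1.mem v2.mem hne
        (vertex_of_frame v1.vert v1.horiz) (vertices_subset_carrier _ hcv)
          ⟨o1.1, (Cell.over_of_mem hq' hz').1⟩).1 (hv _ v1.mem)
  rcases hz with hz | hz
  · exact key c c' hL h h' hz hz'
  · exact key c' c hL.symm h' h hz hz'.symm

lemma Linked.isNormalDisc (W : Window P Δ) (hL : Linked c c') (h : c.Valid P Δ)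
    (h' : c'.Valid P Δ) : IsNormalDisc Δ (c.patch ∪ c'.patch) := by
  have hsub : c.patch ∪ c'.patch ⊆ surface P ∩ Δ.simplex :=
    union_subset h.patch_subset h'.patch_subset
  have hev : ∀ z ∈ c.patch ∪ c'.patch, ∀ᶠ w in 𝓝 z,
      w ∈ surface P ∩ Δ.simplex ↔ w ∈ c.patch ∪ c'.patch := by
    intro z hz
    have : ∀ᶠ w in 𝓝 z, w ∈ surface P ∩ Δ.simplex → w ∈ c.patch ∪ c'.patch := by
      rcases hz with hz | hz
      · exact hL.eventually_mem W h h' hz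
      · rw [union_comm]; exact hL.symm.eventually_mem W h' h hz
    filter_upwards [this] with w hw using ⟨hw, fun h => hsub h⟩
  refine ⟨⟨fun z hz => (hsub hz).2, fun z hz => ?_, hL.isDiscIn h h'⟩, ?_, ?_, ?_, ?_⟩
  · obtain ⟨G, Gi, k, A, hf, -⟩ := exists_localForm_simplex W (hsub hz).1 (hsub hz).2
    obtain ⟨f, hf', -⟩ := (hf.congr (hev z hz)).exists_isConeChart
    exact ⟨A, f, hf.base, hf'⟩
  · rw [Set.disjoint_left]
    rintro z hz hv
    have hF := (hsub hz).1
    rcases hv with rfl | rfl | rfl | rfl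
    · rw [joinPt_one_eq _ _ 0] at hF
      exact (W.theta _ (mem_thetas_of_pt_mem hF)).1 rfl
    · rw [joinPt_one_eq _ _ 0] at hF
      exact (W.theta _ (mem_thetas_of_pt_mem hF)).2 rfl
    · rw [joinPt_zero_eq _ 0] at hF
      exact (W.phi _ (mem_phis_of_pt_mem hF)).1 rfl
    · rw [joinPt_zero_eq _ 0] at hF
      exact (W.phi _ (mem_phis_of_pt_mem hF)).2 rfl
  · intro γ hγ t ht hz
    obtain ⟨G, Gi, k, A, hf, hr⟩ := exists_localForm_simplex W (hsub hz).1 (hsub hz).2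
    exact (hf.congr (hev _ hz)).transverseAt (hr γ hγ t ht rfl)
  · rintro γ hγ _ ⟨hz, t, ht, rfl⟩ _ ⟨hz', t', ht', rfl⟩
    rcases edge_cases W hγ ht (hsub hz).1 with ⟨v, hv, q, hq, rfl, e⟩ | ⟨rfl, e⟩ | ⟨rfl, e⟩
    · beta_reduce at e hz hz' ⊢
      obtain ⟨v', -, q', hq', -, e'⟩ | ⟨e', -⟩ | ⟨e', -⟩ := edge_cases W hγ ht' (hsub hz').1
      · have ev : v.1 = v'.1 ∧ v.2 = v'.2 := by
          rw [joinPt_eq_pt _ _ ht'] at e'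
          obtain ⟨e0, e1, e2⟩ := (pt_eq_iff (cos_sq_mem _) (Ioo_subset_Icc_self hq')).1 e'
          rw [e0] at e1 e2
          exact ⟨e1.resolve_left hq'.2.ne, e2.resolve_left hq'.1.ne'⟩
        rw [← ev.1, ← ev.2] at e'
        have hθ : v.1 ∉ Thetas P := fun hm => hv.1.elim (W.theta _ hm).1 (W.theta _ hm).2
        rw [e] at hz ⊢
        rw [e'] at hz' ⊢
        rw [hL.eq_of_pt_mem W h h' hθ hq hq' hz hz']
      · have := congrFun e' t
        beta_reduce at this
        rw [e, joinPt_one_eq _ _ 0, pt_eq_iff (Ioo_subset_Icc_self hq) (by simp)] at this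
        exact absurd this.1 hq.1.ne'
      · have := congrFun e' t
        beta_reduce at this
        rw [e, joinPt_zero_eq _ 0, pt_eq_iff (Ioo_subset_Icc_self hq) (by simp)] at this
        exact absurd this.1 hq.2.ne
    · simp only [joinPt_one_eq _ _ 0] at hz hz' ⊢
      rw [hL.eq_of_pt_zero_mem h h' hz, hL.eq_of_pt_zero_mem h h' hz']
    · simp only [joinPt_zero_eq _ 0] at hz hz' ⊢
      rw [hL.eq_of_pt_one_mem h h' hz, hL.eq_of_pt_one_mem h h' hz']
  · -- the corner of the cell that is a vertex of the window
    have hx : c.x1 ∈ Icc c.x0 c.x1 := ⟨h.posθ.lt.le, le_rfl⟩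
    have hy : c.y1 ∈ Icc c.y0 c.y1 := ⟨h.posφ.lt.le, le_rfl⟩
    have hq := mfun_rectH_interior (a := c.r.wid) (b := c.r.hei)
      ⟨h.posθ.nonneg.trans_lt h.posθ.lt, h.posθ.lt_len⟩
      ⟨h.posφ.nonneg.trans_lt h.posφ.lt, h.posφ.lt_len⟩
    obtain ⟨τ, hτ, e⟩ := exists_joinPt_eq_pt (c.at c.x1 c.y1).1 (c.at c.x1 c.y1).2
      (mfun (rectH c.r.wid c.r.hei c.x1 c.y1))
    refine ⟨_, Or.inl ⟨c.at c.x1 c.y1, ⟨h.posθ.win1.end_eq, h.posφ.win1.end_eq⟩, rfl⟩, _,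
      Or.inl ⟨c.x1, hx, c.y1, hy, _, (h.over_iff hx hy).2
        ⟨Ioo_subset_Icc_self hq, Or.inr rfl⟩, rfl⟩, τ, hτ, e.symm⟩

lemma Window.isNormalDisc (W : Window P Δ) (hz : z ∈ surface P ∩ Δ.simplex) :
    IsNormalDisc Δ (connectedComponentIn (surface P ∩ Δ.simplex) z) := by
  obtain ⟨c, h, hc⟩ := W.exists_cell hz.1 hz.2
  obtain ⟨c', h', hL⟩ := W.exists_linked h
  have hD := hL.isDiscIn h h'
  rw [connectedComponentIn_eq_of_isPreconnected (D := c.patch ∪ c'.patch) (Or.inl hc)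
    (union_subset h.patch_subset h'.patch_subset) hD.isPreconnected hD.isClosed]
  · exact hL.isNormalDisc W h h'
  · rintro w (hw | hw)
    · exact hL.eventually_mem W h h' hw
    · rw [union_comm]; exact hL.symm.eventually_mem W h' h hw

/-- Every simplex of the triangulation is a window, since no side of a rectangle that contains a
point of `X × Y` fits between consecutive points. -/
lemma ClosedDiagram.window (hP : ClosedDiagram P) {X Y : Finset Angle}
    (hXP : Disjoint (X : Set Angle) (Thetas P)) (hYP : Disjoint (Y : Set Angle) (Phis P))
    (hmeet : ∀ r ∈ P, ∃ x ∈ X, ∃ y ∈ Y, (x, y) ∈ r.carrier) (hΔ : Δ ∈ joinTriangulation X Y) :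
    Window P Δ := by
  have hX : ∀ θ ∈ Thetas P, θ ∉ X := fun θ hθ hx => Set.disjoint_left.1 hXP hx hθ
  have hY : ∀ φ ∈ Phis P, φ ∉ Y := fun φ hφ hy => Set.disjoint_left.1 hYP hy hφ
  refine ⟨hP, fun θ hθ => ⟨?_, ?_⟩, fun φ hφ => ⟨?_, ?_⟩, fun r hr θ h1 h2 => ?_,
    fun r hr φ h1 h2 => ?_⟩
  · rintro rfl; exact hX _ hθ hΔ.1.1
  · rintro rfl; exact hX _ hθ hΔ.1.2.1
  · rintro rfl; exact hY _ hφ hΔ.2.1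
  · rintro rfl; exact hY _ hφ hΔ.2.2.1
  · obtain ⟨x, hx, y, -, hm⟩ := hmeet r hr
    exact hΔ.1.exists_position (hX _ (mem_thetas hr (Or.inl rfl)))
      (hX _ (mem_thetas hr (Or.inr rfl))) ⟨x, hx, hm.1⟩ h1 h2
  · obtain ⟨x, -, y, hy, hm⟩ := hmeet r hr
    exact hΔ.2.exists_position (hY _ (mem_phis hr (Or.inl rfl)))
      (hY _ (mem_phis hr (Or.inr rfl))) ⟨y, hy, hm.2⟩ h1 h2

end Normal

end

end

end RectDiagram

theorem mainTheorem4 (P : Set RectDiagram.Rect)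
    (hP : RectDiagram.IsSurfaceDiagram P) (hbd : RectDiagram.boundary P = ∅)
    (X Y : Finset Real.Angle) (hX : 3 ≤ X.card) (hY : 3 ≤ Y.card)
    (hXP : Disjoint (X : Set Real.Angle) (RectDiagram.Thetas P))
    (hYP : Disjoint (Y : Set Real.Angle) (RectDiagram.Phis P))
    (hmeet : ∀ r ∈ P, ∃ x ∈ X, ∃ y ∈ Y, (x, y) ∈ r.carrier) :
    RectDiagram.IsNormalSurface (RectDiagram.joinTriangulation X Y) (RectDiagram.surface P) := by
  have h := hP.toIsQuasiSurfaceDiagram.closedDiagram hbd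
  exact ⟨h.isEmbeddedSurface, fun Δ hΔ p hp => (h.window hXP hYP hmeet hΔ).isNormalDisc hp⟩
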